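/- **Setting.** Fix integers $d\ge 0$, $L\ge 1$ (batch size) and a finite list $\vec{ID}$ of identities in $\{0,1\}^*$. Parameters *at level* $\kappa$ are primes $p,q$ with $q\ge 2^\kappa$, $p<2^{d\kappa}$ and an element $\alpha\in\mathbb{Z}_p^*$ of order $q$ (so $q\mid p-1$); $G=\langle\alpha\rangle$. $H_0,H_1,H_2:\{0,1\}^*\to\mathbb{Z}_q^*=\{1,\dots,q-1\}$ are independent random oracles; hash values are written as strings of the bit length of $q$ inside concatenations $\|$. **Scheme LA-HASES** (at most $J$ epochs). - Key generation: $msk$ uniform in $\{0,1\}^\kappa$; each $ID\in\vec{ID}$ has private key $y=H_0(msk\|ID)$ and public key $Y=\alpha^y$. - Commitment $ComConstr(msk,ID,j)$ (for $ID\in\vec{ID}$, $1\le j\le J$): $r_j=H_1(y\|j)$, $r_j^\ell=H_1(r_j\|\ell)$, output $R_j=\alpha^{\sum_{\ell=1}^L r_j^\ell}$. - Signing the batch $\vec M=(m^1,\dots,m^L)$, $m^\ell\in\{0,1\}^*$, in epoch $j\le J$: $x_j=H_0(y\|j)$, $x_j^\ell=H_0(x_j\|\ell)$, $e_j^\ell=H_2(m^\ell\|x_j^\ell)$,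 $s=\sum_{\ell=1}^L (r_j^\ell-e_j^\ell y) \bmod q$; output $(s,x_j,ID,j)$ and increment $j$ (initially $1$). - Verification of $(s,x,ID,j)$ on $\vec M$ under $(Y,R_j)$: with $x^\ell=H_0(x\|\ell)$ and $e=\sum_{\ell=1}^L H_2(m^\ell\|x^\ell)$, accept iff $R_j=Y^{e}\alpha^{s}$. **A-EU-CMA experiment** against $ID\in\vec{ID}$. The forger gets $\kappa,p,q,\alpha,J,L,ID$ and all public keys, and access to the random oracles, to signing under the private key of $ID$ (successive calls use the epochs $1,2,\dots$; calls after epoch $J$ are rejected), and to $ComConstr(msk,\cdot,\cdot)$ for all identities in $\vec{ID}$ and all $j\in[1,J]$. It wins if it outputs $j\in[1,J]$, $s,x\in\{0,\dots,q-1\}$ and a batch $\vec M^*$ that the signing oracle has signed in no epoch, such that $(s,x,ID,j)$ verifies on $\vec M^*$ under $Y$ and $R_j=ComConstr(msk,ID,j)$. $Adv^{A\text{-}EU\text{-}CMA}_{LA\text{-}HASES}(t,q_s,q_s')$ is the supremum of the winning probabilities of forgers of time complexity at most $t$ with at most $q_s$ signature and $q_s'$ random oracle queries. **Discrete logarithm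 experiment.** For uniform $b\in\mathbb{Z}_q^*$, the attacker gets $\kappa,p,q,\alpha,B=\alpha^b$ and wins if it outputs $b'$ with $\alpha^{b'}=B$. $Adv^{DL}_{G,\alpha}(t)$ is the supremum of the success probabilities of attackers of time complexity at most $t$. **Time.** Algorithms are probabilistic random access machine programs with bit costs (linear in the operand lengths, quadratic for multiplication and division, cubic for modular exponentiation). Time complexity is code length plus input length plus worst-case running time over all coins and all well-formed oracle answers. Every oracle call is charged $\kappa^3+1$ (the order of the cost of a modular exponentiation) plus the length of the query; signature and commitment calls are also charged the bit length of $J$. **Theorem 5.2.** LA-HASES is A-EU-CMA secure in the random oracle model if the discrete logarithm problem is hard. Precisely: 1. There are a constant $c$ and a map $\mathcal{A}\mapsto\mathcal{F}$ from forgers to DL attackers (depending also on $J$ and $ID$), with $c$ and the map depending only on $d,L,\vec{ID}$, such that for every polynomially bounded $t(\kappa)$ and all $q_s(\kappa),q_s'(\kappa)$ there is a negligible $\varepsilon(\kappa)$ with the following property. For all $\kappa$, all parameters at level $\kappa$, all $J$ and all $ID\in\vec{ID}$, writing $t'=c\,t+c\,\kappa^3$: for every forger $\mathcal{A}$ of time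 complexity at most $t$ with at most $q_s$ signature and $q_s'$ random oracle queries, $\mathcal{F}$ has time complexity at most $t'$ and $Adv(\mathcal{A})\le Adv^{DL}_{G,\alpha}(\mathcal{F})+\varepsilon(\kappa)$; and $$Adv^{A\text{-}EU\text{-}CMA}_{LA\text{-}HASES}(t,q_s,q_s')\le Adv^{DL}_{G,\alpha}(t')+\varepsilon(\kappa),\qquad t'=\mathcal{O}(t)+\mathcal{O}(\kappa^3).$$ 2. Consequently, for every sequence of parameters eventually at level $\kappa$ and every choice of $J(\kappa)$ and $ID(\kappa)\in\vec{ID}$: if $Adv^{DL}_{G,\alpha}(t')$ is negligible for every polynomially bounded $t'$, then $Adv^{A\text{-}EU\text{-}CMA}_{LA\text{-}HASES}(t,q_s,q_s')$ is negligible for every polynomially bounded $t$ and all $q_s,q_s'$. -/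

import Mathlib

open scoped ENNReal

noncomputable section

/-! ### Bit strings -/

/-- Finite binary strings; `++` is string concatenation. -/
abbrev Str := List Bool

/-- The number written by a bit string, least significant bit first. -/
def Str.val (s : Str) : ℕ := s.foldr Nat.bit 0

/-- The `w`-bit string of the number `n`, least significant bit first. -/
def fixedBits (w n : ℕ) : Str := List.ofFn fun i : Fin w => n.testBit i

/-! ### A random access machine with bit costs

Registers and arrays are indexed by numbers that occur literally in the program; cells of an array
are addressed by bit strings. Every cell holds a bit string and is initially empty. -/

/-- The memory: registers and associative arrays. -/
structure Mem where
  reg : ℕ → Str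
  arr : ℕ → Str → Str

def Mem.setReg (m : Mem) (d : ℕ) (s : Str) : Mem := { m with reg := Function.update m.reg d s }

def Mem.setArr (m : Mem) (k : ℕ) (i s : Str) : Mem :=
  { m with arr := Function.update m.arr k (Function.update (m.arr k) i s) }

/-- The basic operations; each takes (up to) three operands. -/
inductive Op where
  | cst (s : Str)
  | cat | take | drop | len | pad
  | add | sub | mul | div | mod | powMod
  | eq | lt

/-- The result of a basic operation. Numbers are returned without leading zeros, truth values as
`[true]` and `[]`. -/
def Op.eval : Op → Str → Str → Str → Str
  | .cst s, _, _, _ => s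
  | .cat, a, b, _ => a ++ b
  | .take, a, b, _ => List.take b.val a
  | .drop, a, b, _ => List.drop b.val a
  | .len, a, _, _ => a.length.bits
  | .pad, a, b, _ => fixedBits b.val a.val
  | .add, a, b, _ => (a.val + b.val).bits
  | .sub, a, b, _ => (a.val - b.val).bits
  | .mul, a, b, _ => (a.val * b.val).bits
  | .div, a, b, _ => (a.val / b.val).bits
  | .mod, a, b, _ => (a.val % b.val).bits
  | .powMod, a, b, n => (a.val ^ b.val % n.val).bits
  | .eq, a, b, _ => if a = b then [true] else []
  | .lt, a, b, _ => if a.val < b.val then [true] else []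

/-- The exponent of the bit cost: multiplication and division are charged quadratically, modular
exponentiation cubically, everything else linearly. -/
def Op.deg : Op → ℕ
  | .mul | .div | .mod => 2
  | .powMod => 3
  | _ => 1

/-- The cost of a basic operation: a power of the total length of operands and result. -/
def Op.cost (o : Op) (a b c : Str) : ℕ :=
  (1 + a.length + b.length + c.length + (o.eval a b c).length) ^ o.deg

/-- Probabilistic programs whose oracle calls are drawn from `Q`.
`op o d a b c` puts the result of `o` on registers `a`, `b`, `c` into register `d`;
`load d k i` reads into `d` the cell of array `k` addressed by register `i`;
`store k i s` writes register `s` into that cell;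
`rand d n` draws a uniform number below the number in register `n`;
`ite` and `loop` test whether the number in a register is nonzero. -/
inductive Prog (Q : Type) where
  | skip
  | op (o : Op) (d a b c : ℕ)
  | load (d k i : ℕ)
  | store (k i s : ℕ)
  | rand (d n : ℕ)
  | call (x : Q)
  | seq (p₁ p₂ : Prog Q)
  | ite (r : ℕ) (p₁ p₂ : Prog Q)
  | loop (r : ℕ) (p : Prog Q)

/-- The length of the code, including the constants in it. -/
def Prog.size {Q : Type} : Prog Q → ℕ
  | .op (.cst s) _ _ _ _ => 1 + s.length
  | .seq p₁ p₂ => 1 + p₁.size + p₂.size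
  | .ite _ p₁ p₂ => 1 + p₁.size + p₂.size
  | .loop _ p => 1 + p.size
  | _ => 1

/-- The meaning and the price of oracle calls; an oracle reads from and writes to the memory and
has an internal state in `σ`. -/
structure Oracle (Q σ : Type) where
  reply : Q → Mem → σ → PMF (Mem × σ)
  cost : Q → Mem → ℕ

/-- A configuration: memory, time consumed so far, state of the oracle. -/
structure Cfg (σ : Type) where
  mem : Mem
  time : ℕ
  orc : σ

/-- Replace the memory and advance the clock. -/
def Cfg.next {σ : Type} (c : Cfg σ) (m : Mem) (cost : ℕ) : Cfg σ :=
  { c with mem := m, time := c.time + cost }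

/-- The uniform distribution on `{0, …, n - 1}` (the point mass at `0` for `n = 0`). -/
def unifBelow (n : ℕ) : PMF ℕ :=
  if h : 0 < n then PMF.uniformOfFinset (Finset.range n) ⟨0, Finset.mem_range.2 h⟩ else PMF.pure 0

/-- Continue after a run that did not time out. -/
def andThen {σ : Type} (d : PMF (Option (Cfg σ))) (f : Cfg σ → PMF (Option (Cfg σ))) :
    PMF (Option (Cfg σ)) :=
  d.bind fun o => o.elim (PMF.pure none) f

/-- A loop with at most `n` evaluations of its test; it times out (`none`) after that. -/
def iterate {σ : Type} (r : ℕ) (body : Cfg σ → PMF (Option (Cfg σ))) :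
    ℕ → Cfg σ → PMF (Option (Cfg σ))
  | 0, _ => PMF.pure none
  | n + 1, c =>
    let c' := c.next c.mem (1 + (c.mem.reg r).length)
    if (c.mem.reg r).val = 0 then PMF.pure (some c')
    else andThen (body c') (iterate r body n)

/-- The distribution of the final configuration. Each test of a loop takes time at least one, so a
program that stops within time `t` never exhausts the bound `fuel = t` on its loops. -/
def run {Q σ : Type} (O : Oracle Q σ) (fuel : ℕ) : Prog Q → Cfg σ → PMF (Option (Cfg σ))
  | .skip, c => PMF.pure (some (c.next c.mem 1))
  | .op o d a b e, c =>
    let x := c.mem.reg a; let y := c.mem.reg b; let z := c.mem.reg e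
    PMF.pure (some (c.next (c.mem.setReg d (o.eval x y z)) (o.cost x y z)))
  | .load d k i, c =>
    let x := c.mem.reg i; let y := c.mem.arr k x
    PMF.pure (some (c.next (c.mem.setReg d y) (1 + x.length + y.length)))
  | .store k i s, c =>
    let x := c.mem.reg i; let y := c.mem.reg s
    PMF.pure (some (c.next (c.mem.setArr k x y) (1 + x.length + y.length)))
  | .rand d n, c =>
    let x := c.mem.reg n
    (unifBelow x.val).bind fun v =>
      PMF.pure (some (c.next (c.mem.setReg d v.bits) (1 + x.length)))
  | .call x, c =>
    (O.reply x c.mem c.orc).bind fun r =>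
      PMF.pure (some { mem := r.1, time := c.time + O.cost x c.mem, orc := r.2 })
  | .seq p₁ p₂, c => andThen (run O fuel p₁ c) (run O fuel p₂)
  | .ite r p₁ p₂, c =>
    let c' := c.next c.mem (1 + (c.mem.reg r).length)
    if (c.mem.reg r).val = 0 then run O fuel p₂ c' else run O fuel p₁ c'
  | .loop r p, c => iterate r (run O fuel p) fuel c

/-- The initial configuration: the strings `ins` in the registers `0, 1, …`, the table `tab` in
array `0`, everything else empty. Reading the input is charged to the clock. -/
def initCfg {σ : Type} (ins : List Str) (tab : List (Str × Str)) (s : σ) : Cfg σ where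
  mem :=
    { reg := fun i => ins.getD i []
      arr := fun k i => if k = 0 then (tab.lookup i).getD [] else [] }
  time := (ins.map List.length).sum + (tab.map fun e => e.1.length + e.2.length).sum
  orc := s

/-! ### The group and the discrete logarithm problem -/

/-- Primes `p` and `q` and a generator `α` of a subgroup of order `q` of `ℤ_p^*`
(so that `q ∣ p - 1`). -/
structure GroupParams where
  p : ℕ
  q : ℕ
  α : (ZMod p)ˣ
  prime_p : p.Prime
  prime_q : q.Prime
  order_α : orderOf α = q

namespace GroupParams

variable (pp : GroupParams)

/-- The parameters fit the security parameter `κ`: `q` is at least `2 ^ κ`, and `p` has at most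
`d * κ` bits. -/
def Level (d κ : ℕ) : Prop := 2 ^ κ ≤ pp.q ∧ pp.p < 2 ^ (d * κ)

/-- The uniform distribution on `ℤ_q^*`, represented by the numbers `1, …, q - 1`. -/
def unifStar : PMF ℕ :=
  PMF.uniformOfFinset (Finset.Ico 1 pp.q) ⟨1, Finset.mem_Ico.2 ⟨le_rfl, pp.prime_q.one_lt⟩⟩

/-- The binary representation of a group element. -/
def elt (g : (ZMod pp.p)ˣ) : Str := (g : ZMod pp.p).val.bits

/-- Numbers below `q` as strings of fixed length. -/
def enc (n : ℕ) : Str := fixedBits pp.q.size n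

end GroupParams

/-- No oracle at all. -/
def noOracle : Oracle Empty Unit := ⟨fun x => x.elim, fun x => x.elim⟩

/-- A discrete logarithm attacker gets the security parameter, the group and the challenge `B`. -/
def dlInit (κ : ℕ) (pp : GroupParams) (B : (ZMod pp.p)ˣ) : Cfg Unit :=
  initCfg [κ.bits, pp.p.bits, pp.q.bits, pp.elt pp.α, pp.elt B] [] ()

/-- The attacker's code plus its running time, on every challenge and for all coin tosses, is at
most `t`. -/
def DLTime (κ : ℕ) (pp : GroupParams) (F : Prog Empty) (t : ℕ) : Prop :=
  ∀ b ∈ Finset.Ico 1 pp.q, ∀ o ∈ (run noOracle t F (dlInit κ pp (pp.α ^ b))).support,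
    ∃ c, o = some c ∧ c.time + F.size ≤ t

open Classical in
/-- The discrete logarithm experiment; the attacker's answer is the number in register `0`. -/
def dlExpt (κ : ℕ) (pp : GroupParams) (F : Prog Empty) (t : ℕ) : PMF Bool :=
  pp.unifStar.bind fun b =>
    (run noOracle t F (dlInit κ pp (pp.α ^ b))).bind fun o =>
      PMF.pure (o.elim false fun c => decide (pp.α ^ (c.mem.reg 0).val = pp.α ^ b))

/-- The advantage of one attacker that runs in time `t`. -/
def dlAdvOf (κ : ℕ) (pp : GroupParams) (F : Prog Empty) (t : ℕ) : ℝ≥0∞ := dlExpt κ pp F t true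

/-- The advantage against the group: the maximum over all attackers of time complexity `t`. -/
def dlAdv (κ : ℕ) (pp : GroupParams) (t : ℕ) : ℝ≥0∞ :=
  ⨆ (F : Prog Empty) (_ : DLTime κ pp F t), dlAdvOf κ pp F t

/-! ### The signature scheme LA-HASES in the random oracle model -/

/-- The points at which `H_0`, `H_1`, `H_2` have been evaluated, with the values. -/
abbrev Table := Fin 3 → Str → Option ℕ

/-- Probabilistic computations with access to the random oracles. -/
abbrev ROM := StateT Table PMF

namespace LAHases

variable (pp : GroupParams) (L : ℕ)

/-- The random oracles `H_k : {0,1}^* → ℤ_q^*`: a new point gets a fresh uniform value. -/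
def H (k : Fin 3) (u : Str) : ROM ℕ := fun T =>
  match T k u with
  | some h => PMF.pure (h, T)
  | none => pp.unifStar.bind fun h =>
      PMF.pure (h, Function.update T k (Function.update (T k) u (some h)))

/-- The private key `y = H_0(msk ‖ ID)` of a user. -/
def userKey (msk id : Str) : ROM ℕ := H pp 0 (msk ++ id)

/-- Key generation: master key, private keys and public keys of the users. -/
def kg (κ : ℕ) (ids : List Str) : ROM (Str × List ℕ × List (ZMod pp.p)ˣ) := do
  let msk : Str ← StateT.lift ((PMF.uniformOfFintype (Fin κ → Bool)).map List.ofFn)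
  let sk ← ids.mapM (userKey pp msk)
  pure (msk, sk, sk.map fun y => pp.α ^ y)

/-- Aggregation: the sum modulo `q`. -/
def agg (δ : List (ZMod pp.q)) : ZMod pp.q := δ.sum

/-- `R_j = α ^ (r_j^1 + … + r_j^L)`, where `r_j = H_1(y ‖ j)` and `r_j^ℓ = H_1(r_j ‖ ℓ)`. -/
def comConstr (msk id : Str) (j : ℕ) : ROM (ZMod pp.p)ˣ := do
  let y ← userKey pp msk id
  let rj ← H pp 1 (pp.enc y ++ j.bits)
  let r ← (List.finRange L).foldlM (fun (acc : ZMod pp.q) ℓ => do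
    let rl ← H pp 1 (pp.enc rj ++ (ℓ.val + 1).bits)
    pure (acc + (rl : ZMod pp.q))) 0
  pure (pp.α ^ r.val)

/-- The components `s_j^{1,L}` and `x_j` of the aggregate signature of a batch in epoch `j`. -/
def asig (y j : ℕ) (M : Fin L → Str) : ROM (ZMod pp.q × ℕ) := do
  let xj ← H pp 0 (pp.enc y ++ j.bits)
  let rj ← H pp 1 (pp.enc y ++ j.bits)
  let s ← (List.finRange L).foldlM (fun (acc : ZMod pp.q) ℓ => do
    let xl ← H pp 0 (pp.enc xj ++ (ℓ.val + 1).bits)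
    let rl ← H pp 1 (pp.enc rj ++ (ℓ.val + 1).bits)
    let el ← H pp 2 (M ℓ ++ pp.enc xl)
    pure (agg pp [acc, (rl : ZMod pp.q) - (el : ZMod pp.q) * (y : ZMod pp.q)])) 0
  pure (s, xj)

open Classical in
/-- Aggregate verification: `R = Y ^ e * α ^ s` with `e = ∑ H_2(m^ℓ ‖ x^ℓ)`, `x^ℓ = H_0(x ‖ ℓ)`. -/
def aver (Y C : (ZMod pp.p)ˣ) (M : Fin L → Str) (s x : ZMod pp.q) : ROM Bool := do
  let e ← (List.finRange L).foldlM (fun (acc : ZMod pp.q) ℓ => do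
    let xl ← H pp 0 (pp.enc x.val ++ (ℓ.val + 1).bits)
    let el ← H pp 2 (M ℓ ++ pp.enc xl)
    pure (acc + (el : ZMod pp.q))) 0
  pure (decide (C = Y ^ e.val * pp.α ^ s.val))

/-! ### The unforgeability experiment -/

/-- The oracle calls of a forger.
`hash k d u` asks `H_k` at the string in register `u`;
`sign ds dx dj a` asks for a signature of the batch in the cells `1, …, L` of array `a`;
`com d i j` asks for the commitment of the user in register `i` in the epoch in register `j`.
The registers `d…` receive the answers. -/
inductive Query where
  | hash (k : Fin 3) (d u : ℕ)
  | sign (ds dx dj a : ℕ)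
  | com (d i j : ℕ)

/-- The batch of messages in an array. -/
def batch (m : Mem) (a : ℕ) : Fin L → Str := fun ℓ => m.arr a (ℓ.val + 1).bits

/-- A hash value as the answer to a call. -/
def putHash (m : Mem) (d h : ℕ) : Mem := m.setReg d (pp.enc h)

/-- A signature `(s, x, j)`, or a rejection, as the answer to a call. -/
def putSig (m : Mem) (ds dx dj : ℕ) : Option (ℕ × ℕ × ℕ) → Mem
  | some (s, x, j) => ((m.setReg ds s.bits).setReg dx (pp.enc x)).setReg dj j.bits
  | none => ((m.setReg ds []).setReg dx []).setReg dj []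

/-- A commitment, or a rejection, as the answer to a call. -/
def putCom (m : Mem) (d : ℕ) : Option (ZMod pp.p)ˣ → Mem
  | some R => m.setReg d (pp.elt R)
  | none => m.setReg d []

/-- A call is charged the cubic price of a modular exponentiation, and the length of the question
and of the epoch counter. -/
def queryCost (κ J : ℕ) : Query → Mem → ℕ
  | .hash _ _ u, m => κ ^ 3 + 1 + (m.reg u).length
  | .sign _ _ _ a, m => κ ^ 3 + 1 + J.size + ∑ ℓ, (batch L m a ℓ).length
  | .com _ i j, m => κ ^ 3 + 1 + J.size + (m.reg i).length + (m.reg j).length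

/-- The state of the experiment: the random oracles, the current epoch, the signed batches. -/
structure Game where
  table : Table
  epoch : ℕ
  signed : List (Fin L → Str)

open Classical in
/-- The oracles of the experiment with master key `msk` and attacked private key `y`. -/
def realOracle (κ J : ℕ) (ids : List Str) (msk : Str) (y : ℕ) : Oracle Query (Game L) where
  cost := queryCost L κ J
  reply
    | .hash k d u, m, g => (H pp k (m.reg u) g.table).bind fun r =>
        PMF.pure (putHash pp m d r.1, { g with table := r.2 })
    | .sign ds dx dj a, m, g =>
        if g.epoch ≤ J then
          (asig pp L y g.epoch (batch L m a) g.table).bind fun r =>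
            PMF.pure (putSig pp m ds dx dj (some (r.1.1.val, r.1.2, g.epoch)),
              { table := r.2, epoch := g.epoch + 1, signed := batch L m a :: g.signed })
        else PMF.pure (putSig pp m ds dx dj none, g)
    | .com d i j, m, g =>
        if m.reg i ∈ ids ∧ 1 ≤ (m.reg j).val ∧ (m.reg j).val ≤ J then
          (comConstr pp L msk (m.reg i) (m.reg j).val g.table).bind fun r =>
            PMF.pure (putCom pp m d (some r.1), { g with table := r.2 })
        else PMF.pure (putCom pp m d none, g)

/-- The forger gets the security parameter, the system parameters, the attacked identity with its
public key, and the table of the public keys of all users. -/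
def laInit {σ : Type} (κ J : ℕ) (ids : List Str) (id : Str) (Y : (ZMod pp.p)ˣ)
    (pks : List (ZMod pp.p)ˣ) (s : σ) : Cfg σ :=
  initCfg [κ.bits, pp.p.bits, pp.q.bits, pp.elt pp.α, J.bits, L.bits, id, pp.elt Y]
    (ids.zip (pks.map pp.elt)) s

open Classical in
/-- The experiment against the user `id`. The forgery is `s`, `x`, `j` in the registers `0`, `1`,
`2` and the batch in array `1`. It must be well-formed (`s` and `x` reduced modulo `q`, and
`1 ≤ j ≤ J`), verify under the commitment that `comConstr` gives for `id` and `j`, and be on a batch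
that was not signed in any epoch. -/
def expt (κ J : ℕ) (ids : List Str) (id : Str) (A : Prog Query) (t : ℕ) : PMF Bool := do
  let ((msk, _, pks), T₀) ← kg pp κ ids fun _ _ => none
  -- the key of `id` is the one that key generation has derived, as the oracle is a function
  let (y, T₁) ← userKey pp msk id T₀
  let Y := pp.α ^ y
  let o ← run (realOracle pp L κ J ids msk y) t A
    (laInit pp L κ J ids id Y pks ⟨T₁, 1, []⟩)
  match o with
  | none => PMF.pure false
  | some c =>
    let M := batch L c.mem 1
    let s := (c.mem.reg 0).val
    let x := (c.mem.reg 1).val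
    let j := (c.mem.reg 2).val
    if s < pp.q ∧ x < pp.q ∧ 1 ≤ j ∧ j ≤ J ∧ M ∉ c.orc.signed then do
      let (C, T₂) ← comConstr pp L msk id j c.orc.table
      let (b, _) ← aver pp L Y C M s x T₂
      PMF.pure b
    else PMF.pure false

/-- Oracles that give arbitrary answers of the right form: every possible sequence of answers has
positive probability. The state counts the hash queries and the signature queries. -/
def anyOracle (κ J : ℕ) : Oracle Query (ℕ × ℕ) where
  cost := queryCost L κ J
  reply
    | .hash _ d _, m, n => pp.unifStar.bind fun h =>
        PMF.pure (putHash pp m d h, (n.1 + 1, n.2))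
    | .sign ds dx dj _, m, n => do
        let s ← unifBelow pp.q
        let x ← pp.unifStar
        let j ← unifBelow (J + 1)
        let ok ← PMF.uniformOfFintype Bool
        PMF.pure (putSig pp m ds dx dj (if ok then some (s, x, j) else none), (n.1, n.2 + 1))
    | .com d _ _, m, n => do
        let r ← unifBelow pp.q
        let ok ← PMF.uniformOfFintype Bool
        PMF.pure (putCom pp m d (if ok then some (pp.α ^ r) else none), n)

/-- For all public keys, all coin tosses and all answers of the oracles, the forger's code plus its
running time is at most `t`, and it makes at most `qs'` hash and `qs` signature queries. -/
def ForgerTime (κ J : ℕ) (ids : List Str) (id : Str) (A : Prog Query) (t qs qs' : ℕ) : Prop :=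
  ∀ ks : List ℕ, ks.length = ids.length → (∀ k ∈ ks, k ∈ Finset.Ico 1 pp.q) →
    ∀ y ∈ Finset.Ico 1 pp.q,
    ∀ o ∈ (run (anyOracle pp L κ J) t A (laInit pp L κ J ids id (pp.α ^ y)
      (ks.map fun k => pp.α ^ k) (0, 0))).support,
    ∃ c, o = some c ∧ c.time + A.size ≤ t ∧ c.orc.1 ≤ qs' ∧ c.orc.2 ≤ qs

/-- The A-EU-CMA advantage of one forger that runs in time `t`. -/
def advOf (κ J : ℕ) (ids : List Str) (id : Str) (A : Prog Query) (t : ℕ) : ℝ≥0∞ :=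
  expt pp L κ J ids id A t true

/-- The A-EU-CMA advantage against the scheme: the maximum over all forgers of time complexity `t`
with at most `qs` signature queries and at most `qs'` hash queries. -/
def adv (κ J : ℕ) (ids : List Str) (id : Str) (t qs qs' : ℕ) : ℝ≥0∞ :=
  ⨆ (A : Prog Query) (_ : ForgerTime pp L κ J ids id A t qs qs'), advOf pp L κ J ids id A t

end LAHases

/-! ### Asymptotics in the security parameter -/

/-- Bounded by a polynomial. -/
def PolyBounded (t : ℕ → ℕ) : Prop := ∃ P : Polynomial ℕ, ∀ κ, t κ ≤ P.eval κ

/-- Negligible: decaying faster than every inverse polynomial. -/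
def Negligible (ε : ℕ → ℝ) : Prop :=
  Asymptotics.SuperpolynomialDecay Filter.atTop (fun κ : ℕ => (κ : ℝ)) ε

end

open scoped ENNReal

noncomputable section

/-! The scheme is an aggregated Schnorr signature whose commitment for each epoch is fixed in
advance, and this makes a reduction without rewinding possible. For an epoch `j` the reduction draws
the hash values `e^1, …, e^L` and the signature component `v` first and publishes `R_j = Y^E α^v`
with `E = ∑ e^ℓ`. When a signature for that epoch is requested, it draws a fresh `x_j` and programs
`H_2` to take the value `e^ℓ` at the point `m^ℓ ‖ x^ℓ`. These points are new with high probability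
because `x_j` is. A forgery `(s, x, j)` with exponent sum `e` is a second representation `R_j = Y^e
α^s`, so `y (e - E) = v - s` and the discrete logarithm is `(v - s) / (e - E)`.

The division is possible except with small probability. If nothing was signed in epoch `j`, the
values `e^ℓ` are still undetermined in the ideal game and `E` hits `e` with probability about `1/q`.
If another batch was signed there, the two sets of points of `H_2` differ as long as `H_0` has no
collisions, and no two different sets of at most `L` points have equal sums of values (`Good`,
`sums_ne`). Among `n` points there are at most `(n + 1) ^ L` such sets, so this costs about `n ^ (2
L) / q` per new point, which is negligible for fixed `L`.

Between the experiment and the simulation stands an ideal game. In it the values at the hidden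
points `msk ‖ ID`, `y ‖ j` and `r_j ‖ ℓ` are independent random variables outside the public tables,
and a flag is raised when `H_0` or `H_1` is asked at a string that starts with a logarithm of `Y`.
The reduction detects this by an exponentiation and then knows the logarithm. Two one-sided
estimates suffice. By `real_le_ideal` the forger wins with at most the probability of "forgery or
flag" in the ideal game, up to an error. By `sim_le_ideal` the simulation fails with at most the
probability of the complementary event, up to an error. Their sum is at most `1 + loss`
(`real_add_sim_le`), and the failure probability of the reduction is at least one minus its
advantage.

Both comparisons are instances of `Hop`. A state of the ideal game stands for a family of states of
the other game, indexed by hidden randomness which the ideal game does not use. `Φ` averages a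
quantity over this family and adds an error potential. Every oracle call has to satisfy one
inequality for `Φ` (`Hop.Sim`), and `Hop.run_le` extends it to all programs. Hidden randomness that
becomes incompatible with the state contributes zero to the average, and the potential, a sum of
step errors over the number of records, pays for what is lost.

The remaining work is computational. The bounds on the forger hold for arbitrary well-formed
answers, so they transfer to each game (`forger_run`). The attacker is the forger with its oracle
calls replaced by loop-free code, whose correctness and cost are expressed together by `Imp`. A
violated time bound is given the value infinity, so the single inequality `attacker_le` yields both
the running time (`dlTime_attacker`) and the success probability (`advOf_le`). -/

/-! ### Expectations -/

/-- The expectation of a nonnegative function. -/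
def ex {α : Type} (μ : PMF α) (f : α → ℝ≥0∞) : ℝ≥0∞ := ∑' a, μ a * f a

theorem ex_mono {α : Type} {μ : PMF α} {f g : α → ℝ≥0∞} (h : ∀ a, f a ≤ g a) : ex μ f ≤ ex μ g :=
  ENNReal.tsum_le_tsum fun a => mul_le_mul_right (h a) _

theorem ex_mono_support {α : Type} {μ : PMF α} {f g : α → ℝ≥0∞}
    (h : ∀ a ∈ μ.support, f a ≤ g a) : ex μ f ≤ ex μ g := by
  refine ENNReal.tsum_le_tsum fun a => ?_
  by_cases ha : μ a = 0
  · simp [ha]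
  · exact mul_le_mul_right (h a ((PMF.mem_support_iff _ _).2 ha)) _

theorem ex_congr_support {α : Type} {μ : PMF α} {f g : α → ℝ≥0∞}
    (h : ∀ a ∈ μ.support, f a = g a) : ex μ f = ex μ g :=
  le_antisymm (ex_mono_support fun a ha => (h a ha).le) (ex_mono_support fun a ha => (h a ha).ge)

@[simp] theorem ex_const {α : Type} (μ : PMF α) (c : ℝ≥0∞) : ex μ (fun _ => c) = c := by
  simp [ex, ENNReal.tsum_mul_right, PMF.tsum_coe]

theorem ex_add {α : Type} (μ : PMF α) (f g : α → ℝ≥0∞) :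
    ex μ (fun a => f a + g a) = ex μ f + ex μ g := by
  simp [ex, mul_add, ENNReal.tsum_add]

theorem ex_le_of_le {α : Type} {μ : PMF α} {f : α → ℝ≥0∞} {c : ℝ≥0∞} (h : ∀ a, f a ≤ c) :
    ex μ f ≤ c := (ex_mono h).trans (ex_const μ c).le

@[simp] theorem ex_pure {α : Type} (a : α) (f : α → ℝ≥0∞) : ex (PMF.pure a) f = f a := by
  classical
  rw [ex, tsum_eq_single a]
  · simp
  · intro b hb; simp [PMF.pure_apply, hb]

@[simp] theorem ex_bind {α β : Type} (μ : PMF α) (k : α → PMF β) (f : β → ℝ≥0∞) :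
    ex (μ.bind k) f = ex μ fun a => ex (k a) f := by
  simp only [ex, PMF.bind_apply, ← ENNReal.tsum_mul_right, ← ENNReal.tsum_mul_left]
  rw [ENNReal.tsum_comm]
  exact tsum_congr fun a => tsum_congr fun b => by ring

@[simp] theorem ex_map {α β : Type} (μ : PMF α) (g : α → β) (f : β → ℝ≥0∞) :
    ex (μ.map g) f = ex μ fun a => f (g a) := by
  rw [PMF.map, ex_bind]; simp [Function.comp]

theorem ex_comm {α β : Type} (μ : PMF α) (ν : PMF β) (f : α → β → ℝ≥0∞) :
    ex μ (fun a => ex ν fun b => f a b) = ex ν fun b => ex μ fun a => f a b := by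
  simp only [ex, ← ENNReal.tsum_mul_left]
  rw [ENNReal.tsum_comm]
  exact tsum_congr fun a => tsum_congr fun b => by ring

/-- The probability of `true` is the expectation of its indicator. -/
theorem apply_true_eq_ex (μ : PMF Bool) : μ true = ex μ fun b => if b then 1 else 0 := by
  simp [ex]

open Classical in
/-- The indicator of a proposition. -/
def ind (p : Prop) : ℝ≥0∞ := if p then 1 else 0

theorem ind_true {p : Prop} (h : p) : ind p = 1 := if_pos h

theorem ind_false {p : Prop} (h : ¬ p) : ind p = 0 := if_neg h

theorem ind_le_one (p : Prop) : ind p ≤ 1 := by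
  unfold ind; split_ifs <;> simp

theorem ind_mono {p q : Prop} (h : p → q) : ind p ≤ ind q := by
  by_cases hp : p
  · rw [ind_true hp, ind_true (h hp)]
  · simp [ind_false hp]

theorem ind_or_le (p q : Prop) : ind (p ∨ q) ≤ ind p + ind q := by
  by_cases hp : p
  · rw [ind_true (Or.inl hp), ind_true hp]; exact le_self_add
  · exact (ind_mono fun h => h.resolve_left hp).trans le_add_self

theorem ind_add_ind_not (p : Prop) : ind p + ind (¬ p) = 1 := by
  by_cases hp : p <;> simp [ind, hp]

theorem ex_uniformOfFintype {α : Type} [Fintype α] [Nonempty α] (f : α → ℝ≥0∞) :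
    ex (PMF.uniformOfFintype α) f = (Fintype.card α : ℝ≥0∞)⁻¹ * ∑ a, f a := by
  simp [ex, tsum_fintype, PMF.uniformOfFintype_apply, Finset.mul_sum]

/-- Resampling one coordinate of a uniform family. -/
theorem ex_pi_update {ι S : Type} [Fintype ι] [DecidableEq ι] [Fintype S] [Nonempty S] (j : ι)
    (f : (ι → S) → ℝ≥0∞) :
    ex (PMF.uniformOfFintype (ι → S)) f = ex (PMF.uniformOfFintype (ι → S)) fun ω =>
      ex (PMF.uniformOfFintype S) fun h => f (Function.update ω j h) := by
  -- Exchanging the sample with the replaced coordinate is an involution on pairs of a family and a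
  -- sample, so the two double sums have the same terms.
  have key : ∑ ω : ι → S, ∑ h : S, f (Function.update ω j h) = ∑ ω : ι → S, ∑ _h : S, f ω := by
    rw [← Fintype.sum_prod_type', ← Fintype.sum_prod_type']
    refine Fintype.sum_bijective (fun x : (ι → S) × S => (Function.update x.1 j x.2, x.1 j))
      (Function.Involutive.bijective fun x => ?_) _ _ fun x => rfl
    simp
  simp only [ex_uniformOfFintype, ← Finset.mul_sum]
  rw [key]
  simp only [Finset.sum_const, nsmul_eq_mul, ← Finset.mul_sum, Finset.card_univ]
  rw [← mul_assoc (Fintype.card S : ℝ≥0∞)⁻¹, ENNReal.inv_mul_cancel, one_mul]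
  · simp
  · simp

theorem ex_pi_eval {ι S : Type} [Fintype ι] [DecidableEq ι] [Fintype S] [Nonempty S] (j : ι)
    (f : S → ℝ≥0∞) :
    ex (PMF.uniformOfFintype (ι → S)) (fun ω => f (ω j)) = ex (PMF.uniformOfFintype S) f := by
  rw [ex_pi_update j]; simp

/-- A function that ignores coordinate `j`, applied to it and to a fresh value. -/
theorem ex_pi_fresh {ι S : Type} [Fintype ι] [DecidableEq ι] [Fintype S] [Nonempty S] (j : ι)
    (f : (ι → S) → S → ℝ≥0∞) (hf : ∀ ω a h, f (Function.update ω j a) h = f ω h) :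
    ex (PMF.uniformOfFintype (ι → S)) (fun ω => ex (PMF.uniformOfFintype S) (f ω)) =
      ex (PMF.uniformOfFintype (ι → S)) fun ω => f ω (ω j) := by
  rw [ex_pi_update j fun ω => f ω (ω j)]
  simp [hf]

theorem ex_uniform_mem_le {S : Type} [Fintype S] [Nonempty S] (B : Finset S) :
    ex (PMF.uniformOfFintype S) (fun h => ind (h ∈ B)) ≤
      B.card * (Fintype.card S : ℝ≥0∞)⁻¹ := by
  have e : ∑ a, ind (a ∈ B) = B.card := by
    rw [← Finset.sum_subset (Finset.subset_univ B) fun a _ h => ind_false h,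
      Finset.sum_congr rfl fun a h => ind_true h]
    simp
  rw [ex_uniformOfFintype, e, mul_comm]

/-! ### State transformers over `PMF` -/

theorem stateT_bind_apply {σ α β : Type} (x : StateT σ PMF α) (k : α → StateT σ PMF β) (s : σ) :
    (x >>= k) s = (x s).bind fun r => k r.1 r.2 := rfl

theorem stateT_pure_apply {σ α : Type} (a : α) (s : σ) :
    (pure a : StateT σ PMF α) s = PMF.pure (a, s) := rfl

theorem ex_stateT_bind {σ α β : Type} (x : StateT σ PMF α) (k : α → StateT σ PMF β) (s : σ)
    (f : β × σ → ℝ≥0∞) : ex ((x >>= k) s) f = ex (x s) fun r => ex (k r.1 r.2) f := by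
  rw [stateT_bind_apply, ex_bind]

theorem ex_stateT_pure {σ α : Type} (a : α) (s : σ) (f : α × σ → ℝ≥0∞) :
    ex ((pure a : StateT σ PMF α) s) f = f (a, s) := by
  rw [stateT_pure_apply, ex_pure]

theorem mem_support_stateT_bind {σ α β : Type} (x : StateT σ PMF α) (k : α → StateT σ PMF β)
    (s : σ) (r : β × σ) : r ∈ ((x >>= k) s).support ↔
      ∃ r₁ ∈ (x s).support, r ∈ (k r₁.1 r₁.2).support := by
  rw [stateT_bind_apply, PMF.mem_support_bind_iff]

/-- An invariant of a state transformer. -/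
def Preserves {σ α : Type} (I : σ → Prop) (op : StateT σ PMF α) : Prop :=
  ∀ s, I s → ∀ r ∈ (op s).support, I r.2

theorem Preserves.pure {σ α : Type} {I : σ → Prop} (a : α) :
    Preserves I (pure a : StateT σ PMF α) := by
  intro s hs r hr
  rw [stateT_pure_apply, PMF.support_pure, Set.mem_singleton_iff] at hr
  exact hr ▸ hs

theorem Preserves.bind {σ α β : Type} {I : σ → Prop} {x : StateT σ PMF α}
    {k : α → StateT σ PMF β} (hx : Preserves I x) (hk : ∀ a, Preserves I (k a)) :
    Preserves I (x >>= k) := by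
  intro s hs r hr
  obtain ⟨r₁, h₁, h₂⟩ := (mem_support_stateT_bind _ _ _ _).1 hr
  exact hk _ _ (hx s hs r₁ h₁) r h₂

theorem Preserves.foldlM {σ α β : Type} {I : σ → Prop} {g : β → α → StateT σ PMF β}
    (l : List α) (hg : ∀ b, ∀ a ∈ l, Preserves I (g b a)) (b : β) :
    Preserves I (l.foldlM g b) := by
  induction l generalizing b with
  | nil => exact Preserves.pure b
  | cons a l ih =>
    rw [List.foldlM_cons]
    exact (hg b a List.mem_cons_self).bind fun b' =>
      ih (fun b a ha => hg b a (List.mem_cons_of_mem _ ha)) b'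

/-- A quantity that grows by at most `n`. -/
def Grows {σ α : Type} (size : σ → ℕ) (n : ℕ) (op : StateT σ PMF α) : Prop :=
  ∀ s, ∀ r ∈ (op s).support, size r.2 ≤ size s + n

theorem Grows.pure {σ α : Type} {size : σ → ℕ} (a : α) :
    Grows size 0 (pure a : StateT σ PMF α) := by
  intro s r hr
  rw [stateT_pure_apply, PMF.support_pure, Set.mem_singleton_iff] at hr
  simp [hr]

theorem Grows.bind {σ α β : Type} {size : σ → ℕ} {n m N : ℕ} {x : StateT σ PMF α}
    {k : α → StateT σ PMF β} (hx : Grows size n x) (hk : ∀ a, Grows size m (k a))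
    (hN : n + m ≤ N := by omega) : Grows size N (x >>= k) := by
  intro s r hr
  obtain ⟨r₁, h₁, h₂⟩ := (mem_support_stateT_bind _ _ _ _).1 hr
  have := hx s r₁ h₁
  have := hk _ _ r h₂
  omega

theorem Grows.foldlM {σ α β : Type} {size : σ → ℕ} {n : ℕ} {g : β → α → StateT σ PMF β}
    (l : List α) (hg : ∀ b a, Grows size n (g b a)) (b : β) :
    Grows size (l.length * n) (l.foldlM g b) := by
  induction l generalizing b with
  | nil => simpa using Grows.pure b
  | cons a l ih =>
    rw [List.foldlM_cons]
    exact (hg b a).bind ih (by simp [Nat.succ_mul, Nat.add_comm])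

/-! ### Invariants of program runs -/

theorem mem_support_andThen {σ : Type} {d : PMF (Option (Cfg σ))}
    {f : Cfg σ → PMF (Option (Cfg σ))} {o : Option (Cfg σ)} :
    o ∈ (andThen d f).support ↔
      (none ∈ d.support ∧ o = none) ∨ ∃ c, some c ∈ d.support ∧ o ∈ (f c).support := by
  rw [andThen, PMF.mem_support_bind_iff]
  constructor
  · rintro ⟨o', h₁, h₂⟩
    cases o' with
    | none => exact Or.inl ⟨h₁, by simpa using h₂⟩
    | some c => exact Or.inr ⟨c, h₁, h₂⟩
  · rintro (⟨h₁, rfl⟩ | ⟨c, h₁, h₂⟩)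
    · exact ⟨none, h₁, by simp⟩
    · exact ⟨some c, h₁, h₂⟩

theorem ex_andThen {σ : Type} (d : PMF (Option (Cfg σ))) (f : Cfg σ → PMF (Option (Cfg σ)))
    (g : Option (Cfg σ) → ℝ≥0∞) :
    ex (andThen d f) g = ex d fun o => o.elim (g none) fun c => ex (f c) g := by
  rw [andThen, ex_bind]
  congr 1
  funext o
  cases o <;> simp

/-- A property of memory and clock that every step of a program other than an oracle call
preserves. -/
structure StepClosed (B : Mem → ℕ → Prop) : Prop where
  mono : ∀ {m t t'}, B m t → t ≤ t' → B m t'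
  op : ∀ {m t}, B m t → ∀ (o : Op) (d a b e : ℕ), B
    (m.setReg d (o.eval (m.reg a) (m.reg b) (m.reg e)))
    (t + o.cost (m.reg a) (m.reg b) (m.reg e))
  load : ∀ {m t}, B m t → ∀ d k i : ℕ,
    B (m.setReg d (m.arr k (m.reg i))) (t + (1 + (m.reg i).length + (m.arr k (m.reg i)).length))
  store : ∀ {m t}, B m t → ∀ k i s : ℕ,
    B (m.setArr k (m.reg i) (m.reg s)) (t + (1 + (m.reg i).length + (m.reg s).length))
  rand : ∀ {m t}, B m t → ∀ d n : ℕ, ∀ v ∈ (unifBelow (m.reg n).val).support,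
    B (m.setReg d v.bits) (t + (1 + (m.reg n).length))

theorem StepClosed.true : StepClosed fun _ _ => True := by
  constructor <;> intros <;> trivial

/-- Outcomes with the same memory and time, and related oracle states. -/
def SameOutcome {σ σ' : Type} (B : Mem → ℕ → Prop) (R : ℕ → σ → σ' → Prop) :
    Option (Cfg σ) → Option (Cfg σ') → Prop
  | none, none => True
  | some c, some c' => c'.mem = c.mem ∧ c'.time = c.time ∧ B c.mem c.time ∧ R c.time c.orc c'.orc
  | _, _ => False

/-- If every answer of one oracle is a possible answer of another one, then every run with the
first oracle is a possible run with the second one. -/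
theorem run_support_rel {Q σ σ' : Type} {O : Oracle Q σ} {O' : Oracle Q σ'} {B : Mem → ℕ → Prop}
    {R : ℕ → σ → σ' → Prop} (hB : StepClosed B)
    (hR : ∀ {t t' s s'}, R t s s' → t ≤ t' → R t' s s') (hcost : O'.cost = O.cost)
    (hcall : ∀ x m t s s', B m t → R t s s' → ∀ r ∈ (O.reply x m s).support,
      ∃ r' ∈ (O'.reply x m s').support, r'.1 = r.1 ∧ B r.1 (t + O.cost x m) ∧
        R (t + O.cost x m) r.2 r'.2)
    (fuel : ℕ) (p : Prog Q) :
    ∀ (m : Mem) (t : ℕ) (s : σ) (s' : σ'), B m t → R t s s' →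
      ∀ o ∈ (run O fuel p ⟨m, t, s⟩).support, ∃ o' ∈ (run O' fuel p ⟨m, t, s'⟩).support,
        SameOutcome B R o o' := by
  -- Sequencing is isolated because the body of a loop is joined to the remaining iterations in the
  -- same way as two consecutive programs.
  have seqCase : ∀ {d : PMF (Option (Cfg σ))} {d' : PMF (Option (Cfg σ'))}
      {f : Cfg σ → PMF (Option (Cfg σ))} {f' : Cfg σ' → PMF (Option (Cfg σ'))},
      (∀ o ∈ d.support, ∃ o' ∈ d'.support, SameOutcome B R o o') →
      (∀ m t s s', B m t → R t s s' → ∀ o ∈ (f ⟨m, t, s⟩).support,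
        ∃ o' ∈ (f' ⟨m, t, s'⟩).support, SameOutcome B R o o') →
      ∀ o ∈ (andThen d f).support, ∃ o' ∈ (andThen d' f').support, SameOutcome B R o o' := by
    intro d d' f f' hd hf o ho
    rcases mem_support_andThen.1 ho with ⟨h₁, rfl⟩ | ⟨c, h₁, h₂⟩
    · obtain ⟨o', h', hs⟩ := hd _ h₁
      cases o' with
      | none => exact ⟨none, mem_support_andThen.2 (Or.inl ⟨h', rfl⟩), trivial⟩
      | some c => exact hs.elim
    · obtain ⟨o', h', hs⟩ := hd _ h₁
      cases o' with
      | none => exact hs.elim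
      | some c' =>
        obtain ⟨m, t, s⟩ := c
        obtain ⟨m', t', s'⟩ := c'
        obtain ⟨e₁, e₂, hB', hR'⟩ := hs
        simp only at e₁ e₂ hB' hR'
        subst e₁ e₂
        obtain ⟨o', h₃, h₄⟩ := hf _ _ _ _ hB' hR' o h₂
        exact ⟨o', mem_support_andThen.2 (Or.inr ⟨_, h', h₃⟩), h₄⟩
  induction p with
  | skip =>
    intro m t s s' hb hr o ho
    simp only [run, PMF.support_pure, Set.mem_singleton_iff] at ho ⊢
    exact ⟨_, rfl, ho ▸ ⟨rfl, rfl, hB.mono hb (Nat.le_add_right _ _), hR hr (Nat.le_add_right _ _)⟩⟩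
  | op o' d a b e =>
    intro m t s s' hb hr o ho
    simp only [run, PMF.support_pure, Set.mem_singleton_iff] at ho ⊢
    exact ⟨_, rfl, ho ▸ ⟨rfl, rfl, hB.op hb _ _ _ _ _, hR hr (Nat.le_add_right _ _)⟩⟩
  | load d k i =>
    intro m t s s' hb hr o ho
    simp only [run, PMF.support_pure, Set.mem_singleton_iff] at ho ⊢
    exact ⟨_, rfl, ho ▸ ⟨rfl, rfl, hB.load hb _ _ _, hR hr (Nat.le_add_right _ _)⟩⟩
  | store k i s₀ =>
    intro m t s s' hb hr o ho
    simp only [run, PMF.support_pure, Set.mem_singleton_iff] at ho ⊢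
    exact ⟨_, rfl, ho ▸ ⟨rfl, rfl, hB.store hb _ _ _, hR hr (Nat.le_add_right _ _)⟩⟩
  | rand d n =>
    intro m t s s' hb hr o ho
    simp only [run, PMF.mem_support_bind_iff, PMF.support_pure, Set.mem_singleton_iff] at ho ⊢
    obtain ⟨v, hv, rfl⟩ := ho
    exact ⟨_, ⟨v, hv, rfl⟩, rfl, rfl, hB.rand hb _ _ v hv, hR hr (Nat.le_add_right _ _)⟩
  | call x =>
    intro m t s s' hb hr o ho
    simp only [run, PMF.mem_support_bind_iff, PMF.support_pure, Set.mem_singleton_iff] at ho ⊢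
    obtain ⟨r, hr₁, rfl⟩ := ho
    obtain ⟨r', hr', h₁, h₂, h₃⟩ := hcall x m t s s' hb hr r hr₁
    exact ⟨_, ⟨r', hr', rfl⟩, h₁, by simp [hcost], h₂, h₃⟩
  | seq p₁ p₂ ih₁ ih₂ =>
    intro m t s s' hb hr
    simp only [run]
    exact seqCase (ih₁ m t s s' hb hr) ih₂
  | ite r p₁ p₂ ih₁ ih₂ =>
    intro m t s s' hb hr
    simp only [run, Cfg.next]
    split_ifs
    · exact ih₂ _ _ _ _ (hB.mono hb (Nat.le_add_right _ _)) (hR hr (Nat.le_add_right _ _))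
    · exact ih₁ _ _ _ _ (hB.mono hb (Nat.le_add_right _ _)) (hR hr (Nat.le_add_right _ _))
  | loop r p ih =>
    simp only [run]
    generalize fuel = n at *
    -- The fuel also bounds the loops nested in the body. Only the count of the outer loop varies in
    -- the induction, while the fuel of the body stays fixed.
    suffices H : ∀ k m t s s', B m t → R t s s' →
        ∀ o ∈ (iterate r (run O n p) k ⟨m, t, s⟩).support,
          ∃ o' ∈ (iterate r (run O' n p) k ⟨m, t, s'⟩).support, SameOutcome B R o o' from
      H n
    intro k
    induction k with
    | zero =>
      intro m t s s' _ _ o ho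
      simp only [iterate, PMF.support_pure, Set.mem_singleton_iff] at ho ⊢
      exact ⟨_, rfl, ho ▸ trivial⟩
    | succ k ihk =>
      intro m t s s' hb hr
      have hb' := hB.mono hb (Nat.le_add_right t (1 + (m.reg r).length))
      have hr' := hR hr (Nat.le_add_right t (1 + (m.reg r).length))
      simp only [iterate, Cfg.next]
      split_ifs
      · intro o ho
        simp only [PMF.support_pure, Set.mem_singleton_iff] at ho ⊢
        exact ⟨_, rfl, ho ▸ ⟨rfl, rfl, hb', hr'⟩⟩
      · exact seqCase (ih _ _ _ _ hb' hr') ihk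

/-- The run is compared with itself, under the relation that both oracle states are equal and
satisfy `I`. -/
theorem run_preserves {Q σ : Type} {O : Oracle Q σ} {I : σ → Prop}
    (H : ∀ x m, Preserves I (O.reply x m)) {fuel : ℕ} {p : Prog Q} {c c' : Cfg σ} (hc : I c.orc)
    (hc' : some c' ∈ (run O fuel p c).support) : I c'.orc := by
  obtain ⟨o', -, ho⟩ := run_support_rel (R := fun _ (s s' : σ) => s' = s ∧ I s) StepClosed.true
    (fun h _ => h) rfl (fun x m t s s' _ hs r hr => by
      obtain ⟨rfl, hs⟩ := hs
      exact ⟨r, hr, rfl, trivial, rfl, H x m _ hs r hr⟩) fuel p c.mem c.time c.orc c.orc trivial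
      ⟨rfl, hc⟩ _ hc'
  cases o' with
  | none => exact ho.elim
  | some c'' => exact ho.2.2.2.2

/-! ### Approximate simulation of stateful computations -/

/-- Data for comparing computations on `σ₂`-states with computations on `σ₁`-states: the hidden
randomness `μ`, which `σ₂`-states represent a `σ₁`-state for given hidden randomness, and the
accumulated error. -/
structure Hop (Ω σ₁ σ₂ : Type) where
  μ : PMF Ω
  rel : σ₁ → Ω → σ₂ → Prop
  w : σ₁ → ℝ≥0∞

namespace Hop

variable {Ω Θ σ₁ σ₂ α β : Type} (h : Hop Ω σ₁ σ₂)

/-- The average over the hidden randomness of a quantity on the represented states. -/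
def avg (f : Ω → σ₂ → ℝ≥0∞) (s : σ₁) : ℝ≥0∞ :=
  ex h.μ fun ω => ⨆ s₂, ⨆ (_ : h.rel s ω s₂), f ω s₂

/-- The average plus the accumulated error. -/
def Φ (f : Ω → σ₂ → ℝ≥0∞) (s : σ₁) : ℝ≥0∞ := h.avg f s + h.w s

variable {h}

theorem avg_mono {f g : Ω → σ₂ → ℝ≥0∞} {s : σ₁} (H : ∀ ω s₂, h.rel s ω s₂ → f ω s₂ ≤ g ω s₂) :
    h.avg f s ≤ h.avg g s :=
  ex_mono fun ω => iSup_mono fun s₂ => iSup_mono fun hr => H ω s₂ hr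

theorem Φ_mono {f g : Ω → σ₂ → ℝ≥0∞} {s : σ₁} (H : ∀ ω s₂, h.rel s ω s₂ → f ω s₂ ≤ g ω s₂) :
    h.Φ f s ≤ h.Φ g s := add_le_add_left (avg_mono H) _

/-- Hidden randomness that represents no state contributes the empty supremum, which is zero. No
existence of represented states has to be shown for upper bounds. -/
theorem avg_le {f : Ω → σ₂ → ℝ≥0∞} {s : σ₁} {c : ℝ≥0∞} (H : ∀ ω s₂, h.rel s ω s₂ → f ω s₂ ≤ c) :
    h.avg f s ≤ c := ex_le_of_le fun ω => iSup₂_le fun s₂ hr => H ω s₂ hr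

/-- A supremum of averages is at most the average of the suprema. Only this direction is needed,
since all comparisons of games are one-sided. -/
theorem Φ_ex_le {γ : Type} (ν : PMF γ) (f : γ → Ω → σ₂ → ℝ≥0∞) (s : σ₁) :
    h.Φ (fun ω s₂ => ex ν fun v => f v ω s₂) s ≤ ex ν fun v => h.Φ (f v) s := by
  simp only [Φ, ex_add, ex_const]
  refine add_le_add_left ?_ _
  simp only [avg]
  rw [ex_comm ν h.μ]
  refine ex_mono fun ω => ?_
  refine iSup₂_le fun s₂ hr => ex_mono fun v => ?_
  exact le_iSup₂_of_le s₂ hr le_rfl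

variable (h)

/-- The computation `op₂` on represented states is matched by `op₁` up to the error. The
computation and the quantities measured afterwards depend on the hidden randomness through
`obs`. -/
def Sim (obs : Ω → Θ) (I : σ₁ → Prop) (op₂ : Θ → StateT σ₂ PMF α) (op₁ : StateT σ₁ PMF α) : Prop :=
  Preserves I op₁ ∧ ∀ s, I s → ∀ f : Θ → α → σ₂ → ℝ≥0∞, (∀ θ a s₂, f θ a s₂ ≤ 1) →
    h.Φ (fun ω s₂ => ex (op₂ (obs ω) s₂) fun r => f (obs ω) r.1 r.2) s ≤
      ex (op₁ s) fun r => h.Φ (fun ω s₂ => f (obs ω) r.1 s₂) r.2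

variable {h} {obs : Ω → Θ} {I : σ₁ → Prop}

theorem Sim.pure (a : α) : h.Sim obs I (fun _ => pure a) (pure a) :=
  ⟨Preserves.pure a, fun s _ f _ => by simp only [ex_stateT_pure]; exact le_rfl⟩

/-- The success of the continuation is itself a quantity bounded by one that is measured after the
first computation. The two inequalities therefore compose, and the errors add up inside the
potential. -/
theorem Sim.bind {op₂ : Θ → StateT σ₂ PMF α} {op₁ : StateT σ₁ PMF α}
    {k₂ : Θ → α → StateT σ₂ PMF β} {k₁ : α → StateT σ₁ PMF β} (hx : h.Sim obs I op₂ op₁)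
    (hk : ∀ a, h.Sim obs I (fun θ => k₂ θ a) (k₁ a)) :
    h.Sim obs I (fun θ => op₂ θ >>= k₂ θ) (op₁ >>= k₁) := by
  refine ⟨hx.1.bind fun a => (hk a).1, fun s hs f hf => ?_⟩
  simp only [ex_stateT_bind]
  refine (hx.2 s hs (fun θ a s₂ => ex (k₂ θ a s₂) fun r => f θ r.1 r.2)
    fun θ a s₂ => ex_le_of_le fun r => hf _ _ _).trans ?_
  exact ex_mono_support fun r hr => (hk r.1).2 r.2 (hx.1 s hs r hr) f hf

theorem Sim.foldlM {γ : Type} {g₂ : Θ → β → γ → StateT σ₂ PMF β} {g₁ : β → γ → StateT σ₁ PMF β}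
    (l : List γ) (hg : ∀ b c, h.Sim obs I (fun θ => g₂ θ b c) (g₁ b c)) (b : β) :
    h.Sim obs I (fun θ => l.foldlM (g₂ θ) b) (l.foldlM g₁ b) := by
  induction l generalizing b with
  | nil => exact Sim.pure b
  | cons a l ih =>
    simp only [List.foldlM_cons]
    exact (hg b a).bind ih

/-- A coarser view of the hidden randomness leaves fewer quantities to be tested, so the comparison
is inherited. -/
theorem Sim.coarsen {Θ' : Type} (obs' : Θ → Θ') {op₂ : Θ' → StateT σ₂ PMF α}
    {op₁ : StateT σ₁ PMF α} (H : h.Sim obs I (fun θ => op₂ (obs' θ)) op₁) :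
    h.Sim (obs' ∘ obs) I op₂ op₁ :=
  ⟨H.1, fun s hs f hf => H.2 s hs (fun θ => f (obs' θ)) fun _ _ _ => hf _ _ _⟩

/-- Matching all oracle calls suffices for matching all programs. -/
theorem run_le {Q : Type} {O₂ : Θ → Oracle Q σ₂} {O₁ : Oracle Q σ₁}
    (hcost : ∀ θ, (O₂ θ).cost = O₁.cost)
    (H : ∀ x m, h.Sim obs I (fun θ => (O₂ θ).reply x m) (O₁.reply x m)) (fuel : ℕ) (p : Prog Q) :
    ∀ (m : Mem) (t : ℕ) (s : σ₁), I s → ∀ (f : Θ → Cfg σ₂ → ℝ≥0∞), (∀ θ c, f θ c ≤ 1) →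
      h.Φ (fun ω s₂ => ex (run (O₂ (obs ω)) fuel p ⟨m, t, s₂⟩) fun o =>
          o.elim 1 (f (obs ω))) s ≤
        ex (run O₁ fuel p ⟨m, t, s⟩) fun o => o.elim ⊤ fun c =>
          h.Φ (fun ω s₂ => f (obs ω) ⟨c.mem, c.time, s₂⟩) c.orc := by
  -- A timeout counts as one on the represented side, which keeps the quantities bounded by one, and
  -- as infinity on the other side. The estimate thus says nothing about timeouts, and `forger_run`
  -- excludes them later.
  have elimLe : ∀ {f : Θ → Cfg σ₂ → ℝ≥0∞}, (∀ θ c, f θ c ≤ 1) → ∀ θ (μ : PMF (Option (Cfg σ₂))),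
      (ex μ fun o => o.elim 1 (f θ)) ≤ 1 := fun hf θ μ => ex_le_of_le fun o => by
    cases o with
    | none => exact le_rfl
    | some c => exact hf θ c
  have elim₂ : ∀ (f : Θ → Cfg σ₂ → ℝ≥0∞) (k : Cfg σ₂ → PMF (Option (Cfg σ₂))) θ,
      (fun o : Option (Cfg σ₂) => o.elim ((none : Option (Cfg σ₂)).elim 1 (f θ)) fun c =>
        ex (k c) fun o => o.elim 1 (f θ)) =
      fun o => o.elim 1 fun c => ex (k c) fun o => o.elim 1 (f θ) := fun f k θ => rfl
  have pres : ∀ x m, Preserves I (O₁.reply x m) := fun x m => (H x m).1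
  induction p with
  | skip => intro m t s _ f _; simp [run, Cfg.next]
  | op => intro m t s _ f _; simp [run, Cfg.next]
  | load => intro m t s _ f _; simp [run, Cfg.next]
  | store => intro m t s _ f _; simp [run, Cfg.next]
  | rand d n =>
    intro m t s _ f _
    simp only [run, ex_bind, ex_pure, Cfg.next, Option.elim]
    exact Φ_ex_le _ _ _
  | call x =>
    intro m t s hs f hf
    simp only [run, ex_bind, ex_pure, Option.elim, hcost]
    exact (H x m).2 s hs (fun θ m' s₂ => f θ ⟨m', t + O₁.cost x m, s₂⟩) fun _ _ _ => hf _ _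
  | seq p₁ p₂ ih₁ ih₂ =>
    intro m t s hs f hf
    simp only [run, ex_andThen]
    refine (ih₁ m t s hs (fun θ c => ex (run (O₂ θ) fuel p₂ c) fun o => o.elim 1 (f θ))
      fun θ c => elimLe hf θ _).trans (ex_mono_support fun o ho => ?_)
    cases o with
    | none => exact le_rfl
    | some c => exact ih₂ c.mem c.time c.orc (run_preserves pres hs ho) f hf
  | ite r p₁ p₂ ih₁ ih₂ =>
    intro m t s hs f hf
    simp only [run, Cfg.next]
    split_ifs
    · exact ih₂ _ _ _ hs f hf
    · exact ih₁ _ _ _ hs f hf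
  | loop r p ih =>
    simp only [run]
    suffices K : ∀ k (m : Mem) (t : ℕ) (s : σ₁), I s → ∀ (f : Θ → Cfg σ₂ → ℝ≥0∞),
        (∀ θ c, f θ c ≤ 1) →
        h.Φ (fun ω s₂ => ex (iterate r (run (O₂ (obs ω)) fuel p) k ⟨m, t, s₂⟩) fun o =>
          o.elim 1 (f (obs ω))) s ≤
        ex (iterate r (run O₁ fuel p) k ⟨m, t, s⟩) fun o => o.elim ⊤ fun c =>
          h.Φ (fun ω s₂ => f (obs ω) ⟨c.mem, c.time, s₂⟩) c.orc from K fuel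
    intro k
    induction k with
    | zero => intro m t s _ f _; simp [iterate]
    | succ k ihk =>
      intro m t s hs f hf
      simp only [iterate, Cfg.next]
      split_ifs
      · simp
      · simp only [ex_andThen]
        refine (ih m _ s hs (fun θ c => ex (iterate r (run (O₂ θ) fuel p) k c) fun o =>
          o.elim 1 (f θ)) fun θ c => elimLe hf θ _).trans (ex_mono_support fun o ho => ?_)
        cases o with
        | none => exact le_rfl
        | some c =>
          exact ihk c.mem c.time c.orc (run_preserves pres (c := ⟨m, _, s⟩) hs ho) f hf

end Hop

namespace LAHases

/-! ### Games -/

/-- Hash values. -/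
abbrev Star (pp : GroupParams) := {n : ℕ // n ∈ Finset.Ico 1 pp.q}

instance (pp : GroupParams) : Inhabited (Star pp) :=
  ⟨⟨1, Finset.mem_Ico.2 ⟨le_rfl, pp.prime_q.one_lt⟩⟩⟩

/-- The uniform distribution on hash values. -/
def unif (pp : GroupParams) : PMF (Star pp) := PMF.uniformOfFintype _

/-- A lazily sampled random oracle with the record of the points asked. The flag tells whether a
point asked of `H_0` or `H_1` starts with the attacked private key. -/
structure Pub (pp : GroupParams) where
  T : Fin 3 → List (Str × Star pp)
  flag : Bool

/-- The string starts with the number of a discrete logarithm of `Y`. -/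
def Hit (pp : GroupParams) (Y : (ZMod pp.p)ˣ) (u : Str) : Prop :=
  pp.α ^ Str.val (u.take pp.q.size) = Y

-- `H_2` is exempt because the scheme never evaluates it at a point derived from a private key.
open Classical in
def Pub.check {pp : GroupParams} (s : Pub pp) (Y : (ZMod pp.p)ˣ) (k : Fin 3) (u : Str) : Pub pp :=
  { s with flag := s.flag || decide (k ≠ 2 ∧ Hit pp Y u) }

/-- A lookup finds the newest record first, so adding a record at a known point overrides its value.
This is how `H_2` gets programmed. -/
def Pub.add {pp : GroupParams} (s : Pub pp) (k : Fin 3) (u : Str) (h : Star pp) : Pub pp :=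
  { s with T := Function.update s.T k ((u, h) :: s.T k) }

/-- A hash query. -/
def pubH (pp : GroupParams) (Y : (ZMod pp.p)ˣ) (k : Fin 3) (u : Str) :
    StateT (Pub pp) PMF (Star pp) := fun s =>
  match (s.T k).lookup u with
  | some h => PMF.pure (h, s.check Y k u)
  | none => (unif pp).bind fun h => PMF.pure (h, (s.check Y k u).add k u h)

/-- The part of a commitment computation after the derivation of the private key. -/
def keyCom (pp : GroupParams) (L : ℕ) {σ : Type} (hash : Fin 3 → Str → StateT σ PMF ℕ) (y j : ℕ) :
    StateT σ PMF (ZMod pp.p)ˣ := do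
  let rj ← hash 1 (pp.enc y ++ j.bits)
  let r ← (List.finRange L).foldlM (fun (acc : ZMod pp.q) ℓ => do
    let rl ← hash 1 (pp.enc rj ++ (ℓ.val + 1).bits)
    pure (acc + (rl : ZMod pp.q))) 0
  pure (pp.α ^ r.val)

/-- The exponent computed in a verification. -/
def verSum (pp : GroupParams) (L : ℕ) {σ : Type} (hash : Fin 3 → Str → StateT σ PMF ℕ)
    (M : Fin L → Str) (x : ℕ) : StateT σ PMF (ZMod pp.q) :=
  (List.finRange L).foldlM (fun (acc : ZMod pp.q) ℓ => do
    let xl ← hash 0 (pp.enc x ++ (ℓ.val + 1).bits)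
    let el ← hash 2 (M ℓ ++ pp.enc xl)
    pure (acc + (el : ZMod pp.q))) 0

/-- The state of the ideal game: besides the random oracle, the strings `x_j` of the signatures,
the epochs whose commitments have been determined, the exponents `r_j^ℓ`, and the values `e_j^ℓ`
used in signatures. -/
structure Ideal (pp : GroupParams) (L J : ℕ) where
  pub : Pub pp
  xs : List (Fin (J + 1) × Star pp)
  com : Finset (Fin (J + 1))
  sh : Fin (J + 1) → Fin L → Option (Star pp)
  es : Fin (J + 1) → Fin L → Option (Star pp)
  epoch : ℕ
  signed : List (Fin L → Str)

/-- The number of records. -/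
def Ideal.size {pp : GroupParams} {L J : ℕ} (s : Ideal pp L J) : ℕ :=
  (s.pub.T 0).length + (s.pub.T 1).length + (s.pub.T 2).length + s.com.card + s.xs.length

namespace Ideal

variable (pp : GroupParams) (L J : ℕ) (y : ℕ)

def hash (k : Fin 3) (u : Str) : StateT (Ideal pp L J) PMF ℕ := fun s =>
  (pubH pp (pp.α ^ y) k u s.pub).bind fun r => PMF.pure (r.1.1, { s with pub := r.2 })

/-- The extra copy in `es` marks the answer as the value `e_j^ℓ` of a signature, which the
simulation has to choose beforehand. -/
def hashRec (j : Fin (J + 1)) (ℓ : Fin L) (u : Str) : StateT (Ideal pp L J) PMF ℕ := fun s =>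
  (pubH pp (pp.α ^ y) 2 u s.pub).bind fun r => PMF.pure (r.1.1, { s with
    pub := r.2
    es := Function.update s.es j (Function.update (s.es j) ℓ (some r.1)) })

/-- This stands for the evaluation of `r_j = H_1(y ‖ j)`. The string `r_j` itself does not occur in
the ideal game; it belongs to the hidden randomness. -/
def touch (j : Fin (J + 1)) : StateT (Ideal pp L J) PMF Unit := fun s =>
  PMF.pure ((), { s with com := insert j s.com })

/-- The lazily drawn counterpart of `H_1(r_j ‖ ℓ)`, kept apart from the public tables. -/
def share (j : Fin (J + 1)) (ℓ : Fin L) : StateT (Ideal pp L J) PMF ℕ := fun s =>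
  match s.sh j ℓ with
  | some h => PMF.pure (h.1, s)
  | none => (unif pp).bind fun h => PMF.pure (h.1, { s with
      sh := Function.update s.sh j (Function.update (s.sh j) ℓ (some h)) })

/-- The lazily drawn counterpart of `H_0(y ‖ j)`. -/
def getX (j : Fin (J + 1)) : StateT (Ideal pp L J) PMF ℕ := fun s =>
  match s.xs.lookup j with
  | some h => PMF.pure (h.1, s)
  | none => (unif pp).bind fun h => PMF.pure (h.1, { s with xs := (j, h) :: s.xs })

def comShares (j : Fin (J + 1)) : StateT (Ideal pp L J) PMF (ZMod pp.q) :=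
  (List.finRange L).foldlM (fun (acc : ZMod pp.q) ℓ => do
    let rl ← share pp L J j ℓ
    pure (acc + (rl : ZMod pp.q))) 0

def comId (j : Fin (J + 1)) : StateT (Ideal pp L J) PMF (ZMod pp.p)ˣ := do
  touch pp L J j
  let r ← comShares pp L J j
  pure (pp.α ^ r.val)

def signStep (j : Fin (J + 1)) (M : Fin L → Str) (x : ℕ) (acc : ZMod pp.q) (ℓ : Fin L) :
    StateT (Ideal pp L J) PMF (ZMod pp.q) := do
  let xl ← hash pp L J y 0 (pp.enc x ++ (ℓ.val + 1).bits)
  let rl ← share pp L J j ℓ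
  let el ← hashRec pp L J y j ℓ (M ℓ ++ pp.enc xl)
  pure (agg pp [acc, (rl : ZMod pp.q) - (el : ZMod pp.q) * (y : ZMod pp.q)])

def sign (j : Fin (J + 1)) (M : Fin L → Str) : StateT (Ideal pp L J) PMF (ZMod pp.q × ℕ) := do
  let x ← getX pp L J j
  touch pp L J j
  let s ← (List.finRange L).foldlM (signStep pp L J y j M x) 0
  pure (s, x)

open Classical in
def com' (keys : Str → Star pp) (id i : Str) (j : Fin (J + 1)) :
    StateT (Ideal pp L J) PMF (ZMod pp.p)ˣ :=
  if i = id then comId pp L J j else keyCom pp L (hash pp L J y) (keys i).1 j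

open Classical in
/-- The answers of the oracles of the ideal game. -/
def reply (ids : List Str) (keys : Str → Star pp) (id : Str) :
    Query → Mem → StateT (Ideal pp L J) PMF Mem
  | .hash k d u, m => do
      let h ← hash pp L J (keys id).1 k (m.reg u)
      pure (putHash pp m d h)
  | .sign ds dx dj a, m => fun (s : Ideal pp L J) =>
      if h : s.epoch ≤ J then
        (sign pp L J (keys id).1 ⟨s.epoch, Nat.lt_succ_of_le h⟩ (batch L m a) s).bind fun r =>
          PMF.pure (putSig pp m ds dx dj (some (r.1.1.val, r.1.2, s.epoch)),
            { r.2 with epoch := s.epoch + 1, signed := batch L m a :: s.signed })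
      else PMF.pure (putSig pp m ds dx dj none, s)
  | .com d i j, m =>
      if h : m.reg i ∈ ids ∧ 1 ≤ (m.reg j).val ∧ (m.reg j).val ≤ J then do
        let R ← com' pp L J (keys id).1 keys id (m.reg i) ⟨(m.reg j).val, Nat.lt_succ_of_le h.2.2⟩
        pure (putCom pp m d (some R))
      else pure (putCom pp m d none)

/-- The oracles of the ideal game. -/
def oracle (κ : ℕ) (ids : List Str) (keys : Str → Star pp) (id : Str) :
    Oracle Query (Ideal pp L J) where
  cost := queryCost L κ J
  reply := reply pp L J ids keys id

open Classical in
/-- Verification of a forgery in the ideal game. -/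
def verify (j : Fin (J + 1)) (M : Fin L → Str) (s x : ZMod pp.q) :
    StateT (Ideal pp L J) PMF Bool := do
  let C ← comId pp L J j
  let e ← verSum pp L (hash pp L J y) M x.val
  pure (decide (C = (pp.α ^ y) ^ e.val * pp.α ^ s.val))

open Classical in
/-- The outcome of the ideal game for a forgery in the memory. -/
def finish (m : Mem) : StateT (Ideal pp L J) PMF Bool := fun st =>
  if h : ((m.reg 0).val < pp.q ∧ (m.reg 1).val < pp.q ∧ 1 ≤ (m.reg 2).val ∧ (m.reg 2).val ≤ J) ∧
      batch L m 1 ∉ st.signed then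
    verify pp L J y ⟨(m.reg 2).val, Nat.lt_succ_of_le h.1.2.2.2⟩ (batch L m 1) (m.reg 0).val
      (m.reg 1).val st
  else PMF.pure (false, st)

end Ideal

/-- The state of the simulation of the ideal game by an attacker who does not know the private
key: for each epoch, the values `e_j^ℓ` and the component `s` of the signature are chosen when the
commitment is determined. -/
structure SimState (pp : GroupParams) (L J : ℕ) where
  pub : Pub pp
  memo : Fin (J + 1) → Option ((Fin L → Star pp) × ZMod pp.q)
  epoch : ℕ

namespace SimState

variable (pp : GroupParams) (L J : ℕ) (Y : (ZMod pp.p)ˣ)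

def hash (k : Fin 3) (u : Str) : StateT (SimState pp L J) PMF ℕ := fun s =>
  (pubH pp Y k u s.pub).bind fun r => PMF.pure (r.1.1, { s with pub := r.2 })

/-- The component `s` is uniform over all residues, whereas in the ideal game it is a sum of nonzero
hash values minus `y ∑ e_j^ℓ`. The small difference is accounted for in `sim_touch`. -/
def touch (j : Fin (J + 1)) : StateT (SimState pp L J) PMF Unit := fun s =>
  match s.memo j with
  | some _ => PMF.pure ((), s)
  | none => (PMF.uniformOfFintype (Fin L → Star pp)).bind fun e => (unifBelow pp.q).bind fun v =>
      PMF.pure ((), { s with memo := Function.update s.memo j (some (e, (v : ZMod pp.q))) })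

def read (j : Fin (J + 1)) :
    StateT (SimState pp L J) PMF ((Fin L → Star pp) × ZMod pp.q) := fun s =>
  PMF.pure ((s.memo j).getD default, s)

/-- The sum of the values `e_j^ℓ`. -/
def esum (e : Fin L → Star pp) : ZMod pp.q := ∑ ℓ, ((e ℓ).1 : ZMod pp.q)

/-- The commitment is computed from the prepared signature through the verification equation, hence
without the private key. -/
def comId (j : Fin (J + 1)) : StateT (SimState pp L J) PMF (ZMod pp.p)ˣ := do
  touch pp L J j
  let v ← read pp L J j
  pure (Y ^ (esum pp L v.1).val * pp.α ^ v.2.val)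

/-- No test for an earlier record at the point is made. That case is one of the bad events in
`sim_signStep`. -/
def program (j : Fin (J + 1)) (ℓ : Fin L) (u : Str) : StateT (SimState pp L J) PMF Unit := fun s =>
  PMF.pure ((), { s with pub := s.pub.add 2 u (((s.memo j).getD default).1 ℓ) })

def signStep (j : Fin (J + 1)) (M : Fin L → Str) (x : ℕ) (_ : Unit) (ℓ : Fin L) :
    StateT (SimState pp L J) PMF Unit := do
  let xl ← hash pp L J Y 0 (pp.enc x ++ (ℓ.val + 1).bits)
  program pp L J j ℓ (M ℓ ++ pp.enc xl)

/-- The string `x` need not be stored, because the epoch counter lets each epoch be signed only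
once. -/
def sign (j : Fin (J + 1)) (M : Fin L → Str) : StateT (SimState pp L J) PMF (ZMod pp.q × ℕ) := do
  let x ← fun s => (unif pp).bind fun h => PMF.pure (h.1, s)
  touch pp L J j
  (List.finRange L).foldlM (signStep pp L J Y j M x) ()
  let v ← read pp L J j
  pure (v.2, x)

open Classical in
def com' (keys : Str → Star pp) (id i : Str) (j : Fin (J + 1)) :
    StateT (SimState pp L J) PMF (ZMod pp.p)ˣ :=
  if i = id then comId pp L J Y j else keyCom pp L (hash pp L J Y) (keys i).1 j

open Classical in
/-- The answers of the simulated oracles. -/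
def reply (ids : List Str) (keys : Str → Star pp) (id : Str) :
    Query → Mem → StateT (SimState pp L J) PMF Mem
  | .hash k d u, m => do
      let h ← hash pp L J Y k (m.reg u)
      pure (putHash pp m d h)
  | .sign ds dx dj a, m => fun (s : SimState pp L J) =>
      if h : s.epoch ≤ J then
        (sign pp L J Y ⟨s.epoch, Nat.lt_succ_of_le h⟩ (batch L m a) s).bind fun r =>
          PMF.pure (putSig pp m ds dx dj (some (r.1.1.val, r.1.2, s.epoch)),
            { r.2 with epoch := s.epoch + 1 })
      else PMF.pure (putSig pp m ds dx dj none, s)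
  | .com d i j, m =>
      if h : m.reg i ∈ ids ∧ 1 ≤ (m.reg j).val ∧ (m.reg j).val ≤ J then do
        let R ← com' pp L J Y keys id (m.reg i) ⟨(m.reg j).val, Nat.lt_succ_of_le h.2.2⟩
        pure (putCom pp m d (some R))
      else pure (putCom pp m d none)

/-- The simulated oracles. -/
def oracle (κ : ℕ) (ids : List Str) (keys : Str → Star pp) (id : Str) :
    Oracle Query (SimState pp L J) where
  cost := queryCost L κ J
  reply := reply pp L J Y ids keys id

/-- The discrete logarithm computed from a forgery. -/
def extract (j : Fin (J + 1)) (M : Fin L → Str) (s x : ZMod pp.q) :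
    StateT (SimState pp L J) PMF (ZMod pp.q) := do
  touch pp L J j
  let v ← read pp L J j
  let e ← verSum pp L (hash pp L J Y) M x.val
  pure ((v.2 - s) * (e - esum pp L v.1) ^ (pp.q - 2))

/-- The discrete logarithm computed from a forgery in the memory. -/
def finish (m : Mem) : StateT (SimState pp L J) PMF (ZMod pp.q) := fun st =>
  if h : (m.reg 0).val < pp.q ∧ (m.reg 1).val < pp.q ∧ 1 ≤ (m.reg 2).val ∧ (m.reg 2).val ≤ J then
    extract pp L J Y ⟨(m.reg 2).val, Nat.lt_succ_of_le h.2.2.2⟩ (batch L m 1) (m.reg 0).val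
      (m.reg 1).val st
  else PMF.pure (0, st)

end SimState

end LAHases

/-! ### Bit strings -/

theorem Str.val_nil : Str.val [] = 0 := rfl

theorem Str.val_cons (b : Bool) (s : Str) : Str.val (b :: s) = Nat.bit b (Str.val s) := rfl

theorem Str.val_lt (s : Str) : s.val < 2 ^ s.length := by
  induction s with
  | nil => simp [Str.val_nil]
  | cons b s ih =>
    rw [Str.val_cons, List.length_cons, pow_succ, Nat.bit_val]
    cases b <;> simp <;> omega

@[simp] theorem Str.val_bits (n : ℕ) : Str.val n.bits = n := by
  induction n using Nat.binaryRec' with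
  | zero => simp [Str.val_nil]
  | bit b n h ih => rw [Nat.bits_append_bit n b h, Str.val_cons, ih]

theorem bits_injective : Function.Injective Nat.bits := fun a b h => by
  rw [← Str.val_bits a, h, Str.val_bits]

theorem length_bits (n : ℕ) : n.bits.length = n.size := (Nat.size_eq_bits_len n).symm ▸ rfl

@[simp] theorem length_fixedBits (w n : ℕ) : (fixedBits w n).length = w := by simp [fixedBits]

theorem fixedBits_succ (w n : ℕ) : fixedBits (w + 1) n = n.bodd :: fixedBits w n.div2 := by
  simp only [fixedBits, List.ofFn_succ, Fin.val_zero, Nat.testBit_zero, Fin.val_succ,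
    Nat.testBit_succ, Nat.div2_val]
  congr 1
  rw [Nat.mod_two_of_bodd]; cases n.bodd <;> rfl

theorem val_fixedBits {w n : ℕ} (h : n < 2 ^ w) : (fixedBits w n).val = n := by
  induction w generalizing n with
  | zero => simp at h; simp [h, fixedBits, Str.val_nil]
  | succ w ih =>
    rw [fixedBits_succ, Str.val_cons, ih, Nat.bit_bodd_div2]
    rw [Nat.div2_val]; rw [pow_succ] at h; omega

theorem fixedBits_injOn {w m n : ℕ} (hm : m < 2 ^ w) (hn : n < 2 ^ w)
    (h : fixedBits w m = fixedBits w n) : m = n := by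
  rw [← val_fixedBits hm, h, val_fixedBits hn]

namespace GroupParams

variable (pp : GroupParams)

theorem length_enc (n : ℕ) : (pp.enc n).length = pp.q.size := length_fixedBits _ _

theorem lt_two_pow {n : ℕ} (h : n < pp.q) : n < 2 ^ pp.q.size := h.trans (Nat.lt_size_self _)

theorem val_enc {n : ℕ} (h : n < pp.q) : (pp.enc n).val = n := val_fixedBits (pp.lt_two_pow h)

theorem enc_inj {m n : ℕ} (hm : m < pp.q) (hn : n < pp.q) (h : pp.enc m = pp.enc n) : m = n :=
  fixedBits_injOn (pp.lt_two_pow hm) (pp.lt_two_pow hn) h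

@[simp] theorem take_enc_append (n : ℕ) (u : Str) : (pp.enc n ++ u).take pp.q.size = pp.enc n := by
  simp [length_enc]

theorem enc_append_inj {m n : ℕ} {u v : Str} (hm : m < pp.q) (hn : n < pp.q)
    (h : pp.enc m ++ u = pp.enc n ++ v) : m = n ∧ u = v := by
  obtain ⟨h₁, h₂⟩ := List.append_inj h (by simp [length_enc])
  exact ⟨pp.enc_inj hm hn h₁, h₂⟩

/-- The fixed length of encoded hash values makes `m ‖ x` decodable from its end, although messages
have arbitrary length. -/
theorem append_enc_inj {m n : ℕ} {u v : Str} (hm : m < pp.q) (hn : n < pp.q)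
    (h : u ++ pp.enc m = v ++ pp.enc n) : u = v ∧ m = n := by
  obtain ⟨h₁, h₂⟩ := List.append_inj' h (by simp [length_enc])
  exact ⟨h₁, pp.enc_inj hm hn h₂⟩

theorem pow_mod_q (n : ℕ) : pp.α ^ (n % pp.q) = pp.α ^ n := by
  conv_rhs => rw [← pow_mod_orderOf, pp.order_α]

theorem pow_eq_pow_iff {m n : ℕ} : pp.α ^ m = pp.α ^ n ↔ (m : ZMod pp.q) = n := by
  rw [pow_eq_pow_iff_modEq, pp.order_α, ZMod.natCast_eq_natCast_iff]

end GroupParams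

namespace LAHases

theorem star_lt {pp : GroupParams} (h : Star pp) : h.1 < pp.q := (Finset.mem_Ico.1 h.2).2

theorem star_pos {pp : GroupParams} (h : Star pp) : 1 ≤ h.1 := (Finset.mem_Ico.1 h.2).1

theorem card_star (pp : GroupParams) : Fintype.card (Star pp) = pp.q - 1 := by simp

theorem ex_unifStar (pp : GroupParams) (f : ℕ → ℝ≥0∞) :
    ex pp.unifStar f = ex (unif pp) fun h => f h.1 := by
  have e : pp.unifStar = (unif pp).map (·.1) := by
    ext n
    have e₁ : pp.unifStar n = if n ∈ Finset.Ico 1 pp.q then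
        ((Finset.Ico 1 pp.q).card : ℝ≥0∞)⁻¹ else 0 := by
      refine Eq.trans (PMF.uniformOfFinset_apply (s := Finset.Ico 1 pp.q) _ n) ?_
      congr
    rw [e₁, unif, PMF.map_apply, tsum_fintype]
    simp only [PMF.uniformOfFintype_apply, card_star, Nat.card_Ico]
    split_ifs with h
    · rw [Finset.sum_eq_single ⟨n, h⟩]
      · simp
      · intro b _ hb; rw [if_neg]; rintro rfl; exact hb rfl
      · simp
    · rw [Finset.sum_eq_zero]; intro b _; rw [if_neg]; rintro rfl; exact h b.2
  rw [e, ex_map]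

/-- The basic unit of error probabilities. -/
def eta (κ : ℕ) : ℝ≥0∞ := 2 / 2 ^ κ

theorem inv_two_pow_le_eta (κ : ℕ) : ((2 : ℝ≥0∞) ^ κ)⁻¹ ≤ eta κ := by
  rw [eta, div_eq_mul_inv]
  exact le_mul_of_one_le_left (by simp) (by norm_num)

theorem inv_q_le_eta {pp : GroupParams} {κ : ℕ} (h : 2 ^ κ ≤ pp.q) :
    (pp.q : ℝ≥0∞)⁻¹ ≤ eta κ := by
  refine le_trans (ENNReal.inv_le_inv.2 ?_) (inv_two_pow_le_eta κ)
  exact_mod_cast h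

/-- Here the factor 2 in `eta` is used: `q ≥ 2 ^ κ` only gives `q - 1 ≥ 2 ^ κ / 2`. -/
theorem inv_card_star_le_eta {pp : GroupParams} {κ : ℕ} (h : 2 ^ κ ≤ pp.q) :
    (Fintype.card (Star pp) : ℝ≥0∞)⁻¹ ≤ eta κ := by
  rw [card_star, eta, ← one_div]
  have h2 := pp.prime_q.two_le
  refine ENNReal.div_le_of_le_mul ?_
  have h3 : (2 : ℝ≥0∞) ^ κ ≤ 2 * ((pp.q - 1 : ℕ) : ℝ≥0∞) := by
    have : 2 ^ κ ≤ 2 * (pp.q - 1) := by omega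
    exact_mod_cast this
  rw [mul_comm, mul_div, ENNReal.le_div_iff_mul_le (by simp) (by simp), one_mul, mul_comm]
  exact h3

open Classical in
/-- A uniform hash value hits a small set with small probability. -/
theorem ex_unif_mem_le {pp : GroupParams} {κ : ℕ} (h : 2 ^ κ ≤ pp.q) (p : Star pp → Prop)
    {ι : Type*} (B : Finset ι) (n : ℕ) (hn : B.card ≤ n) (g : ι → Star pp)
    (hB : ∀ h, p h → ∃ i ∈ B, g i = h) :
    ex (unif pp) (fun h => ind (p h)) ≤ n * eta κ := by
  refine le_trans (ex_mono fun h => ?_) ((ex_uniform_mem_le (B.image g)).trans ?_)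
  · exact ind_mono fun h₁ => Finset.mem_image.2 (hB h h₁)
  · refine mul_le_mul' ?_ (inv_card_star_le_eta h)
    exact_mod_cast Finset.card_image_le.trans hn

/-- The accumulated error of `n` steps. -/
def pot (δ : ℕ → ℝ≥0∞) (n : ℕ) : ℝ≥0∞ := ∑ i ∈ Finset.range n, δ i

theorem pot_mono (δ : ℕ → ℝ≥0∞) : Monotone (pot δ) := fun _ _ h =>
  Finset.sum_le_sum_of_subset (Finset.range_mono h)

/-- A step that adds a record to `m` existing ones may make an error of `δ m`, because the potential
rises by at least that much. -/
theorem pot_add_le (δ : ℕ → ℝ≥0∞) {m n : ℕ} (h : m < n) : pot δ m + δ m ≤ pot δ n := by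
  have e : pot δ (m + 1) = pot δ m + δ m := Finset.sum_range_succ _ _
  exact e ▸ pot_mono δ h

theorem pot_le (δ : ℕ → ℝ≥0∞) (hδ : Monotone δ) (n : ℕ) : pot δ n ≤ n * δ n := by
  refine (Finset.sum_le_card_nsmul _ _ (δ n) fun i hi => hδ (Finset.mem_range.1 hi).le).trans ?_
  simp

theorem ex_H (pp : GroupParams) (k : Fin 3) (u : Str) (T : Table) (f : ℕ × Table → ℝ≥0∞) :
    ex (H pp k u T) f = match T k u with
      | some h => f (h, T)
      | none => ex (unif pp) fun h =>
          f (h.1, Function.update T k (Function.update (T k) u (some h.1))) := by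
  unfold H
  cases T k u with
  | some h => exact ex_pure _ _
  | none => simp only [ex_bind, ex_pure]; exact ex_unifStar pp _

theorem ex_pubH (pp : GroupParams) (Y : (ZMod pp.p)ˣ) (k : Fin 3) (u : Str) (s : Pub pp)
    (f : Star pp × Pub pp → ℝ≥0∞) :
    ex (pubH pp Y k u s) f = match (s.T k).lookup u with
      | some h => f (h, s.check Y k u)
      | none => ex (unif pp) fun h => f (h, (s.check Y k u).add k u h) := by
  unfold pubH
  cases (s.T k).lookup u with
  | some h => exact ex_pure _ _
  | none => simp

theorem lookup_add {pp : GroupParams} (s : Pub pp) (k k' : Fin 3) (u u' : Str) (h : Star pp) :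
    ((s.add k u h).T k').lookup u' = if k' = k ∧ u' = u then some h else (s.T k').lookup u' := by
  unfold Pub.add
  by_cases hk : k' = k
  · subst hk
    by_cases hu : u' = u
    · simp [hu]
    · simp [hu, List.lookup_cons]
      have : (u' == u) = false := by simpa using hu
      simp [this]
  · simp [hk]

@[simp] theorem check_T {pp : GroupParams} (s : Pub pp) (Y : (ZMod pp.p)ˣ) (k : Fin 3) (u : Str) :
    (s.check Y k u).T = s.T := rfl

/-- The number of records of a random oracle. -/
def Pub.size {pp : GroupParams} (s : Pub pp) : ℕ :=
  (s.T 0).length + (s.T 1).length + (s.T 2).length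

@[simp] theorem size_check {pp : GroupParams} (s : Pub pp) (Y : (ZMod pp.p)ˣ) (k : Fin 3)
    (u : Str) : (s.check Y k u).size = s.size := rfl

theorem size_add {pp : GroupParams} (s : Pub pp) (k : Fin 3) (u : Str) (h : Star pp) :
    (s.add k u h).size = s.size + 1 := by
  unfold Pub.add Pub.size
  fin_cases k <;> simp [Function.update] <;> omega

theorem length_le_size {pp : GroupParams} (s : Pub pp) (k : Fin 3) : (s.T k).length ≤ s.size := by
  unfold Pub.size
  fin_cases k <;> simp <;> omega

theorem Ideal.size_eq {pp : GroupParams} {L J : ℕ} (s : Ideal pp L J) :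
    s.size = s.pub.size + s.com.card + s.xs.length := rfl

theorem mem_keys_of_lookup {α β : Type} [BEq α] [LawfulBEq α] {l : List (α × β)} {a : α}
    (h : l.lookup a ≠ none) : ∃ x ∈ l, x.1 = a := by
  by_contra hc
  push Not at hc
  exact h (List.lookup_eq_none_iff.2 fun x hx => by simpa using (hc x hx).symm)

theorem mem_of_lookup {α β : Type} [BEq α] [LawfulBEq α] {l : List (α × β)} {a : α} {b : β}
    (h : l.lookup a = some b) : (a, b) ∈ l := by
  induction l with
  | nil => simp at h
  | cons x l ih =>
    obtain ⟨x₁, x₂⟩ := x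
    rw [List.lookup_cons] at h
    by_cases hx : a = x₁
    · subst hx; simp at h; simp [h]
    · have : (a == x₁) = false := by simpa using hx
      simp [this] at h
      exact List.mem_cons_of_mem _ (ih h)


/-! ### From the experiment to the ideal game -/

section RealIdeal

variable {pp : GroupParams} {L J κ : ℕ} {ids : List Str} {keys : Str → Star pp} {id : Str}
  {δ : ℕ → ℝ≥0∞}

/-- The hidden points of the random oracles at which nothing has been derived from the attacked
private key itself. -/
def Special (pp : GroupParams) {J : ℕ} (ids : List Str) (msk : Str) (r : Fin (J + 1) → Star pp)
    (com : Finset (Fin (J + 1))) (k : Fin 3) (u : Str) : Prop :=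
  (k = 0 ∧ ∃ i ∈ ids, u = msk ++ i) ∨
    (k = 1 ∧ ∃ j ∈ com, u.take pp.q.size = pp.enc (r j).1)

/-- The table of the experiment represents the state of the ideal game when the master key is `msk`
and the hidden strings of the commitments are `r`. -/
structure RealRep (ids : List Str) (keys : Str → Star pp) (id msk : Str)
    (r : Fin (J + 1) → Star pp) (s : Ideal pp L J) (T : Table) : Prop where
  noflag : s.pub.flag = false
  key : ∀ i ∈ ids, T 0 (msk ++ i) = some (keys i).1
  keyhid : ∀ i ∈ ids, (msk ++ i).take pp.q.size ≠ pp.enc (keys id).1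
  x : ∀ j : Fin (J + 1), T 0 (pp.enc (keys id).1 ++ (j : ℕ).bits) =
    (s.xs.lookup j).map Subtype.val
  hid : ∀ j : Fin (J + 1), T 1 (pp.enc (keys id).1 ++ (j : ℕ).bits) =
    if j ∈ s.com then some (r j).1 else none
  rinj : ∀ j ∈ s.com, ∀ j' ∈ s.com, r j = r j' → j = j'
  ry : ∀ j ∈ s.com, r j ≠ keys id
  sh : ∀ j ∈ s.com, ∀ ℓ : Fin L, T 1 (pp.enc (r j).1 ++ (ℓ.val + 1).bits) =
    (s.sh j ℓ).map Subtype.val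
  shnone : ∀ j ∉ s.com, ∀ ℓ, s.sh j ℓ = none
  special : ∀ k u, Special pp ids msk r s.com k u → (s.pub.T k).lookup u = none
  other : ∀ k u, ¬ Special pp ids msk r s.com k u → (k ≠ 2 → ¬ Hit pp (pp.α ^ (keys id).1) u) →
    T k u = ((s.pub.T k).lookup u).map Subtype.val

/-- The hidden randomness: the master key and the strings `r_j`. -/
abbrev Hidden (pp : GroupParams) (κ J : ℕ) := (Fin κ → Bool) × (Fin (J + 1) → Star pp)

open Classical in
/-- The comparison of the experiment with the ideal game. -/
def realHop (L J κ : ℕ) (ids : List Str) (keys : Str → Star pp) (id : Str) (δ : ℕ → ℝ≥0∞) :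
    Hop (Hidden pp κ J) (Ideal pp L J) Table where
  μ := (PMF.uniformOfFintype (Fin κ → Bool)).bind fun a =>
    (PMF.uniformOfFintype (Fin (J + 1) → Star pp)).bind fun r => PMF.pure (a, r)
  rel s ω T := RealRep ids keys id (List.ofFn ω.1) ω.2 s T
  w s := pot δ s.size + if s.pub.flag then 1 else 0

/-- Exponents below `q` are determined by the power of `α`. Comparison with the public key therefore
recognizes the private key without knowing it. -/
theorem hit_enc_iff {n : ℕ} (y : Star pp) (hn : n < pp.q) (u : Str) :
    Hit pp (pp.α ^ y.1) (pp.enc n ++ u) ↔ n = y.1 := by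
  unfold Hit
  rw [GroupParams.take_enc_append, GroupParams.val_enc _ hn, pp.pow_eq_pow_iff,
    ZMod.natCast_eq_natCast_iff']
  rw [Nat.mod_eq_of_lt hn, Nat.mod_eq_of_lt (star_lt y)]

theorem check_flag_mono (s : Pub pp) (Y : (ZMod pp.p)ˣ) (k : Fin 3) (u : Str)
    (h : s.flag = true) : (s.check Y k u).flag = true := by simp [Pub.check, h]

theorem check_eq_self {s : Pub pp} {Y : (ZMod pp.p)ˣ} {k : Fin 3} {u : Str}
    (h : ¬ (k ≠ 2 ∧ Hit pp Y u)) : s.check Y k u = s := by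
  unfold Pub.check
  simp [h]

theorem check_flag_of_hit (s : Pub pp) {Y : (ZMod pp.p)ˣ} {k : Fin 3} {u : Str}
    (h : k ≠ 2 ∧ Hit pp Y u) : (s.check Y k u).flag = true := by
  unfold Pub.check
  simp [h]

@[simp] theorem add_flag (s : Pub pp) (k : Fin 3) (u : Str) (h : Star pp) :
    (s.add k u h).flag = s.flag := rfl

theorem realHop_w_mono {s s' : Ideal pp L J} (h₁ : s.size ≤ s'.size)
    (h₂ : s.pub.flag = true → s'.pub.flag = true) :
    (realHop L J κ ids keys id δ).w s ≤ (realHop L J κ ids keys id δ).w s' := by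
  refine add_le_add (pot_mono δ h₁) ?_
  split_ifs with a b
  · exact le_rfl
  · exact absurd (h₂ a) b
  · exact zero_le
  · exact le_rfl

/-- Once the flag is raised no table is a representation and the average vanishes. The summand one
in the potential pays for everything that happens afterwards. -/
theorem realHop_Φ_flag {s : Ideal pp L J} (hs : s.pub.flag = true)
    (f : Hidden pp κ J → Table → ℝ≥0∞) :
    (realHop L J κ ids keys id δ).Φ f s = (realHop L J κ ids keys id δ).w s := by
  have : (realHop L J κ ids keys id δ).avg f s = 0 := by
    refine le_antisymm (Hop.avg_le fun ω T hr => ?_) zero_le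
    exact absurd (RealRep.noflag hr) (by simp [hs])
  rw [Hop.Φ, this, zero_add]

theorem Hop.w_le_Φ {Ω σ₁ σ₂ : Type} (h : Hop Ω σ₁ σ₂) (f : Ω → σ₂ → ℝ≥0∞) (s : σ₁) :
    h.w s ≤ h.Φ f s := le_add_self

/-- Excluding unlikely hidden randomness. -/
theorem Hop.avg_le_add {Ω σ₁ σ₂ : Type} (h : Hop Ω σ₁ σ₂) {f : Ω → σ₂ → ℝ≥0∞} {s : σ₁}
    (hf : ∀ ω s₂, f ω s₂ ≤ 1) (bad : Ω → ℝ≥0∞) (g : Ω → ℝ≥0∞)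
    (H : ∀ ω, 1 ≤ bad ω ∨ ∀ s₂, h.rel s ω s₂ → f ω s₂ ≤ g ω) :
    h.avg f s ≤ ex h.μ bad + ex h.μ g := by
  rw [← ex_add]
  refine ex_mono fun ω => iSup₂_le fun s₂ hr => ?_
  rcases H ω with hb | hg
  · exact (hf _ _).trans (hb.trans le_self_add)
  · exact (hg s₂ hr).trans le_add_self

theorem ex_realHop (f : Hidden pp κ J → ℝ≥0∞) :
    ex (realHop L J κ ids keys id δ).μ f = ex (PMF.uniformOfFintype (Fin κ → Bool)) fun a =>
      ex (PMF.uniformOfFintype (Fin (J + 1) → Star pp)) fun r => f (a, r) := by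
  simp [realHop]

open Classical in
/-- A uniform master key is guessed with small probability. -/
theorem ex_msk_le (κ : ℕ) (p : (Fin κ → Bool) → Prop) (hp : ∀ a b, p a → p b → a = b) :
    ex (PMF.uniformOfFintype (Fin κ → Bool)) (fun a => ind (p a)) ≤ eta κ := by
  refine le_trans ?_ ((ex_uniform_mem_le (Finset.univ.filter p)).trans ?_)
  · exact ex_mono fun a => ind_mono fun h => by simpa using h
  · refine le_trans ?_ (inv_two_pow_le_eta κ)
    have hc : (Finset.univ.filter p).card ≤ 1 := Finset.card_le_one.2 fun a ha b hb =>
      hp a b (by simpa using ha) (by simpa using hb)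
    calc _ ≤ (1 : ℝ≥0∞) * (Fintype.card (Fin κ → Bool) : ℝ≥0∞)⁻¹ :=
          mul_le_mul' (by exact_mod_cast hc) le_rfl
      _ = _ := by simp

/-- Each single string `r_j` is uniform and its encoding is injective, so a union bound over the
determined epochs applies. -/
theorem ex_r_le (hκ : 2 ^ κ ≤ pp.q) (com : Finset (Fin (J + 1))) (v : Str) :
    ex (PMF.uniformOfFintype (Fin (J + 1) → Star pp)) (fun r =>
      ind (∃ j ∈ com, v = pp.enc (r j).1)) ≤ com.card * eta κ := by
  have h₁ : ∀ r : Fin (J + 1) → Star pp, ind (∃ j ∈ com, v = pp.enc (r j).1)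
      ≤ ∑ j ∈ com, ind (v = pp.enc (r j).1) := by
    intro r
    by_cases h : ∃ j ∈ com, v = pp.enc (r j).1
    · obtain ⟨j, hj, e⟩ := h
      refine le_trans ?_ (Finset.single_le_sum (f := fun j => ind (v = pp.enc (r j).1))
        (fun _ _ => zero_le) hj)
      exact ind_mono fun _ => e
    · simp [ind_false h]
  refine (ex_mono h₁).trans ?_
  have h₂ : ∀ j, ex (PMF.uniformOfFintype (Fin (J + 1) → Star pp)) (fun r =>
      ind (v = pp.enc (r j).1)) ≤ eta κ := by
    intro j
    rw [ex_pi_eval j fun h : Star pp => ind (v = pp.enc h.1)]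
    by_cases hv : ∃ h : Star pp, v = pp.enc h.1
    · obtain ⟨h, rfl⟩ := hv
      refine le_of_le_of_eq (ex_unif_mem_le hκ _ {()} 1 le_rfl (fun _ => h) fun h' e =>
        ⟨(), by simp, ?_⟩) (by simp)
      exact Subtype.ext (pp.enc_inj (star_lt _) (star_lt _) e)
    · push Not at hv
      simp [ind, hv]
  have h₃ : ∀ c : Finset (Fin (J + 1)), ex (PMF.uniformOfFintype (Fin (J + 1) → Star pp))
      (fun r => ∑ j ∈ c, ind (v = pp.enc (r j).1)) ≤ c.card * eta κ := by
    intro c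
    induction c using Finset.induction_on with
    | empty => simp
    | insert a c ha ih =>
      simp only [Finset.sum_insert ha, ex_add, Finset.card_insert_of_notMem ha]
      push_cast
      rw [add_mul, one_mul, add_comm]
      exact add_le_add ih (h₂ a)
  exact h₃ com

/-- The point and the set of epochs come from the ideal game, so they are fixed before the hidden
randomness is averaged. The first `κ` bits of the point guess the whole master key, and its first
`q.size` bits guess some `r_j`. -/
theorem ex_special_le (hκ : 2 ^ κ ≤ pp.q) (com : Finset (Fin (J + 1))) (k : Fin 3) (u : Str) :
    ex (realHop L J κ ids keys id δ).μ (fun ω =>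
      ind (Special pp ids (List.ofFn ω.1) ω.2 com k u)) ≤ (1 + com.card) * eta κ := by
  have h₁ : ∀ ω : Hidden pp κ J, ind (Special pp ids (List.ofFn ω.1) ω.2 com k u) ≤
      ind (u.take κ = List.ofFn ω.1) + ind (∃ j ∈ com, u.take pp.q.size = pp.enc (ω.2 j).1) := by
    intro ω
    refine (ind_mono ?_).trans (ind_or_le _ _)
    rintro (⟨-, i, -, rfl⟩ | ⟨-, h⟩)
    · exact Or.inl (List.take_left' (by simp))
    · exact Or.inr h
  refine (ex_mono h₁).trans ?_
  rw [ex_add, ex_realHop, ex_realHop, add_mul, one_mul]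
  refine add_le_add ?_ ?_
  · simp only [ex_const]
    exact ex_msk_le κ _ fun a b ha hb => List.ofFn_injective (ha.symm.trans hb)
  · exact (ex_mono fun a => ex_r_le hκ _ _).trans (ex_const _ _).le

/-- A point that is neither special nor starts with the private key is none of the points used
internally by the scheme, so a public record there leaves all other clauses intact. -/
theorem RealRep.add {msk : Str} {r : Fin (J + 1) → Star pp} {s : Ideal pp L J} {T : Table}
    (H : RealRep ids keys id msk r s T) {k : Fin 3} {u : Str}
    (h₁ : ¬ Special pp ids msk r s.com k u) (h₂ : k ≠ 2 → ¬ Hit pp (pp.α ^ (keys id).1) u)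
    (h : Star pp) (es : Fin (J + 1) → Fin L → Option (Star pp)) :
    RealRep ids keys id msk r { s with pub := s.pub.add k u h, es := es }
      (Function.update T k (Function.update (T k) u (some h.1))) := by
  have ne : ∀ k' u', (Special pp ids msk r s.com k' u' ∨ k' ≠ 2 ∧ Hit pp (pp.α ^ (keys id).1) u') →
      Function.update T k (Function.update (T k) u (some h.1)) k' u' = T k' u' := by
    intro k' u' hs
    by_cases hk : k' = k
    · subst hk
      by_cases hu : u' = u
      · subst hu
        rcases hs with hs | hs
        · exact absurd hs h₁
        · exact absurd hs.2 (h₂ hs.1)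
      · simp [hu]
    · simp [hk]
  have hy : ∀ v : Str, Hit pp (pp.α ^ (keys id).1) (pp.enc (keys id).1 ++ v) := fun v =>
    (hit_enc_iff _ (star_lt _) v).2 rfl
  refine ⟨H.noflag, fun i hi => ?_, H.keyhid, fun j => ?_, fun j => ?_, H.rinj, H.ry,
    fun j hj ℓ => ?_, H.shnone, fun k' u' hs => ?_, fun k' u' hs hh => ?_⟩
  · rw [ne _ _ (Or.inl (Or.inl ⟨rfl, i, hi, rfl⟩))]; exact H.key i hi
  · rw [ne _ _ (Or.inr ⟨by decide, hy _⟩)]; exact H.x j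
  · rw [ne _ _ (Or.inr ⟨by decide, hy _⟩)]; exact H.hid j
  · rw [ne _ _ (Or.inl (Or.inr ⟨rfl, j, hj, by simp⟩))]; exact H.sh j hj ℓ
  · rw [lookup_add, if_neg, H.special k' u' hs]
    rintro ⟨rfl, rfl⟩
    exact h₁ hs
  · simp only
    rw [lookup_add]
    by_cases hc : k' = k ∧ u' = u
    · obtain ⟨rfl, rfl⟩ := hc; simp
    · rw [if_neg hc, ← H.other k' u' hs hh]
      by_cases hk : k' = k
      · subst hk
        have hu : u' ≠ u := fun e => hc ⟨rfl, e⟩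
        simp [hu]
      · simp [hk]

theorem RealRep.es {msk : Str} {r : Fin (J + 1) → Star pp} {s : Ideal pp L J} {T : Table}
    (H : RealRep ids keys id msk r s T) (es : Fin (J + 1) → Fin L → Option (Star pp)) :
    RealRep ids keys id msk r { s with es := es } T :=
  ⟨H.noflag, H.key, H.keyhid, H.x, H.hid, H.rinj, H.ry, H.sh, H.shnone, H.special, H.other⟩

/-- The error allowance needed for the comparison. -/
def RealError (κ : ℕ) (δ : ℕ → ℝ≥0∞) : Prop := ∀ n : ℕ, ((1 + n : ℕ) : ℝ≥0∞) * eta κ ≤ δ n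

/-- The experiment and the ideal game answer a public query alike unless the point is hidden. A
point starting with the key raises the flag, and any other hidden point is hit with probability at
most `(1 + n) * eta κ` over the hidden randomness, which the potential absorbs because a new record
is made. The function `E` is an arbitrary update of the records `es`, to which the experiment has no
counterpart. It lets one proof serve both `Ideal.hash` and `Ideal.hashRec`. -/
theorem real_hash_le (hκ : 2 ^ κ ≤ pp.q) (hδ : RealError κ δ) (k : Fin 3) (u : Str)
    (s : Ideal pp L J) (f : Hidden pp κ J → ℕ → Table → ℝ≥0∞) (hf : ∀ ω a T, f ω a T ≤ 1)
    (E : Star pp → Fin (J + 1) → Fin L → Option (Star pp)) :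
    (realHop L J κ ids keys id δ).Φ (fun ω T => ex (H pp k u T) fun r => f ω r.1 r.2) s ≤
      ex (pubH pp (pp.α ^ (keys id).1) k u s.pub) fun r =>
        (realHop L J κ ids keys id δ).Φ (fun ω T => f ω r.1.1 T)
          { s with pub := r.2, es := E r.1 } := by
  classical
  by_cases hfl : s.pub.flag = true
  · rw [realHop_Φ_flag hfl, ex_pubH]
    split
    · exact (realHop_w_mono (by exact le_rfl) fun h => check_flag_mono _ _ _ _ h).trans
        (Hop.w_le_Φ _ _ _)
    · rw [← ex_const (unif pp) ((realHop L J κ ids keys id δ).w s)]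
      refine ex_mono fun h => ?_
      refine (realHop_w_mono (s' := { s with pub := (s.pub.check _ k u).add k u h, es := E h })
        ?_ fun h => check_flag_mono _ _ _ _ h).trans (Hop.w_le_Φ _ _ _)
      simp only [Ideal.size_eq, size_add, size_check]
      omega
  · by_cases hh : k ≠ 2 ∧ Hit pp (pp.α ^ (keys id).1) u
    -- The query reveals the key. The flag goes up, and its unit of error dominates the probability
    -- on the left.
    · have h₁ : (realHop L J κ ids keys id δ).Φ (fun ω T => ex (H pp k u T) fun r => f ω r.1 r.2) s
          ≤ 1 + pot δ s.size := by
        refine add_le_add (Hop.avg_le fun ω T _ => ex_le_of_le fun r => hf _ _ _) ?_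
        simp [realHop, hfl]
      refine h₁.trans ?_
      rw [ex_pubH]
      split
      · refine le_trans ?_ (Hop.w_le_Φ _ _ _)
        simp only [realHop, check_flag_of_hit _ hh, if_true, add_comm (1 : ℝ≥0∞)]
        exact le_rfl
      · rw [← ex_const (unif pp) (1 + pot δ s.size)]
        refine ex_mono fun h => le_trans ?_ (Hop.w_le_Φ _ _ _)
        simp only [realHop, add_flag, check_flag_of_hit _ hh, if_true, add_comm (1 : ℝ≥0∞)]
        refine add_le_add_left (pot_mono _ ?_) _
        simp only [Ideal.size_eq, size_add, size_check]
        omega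
    · rw [ex_pubH, check_eq_self hh]
      have hh' : k ≠ 2 → ¬ Hit pp (pp.α ^ (keys id).1) u := fun a b => hh ⟨a, b⟩
      cases hl : (s.pub.T k).lookup u with
      | some h =>
        refine add_le_add (ex_mono fun ω => iSup₂_le fun T hr => ?_) le_rfl
        have hT : T k u = some h.1 := by
          -- A recorded point cannot be special, since special points have never been asked.
          rw [RealRep.other hr k u (fun hs => ?_) hh', hl]; rfl
          have := RealRep.special hr k u hs
          simp [hl] at this
        simp only [ex_H, hT]
        exact le_iSup₂_of_le (f := fun T _ => f ω h.1 T) T (RealRep.es hr (E h)) le_rfl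
      | none =>
        simp only
        -- For a point without a record, only hidden randomness that makes the point special is
        -- given up. For all other randomness both games draw the answer anew.
        have hav := Hop.avg_le_add (realHop L J κ ids keys id δ) (s := s)
          (f := fun ω T => ex (H pp k u T) fun r => f ω r.1 r.2)
          (fun ω T => ex_le_of_le fun r => hf _ _ _)
          (fun ω => ind (Special pp ids (List.ofFn ω.1) ω.2 s.com k u))
          (fun ω => ex (unif pp) fun h => ⨆ T, ⨆ (_ : (realHop L J κ ids keys id δ).rel
            { s with pub := s.pub.add k u h, es := E h } ω T), f ω h.1 T) (fun ω => by
            by_cases hs : Special pp ids (List.ofFn ω.1) ω.2 s.com k u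
            · left; simp [ind, hs]
            · right
              intro T hr
              have hT : T k u = none := by rw [RealRep.other hr k u hs hh', hl]; rfl
              rw [ex_H, hT]
              exact ex_mono fun h => le_iSup₂_of_le (f := fun T _ => f ω h.1 T) _
                (RealRep.add hr hs hh' h (E h)) le_rfl)
        rw [ex_comm] at hav
        calc (realHop L J κ ids keys id δ).Φ (fun ω T => ex (H pp k u T) fun r => f ω r.1 r.2) s
            ≤ (δ s.size + ex (unif pp) fun h => (realHop L J κ ids keys id δ).avg
                (fun ω T => f ω h.1 T) { s with pub := s.pub.add k u h, es := E h }) +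
                pot δ s.size := by
              refine add_le_add (hav.trans (add_le_add ((ex_special_le hκ _ _ _).trans
                (le_trans ?_ (hδ s.size))) le_rfl)) ?_
              · refine mul_le_mul' ?_ le_rfl
                have : s.com.card ≤ s.size := by unfold Ideal.size; omega
                exact_mod_cast Nat.add_le_add_left this 1
              · simp [realHop, hfl]
          _ = ex (unif pp) fun h => (realHop L J κ ids keys id δ).avg (fun ω T => f ω h.1 T)
                { s with pub := s.pub.add k u h, es := E h } + (pot δ s.size + δ s.size) := by
              rw [ex_add, ex_const]; ring
          _ ≤ _ := by
              refine ex_mono fun h => add_le_add_right ?_ _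
              simp only [realHop, add_flag, hfl, Bool.false_eq_true, if_false, add_zero]
              refine pot_add_le δ ?_
              simp only [Ideal.size_eq, size_add]
              omega

/-- The commitments of a set of epochs have been determined. -/
def Touched (A : Finset (Fin (J + 1))) (s : Ideal pp L J) : Prop := A ⊆ s.com

theorem preserves_touched_hash (A : Finset (Fin (J + 1))) (y : ℕ) (k : Fin 3) (u : Str) :
    Preserves (Touched A) (Ideal.hash pp L J y k u) := by
  intro s hs r hr
  simp only [Ideal.hash, PMF.mem_support_bind_iff, PMF.mem_support_pure_iff] at hr
  obtain ⟨r', -, rfl⟩ := hr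
  exact hs

theorem preserves_touched_hashRec (A : Finset (Fin (J + 1))) (y : ℕ) (j : Fin (J + 1)) (ℓ : Fin L)
    (u : Str) : Preserves (Touched A) (Ideal.hashRec pp L J y j ℓ u) := by
  intro s hs r hr
  simp only [Ideal.hashRec, PMF.mem_support_bind_iff, PMF.mem_support_pure_iff] at hr
  obtain ⟨r', -, rfl⟩ := hr
  exact hs

theorem preserves_touched_share (A : Finset (Fin (J + 1))) (j : Fin (J + 1)) (ℓ : Fin L) :
    Preserves (Touched A) (Ideal.share pp L J j ℓ) := by
  intro s hs r hr
  unfold Ideal.share at hr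
  split at hr
  · rw [PMF.mem_support_pure_iff] at hr; exact hr ▸ hs
  · simp only [PMF.mem_support_bind_iff, PMF.mem_support_pure_iff] at hr
    obtain ⟨r', -, rfl⟩ := hr
    exact hs

theorem preserves_touched_getX (A : Finset (Fin (J + 1))) (j : Fin (J + 1)) :
    Preserves (Touched A) (Ideal.getX pp L J j) := by
  intro s hs r hr
  unfold Ideal.getX at hr
  split at hr
  · rw [PMF.mem_support_pure_iff] at hr; exact hr ▸ hs
  · simp only [PMF.mem_support_bind_iff, PMF.mem_support_pure_iff] at hr
    obtain ⟨r', -, rfl⟩ := hr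
    exact hs

theorem real_hash (hκ : 2 ^ κ ≤ pp.q) (hδ : RealError κ δ) (A : Finset (Fin (J + 1)))
    (k : Fin 3) (u : Str) : (realHop L J κ ids keys id δ).Sim (Θ := Hidden pp κ J) (fun ω => ω)
      (Touched A) (fun _ => H pp k u) (Ideal.hash pp L J (keys id).1 k u) := by
  refine ⟨preserves_touched_hash _ _ _ _, fun s _ f hf => ?_⟩
  refine (real_hash_le hκ hδ k u s f hf fun _ => s.es).trans ?_
  simp only [Ideal.hash, ex_bind, ex_pure]
  exact le_rfl

theorem real_hashRec (hκ : 2 ^ κ ≤ pp.q) (hδ : RealError κ δ) (A : Finset (Fin (J + 1)))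
    (j : Fin (J + 1)) (ℓ : Fin L) (u : Str) :
    (realHop L J κ ids keys id δ).Sim (Θ := Hidden pp κ J) (fun ω => ω)
      (Touched A) (fun _ => H pp 2 u) (Ideal.hashRec pp L J (keys id).1 j ℓ u) := by
  refine ⟨preserves_touched_hashRec _ _ _ _ _, fun s _ f hf => ?_⟩
  refine (real_hash_le hκ hδ 2 u s f hf fun h =>
    Function.update s.es j (Function.update (s.es j) ℓ (some h))).trans ?_
  simp only [Ideal.hashRec, ex_bind, ex_pure]
  exact le_rfl

end RealIdeal

/-! ### Exponents, signature strings and commitments of the attacked user. -/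

section RealIdeal

variable {pp : GroupParams} {L J κ : ℕ} {ids : List Str} {keys : Str → Star pp} {id : Str}
  {δ : ℕ → ℝ≥0∞}

theorem update₂_eq {α β γ : Type} [DecidableEq α] [DecidableEq β] (T : α → β → γ) (k k' : α)
    (u u' : β) (v : γ) : Function.update T k (Function.update (T k) u v) k' u' =
      if k' = k ∧ u' = u then v else T k' u' := by
  by_cases hk : k' = k
  · subst hk
    by_cases hu : u' = u
    · simp [hu]
    · simp [hu]
  · simp [hk]

theorem enc_bits_inj {n n' m m' : ℕ} (h : n < pp.q) (h' : n' < pp.q) :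
    pp.enc n ++ m.bits = pp.enc n' ++ m'.bits ↔ n = n' ∧ m = m' := by
  constructor
  · intro e
    obtain ⟨h₁, h₂⟩ := pp.enc_append_inj h h' e
    exact ⟨h₁, bits_injective h₂⟩
  · rintro ⟨rfl, rfl⟩; rfl

/-- No error arises: distinct pairs `(j, ℓ)` give distinct points because the determined strings
`r_j` are distinct, and these points are special, so the public tables do not contain them. -/
theorem real_share (A : Finset (Fin (J + 1))) (j : Fin (J + 1)) (hj : j ∈ A) (ℓ : Fin L) :
    (realHop L J κ ids keys id δ).Sim (Θ := Hidden pp κ J) (fun ω => ω) (Touched A)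
      (fun ω => H pp 1 (pp.enc (ω.2 j).1 ++ (ℓ.val + 1).bits)) (Ideal.share pp L J j ℓ) := by
  refine ⟨preserves_touched_share _ _ _, fun s hs f hf => ?_⟩
  have hj' : j ∈ s.com := hs hj
  unfold Ideal.share
  cases hsh : s.sh j ℓ with
  | some h =>
    rw [ex_pure]
    refine Hop.Φ_mono fun ω T hr => ?_
    rw [ex_H, RealRep.sh hr j hj' ℓ, hsh]
    exact le_rfl
  | none =>
    simp only [ex_bind, ex_pure]
    have hw : ∀ h, (realHop L J κ ids keys id δ).w { s with
      sh := Function.update s.sh j (Function.update (s.sh j) ℓ (some h)) } =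
        (realHop L J κ ids keys id δ).w s := fun h => rfl
    simp only [Hop.Φ, hw, ex_add, ex_const]
    refine add_le_add ?_ le_rfl
    simp only [Hop.avg]
    rw [ex_comm]
    refine ex_mono fun ω => iSup₂_le fun T hr => ?_
    rw [ex_H, RealRep.sh hr j hj' ℓ, hsh]
    refine ex_mono fun h => le_iSup₂_of_le (f := fun T _ => f ω h.1 T) _ ?_ le_rfl
    have hr' : RealRep ids keys id (List.ofFn ω.1) ω.2 s T := hr
    refine ⟨hr'.noflag, fun i hi => ?_, hr'.keyhid, fun j' => ?_, fun j' => ?_, hr'.rinj, hr'.ry,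
      fun j' hj' ℓ' => ?_, fun j' hj'' ℓ' => ?_, hr'.special, fun k u h₁ h₂ => ?_⟩
    · dsimp only
      rw [update₂_eq, if_neg (by simp)]; exact hr'.key i hi
    · dsimp only
      rw [update₂_eq, if_neg (by simp)]; exact hr'.x j'
    · dsimp only
      rw [update₂_eq, if_neg]
      · exact hr'.hid j'
      · rintro ⟨-, e⟩
        exact hr'.ry j ‹_› (Subtype.ext ((enc_bits_inj (star_lt _) (star_lt _)).1 e).1.symm)
    · dsimp only
      rw [update₂_eq, update₂_eq]
      have : (pp.enc (ω.2 j').1 ++ (ℓ'.val + 1).bits = pp.enc (ω.2 j).1 ++ (ℓ.val + 1).bits) ↔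
          (j' = j ∧ ℓ' = ℓ) := by
        rw [enc_bits_inj (star_lt _) (star_lt _)]
        constructor
        · rintro ⟨e₁, e₂⟩
          exact ⟨hr'.rinj _ hj' _ (hs hj) (Subtype.ext e₁), Fin.ext (by omega)⟩
        · rintro ⟨rfl, rfl⟩; exact ⟨rfl, rfl⟩
      simp only [this, true_and]
      split_ifs with h₁
      · rfl
      · exact hr'.sh _ hj' _
    · dsimp only
      rw [update₂_eq, if_neg]
      · exact hr'.shnone j' hj'' ℓ'
      · rintro ⟨rfl, -⟩; exact hj'' (hs hj)
    · dsimp only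
      rw [update₂_eq, if_neg]
      · exact hr'.other k u h₁ h₂
      · rintro ⟨rfl, rfl⟩
        exact h₁ (Or.inr ⟨rfl, j, hs hj, by simp⟩)

/-- No error arises: the point starts with the private key, so a public query there would have
raised the flag, and it differs from every point `msk ‖ ID` by the clause `keyhid`. -/
theorem real_getX (A : Finset (Fin (J + 1))) (j : Fin (J + 1)) :
    (realHop L J κ ids keys id δ).Sim (Θ := Hidden pp κ J) (fun ω => ω) (Touched A)
      (fun _ => H pp 0 (pp.enc (keys id).1 ++ (j : ℕ).bits)) (Ideal.getX pp L J j) := by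
  refine ⟨preserves_touched_getX _ _, fun s hs f hf => ?_⟩
  unfold Ideal.getX
  cases hx : s.xs.lookup j with
  | some h =>
    rw [ex_pure]
    refine Hop.Φ_mono fun ω T hr => ?_
    rw [ex_H, RealRep.x hr j, hx]
    exact le_rfl
  | none =>
    simp only [ex_bind, ex_pure]
    have hw : ∀ h, (realHop L J κ ids keys id δ).w s ≤
        (realHop L J κ ids keys id δ).w { s with xs := (j, h) :: s.xs } := fun h =>
      realHop_w_mono (by simp only [Ideal.size_eq, List.length_cons]; omega) fun h => h
    refine le_trans ?_ (ex_mono fun h => add_le_add le_rfl (hw h))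
    simp only [Hop.Φ, ex_add, ex_const]
    refine add_le_add ?_ le_rfl
    simp only [Hop.avg]
    rw [ex_comm]
    refine ex_mono fun ω => iSup₂_le fun T hr => ?_
    rw [ex_H, RealRep.x hr j, hx]
    refine ex_mono fun h => le_iSup₂_of_le (f := fun T _ => f ω h.1 T) _ ?_ le_rfl
    have hr' : RealRep ids keys id (List.ofFn ω.1) ω.2 s T := hr
    refine ⟨hr'.noflag, fun i hi => ?_, hr'.keyhid, fun j' => ?_, fun j' => ?_, hr'.rinj, hr'.ry,
      fun j' hj' ℓ' => ?_, hr'.shnone, hr'.special, fun k u h₁ h₂ => ?_⟩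
    · dsimp only
      rw [update₂_eq, if_neg]
      · exact hr'.key i hi
      · rintro ⟨-, e⟩
        exact hr'.keyhid i hi (by rw [e]; simp)
    · dsimp only
      rw [update₂_eq]
      simp only [enc_bits_inj (pp := pp) (star_lt _) (star_lt _), true_and, List.lookup_cons]
      by_cases e : j' = j
      · subst e; simp
      · have : (j' == j) = false := by simpa using e
        rw [if_neg fun h => e (Fin.ext h), this]
        exact hr'.x j'
    · dsimp only
      rw [update₂_eq, if_neg (by simp)]; exact hr'.hid j'
    · dsimp only
      rw [update₂_eq, if_neg (by simp)]; exact hr'.sh j' hj' ℓ'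
    · dsimp only
      rw [update₂_eq, if_neg]
      · exact hr'.other k u h₁ h₂
      · rintro ⟨rfl, rfl⟩
        exact h₂ (by decide) ((hit_enc_iff _ (star_lt _) _).2 rfl)

/-- The coordinate of an epoch not yet determined is independent of the others and acts as a fresh
value. It has to avoid the private key, the strings `r_j'` already in use, and the prefixes of the
points recorded for `H_1`. -/
theorem ex_collision_le (hκ : 2 ^ κ ≤ pp.q) (s : Ideal pp L J) (j : Fin (J + 1)) (hj : j ∉ s.com)
    (y : Star pp) :
    ex (realHop L J κ ids keys id δ).μ (fun ω => ind (ω.2 j = y ∨ (∃ j' ∈ s.com, ω.2 j' = ω.2 j) ∨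
      ∃ v ∈ s.pub.T 1, v.1.take pp.q.size = pp.enc (ω.2 j).1)) ≤
      ((1 + s.size : ℕ) : ℝ≥0∞) * eta κ := by
  classical
  rw [ex_realHop]
  refine ex_le_of_le fun a => ?_
  have hfresh := ex_pi_fresh j (fun (r : Fin (J + 1) → Star pp) (h : Star pp) =>
    ind (h = y ∨ (∃ j' ∈ s.com, r j' = h) ∨ ∃ v ∈ s.pub.T 1, v.1.take pp.q.size = pp.enc h.1))
    (fun r b h => by
      congr 1
      have : (∃ j' ∈ s.com, Function.update r j b j' = h) ↔ ∃ j' ∈ s.com, r j' = h := by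
        refine exists_congr fun j' => and_congr_right fun hj' => ?_
        rw [Function.update_of_ne]
        rintro rfl; exact hj hj'
      rw [this])
  refine hfresh.symm.le.trans (ex_le_of_le fun r => ?_)
  -- An index set for the forbidden values: `none` for the private key, the left summand for earlier
  -- epochs, the right summand for recorded points.
  let B : Finset (Option (Fin (J + 1) ⊕ ((Str × Star pp)))) :=
    insert none ((s.com.disjSum (s.pub.T 1).toFinset).image some)
  refine ex_unif_mem_le hκ _ B (1 + s.size) ?_
    (fun x => match x with
      | none => y
      | some (.inl j') => r j'
      | some (.inr v) => if hh : ∃ h : Star pp, v.1.take pp.q.size = pp.enc h.1 then hh.choose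
          else default) ?_
  · refine (Finset.card_insert_le _ _).trans ?_
    have h₁ : ((s.com.disjSum (s.pub.T 1).toFinset).image some).card ≤
        s.com.card + (s.pub.T 1).length := by
      refine Finset.card_image_le.trans ?_
      rw [Finset.card_disjSum]
      exact Nat.add_le_add_left (List.toFinset_card_le _) _
    have h₂ := length_le_size s.pub 1
    rw [Ideal.size_eq]
    omega
  · rintro h (rfl | ⟨j', hj', rfl⟩ | ⟨v, hv, e⟩)
    · exact ⟨none, by simp [B], rfl⟩
    · exact ⟨some (.inl j'), by simp [B, hj'], rfl⟩
    · refine ⟨some (.inr v), by simp [B, hv], ?_⟩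
      have hh : ∃ h : Star pp, v.1.take pp.q.size = pp.enc h.1 := ⟨h, e⟩
      simp only [dif_pos hh]
      exact Subtype.ext (pp.enc_inj (star_lt _) (star_lt _) (hh.choose_spec.symm.trans e))

/-- With a new `r j` that avoids the collisions, the points starting with it become special at a
moment when none of them has been asked. The exponents of epoch `j` are therefore undetermined on
both sides. -/
theorem RealRep.touch {msk : Str} {r : Fin (J + 1) → Star pp} {s : Ideal pp L J} {T : Table}
    (H : RealRep ids keys id msk r s T) {j : Fin (J + 1)} (hj : j ∉ s.com)
    (h₁ : r j ≠ keys id) (h₂ : ∀ j' ∈ s.com, r j' ≠ r j)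
    (h₃ : ∀ v ∈ s.pub.T 1, v.1.take pp.q.size ≠ pp.enc (r j).1) :
    RealRep ids keys id msk r { s with com := insert j s.com }
      (Function.update T 1 (Function.update (T 1) (pp.enc (keys id).1 ++ (j : ℕ).bits)
        (some (r j).1))) := by
  have hy : ∀ v : Str, Hit pp (pp.α ^ (keys id).1) (pp.enc (keys id).1 ++ v) := fun v =>
    (hit_enc_iff _ (star_lt _) v).2 rfl
  have look : ∀ u : Str, u.take pp.q.size = pp.enc (r j).1 → (s.pub.T 1).lookup u = none := by
    intro u hu
    by_contra hc
    obtain ⟨v, hv, rfl⟩ := mem_keys_of_lookup hc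
    exact h₃ v hv hu
  refine ⟨H.noflag, fun i hi => ?_, H.keyhid, fun j' => ?_, fun j' => ?_, ?_, ?_,
    fun j' hj' ℓ' => ?_, fun j' hj' ℓ' => ?_, ?_, fun k u hs hh => ?_⟩
  · rw [update₂_eq, if_neg (by simp)]; exact H.key i hi
  · dsimp only
    rw [update₂_eq, if_neg (by simp)]; exact H.x j'
  · dsimp only
    rw [update₂_eq]
    simp only [enc_bits_inj (pp := pp) (star_lt _) (star_lt _), true_and, Finset.mem_insert]
    by_cases e : j' = j
    · subst e; simp
    · rw [if_neg fun h => e (Fin.ext h), H.hid j']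
      simp [e]
  · intro a ha b hb e
    rcases Finset.mem_insert.1 ha with ha | ha
    · rcases Finset.mem_insert.1 hb with hb | hb
      · rw [ha, hb]
      · exact absurd (ha ▸ e.symm) (h₂ b hb)
    · rcases Finset.mem_insert.1 hb with hb | hb
      · exact absurd (hb ▸ e) (h₂ a ha)
      · exact H.rinj a ha b hb e
  · intro a ha
    rcases Finset.mem_insert.1 ha with rfl | ha
    · exact h₁
    · exact H.ry a ha
  · have hne : r j' ≠ keys id := by
      rcases Finset.mem_insert.1 hj' with rfl | ha
      · exact h₁
      · exact H.ry _ ha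
    dsimp only
    rw [update₂_eq, if_neg]
    · rcases Finset.mem_insert.1 hj' with rfl | ha
      · rw [H.other, look _ (by simp), H.shnone _ hj]
        · rintro (⟨h, -⟩ | ⟨-, j'', hj'', e⟩)
          · simp at h
          · rw [GroupParams.take_enc_append] at e
            exact h₂ j'' hj'' (Subtype.ext (pp.enc_inj (star_lt _) (star_lt _) e).symm)
        · intro _ hh
          exact hne (Subtype.ext ((hit_enc_iff _ (star_lt _) _).1 hh))
      · exact H.sh _ ha _
    · rintro ⟨-, e⟩
      exact hne (Subtype.ext ((enc_bits_inj (star_lt _) (star_lt _)).1 e).1)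
  · exact H.shnone _ (fun h => hj' (Finset.mem_insert_of_mem h)) _
  · rintro k u (⟨rfl, hs⟩ | ⟨rfl, j', hj', e⟩)
    · exact H.special 0 u (Or.inl ⟨rfl, hs⟩)
    · rcases Finset.mem_insert.1 hj' with rfl | ha
      · exact look _ e
      · exact H.special 1 u (Or.inr ⟨rfl, _, ha, e⟩)
  · dsimp only
    rw [update₂_eq, if_neg]
    · refine H.other k u (fun h => hs ?_) hh
      rcases h with h | ⟨h, j', hj', e⟩
      · exact Or.inl h
      · exact Or.inr ⟨h, j', Finset.mem_insert_of_mem hj', e⟩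
    · rintro ⟨rfl, rfl⟩
      exact hh (by decide) (hy _)

/-- The representation reads `r` only at determined epochs, so an untouched coordinate may still be
resampled. -/
theorem RealRep.update_hidden {msk : Str} {r : Fin (J + 1) → Star pp} {s : Ideal pp L J}
    {T : Table} {j : Fin (J + 1)} (hj : j ∉ s.com) (a : Star pp) :
    RealRep ids keys id msk (Function.update r j a) s T ↔ RealRep ids keys id msk r s T := by
  have e : ∀ j' ∈ s.com, Function.update r j a j' = r j' := fun j' hj' =>
    Function.update_of_ne (by rintro rfl; exact hj hj') _ _
  have sp : ∀ k u, Special pp ids msk (Function.update r j a) s.com k u ↔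
      Special pp ids msk r s.com k u := by
    intro k u
    refine or_congr Iff.rfl (and_congr_right fun _ => exists_congr fun j' =>
      and_congr_right fun hj' => ?_)
    rw [e j' hj']
  have hd : ∀ j', (if j' ∈ s.com then some (Function.update r j a j').1 else none) =
      if j' ∈ s.com then some (r j').1 else none := by
    intro j'
    split_ifs with h
    · rw [e j' h]
    · rfl
  constructor
  · intro H
    refine ⟨H.noflag, H.key, H.keyhid, H.x, fun j' => (H.hid j').trans (hd j'), ?_, ?_, ?_, H.shnone,
      fun k u hs => H.special k u ((sp k u).2 hs), fun k u hs => H.other k u fun h => hs ((sp k u).1 h)⟩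
    · intro a ha b hb h; exact H.rinj a ha b hb (by rw [e a ha, e b hb, h])
    · intro a ha; have := H.ry a ha; rwa [e a ha] at this
    · intro a ha ℓ; have := H.sh a ha ℓ; rwa [e a ha] at this
  · intro H
    refine ⟨H.noflag, H.key, H.keyhid, H.x, fun j' => (H.hid j').trans (hd j').symm, ?_, ?_, ?_,
      H.shnone, fun k u hs => H.special k u ((sp k u).1 hs),
      fun k u hs => H.other k u fun h => hs ((sp k u).2 h)⟩
    · intro a ha b hb h; exact H.rinj a ha b hb (by rwa [e a ha, e b hb] at h)
    · intro a ha; rw [e a ha]; exact H.ry a ha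
    · intro a ha ℓ; rw [e a ha]; exact H.sh a ha ℓ

/-- The hash value `r_j` is returned in the experiment but has no counterpart in the ideal game. The
comparison therefore includes the continuation, which on the left receives `r_j` and may afterwards
be compared by using the hidden coordinate `ω.2 j`. What is measured at the end depends on the
master key only. -/
theorem real_touch (hκ : 2 ^ κ ≤ pp.q) (hδ : RealError κ δ) {α : Type} (j : Fin (J + 1))
    (k₂ : ℕ → ROM α) (k₁ : StateT (Ideal pp L J) PMF α)
    (hk : (realHop L J κ ids keys id δ).Sim (Θ := Hidden pp κ J) (fun ω => ω) (Touched {j})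
      (fun ω => k₂ (ω.2 j).1) k₁) :
    (realHop L J κ ids keys id δ).Sim (Θ := Fin κ → Bool) Prod.fst (Touched ∅)
      (fun _ => H pp 1 (pp.enc (keys id).1 ++ (j : ℕ).bits) >>= k₂)
      (Ideal.touch pp L J j >>= fun _ => k₁) := by
  refine ⟨fun s hs r hr => Finset.empty_subset _, fun s _ f hf => ?_⟩
  rw [ex_stateT_bind]
  simp only [Ideal.touch, ex_pure]
  refine le_trans ?_ (hk.2 { s with com := insert j s.com } (by simp [Touched])
    (fun ω => f ω.1) fun _ _ _ => hf _ _ _)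
  have hw : (realHop L J κ ids keys id δ).w s ≤
      (realHop L J κ ids keys id δ).w { s with com := insert j s.com } :=
    realHop_w_mono (by
      have := Finset.card_le_card (Finset.subset_insert j s.com)
      simp only [Ideal.size_eq]; omega) fun h => h
  by_cases hfl : s.pub.flag = true
  · rw [realHop_Φ_flag hfl]
    exact hw.trans (Hop.w_le_Φ _ _ _)
  · simp only [ex_stateT_bind]
    by_cases hj : j ∈ s.com
    · have : ({ s with com := insert j s.com } : Ideal pp L J) = s := by
        rw [Finset.insert_eq_of_mem hj]
      rw [this]
      refine Hop.Φ_mono fun ω T hr => ?_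
      rw [ex_H, RealRep.hid hr j, if_pos hj]
    -- Here `G a r h` is the best value over the tables represented before the step when the answer
    -- is `h`. It ignores coordinate `j` of `r`.
    · let g : (Fin κ → Bool) → Star pp → Table → ℝ≥0∞ := fun a h T =>
        ex (k₂ h.1 (Function.update T 1 (Function.update (T 1)
          (pp.enc (keys id).1 ++ (j : ℕ).bits) (some h.1)))) fun r => f a r.1 r.2
      let G : (Fin κ → Bool) → (Fin (J + 1) → Star pp) → Star pp → ℝ≥0∞ := fun a r h =>
        ⨆ T, ⨆ (_ : RealRep ids keys id (List.ofFn a) r s T), g a h T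
      have h₁ : (realHop L J κ ids keys id δ).avg (fun ω T =>
          ex (H pp 1 (pp.enc (keys id).1 ++ (j : ℕ).bits) T) fun r =>
            ex (k₂ r.1 r.2) fun r => f ω.1 r.1 r.2) s ≤
          ex (realHop L J κ ids keys id δ).μ fun ω => G ω.1 ω.2 (ω.2 j) := by
        rw [ex_realHop, Hop.avg, ex_realHop]
        refine ex_mono fun a => ?_
        -- The freshly drawn answer is identified with the unused hidden coordinate `j`.
        rw [← ex_pi_fresh j (G a) fun r b h => ?_]
        · refine ex_mono fun r => iSup₂_le fun T hr => ?_
          rw [ex_H, RealRep.hid hr j, if_neg hj]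
          exact ex_mono fun h => le_iSup₂_of_le (f := fun T _ => g a h T) T hr le_rfl
        · simp only [G, RealRep.update_hidden hj]
      have h₂ : ∀ ω : Hidden pp κ J, G ω.1 ω.2 (ω.2 j) ≤
          ind (ω.2 j = keys id ∨ (∃ j' ∈ s.com, ω.2 j' = ω.2 j) ∨
            ∃ v ∈ s.pub.T 1, v.1.take pp.q.size = pp.enc (ω.2 j).1) +
          ⨆ T, ⨆ (_ : (realHop L J κ ids keys id δ).rel { s with com := insert j s.com } ω T),
            ex (k₂ (ω.2 j).1 T) fun r => f ω.1 r.1 r.2 := by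
        intro ω
        refine iSup₂_le fun T hr => ?_
        by_cases hb : ω.2 j = keys id ∨ (∃ j' ∈ s.com, ω.2 j' = ω.2 j) ∨
            ∃ v ∈ s.pub.T 1, v.1.take pp.q.size = pp.enc (ω.2 j).1
        · rw [ind_true hb]
          exact (ex_le_of_le fun r => hf _ _ _).trans le_self_add
        · push Not at hb
          refine le_trans ?_ le_add_self
          exact le_iSup₂_of_le (f := fun T _ => ex (k₂ (ω.2 j).1 T) fun r => f ω.1 r.1 r.2) _
            (RealRep.touch hr hj hb.1 hb.2.1 hb.2.2) le_rfl
      have hsize : ({ s with com := insert j s.com } : Ideal pp L J).size = s.size + 1 := by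
        simp only [Ideal.size_eq, Finset.card_insert_of_notMem hj]; omega
      calc _ ≤ (δ s.size + (realHop L J κ ids keys id δ).avg (fun ω T => ex (k₂ (ω.2 j).1 T)
              fun r => f ω.1 r.1 r.2) { s with com := insert j s.com }) + pot δ s.size := by
            refine add_le_add (h₁.trans ((ex_mono h₂).trans ?_)) ?_
            · rw [ex_add]
              exact add_le_add ((ex_collision_le hκ s j hj _).trans (hδ _)) le_rfl
            · simp [realHop, hfl]
        _ = (realHop L J κ ids keys id δ).avg (fun ω T => ex (k₂ (ω.2 j).1 T)
              fun r => f ω.1 r.1 r.2) { s with com := insert j s.com } +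
                (pot δ s.size + δ s.size) := by ring
        _ ≤ _ := by
            refine add_le_add_right ?_ _
            simp only [realHop, hfl, Bool.false_eq_true, if_false, add_zero, hsize]
            exact pot_add_le δ (Nat.lt_succ_self _)

end RealIdeal

/-! ### Invariants of the ideal game -/

section Invariants

variable {pp : GroupParams} {L J : ℕ} {y : ℕ}

/-- A property that all primitive operations of the ideal game preserve. -/
structure OpClosed (pp : GroupParams) (L J y : ℕ) (I : Ideal pp L J → Prop) : Prop where
  hash : ∀ k u, Preserves I (Ideal.hash pp L J y k u)
  hashRec : ∀ j ℓ u, Preserves I (Ideal.hashRec pp L J y j ℓ u)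
  touch : ∀ j, Preserves I (Ideal.touch pp L J j)
  share : ∀ j ℓ, Preserves I (Ideal.share pp L J j ℓ)
  getX : ∀ j, Preserves I (Ideal.getX pp L J j)

theorem preserves_keyCom {σ : Type} {I : σ → Prop} {hash : Fin 3 → Str → StateT σ PMF ℕ}
    (h : ∀ k u, Preserves I (hash k u)) (y' j : ℕ) : Preserves I (keyCom pp L hash y' j) :=
  (h _ _).bind fun _ => (Preserves.foldlM _ (fun _ _ _ => (h _ _).bind fun _ =>
    Preserves.pure _) _).bind fun _ => Preserves.pure _

theorem preserves_verSum {σ : Type} {I : σ → Prop} {hash : Fin 3 → Str → StateT σ PMF ℕ}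
    (h : ∀ k u, Preserves I (hash k u)) (M : Fin L → Str) (x : ℕ) :
    Preserves I (verSum pp L hash M x) :=
  Preserves.foldlM _ (fun _ _ _ => (h _ _).bind fun _ => (h _ _).bind fun _ =>
    Preserves.pure _) _

namespace OpClosed

variable {I : Ideal pp L J → Prop} (H : OpClosed pp L J y I)
include H

theorem comShares (j : Fin (J + 1)) : Preserves I (Ideal.comShares pp L J j) :=
  Preserves.foldlM _ (fun _ _ _ => (H.share _ _).bind fun _ => Preserves.pure _) _

theorem comId (j : Fin (J + 1)) : Preserves I (Ideal.comId pp L J j) :=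
  (H.touch _).bind fun _ => (H.comShares j).bind fun _ => Preserves.pure _

theorem com' (keys : Str → Star pp) (id i : Str) (j : Fin (J + 1)) :
    Preserves I (Ideal.com' pp L J y keys id i j) := by
  unfold Ideal.com'
  split_ifs
  · exact H.comId j
  · exact preserves_keyCom H.hash _ _

theorem signStep (j : Fin (J + 1)) (M : Fin L → Str) (x : ℕ) (acc : ZMod pp.q) (ℓ : Fin L) :
    Preserves I (Ideal.signStep pp L J y j M x acc ℓ) :=
  (H.hash _ _).bind fun _ => (H.share _ _).bind fun _ => (H.hashRec _ _ _).bind fun _ =>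
    Preserves.pure _

theorem sign (j : Fin (J + 1)) (M : Fin L → Str) : Preserves I (Ideal.sign pp L J y j M) :=
  (H.getX _).bind fun _ => (H.touch _).bind fun _ =>
    (Preserves.foldlM _ (fun _ _ _ => H.signStep _ _ _ _ _) _).bind fun _ => Preserves.pure _

end OpClosed

/-- The part of the state that only signature queries change. -/
def Frame (e : ℕ) (l : List (Fin L → Str)) (s : Ideal pp L J) : Prop := s.epoch = e ∧ s.signed = l

theorem frame_opClosed (e : ℕ) (l : List (Fin L → Str)) :
    OpClosed pp L J y (Frame e l) := by
  constructor
  · intro k u s hs r hr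
    simp only [Ideal.hash, PMF.mem_support_bind_iff, PMF.mem_support_pure_iff] at hr
    obtain ⟨r', -, rfl⟩ := hr
    exact hs
  · intro j ℓ u s hs r hr
    simp only [Ideal.hashRec, PMF.mem_support_bind_iff, PMF.mem_support_pure_iff] at hr
    obtain ⟨r', -, rfl⟩ := hr
    exact hs
  · intro j s hs r hr
    simp only [Ideal.touch, PMF.mem_support_pure_iff] at hr
    subst hr
    exact hs
  · intro j ℓ s hs r hr
    unfold Ideal.share at hr
    split at hr
    · rw [PMF.mem_support_pure_iff] at hr; exact hr ▸ hs
    · simp only [PMF.mem_support_bind_iff, PMF.mem_support_pure_iff] at hr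
      obtain ⟨r', -, rfl⟩ := hr
      exact hs
  · intro j s hs r hr
    unfold Ideal.getX at hr
    split at hr
    · rw [PMF.mem_support_pure_iff] at hr; exact hr ▸ hs
    · simp only [PMF.mem_support_bind_iff, PMF.mem_support_pure_iff] at hr
      obtain ⟨r', -, rfl⟩ := hr
      exact hs

end Invariants

/-! ### Oracle answers, verification and initial states of the experiment and the ideal game. -/

section RealIdeal

variable {pp : GroupParams} {L J κ : ℕ} {ids : List Str} {keys : Str → Star pp} {id : Str}
  {δ : ℕ → ℝ≥0∞}

theorem real_hash_fst (hκ : 2 ^ κ ≤ pp.q) (hδ : RealError κ δ) (k : Fin 3) (u : Str) :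
    (realHop L J κ ids keys id δ).Sim (Θ := Fin κ → Bool) Prod.fst
      (Touched ∅) (fun _ => H pp k u) (Ideal.hash pp L J (keys id).1 k u) :=
  Hop.Sim.coarsen Prod.fst (real_hash hκ hδ ∅ k u)

/-- The keys are in the table from the start, so deriving one is a lookup and disappears in the
ideal game. -/
theorem real_key_bind {α : Type} (i : Str) (hi : i ∈ ids) (k₂ : ℕ → ROM α)
    (k₁ : StateT (Ideal pp L J) PMF α)
    (hk : (realHop L J κ ids keys id δ).Sim (Θ := Fin κ → Bool) Prod.fst (Touched ∅)
      (fun _ => k₂ (keys i).1) k₁) :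
    (realHop L J κ ids keys id δ).Sim (Θ := Fin κ → Bool) Prod.fst (Touched ∅)
      (fun a => userKey pp (List.ofFn a) i >>= k₂) k₁ := by
  refine ⟨hk.1, fun s hs f hf => ?_⟩
  refine le_trans (Hop.Φ_mono fun ω T hr => ?_) (hk.2 s hs f hf)
  rw [ex_stateT_bind]
  unfold userKey
  rw [ex_H, RealRep.key hr i hi]

theorem real_keyCom (hκ : 2 ^ κ ≤ pp.q) (hδ : RealError κ δ) (y' j : ℕ) :
    (realHop L J κ ids keys id δ).Sim (Θ := Fin κ → Bool) Prod.fst (Touched ∅)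
      (fun _ => keyCom pp L (H pp) y' j)
      (keyCom pp L (Ideal.hash pp L J (keys id).1) y' j) :=
  (real_hash_fst hκ hδ _ _).bind fun _ => (Hop.Sim.foldlM _ (fun _ _ =>
    (real_hash_fst hκ hδ _ _).bind fun _ => Hop.Sim.pure _) _).bind fun _ => Hop.Sim.pure _

theorem real_comConstr (hκ : 2 ^ κ ≤ pp.q) (hδ : RealError κ δ) (i : Str) (hi : i ∈ ids)
    (j : Fin (J + 1)) :
    (realHop L J κ ids keys id δ).Sim (Θ := Fin κ → Bool) Prod.fst (Touched ∅)
      (fun a => comConstr pp L (List.ofFn a) i j)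
      (Ideal.com' pp L J (keys id).1 keys id i j) := by
  unfold comConstr Ideal.com'
  refine real_key_bind i hi _ _ ?_
  split_ifs with h
  · subst h
    refine real_touch hκ hδ j _ _ ?_
    refine Hop.Sim.bind (op₂ := fun ω : Hidden pp κ J => (List.finRange L).foldlM
      (fun (acc : ZMod pp.q) ℓ => do
        let rl ← H pp 1 (pp.enc (ω.2 j).1 ++ (ℓ.val + 1).bits)
        pure (acc + (rl : ZMod pp.q))) 0) (k₂ := fun _ r => pure (pp.α ^ r.val))
      (Hop.Sim.foldlM _ (fun b ℓ => ?_) _) fun _ => Hop.Sim.pure _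
    exact Hop.Sim.bind (real_share {j} j (by simp) ℓ) fun _ => Hop.Sim.pure _
  · exact real_keyCom hκ hδ _ _

theorem real_sign (hκ : 2 ^ κ ≤ pp.q) (hδ : RealError κ δ) (j : Fin (J + 1)) (M : Fin L → Str) :
    (realHop L J κ ids keys id δ).Sim (Θ := Fin κ → Bool) Prod.fst (Touched ∅)
      (fun _ => asig pp L (keys id).1 j M) (Ideal.sign pp L J (keys id).1 j M) := by
  unfold asig Ideal.sign
  refine Hop.Sim.bind (Hop.Sim.coarsen Prod.fst (real_getX ∅ j)) fun xj => ?_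
  refine real_touch hκ hδ j _ _ ?_
  refine Hop.Sim.bind (op₂ := fun ω : Hidden pp κ J => (List.finRange L).foldlM
      (fun (acc : ZMod pp.q) ℓ => do
        let xl ← H pp 0 (pp.enc xj ++ (ℓ.val + 1).bits)
        let rl ← H pp 1 (pp.enc (ω.2 j).1 ++ (ℓ.val + 1).bits)
        let el ← H pp 2 (M ℓ ++ pp.enc xl)
        pure (agg pp [acc, (rl : ZMod pp.q) - (el : ZMod pp.q) * ((keys id).1 : ZMod pp.q)])) 0)
      (k₂ := fun _ r => pure (r, xj))
      (Hop.Sim.foldlM _ (fun b ℓ => ?_) _) fun _ => Hop.Sim.pure _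
  unfold Ideal.signStep
  refine Hop.Sim.bind (real_hash hκ hδ _ _ _) fun xl => ?_
  refine Hop.Sim.bind (real_share {j} j (by simp) ℓ) fun rl => ?_
  exact Hop.Sim.bind (real_hashRec hκ hδ _ _ _ _) fun el => Hop.Sim.pure _

theorem real_verify (hκ : 2 ^ κ ≤ pp.q) (hδ : RealError κ δ) (hid : id ∈ ids) (j : Fin (J + 1))
    (M : Fin L → Str) (s x : ZMod pp.q) :
    (realHop L J κ ids keys id δ).Sim (Θ := Fin κ → Bool) Prod.fst (Touched ∅)
      (fun a => comConstr pp L (List.ofFn a) id j >>= fun C =>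
        aver pp L (pp.α ^ (keys id).1) C M s x)
      (Ideal.verify pp L J (keys id).1 j M s x) := by
  unfold Ideal.verify aver
  have h := real_comConstr (L := L) (keys := keys) (id := id) hκ hδ id hid j
  unfold Ideal.com' at h
  rw [if_pos rfl] at h
  refine Hop.Sim.bind h fun C => Hop.Sim.bind ?_ fun e => Hop.Sim.pure _
  exact Hop.Sim.foldlM _ (fun _ _ => (real_hash_fst hκ hδ _ _).bind fun _ =>
    (real_hash_fst hκ hδ _ _).bind fun _ => Hop.Sim.pure _) _

/-- The comparison of the complete states of the games. -/
def gameHop (L J κ : ℕ) (ids : List Str) (keys : Str → Star pp) (id : Str) (δ : ℕ → ℝ≥0∞) :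
    Hop (Hidden pp κ J) (Ideal pp L J) (Game L) where
  μ := (realHop L J κ ids keys id δ).μ
  rel s ω g := (realHop L J κ ids keys id δ).rel s ω g.table ∧ g.epoch = s.epoch ∧
    g.signed = s.signed
  w := (realHop L J κ ids keys id δ).w

theorem gameHop_Φ (f : Hidden pp κ J → Game L → ℝ≥0∞) (s : Ideal pp L J) :
    (gameHop L J κ ids keys id δ).Φ f s =
      (realHop L J κ ids keys id δ).Φ (fun ω T => f ω ⟨T, s.epoch, s.signed⟩) s := by
  unfold Hop.Φ Hop.avg gameHop
  congr 2
  funext ω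
  refine le_antisymm (iSup₂_le fun g hg => ?_) (iSup₂_le fun T hT => ?_)
  · obtain ⟨T, e, l⟩ := g
    obtain ⟨h, rfl, rfl⟩ := hg
    exact le_iSup₂_of_le (f := fun T _ => f ω ⟨T, s.epoch, s.signed⟩) T h le_rfl
  · exact le_iSup₂_of_le (f := fun g _ => f ω g) ⟨T, s.epoch, s.signed⟩ ⟨hT, rfl, rfl⟩ le_rfl

theorem realHop_Φ_frame (f : Hidden pp κ J → Table → ℝ≥0∞) (s : Ideal pp L J) (e : ℕ)
    (l : List (Fin L → Str)) :
    (realHop L J κ ids keys id δ).Φ f { s with epoch := e, signed := l } =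
      (realHop L J κ ids keys id δ).Φ f s := by
  have h : ∀ ω T, (realHop L J κ ids keys id δ).rel { s with epoch := e, signed := l } ω T ↔
      (realHop L J κ ids keys id δ).rel s ω T := fun ω T =>
    ⟨fun H => by
      have H' : RealRep ids keys id (List.ofFn ω.1) ω.2 { s with epoch := e, signed := l } T := H
      exact (⟨H'.noflag, H'.key, H'.keyhid, H'.x, H'.hid, H'.rinj, H'.ry, H'.sh, H'.shnone,
        H'.special, H'.other⟩ : RealRep ids keys id (List.ofFn ω.1) ω.2 s T),
    fun H => by
      have H' : RealRep ids keys id (List.ofFn ω.1) ω.2 s T := H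
      exact (⟨H'.noflag, H'.key, H'.keyhid, H'.x, H'.hid, H'.rinj, H'.ry, H'.sh, H'.shnone,
        H'.special, H'.other⟩ :
        RealRep ids keys id (List.ofFn ω.1) ω.2 { s with epoch := e, signed := l } T)⟩
  unfold Hop.Φ Hop.avg
  simp only [h]
  rfl

/-- Used to lift a comparison of tables to complete game states for operations that leave the epoch
and the list of signed batches alone. -/
theorem game_le {α : Type} {op₂ : (Fin κ → Bool) → ROM α} {op₁ : StateT (Ideal pp L J) PMF α}
    (hop : (realHop L J κ ids keys id δ).Sim (Θ := Fin κ → Bool) Prod.fst (Touched ∅) op₂ op₁)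
    (hfr : ∀ e l, Preserves (Frame e l) op₁) (s : Ideal pp L J)
    (f : (Fin κ → Bool) → α → Game L → ℝ≥0∞) (hf : ∀ a b g, f a b g ≤ 1) :
    (realHop L J κ ids keys id δ).Φ (fun ω T => ex (op₂ ω.1 T) fun r =>
        f ω.1 r.1 ⟨r.2, s.epoch, s.signed⟩) s ≤
      ex (op₁ s) fun r => (gameHop L J κ ids keys id δ).Φ (fun ω g => f ω.1 r.1 g) r.2 := by
  refine (hop.2 s (Finset.empty_subset _) (fun a b T => f a b ⟨T, s.epoch, s.signed⟩)
    fun _ _ _ => hf _ _ _).trans (ex_mono_support fun r hr => ?_)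
  obtain ⟨h₁, h₂⟩ := hfr s.epoch s.signed s ⟨rfl, rfl⟩ r hr
  rw [gameHop_Φ, h₁, h₂]

theorem touched_empty_preserves {α : Type} (op : StateT (Ideal pp L J) PMF α) :
    Preserves (Touched ∅) op := fun _ _ _ _ => Finset.empty_subset _

theorem real_reply (hκ : 2 ^ κ ≤ pp.q) (hδ : RealError κ δ) (x : Query) (m : Mem) :
    (gameHop L J κ ids keys id δ).Sim (Θ := Fin κ → Bool) Prod.fst (Touched ∅)
      (fun a => (realOracle pp L κ J ids (List.ofFn a) (keys id).1).reply x m)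
      ((Ideal.oracle pp L J κ ids keys id).reply x m) := by
  refine ⟨touched_empty_preserves _, fun s _ f hf => ?_⟩
  rw [gameHop_Φ]
  cases x with
  | hash k d u =>
    simp only [realOracle, Ideal.oracle, Ideal.reply, ex_bind, ex_pure, ex_stateT_bind,
      ex_stateT_pure]
    exact game_le (real_hash_fst hκ hδ k (m.reg u)) (fun e l => (frame_opClosed e l).hash _ _) s
      (fun a h g => f a (putHash pp m d h) g) fun _ _ _ => hf _ _ _
  | sign ds dx dj a =>
    simp only [realOracle, Ideal.oracle, Ideal.reply]
    split_ifs with h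
    · simp only [ex_bind, ex_pure]
      refine ((real_sign hκ hδ ⟨s.epoch, Nat.lt_succ_of_le h⟩ (batch L m a)).2 s
        (Finset.empty_subset _) (fun θ r T => f θ (putSig pp m ds dx dj
          (some (r.1.val, r.2, s.epoch))) ⟨T, s.epoch + 1, batch L m a :: s.signed⟩)
        fun _ _ _ => hf _ _ _).trans (ex_mono fun r => ?_)
      rw [gameHop_Φ]
      exact (realHop_Φ_frame _ r.2 (s.epoch + 1) (batch L m a :: s.signed)).ge
    · simp only [ex_pure]
      rw [gameHop_Φ]
  | com d i j =>
    simp only [realOracle, Ideal.oracle, Ideal.reply]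
    split_ifs with h
    · simp only [ex_bind, ex_pure, ex_stateT_bind, ex_stateT_pure]
      exact game_le (real_comConstr hκ hδ (m.reg i) h.1 ⟨(m.reg j).val, Nat.lt_succ_of_le h.2.2⟩)
        (fun e l => (frame_opClosed e l).com' _ _ _ _) s
        (fun a R g => f a (putCom pp m d (some R)) g) fun _ _ _ => hf _ _ _
    · simp only [ex_pure, ex_stateT_pure]
      rw [gameHop_Φ]

open Classical in
/-- The table of the random oracle after key generation. -/
def keyTable (ids : List Str) (keys : Str → Star pp) (msk : Str) : Table := fun k u =>
  if k = 0 ∧ ∃ i ∈ ids, u = msk ++ i then some (keys (u.drop msk.length)).1 else none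

/-- The initial state of the ideal game. -/
def Ideal.init (pp : GroupParams) (L J : ℕ) : Ideal pp L J :=
  ⟨⟨fun _ => [], false⟩, [], ∅, fun _ _ => none, fun _ _ => none, 1, []⟩

open Classical in
/-- The probability that the experiment ends with a forgery after the forger has stopped. -/
def finalProb (pp : GroupParams) (L J : ℕ) (id msk : Str) (Y : (ZMod pp.p)ˣ) (c : Cfg (Game L)) :
    ℝ≥0∞ :=
  if ((c.mem.reg 0).val < pp.q ∧ (c.mem.reg 1).val < pp.q ∧ 1 ≤ (c.mem.reg 2).val ∧
      (c.mem.reg 2).val ≤ J) ∧ batch L c.mem 1 ∉ c.orc.signed then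
    ex ((comConstr pp L msk id (c.mem.reg 2).val >>= fun C =>
      aver pp L Y C (batch L c.mem 1) (c.mem.reg 0).val (c.mem.reg 1).val) c.orc.table) fun r =>
        ind (r.1 = true)
  else 0

theorem finalProb_le_one (id msk : Str) (Y : (ZMod pp.p)ˣ) (c : Cfg (Game L)) :
    finalProb pp L J id msk Y c ≤ 1 := by
  unfold finalProb
  split_ifs
  · exact ex_le_of_le fun r => ind_le_one _
  · simp

theorem real_final (hκ : 2 ^ κ ≤ pp.q) (hδ : RealError κ δ) (hid : id ∈ ids) (m : Mem) (t : ℕ)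
    (s : Ideal pp L J) :
    (gameHop L J κ ids keys id δ).Φ (fun ω g => finalProb pp L J id (List.ofFn ω.1)
        (pp.α ^ (keys id).1) ⟨m, t, g⟩) s ≤
      ex (Ideal.finish pp L J (keys id).1 m s) fun r =>
        ind (r.1 = true ∨ r.2.pub.flag = true) + pot δ r.2.size := by
  -- At the end the unit of error of a raised flag becomes part of the event "forgery or flag".
  have last : ∀ (b : Bool) (s : Ideal pp L J), (realHop L J κ ids keys id δ).Φ
      (fun _ _ => ind (b = true)) s ≤ ind (b = true ∨ s.pub.flag = true) + pot δ s.size := by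
    intro b s
    by_cases hfl : s.pub.flag = true
    · rw [realHop_Φ_flag hfl, ind_true (Or.inr hfl), add_comm]
      simp [realHop, hfl]
    · refine add_le_add ((Hop.avg_le fun _ _ _ => le_rfl).trans (ind_mono Or.inl)) ?_
      simp [realHop, hfl]
  rw [gameHop_Φ]
  unfold finalProb Ideal.finish
  simp only
  split_ifs with h
  · exact ((real_verify hκ hδ hid ⟨(m.reg 2).val, Nat.lt_succ_of_le h.1.2.2.2⟩ (batch L m 1)
      (m.reg 0).val (m.reg 1).val).2 s (Finset.empty_subset _) (fun _ b _ => ind (b = true))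
      fun _ _ _ => ind_le_one _).trans (ex_mono fun r => last r.1 r.2)
  · rw [ex_pure]
    have := last false s
    simpa [ind] using this

/-- Initially nothing has been derived from the attacked key. The only genuine requirement is that
no key derivation point `msk ‖ i` begins with that key. -/
theorem realRep_init (a : Fin κ → Bool) (r : Fin (J + 1) → Star pp)
    (h : ∀ i ∈ ids, (List.ofFn a ++ i).take pp.q.size ≠ pp.enc (keys id).1) :
    RealRep ids keys id (List.ofFn a) r (Ideal.init pp L J) (keyTable ids keys (List.ofFn a)) := by
  have hne : ∀ u i : Str, i ∈ ids → pp.enc (keys id).1 ++ u ≠ List.ofFn a ++ i := by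
    intro u i hi e
    exact h i hi (by rw [← e]; simp)
  refine ⟨rfl, fun i hi => ?_, h, fun j => ?_, fun j => ?_, ?_, ?_, ?_, fun _ _ _ => rfl,
    fun _ _ _ => rfl, fun k u hs _ => ?_⟩
  · unfold keyTable
    rw [if_pos ⟨rfl, i, hi, rfl⟩]
    simp
  · unfold keyTable
    rw [if_neg]
    · rfl
    · rintro ⟨-, i, hi, e⟩
      exact hne _ i hi e
  · unfold keyTable
    simp [Ideal.init]
  · intro j hj; simp [Ideal.init] at hj
  · intro j hj; simp [Ideal.init] at hj
  · intro j hj; simp [Ideal.init] at hj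
  · unfold keyTable
    rw [if_neg]
    · rfl
    · exact fun hc => hs (Or.inl hc)

/-- The success probability in the experiment, for fixed keys, is at most the probability of a
forgery or a query that reveals the private key in the ideal game, up to the error. -/
theorem real_le_ideal (hκ : 2 ^ κ ≤ pp.q) (hδ : RealError κ δ) (hid : id ∈ ids) (A : Prog Query)
    (fuel : ℕ) (m : Mem) (t : ℕ) :
    ex (PMF.uniformOfFintype (Fin κ → Bool)) (fun a =>
      ex (run (realOracle pp L κ J ids (List.ofFn a) (keys id).1) fuel A
        ⟨m, t, ⟨keyTable ids keys (List.ofFn a), 1, []⟩⟩) fun o =>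
          o.elim 1 (finalProb pp L J id (List.ofFn a) (pp.α ^ (keys id).1))) ≤
    eta κ + ex (run (Ideal.oracle pp L J κ ids keys id) fuel A ⟨m, t, Ideal.init pp L J⟩) fun o =>
      o.elim ⊤ fun c => ex (Ideal.finish pp L J (keys id).1 c.mem c.orc) fun r =>
        ind (r.1 = true ∨ r.2.pub.flag = true) + pot δ r.2.size := by
  have key := Hop.run_le (h := gameHop L J κ ids keys id δ) (obs := Prod.fst) (I := Touched ∅)
    (O₂ := fun a : Fin κ → Bool => realOracle pp L κ J ids (List.ofFn a) (keys id).1)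
    (O₁ := Ideal.oracle pp L J κ ids keys id) (fun _ => rfl) (real_reply hκ hδ) fuel A m t
    (Ideal.init pp L J) (Finset.empty_subset _)
    (fun a => finalProb pp L J id (List.ofFn a) (pp.α ^ (keys id).1))
    fun _ _ => finalProb_le_one _ _ _ _
  refine le_trans ?_ (add_le_add le_rfl (key.trans (ex_mono fun o => ?_)))
  · rw [gameHop_Φ]
    set F : (Fin κ → Bool) → Table → ℝ≥0∞ := fun a T =>
      ex (run (realOracle pp L κ J ids (List.ofFn a) (keys id).1) fuel A ⟨m, t, ⟨T, 1, []⟩⟩)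
        fun o => o.elim 1 (finalProb pp L J id (List.ofFn a) (pp.α ^ (keys id).1)) with hF
    have hF1 : ∀ a T, F a T ≤ 1 := fun a T => ex_le_of_le fun o => by
      cases o with
      | none => exact le_rfl
      | some c => exact finalProb_le_one _ _ _ _
    refine le_trans ?_ (add_le_add le_rfl le_self_add)
    have hr : ∀ a, F a (keyTable ids keys (List.ofFn a)) ≤
        ind (List.ofFn a = (pp.enc (keys id).1).take κ) +
          ex (PMF.uniformOfFintype (Fin (J + 1) → Star pp)) fun r => ⨆ T,
            ⨆ (_ : (realHop L J κ ids keys id δ).rel (Ideal.init pp L J) (a, r) T), F a T := by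
      intro a
      by_cases hb : List.ofFn a = (pp.enc (keys id).1).take κ
      · rw [ind_true hb]
        exact (hF1 _ _).trans le_self_add
      · refine le_trans ?_ le_add_self
        refine (ex_const (PMF.uniformOfFintype (Fin (J + 1) → Star pp)) _).symm.le.trans
          (ex_mono fun r => ?_)
        refine le_iSup₂_of_le (f := fun T _ => F a T) _ (realRep_init a r fun i _ e => hb ?_) le_rfl
        -- Encoded hash values have at least `κ` bits. If `msk ‖ i` began with the private key, its
        -- first `κ` bits would determine the master key, which has probability at most `eta κ`.
        have hsz : κ ≤ pp.q.size := by
          by_contra hc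
          have := Nat.lt_size_self pp.q
          have h2 : 2 ^ pp.q.size ≤ 2 ^ κ := Nat.pow_le_pow_right (by norm_num) (by omega)
          omega
        rw [← e, List.take_take, min_eq_left hsz]
        exact (List.take_left' (by simp)).symm
    refine (ex_mono hr).trans ?_
    rw [ex_add]
    refine add_le_add (ex_msk_le κ _ fun a b ha hb => List.ofFn_injective (ha.trans hb.symm)) ?_
    unfold Hop.avg
    rw [ex_realHop]
    exact le_rfl
  · cases o with
    | none => exact le_rfl
    | some c => exact real_final hκ hδ hid c.mem c.time c.orc

end RealIdeal

/-! ### From the ideal game to the simulation -/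

/-! ### Coincidences between sums of hash values. -/

section SubsetSums

variable {pp : GroupParams}

/-- The value of `H_2` at a point. -/
def Pub.sumVal (p : Pub pp) (u : Str) : ZMod pp.q := (((p.T 2).lookup u).getD default).1

/-- No two points of `H_0` have the same value, and no two sets of at most `L` points of `H_2` have
the same sum of values. -/
structure Good (L : ℕ) (p : Pub pp) : Prop where
  inj : ∀ u u' h, (p.T 0).lookup u = some h → (p.T 0).lookup u' = some h → u = u'
  sums : ∀ A B : Finset Str, A.card ≤ L → B.card ≤ L → (∀ u ∈ A, (p.T 2).lookup u ≠ none) →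
    (∀ u ∈ B, (p.T 2).lookup u ≠ none) → ∑ u ∈ A, p.sumVal u = ∑ u ∈ B, p.sumVal u → A = B

theorem good_check {L : ℕ} (p : Pub pp) (Y : (ZMod pp.p)ˣ) (k : Fin 3) (u : Str) :
    Good L (p.check Y k u) ↔ Good L p :=
  ⟨fun h => ⟨h.inj, h.sums⟩, fun h => ⟨h.inj, h.sums⟩⟩

theorem good_add_zero {L : ℕ} {p : Pub pp} (hp : Good L p) {u : Str} {h : Star pp}
    (hh : ∀ x ∈ p.T 0, x.2 ≠ h) : Good L (p.add 0 u h) := by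
  refine ⟨fun v v' g hv hv' => ?_, fun A B hA hB hA' hB' e => ?_⟩
  · rw [lookup_add] at hv hv'
    have aux : ∀ w, (p.T 0).lookup w = some h → False := fun w hw => hh _ (mem_of_lookup hw) rfl
    split_ifs at hv hv' with h₁ h₂ h₂
    · exact h₁.2.trans h₂.2.symm
    · obtain rfl := Option.some.inj hv
      exact (aux _ hv').elim
    · obtain rfl := Option.some.inj hv'
      exact (aux _ hv).elim
    · exact hp.inj v v' g hv hv'
  · have e2 : ((p.add 0 u h).T 2) = p.T 2 := by simp [Pub.add]
    simp only [Pub.sumVal, e2] at hA' hB' e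
    exact hp.sums A B hA hB hA' hB' e

theorem good_add_one {L : ℕ} {p : Pub pp} (hp : Good L p) (u : Str) (h : Star pp) :
    Good L (p.add 1 u h) := by
  have e0 : ((p.add 1 u h).T 0) = p.T 0 := by simp [Pub.add]
  have e2 : ((p.add 1 u h).T 2) = p.T 2 := by simp [Pub.add]
  refine ⟨fun v v' g hv hv' => ?_, fun A B hA hB hA' hB' e => ?_⟩
  · rw [e0] at hv hv'
    exact hp.inj v v' g hv hv'
  · simp only [Pub.sumVal, e2] at hA' hB' e
    exact hp.sums A B hA hB hA' hB' e

open Classical in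
/-- The points of `H_2`. -/
def Pub.dom (p : Pub pp) : Finset Str := ((p.T 2).map Prod.fst).toFinset

theorem Pub.mem_dom {p : Pub pp} {u : Str} (h : (p.T 2).lookup u ≠ none) : u ∈ p.dom := by
  obtain ⟨x, hx, rfl⟩ := mem_keys_of_lookup h
  simp only [Pub.dom, List.mem_toFinset]
  exact List.mem_map_of_mem hx

theorem Pub.card_dom_le (p : Pub pp) : p.dom.card ≤ p.size :=
  (List.toFinset_card_le _).trans (by simpa using length_le_size p 2)

open Classical in
/-- The sets of at most `L` elements of a finite set are few. -/
theorem card_small_subsets_le {α : Type} (D : Finset α) (L : ℕ) :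
    (D.powerset.filter fun A => A.card ≤ L).card ≤ (D.card + 1) ^ L := by
  have : (D.powerset.filter fun A => A.card ≤ L) ⊆
      (Fintype.piFinset fun _ : Fin L => Finset.insertNone D).image
        fun f => Finset.eraseNone (Finset.univ.image f) := by
    intro A hA
    rw [Finset.mem_filter, Finset.mem_powerset] at hA
    -- A small set is coded by a list of its elements, padded with `none` to length `L`.
    refine Finset.mem_image.2 ⟨fun i => A.toList[i.1]?, ?_, ?_⟩
    · rw [Fintype.mem_piFinset]
      intro i
      rw [Finset.mem_insertNone]
      intro a ha
      exact hA.1 (Finset.mem_toList.1 (List.mem_of_getElem? ha))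
    · ext a
      rw [Finset.mem_eraseNone, Finset.mem_image]
      constructor
      · rintro ⟨i, -, hi⟩
        exact Finset.mem_toList.1 (List.mem_of_getElem? hi)
      · intro ha
        obtain ⟨n, hn, e⟩ := List.mem_iff_getElem.1 (Finset.mem_toList.2 ha)
        have hn' : n < A.card := by simpa using hn
        exact ⟨⟨n, by omega⟩, Finset.mem_univ _, by simp [hn', e]⟩
  refine (Finset.card_le_card this).trans (Finset.card_image_le.trans ?_)
  rw [Fintype.card_piFinset_const, Finset.card_insertNone]

theorem star_cast_injective (pp : GroupParams) {h h' : Star pp}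
    (e : (h.1 : ZMod pp.q) = (h'.1 : ZMod pp.q)) : h = h' := by
  rw [ZMod.natCast_eq_natCast_iff', Nat.mod_eq_of_lt (star_lt h), Nat.mod_eq_of_lt (star_lt h')] at e
  exact Subtype.ext e

/-- A fresh value that creates a coincidence of sums is determined by two sets of points. -/
theorem good_add_two {L : ℕ} {p : Pub pp} (hp : Good L p) {u : Str}
    (h : Star pp)
    (hh : ∀ A B : Finset Str, A ⊆ p.dom → B ⊆ p.dom → A.card ≤ L → B.card ≤ L →
      (h.1 : ZMod pp.q) ≠ ∑ v ∈ B, p.sumVal v - ∑ v ∈ A, p.sumVal v) :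
    Good L (p.add 2 u h) := by
  classical
  have e0 : ((p.add 2 u h).T 0) = p.T 0 := by simp [Pub.add]
  have hv : ∀ v, v ≠ u → (p.add 2 u h).sumVal v = p.sumVal v := fun v hv => by
    simp [Pub.sumVal, lookup_add, hv]
  have hvu : (p.add 2 u h).sumVal u = (h.1 : ZMod pp.q) := by simp [Pub.sumVal, lookup_add]
  have hl : ∀ v, v ≠ u → ((p.add 2 u h).T 2).lookup v ≠ none → (p.T 2).lookup v ≠ none :=
    fun v hv h' => by simpa [lookup_add, hv] using h'
  have hs : ∀ A : Finset Str, u ∉ A → ∑ v ∈ A, (p.add 2 u h).sumVal v = ∑ v ∈ A, p.sumVal v :=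
    fun A hA => Finset.sum_congr rfl fun v hv' => hv v fun e => hA (e ▸ hv')
  have hsu : ∀ A : Finset Str, u ∈ A →
      ∑ v ∈ A, (p.add 2 u h).sumVal v = h.1 + ∑ v ∈ A.erase u, p.sumVal v := fun A hA => by
    rw [← Finset.add_sum_erase A _ hA, hvu, hs _ (Finset.notMem_erase u A)]
  have hd : ∀ A : Finset Str, (∀ v ∈ A, ((p.add 2 u h).T 2).lookup v ≠ none) →
      ∀ v ∈ A.erase u, (p.T 2).lookup v ≠ none := fun A hA v hv' =>
    hl v (Finset.ne_of_mem_erase hv') (hA v (Finset.mem_of_mem_erase hv'))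
  have hd' : ∀ A : Finset Str, u ∉ A → (∀ v ∈ A, ((p.add 2 u h).T 2).lookup v ≠ none) →
      ∀ v ∈ A, (p.T 2).lookup v ≠ none := fun A hu hA v hv' =>
    hl v (fun e => hu (e ▸ hv')) (hA v hv')
  have hc : ∀ A : Finset Str, A.card ≤ L → (A.erase u).card ≤ L := fun A hA =>
    (Finset.card_erase_le).trans hA
  refine ⟨fun v v' g hv hv' => ?_, fun A B hA hB hA' hB' e => ?_⟩
  · rw [e0] at hv hv'
    exact hp.inj v v' g hv hv'
  -- If both sets or neither contain the new point, its value cancels or does not occur and the old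
  -- property applies. If exactly one does, the equation would express the new value as a difference
  -- of two old sums, which `hh` excludes.
  · by_cases ha : u ∈ A <;> by_cases hb : u ∈ B
    · rw [hsu A ha, hsu B hb] at e
      have := hp.sums _ _ (hc A hA) (hc B hB) (hd A hA') (hd B hB') (add_left_cancel e)
      rw [← Finset.insert_erase ha, this, Finset.insert_erase hb]
    · rw [hsu A ha, hs B hb] at e
      exact (hh (A.erase u) B (fun v hv => Pub.mem_dom (hd A hA' v hv))
        (fun v hv => Pub.mem_dom (hd' B hb hB' v hv)) (hc A hA) hB (eq_sub_of_add_eq e)).elim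
    · rw [hs A ha, hsu B hb] at e
      exact (hh (B.erase u) A (fun v hv => Pub.mem_dom (hd B hB' v hv))
        (fun v hv => Pub.mem_dom (hd' A ha hA' v hv)) (hc B hB) hA (eq_sub_of_add_eq e.symm)).elim
    · rw [hs A ha, hs B hb] at e
      exact hp.sums A B hA hB (hd' A ha hA') (hd' B hb hB') e

/-- Bounds on the errors of the steps of the simulation. -/
structure SimError (κ L : ℕ) (δ : ℕ → ℝ≥0∞) : Prop where
  points : ∀ n : ℕ, 2 * ((1 + n : ℕ) * eta κ) ≤ δ n
  sums : ∀ n : ℕ, ((n + 1) ^ L * (n + 1) ^ L : ℕ) * eta κ ≤ δ n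

-- For `H_0` the bad values are those already taken, and for `H_1` there are none. For `H_2` every
-- bad value is determined by a pair of small sets of old points, which gives the square of `(n + 1)
-- ^ L`.
open Classical in
theorem ex_not_good_le {κ L : ℕ} (hκ : 2 ^ κ ≤ pp.q) {p : Pub pp}
    (hp : Good L p) (k : Fin 3) {u : Str} :
    (k ≠ 2 → ex (unif pp) (fun h => ind (¬ Good L (p.add k u h))) ≤ p.size * eta κ) ∧
    (k = 2 → ex (unif pp) (fun h => ind (¬ Good L (p.add k u h))) ≤
      ((p.size + 1) ^ L * (p.size + 1) ^ L : ℕ) * eta κ) := by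
  refine ⟨fun hk => ?_, ?_⟩
  · rcases (by omega : k = 0 ∨ k = 1 ∨ k = 2) with rfl | rfl | rfl
    · refine ex_unif_mem_le hκ _ ((p.T 0).map Prod.snd).toFinset _
        ((List.toFinset_card_le _).trans (by simpa using length_le_size p 0)) (fun h => h) ?_
      intro h hh
      by_contra hc
      refine hh (good_add_zero hp fun x hx e => hc ⟨h, ?_, rfl⟩)
      rw [List.mem_toFinset]
      exact List.mem_map.2 ⟨x, hx, e⟩
    · refine (ex_mono fun h => (ind_false (not_not.2 (good_add_one hp u h))).le).trans ?_
      simp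
    · exact absurd rfl hk
  · rintro rfl
    set P := p.dom.powerset.filter fun A => A.card ≤ L with hP
    refine ex_unif_mem_le hκ _ (P ×ˢ P) _ ?_ (fun AB : Finset Str × Finset Str =>
      if h : ∃ h : Star pp, (h.1 : ZMod pp.q) =
        ∑ v ∈ AB.2, p.sumVal v - ∑ v ∈ AB.1, p.sumVal v then h.choose else default) ?_
    · rw [Finset.card_product]
      have : P.card ≤ (p.size + 1) ^ L := (card_small_subsets_le p.dom L).trans
        (Nat.pow_le_pow_left (Nat.succ_le_succ p.card_dom_le) L)
      exact Nat.mul_le_mul this this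
    · intro h hh
      by_contra hc
      refine hh (good_add_two hp h fun A B hA hB hA' hB' e => hc ⟨(A, B), ?_, ?_⟩)
      · simp only [hP, Finset.mem_product, Finset.mem_filter, Finset.mem_powerset]
        exact ⟨⟨hA, hA'⟩, hB, hB'⟩
      · have hex : ∃ h : Star pp, (h.1 : ZMod pp.q) =
            ∑ v ∈ B, p.sumVal v - ∑ v ∈ A, p.sumVal v := ⟨h, e⟩
        simp only [dif_pos hex]
        exact star_cast_injective pp (hex.choose_spec.trans e.symm)

theorem ex_not_good_le_error {κ L : ℕ} {δ : ℕ → ℝ≥0∞} (hκ : 2 ^ κ ≤ pp.q) (hδ : SimError κ L δ)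
    {p : Pub pp} (hp : Good L p) (k : Fin 3) {u : Str} {n : ℕ}
    (hn : p.size ≤ n) : ex (unif pp) (fun h => ind (¬ Good L (p.add k u h))) ≤ δ n := by
  obtain ⟨h₁, h₂⟩ := ex_not_good_le hκ hp k (u := u)
  by_cases hk : k = 2
  · refine (h₂ hk).trans (le_trans ?_ (hδ.sums n))
    gcongr
  · refine (h₁ hk).trans (le_trans ?_ (hδ.points n))
    refine le_trans ?_ (le_mul_of_one_le_left (by simp) (by norm_num))
    gcongr
    omega

/-- Absorbing an unlikely event into the error. -/
theorem ex_bad_le {α : Type} {μ : PMF α} {X R : α → ℝ≥0∞} {bad : α → Prop} {w d W : ℝ≥0∞}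
    (hX : ∀ a, X a ≤ 1) (hbad : ex μ (fun a => ind (bad a)) ≤ d) (hW : w + d ≤ W)
    (h₁ : ∀ a, ¬ bad a → X a + W ≤ R a) (h₂ : ∀ a, W ≤ R a) : ex μ X + w ≤ ex μ R := by
  have : ∀ a, X a + W ≤ ind (bad a) + R a := fun a => by
    by_cases hb : bad a
    · rw [ind_true hb]; exact add_le_add (hX a) (h₂ a)
    · exact (h₁ a hb).trans le_add_self
  have e := ex_mono (μ := μ) this
  rw [ex_add, ex_add, ex_const] at e
  -- Adding the potential first avoids subtraction in `ℝ≥0∞`. The error `d` can be cancelled when it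
  -- is finite, and otherwise the right-hand side is infinite.
  by_cases hd : d = ⊤
  · have hW' : W = ⊤ := top_le_iff.1 ((hd ▸ le_add_self : d ≤ w + d).trans hW |>.trans' hd.ge)
    have : ex μ R = ⊤ := top_le_iff.1 ((ex_const μ ⊤).symm.le.trans (ex_mono fun a => hW' ▸ h₂ a))
    rw [this]; exact le_top
  · refine (ENNReal.add_le_add_iff_right hd).1 ?_
    calc ex μ X + w + d = ex μ X + (w + d) := add_assoc _ _ _
      _ ≤ ex μ X + W := by gcongr
      _ ≤ _ := e
      _ ≤ d + ex μ R := by gcongr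
      _ = _ := add_comm _ _

end SubsetSums

/-! ### Ideal states, their completions, and simulated states. -/

section IdealSim

variable {pp : GroupParams} {L J κ : ℕ} {y : Star pp} {δ : ℕ → ℝ≥0∞}

/-- Values for the exponents and hash values that the ideal game has not determined. -/
abbrev Rows (pp : GroupParams) (L J : ℕ) := Fin (J + 1) → Fin L → Star pp

/-- The values `e_j^ℓ`, completed by `e`. -/
def Ideal.evec (s : Ideal pp L J) (e : Rows pp L J) (j : Fin (J + 1)) : Fin L → Star pp :=
  fun ℓ => (s.es j ℓ).getD (e j ℓ)

/-- The component `s` of the signature in epoch `j`, when the exponents are completed by `r`. -/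
def Ideal.sval (y : Star pp) (s : Ideal pp L J) (e r : Rows pp L J) (j : Fin (J + 1)) : ZMod pp.q :=
  ∑ ℓ, (((s.sh j ℓ).getD (r j ℓ)).1 : ZMod pp.q) - y.1 * SimState.esum pp L (s.evec e j)

open Classical in
/-- The state of the simulation that corresponds to a state of the ideal game. -/
def Ideal.img (y : Star pp) (s : Ideal pp L J) (ω : Rows pp L J × Rows pp L J) :
    SimState pp L J where
  pub := s.pub
  memo j := if j ∈ s.com then some (s.evec ω.1 j, s.sval y ω.1 ω.2 j) else none
  epoch := s.epoch

/-- The comparison of the simulation with the ideal game. -/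
def simHop (L J : ℕ) (y : Star pp) (δ : ℕ → ℝ≥0∞) :
    Hop (Rows pp L J × Rows pp L J) (Ideal pp L J) (SimState pp L J) where
  μ := (PMF.uniformOfFintype (Rows pp L J)).bind fun e =>
    (PMF.uniformOfFintype (Rows pp L J)).bind fun r => PMF.pure (e, r)
  rel s ω g := g = s.img y ω ∧ Good L s.pub
  w s := pot δ s.size

/-- The quantity compared with the ideal game. -/
def simΦ (y : Star pp) (δ : ℕ → ℝ≥0∞) (f : SimState pp L J → ℝ≥0∞) (s : Ideal pp L J) : ℝ≥0∞ :=
  (simHop L J y δ).Φ (fun _ => f) s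

/-- The average over the undetermined values. -/
def simAvg (y : Star pp) (f : SimState pp L J → ℝ≥0∞) (s : Ideal pp L J) : ℝ≥0∞ :=
  ex (PMF.uniformOfFintype (Rows pp L J)) fun e =>
    ex (PMF.uniformOfFintype (Rows pp L J)) fun r => f (s.img y (e, r))

theorem simAvg_le_one {f : SimState pp L J → ℝ≥0∞} (hf : ∀ g, f g ≤ 1) (s : Ideal pp L J) :
    simAvg y f s ≤ 1 := ex_le_of_le fun _ => ex_le_of_le fun _ => hf _

theorem simΦ_good {s : Ideal pp L J} (hs : Good L s.pub) (f : SimState pp L J → ℝ≥0∞) :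
    simΦ y δ f s = simAvg y f s + pot δ s.size := by
  unfold simΦ Hop.Φ Hop.avg simAvg
  congr 1
  simp only [simHop, ex_bind, ex_pure]
  refine congrArg _ (funext fun e => congrArg _ (funext fun r => ?_))
  exact le_antisymm (iSup₂_le fun g hg => by rw [hg.1])
    (le_iSup₂_of_le (f := fun g _ => f g) (s.img y (e, r)) ⟨rfl, hs⟩ le_rfl)

theorem simΦ_bad {s : Ideal pp L J} (hs : ¬ Good L s.pub) (f : SimState pp L J → ℝ≥0∞) :
    simΦ y δ f s = pot δ s.size := by
  have : (simHop L J y δ).avg (fun _ => f) s = 0 :=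
    le_antisymm (Hop.avg_le fun ω g hr => absurd hr.2 hs) zero_le
  rw [simΦ, Hop.Φ, this, zero_add]
  rfl

theorem pot_le_simΦ (f : SimState pp L J → ℝ≥0∞) (s : Ideal pp L J) :
    pot δ s.size ≤ simΦ y δ f s := Hop.w_le_Φ (simHop L J y δ) _ s

theorem simΦ_le {f : SimState pp L J → ℝ≥0∞} (s : Ideal pp L J) {X : ℝ≥0∞}
    (h₁ : Good L s.pub → simAvg y f s + pot δ s.size ≤ X) (h₂ : pot δ s.size ≤ X) :
    simΦ y δ f s ≤ X := by
  by_cases hs : Good L s.pub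
  · rw [simΦ_good hs]; exact h₁ hs
  · rw [simΦ_bad hs]; exact h₂

/-- Records are never removed, so the potential cannot decrease. -/
theorem sizeMono_opClosed (n : ℕ) : OpClosed pp L J y.1 fun s => n ≤ s.size := by
  constructor
  · intro k u s hs r hr
    simp only [Ideal.hash, PMF.mem_support_bind_iff, PMF.mem_support_pure_iff] at hr
    obtain ⟨r', hr', rfl⟩ := hr
    refine hs.trans ?_
    simp only [Ideal.size_eq]
    unfold pubH at hr'
    split at hr'
    · rw [PMF.mem_support_pure_iff] at hr'; simp [hr']
    · simp only [PMF.mem_support_bind_iff, PMF.mem_support_pure_iff] at hr'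
      obtain ⟨h, -, rfl⟩ := hr'
      simp only [size_add, size_check]; omega
  · intro j ℓ u s hs r hr
    simp only [Ideal.hashRec, PMF.mem_support_bind_iff, PMF.mem_support_pure_iff] at hr
    obtain ⟨r', hr', rfl⟩ := hr
    refine hs.trans ?_
    simp only [Ideal.size_eq]
    unfold pubH at hr'
    split at hr'
    · rw [PMF.mem_support_pure_iff] at hr'; simp [hr']
    · simp only [PMF.mem_support_bind_iff, PMF.mem_support_pure_iff] at hr'
      obtain ⟨h, -, rfl⟩ := hr'
      simp only [size_add, size_check]; omega
  · intro j s hs r hr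
    simp only [Ideal.touch, PMF.mem_support_pure_iff] at hr
    subst hr
    refine hs.trans ?_
    simp only [Ideal.size_eq]
    have := Finset.card_le_card (Finset.subset_insert j s.com)
    omega
  · intro j ℓ s hs r hr
    unfold Ideal.share at hr
    split at hr
    · rw [PMF.mem_support_pure_iff] at hr; exact hr ▸ hs
    · simp only [PMF.mem_support_bind_iff, PMF.mem_support_pure_iff] at hr
      obtain ⟨r', -, rfl⟩ := hr
      exact hs
  · intro j s hs r hr
    unfold Ideal.getX at hr
    split at hr
    · rw [PMF.mem_support_pure_iff] at hr; exact hr ▸ hs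
    · simp only [PMF.mem_support_bind_iff, PMF.mem_support_pure_iff] at hr
      obtain ⟨r', -, rfl⟩ := hr
      refine hs.trans ?_
      simp only [Ideal.size_eq, List.length_cons]; omega

/-- This settles states in which `Good` has already failed: there only the potential is left on the
side of the simulation. -/
theorem pot_le_ex {α : Type} {op : StateT (Ideal pp L J) PMF α}
    (hop : ∀ n, Preserves (fun s => n ≤ s.size) op) (f : α → SimState pp L J → ℝ≥0∞)
    (s : Ideal pp L J) :
    pot δ s.size ≤ ex (op s) fun r => simΦ y δ (f r.1) r.2 :=
  (ex_const (op s) (pot δ s.size)).ge.trans (ex_mono_support fun r hr =>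
    (pot_mono δ (hop s.size s le_rfl r hr)).trans (pot_le_simΦ _ _))

/-- Matching of one computation of the simulation by one of the ideal game, from a given state. -/
def SimAt {α : Type} (y : Star pp) (δ : ℕ → ℝ≥0∞) (s : Ideal pp L J)
    (op₂ : StateT (SimState pp L J) PMF α) (op₁ : StateT (Ideal pp L J) PMF α) : Prop :=
  ∀ f : α → SimState pp L J → ℝ≥0∞, (∀ a g, f a g ≤ 1) →
    simΦ y δ (fun g => ex (op₂ g) fun r => f r.1 r.2) s ≤
      ex (op₁ s) fun r => simΦ y δ (f r.1) r.2

theorem SimAt.pure {α : Type} (s : Ideal pp L J) (a : α) :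
    SimAt y δ s (Pure.pure a) (Pure.pure a) := fun f _ => by
  simp only [ex_stateT_pure]; exact le_rfl

/-- The continuations are compared only at states that can actually occur, so facts about the
reached state, such as a point being unasked, may be used. -/
theorem SimAt.bind {α β : Type} {s : Ideal pp L J} {op₂ : StateT (SimState pp L J) PMF α}
    {op₁ : StateT (Ideal pp L J) PMF α} {k₂ : α → StateT (SimState pp L J) PMF β}
    {k₁ : α → StateT (Ideal pp L J) PMF β} (hx : SimAt y δ s op₂ op₁)
    (hk : ∀ r ∈ (op₁ s).support, SimAt y δ r.2 (k₂ r.1) (k₁ r.1)) :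
    SimAt y δ s (op₂ >>= k₂) (op₁ >>= k₁) := fun f hf => by
  simp only [ex_stateT_bind]
  refine (hx (fun a g => ex (k₂ a g) fun r => f r.1 r.2) fun a g => ex_le_of_le fun r =>
    hf _ _).trans ?_
  exact ex_mono_support fun r hr => hk r hr f hf

theorem SimAt.foldlM {β γ : Type} {s : Ideal pp L J} {g₂ : β → γ → StateT (SimState pp L J) PMF β}
    {g₁ : β → γ → StateT (Ideal pp L J) PMF β} (l : List γ)
    (hg : ∀ s b c, SimAt y δ s (g₂ b c) (g₁ b c)) (b : β) :
    SimAt y δ s (l.foldlM g₂ b) (l.foldlM g₁ b) := by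
  induction l generalizing b s with
  | nil => exact SimAt.pure s b
  | cons a l ih =>
    simp only [List.foldlM_cons]
    exact (hg s b a).bind fun r _ => ih r.1

theorem ex_sim_hash (k : Fin 3) (u : Str) (g : SimState pp L J) (Y : (ZMod pp.p)ˣ)
    (f : ℕ × SimState pp L J → ℝ≥0∞) :
    ex (SimState.hash pp L J Y k u g) f = match (g.pub.T k).lookup u with
      | some h => f (h.1, { g with pub := g.pub.check Y k u })
      | none => ex (unif pp) fun h =>
          f (h.1, { g with pub := (g.pub.check Y k u).add k u h }) := by
  simp only [SimState.hash, ex_bind, ex_pure, ex_pubH]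

theorem ex_ideal_hash (k : Fin 3) (u : Str) (s : Ideal pp L J) (f : ℕ × Ideal pp L J → ℝ≥0∞) :
    ex (Ideal.hash pp L J y.1 k u s) f = match (s.pub.T k).lookup u with
      | some h => f (h.1, { s with pub := s.pub.check (pp.α ^ y.1) k u })
      | none => ex (unif pp) fun h =>
          f (h.1, { s with pub := (s.pub.check (pp.α ^ y.1) k u).add k u h }) := by
  simp only [Ideal.hash, ex_bind, ex_pure, ex_pubH]

theorem size_pub (s : Ideal pp L J) (p : Pub pp) :
    Ideal.size { s with pub := p } = p.size + s.com.card + s.xs.length := rfl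

/-- Both sides answer from the same public record. The only error is that a new value may destroy
`Good`. -/
theorem sim_hash (hκ : 2 ^ κ ≤ pp.q) (hδ : SimError κ L δ) (k : Fin 3) (u : Str)
    (s : Ideal pp L J) : SimAt y δ s (SimState.hash pp L J (pp.α ^ y.1) k u)
      (Ideal.hash pp L J y.1 k u) := by
  intro f hf
  refine simΦ_le s (fun hs => ?_) (pot_le_ex (fun n => (sizeMono_opClosed n).hash k u) f s)
  rw [ex_ideal_hash]
  unfold simAvg
  simp only [ex_sim_hash]
  have hp : ∀ ω, (s.img y ω).pub = s.pub := fun _ => rfl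
  simp only [hp]
  cases hl : (s.pub.T k).lookup u with
  | some h =>
    simp only
    rw [simΦ_good ((good_check _ _ _ _).2 hs)]
    exact le_rfl
  | none =>
    simp only
    have hs' : Good L (s.pub.check (pp.α ^ y.1) k u) := (good_check _ _ _ _).2 hs
    have hw : ∀ h, Ideal.size { s with pub := (s.pub.check (pp.α ^ y.1) k u).add k u h } =
        s.size + 1 := fun h => by
      rw [size_pub, size_add, size_check, Ideal.size_eq]; omega
    have e : (ex (PMF.uniformOfFintype (Rows pp L J)) fun e =>
        ex (PMF.uniformOfFintype (Rows pp L J)) fun r => ex (unif pp) fun h =>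
          f h.1 { s.img y (e, r) with pub := (s.pub.check (pp.α ^ y.1) k u).add k u h }) =
        ex (unif pp) fun h => simAvg y (f h.1)
          { s with pub := (s.pub.check (pp.α ^ y.1) k u).add k u h } := by
      unfold simAvg
      rw [ex_comm (unif pp)]
      refine congrArg _ (funext fun e => ?_)
      rw [ex_comm (unif pp)]
      rfl
    rw [e]
    refine ex_bad_le (fun h => simAvg_le_one (hf _) _)
      (ex_not_good_le_error hκ hδ hs' k (u := u) (n := s.size)
        (by rw [size_check, Ideal.size_eq]; omega))
      (pot_add_le δ (Nat.lt_succ_self s.size)) (fun h hb => ?_) fun h => ?_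
    · rw [simΦ_good (by simpa using hb), hw]
    · refine le_trans ?_ (pot_le_simΦ _ _)
      rw [hw]

theorem sim_keyCom (hκ : 2 ^ κ ≤ pp.q) (hδ : SimError κ L δ) (y' j : ℕ) (s : Ideal pp L J) :
    SimAt y δ s (keyCom pp L (SimState.hash pp L J (pp.α ^ y.1)) y' j)
      (keyCom pp L (Ideal.hash pp L J y.1) y' j) := by
  unfold keyCom
  refine SimAt.bind (sim_hash hκ hδ _ _ _) fun r _ => ?_
  refine SimAt.bind (SimAt.foldlM _ (fun s b c => ?_) _) fun r _ => SimAt.pure _ _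
  exact SimAt.bind (sim_hash hκ hδ _ _ _) fun r _ => SimAt.pure _ _

theorem sim_verSum (hκ : 2 ^ κ ≤ pp.q) (hδ : SimError κ L δ) (M : Fin L → Str) (x : ℕ)
    (s : Ideal pp L J) :
    SimAt y δ s (verSum pp L (SimState.hash pp L J (pp.α ^ y.1)) M x)
      (verSum pp L (Ideal.hash pp L J y.1) M x) := by
  unfold verSum
  refine SimAt.foldlM _ (fun s b c => ?_) _
  refine SimAt.bind (sim_hash hκ hδ _ _ _) fun r _ => ?_
  exact SimAt.bind (sim_hash hκ hδ _ _ _) fun r _ => SimAt.pure _ _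

/-- Resampling one row. -/
theorem ex_row (j : Fin (J + 1)) (f : Rows pp L J → ℝ≥0∞) :
    ex (PMF.uniformOfFintype (Rows pp L J)) f = ex (PMF.uniformOfFintype (Rows pp L J)) fun ω =>
      ex (PMF.uniformOfFintype (Fin L → Star pp)) fun h => f (Function.update ω j h) :=
  ex_pi_update j f

/-- Resampling one entry. -/
theorem ex_entry (j : Fin (J + 1)) (ℓ : Fin L) (f : Rows pp L J → ℝ≥0∞) :
    ex (PMF.uniformOfFintype (Rows pp L J)) f = ex (PMF.uniformOfFintype (Rows pp L J)) fun ω =>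
      ex (unif pp) fun h => f (Function.update ω j (Function.update (ω j) ℓ h)) := by
  rw [ex_row j f, ex_row j fun ω => ex (unif pp) fun h =>
    f (Function.update ω j (Function.update (ω j) ℓ h))]
  refine congrArg _ (funext fun ω => ?_)
  rw [ex_pi_update ℓ]
  simp [unif]

/-- Determine an exponent. -/
def Ideal.setSh (s : Ideal pp L J) (j : Fin (J + 1)) (ℓ : Fin L) (h : Star pp) : Ideal pp L J :=
  { s with sh := Function.update s.sh j (Function.update (s.sh j) ℓ (some h)) }

theorem ex_share (j : Fin (J + 1)) (ℓ : Fin L) (s : Ideal pp L J) (f : ℕ × Ideal pp L J → ℝ≥0∞) :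
    ex (Ideal.share pp L J j ℓ s) f = match s.sh j ℓ with
      | some h => f (h.1, s)
      | none => ex (unif pp) fun h => f (h.1, s.setSh j ℓ h) := by
  unfold Ideal.share
  cases s.sh j ℓ with
  | some h => exact ex_pure _ _
  | none => simp only [ex_bind, ex_pure]; rfl

/-- Determining an exponent gives the same simulated state as writing it into the completion,
because completions are consulted only at undetermined places. -/
theorem img_setSh {s : Ideal pp L J} {j : Fin (J + 1)} {ℓ : Fin L} (hsh : s.sh j ℓ = none)
    (h : Star pp) (e r : Rows pp L J) : (s.setSh j ℓ h).img y (e, r) =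
      s.img y (e, Function.update r j (Function.update (r j) ℓ h)) := by
  have : ∀ j' ℓ', (((s.setSh j ℓ h).sh j' ℓ').getD (r j' ℓ')) =
      ((s.sh j' ℓ').getD (Function.update r j (Function.update (r j) ℓ h) j' ℓ')) := by
    intro j' ℓ'
    by_cases hj : j' = j
    · subst hj
      by_cases hℓ : ℓ' = ℓ
      · subst hℓ; simp [hsh, Ideal.setSh]
      · simp [hℓ, Ideal.setSh]
    · simp [hj, Ideal.setSh]
  unfold Ideal.img Ideal.sval
  simp only [this]
  rfl

/-- The simulation does nothing here. Drawing an undetermined exponent in the ideal game merely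
resamples an independent uniform entry of the completion. -/
theorem sim_share (j : Fin (J + 1)) (ℓ : Fin L) (s : Ideal pp L J)
    (f : SimState pp L J → ℝ≥0∞) :
    simΦ y δ f s ≤ ex (Ideal.share pp L J j ℓ s) fun r => simΦ y δ f r.2 := by
  rw [ex_share]
  cases hsh : s.sh j ℓ with
  | some h => exact le_rfl
  | none =>
    simp only
    have hsz : ∀ h, (s.setSh j ℓ h).size = s.size := fun _ => rfl
    refine simΦ_le s (fun hs => ?_) ((ex_const (unif pp) _).ge.trans (ex_mono fun h =>
      (pot_le_simΦ (y := y) f (s.setSh j ℓ h)).trans' (hsz h ▸ le_rfl)))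
    have : ∀ h, simΦ y δ f (s.setSh j ℓ h) = ex (PMF.uniformOfFintype (Rows pp L J)) (fun e =>
        ex (PMF.uniformOfFintype (Rows pp L J)) fun r =>
          f (s.img y (e, Function.update r j (Function.update (r j) ℓ h)))) + pot δ s.size := by
      intro h
      have hs' : Good L (s.setSh j ℓ h).pub := hs
      rw [simΦ_good hs', hsz]
      unfold simAvg
      simp only [img_setSh hsh]
    simp only [this, ex_add, ex_const]
    refine add_le_add_left (le_of_eq ?_) _
    unfold simAvg
    rw [ex_comm (unif pp)]
    refine congrArg _ (funext fun e => ?_)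
    rw [ex_comm (unif pp)]
    exact ex_entry j ℓ fun r => f (s.img y (e, r))

theorem sim_comShares (j : Fin (J + 1)) (l : List (Fin L)) (a : ZMod pp.q) (s : Ideal pp L J)
    (f : SimState pp L J → ℝ≥0∞) :
    simΦ y δ f s ≤ ex ((l.foldlM (fun (acc : ZMod pp.q) ℓ => do
      let rl ← Ideal.share pp L J j ℓ
      pure (acc + (rl : ZMod pp.q))) a : StateT (Ideal pp L J) PMF (ZMod pp.q)) s)
        fun r => simΦ y δ f r.2 := by
  induction l generalizing a s with
  | nil => simp only [List.foldlM_nil, ex_stateT_pure]; exact le_rfl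
  | cons ℓ l ih =>
    simp only [List.foldlM_cons, ex_stateT_bind, ex_stateT_pure]
    exact (sim_share j ℓ s f).trans (ex_mono fun r => ih _ _)

end IdealSim

section IdealSim

variable {pp : GroupParams} {L J κ : ℕ} {y : Star pp} {δ : ℕ → ℝ≥0∞}

/-! ### Commitments -/

instance : NeZero pp.q := ⟨pp.prime_q.ne_zero⟩

theorem sum_range_zmod (pp : GroupParams) (G : ZMod pp.q → ℝ≥0∞) :
    ∑ v ∈ Finset.range pp.q, G (v : ZMod pp.q) = ∑ z : ZMod pp.q, G z := by
  refine Finset.sum_nbij' (fun v => (v : ZMod pp.q)) ZMod.val (fun _ _ => Finset.mem_univ _)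
    (fun z _ => Finset.mem_range.2 (ZMod.val_lt z)) (fun v hv => ?_) (fun z _ => ?_) fun _ _ => rfl
  · exact ZMod.val_cast_of_lt (Finset.mem_range.1 hv)
  · exact ZMod.natCast_zmod_val z

theorem ex_unifBelow {n : ℕ} (hn : 0 < n) (G : ℕ → ℝ≥0∞) :
    ex (unifBelow n) G = (n : ℝ≥0∞)⁻¹ * ∑ v ∈ Finset.range n, G v := by
  classical
  have e : ∀ v, unifBelow n v = if v ∈ Finset.range n then (n : ℝ≥0∞)⁻¹ else 0 := by
    intro v
    rw [unifBelow, dif_pos hn]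
    refine (PMF.uniformOfFinset_apply (s := Finset.range n) _ v).trans ?_
    rw [Finset.card_range]
    congr
  unfold ex
  rw [tsum_eq_sum (s := Finset.range n)]
  · rw [Finset.mul_sum]
    exact Finset.sum_congr rfl fun v hv => by rw [e, if_pos hv]
  · intro v hv; rw [e, if_neg hv, zero_mul]

/-- A uniform residue is almost a shifted hash value. -/
theorem ex_residue_le (hκ : 2 ^ κ ≤ pp.q) {G : ZMod pp.q → ℝ≥0∞} (hG : ∀ z, G z ≤ 1)
    (b : ZMod pp.q) :
    ex (unifBelow pp.q) (fun v => G v) ≤ ex (unif pp) (fun h => G (h.1 + b)) + eta κ := by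
  have hq := pp.prime_q.two_le
  -- The residues are `b` together with the shifts by `b` of the nonzero ones. The residue `b` costs
  -- `1/q`, and for the others `1/q ≤ 1/(q - 1)`.
  have e : ∑ v ∈ Finset.range pp.q, G (v : ZMod pp.q) =
      G b + ∑ h : Star pp, G ((h.1 : ZMod pp.q) + b) := by
    rw [sum_range_zmod, ← Equiv.sum_comp (Equiv.addRight b) G]
    simp only [Equiv.coe_addRight]
    rw [← sum_range_zmod pp fun z => G (z + b), Finset.range_eq_Ico,
      Finset.sum_eq_sum_Ico_succ_bot (by omega)]
    congr 1
    · simp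
    · exact (Finset.sum_coe_sort (Finset.Ico 1 pp.q) fun v => G ((v : ZMod pp.q) + b)).symm
  rw [ex_unifBelow pp.prime_q.pos fun v => G v, e, mul_add, add_comm, unif, ex_uniformOfFintype]
  refine add_le_add (mul_le_mul' ?_ le_rfl) ?_
  · rw [ENNReal.inv_le_inv, card_star]
    exact_mod_cast Nat.sub_le _ _
  · exact (mul_le_mul' (inv_q_le_eta hκ) (hG b)).trans (mul_one _).le

/-- With all exponents but the first held fixed, the sum is a shifted single hash value. This needs
`1 ≤ L`. -/
theorem ex_residue_sum_le (hκ : 2 ^ κ ≤ pp.q) (hL : 1 ≤ L) {G : ZMod pp.q → ℝ≥0∞}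
    (hG : ∀ z, G z ≤ 1) (c : ZMod pp.q) :
    ex (unifBelow pp.q) (fun v => G v) ≤ ex (PMF.uniformOfFintype (Fin L → Star pp))
      (fun r => G (∑ ℓ, ((r ℓ).1 : ZMod pp.q) - c)) + eta κ := by
  rw [ex_pi_update ⟨0, hL⟩]
  refine (ex_const (PMF.uniformOfFintype (Fin L → Star pp)) _).ge.trans ?_
  rw [← ex_const (PMF.uniformOfFintype (Fin L → Star pp)) (eta κ), ← ex_add]
  refine ex_mono fun r => ?_
  refine (ex_residue_le hκ hG (∑ ℓ ∈ Finset.univ \ {⟨0, hL⟩}, ((r ℓ).1 : ZMod pp.q) - c)).trans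
    (add_le_add_left (le_of_eq ?_) _)
  refine congrArg _ (funext fun h => congrArg _ ?_)
  rw [← add_sub_assoc]
  congr 1
  rw [Finset.sdiff_singleton_eq_erase, ← Finset.add_sum_erase Finset.univ
    (fun ℓ => ((Function.update r ⟨0, hL⟩ h ℓ).1 : ZMod pp.q)) (Finset.mem_univ (⟨0, hL⟩ : Fin L))]
  congr 1
  exact Finset.sum_congr rfl fun ℓ hℓ => by simp [Finset.ne_of_mem_erase hℓ]

/-- Fix the simulated signature for an epoch. -/
def SimState.setMemo (g : SimState pp L J) (j : Fin (J + 1)) (v : (Fin L → Star pp) × ZMod pp.q) :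
    SimState pp L J := { g with memo := Function.update g.memo j (some v) }

theorem ex_sim_touch (j : Fin (J + 1)) (g : SimState pp L J)
    (f : Unit × SimState pp L J → ℝ≥0∞) :
    ex (SimState.touch pp L J j g) f = match g.memo j with
      | some _ => f ((), g)
      | none => ex (PMF.uniformOfFintype (Fin L → Star pp)) fun e => ex (unifBelow pp.q) fun v =>
          f ((), g.setMemo j (e, (v : ZMod pp.q))) := by
  unfold SimState.touch
  cases g.memo j with
  | some h => exact ex_pure _ _
  | none => simp only [ex_bind, ex_pure]; rfl

theorem img_insert {s : Ideal pp L J} {j : Fin (J + 1)} (hj : j ∉ s.com)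
    (hsh : ∀ ℓ, s.sh j ℓ = none) (hes : ∀ ℓ, s.es j ℓ = none) (e r : Rows pp L J)
    (e' r' : Fin L → Star pp) :
    Ideal.img y { s with com := insert j s.com } (Function.update e j e', Function.update r j r') =
      (s.img y (e, r)).setMemo j (e', ∑ ℓ, ((r' ℓ).1 : ZMod pp.q) -
        y.1 * SimState.esum pp L e') := by
  unfold Ideal.img SimState.setMemo Ideal.sval Ideal.evec
  congr 1
  funext j'
  by_cases h : j' = j
  · subst h
    simp [hsh, hes]
  · simp [h]

/-- This is the simulation of Schnorr transcripts. In the ideal game row `j` is undetermined, so `∑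
r_j^ℓ - y ∑ e_j^ℓ` is, for each fixed choice of the `e_j^ℓ`, nearly a uniform residue, and uniform
values `e_j^ℓ` with an independent uniform component `s` imitate it at a cost of `eta κ`. -/
theorem sim_touch (hκ : 2 ^ κ ≤ pp.q) (hL : 1 ≤ L) (hδ : SimError κ L δ) (j : Fin (J + 1))
    (s : Ideal pp L J) (hsh : j ∉ s.com → ∀ ℓ, s.sh j ℓ = none)
    (hes : j ∉ s.com → ∀ ℓ, s.es j ℓ = none) :
    SimAt y δ s (SimState.touch pp L J j) (Ideal.touch pp L J j) := by
  intro f hf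
  refine simΦ_le s (fun hs => ?_)
    (pot_le_ex (fun n => (sizeMono_opClosed (y := y) n).touch j) f s)
  unfold Ideal.touch
  rw [ex_pure]
  have hs' : Good L { s with com := insert j s.com }.pub := hs
  rw [simΦ_good hs']
  unfold simAvg
  simp only [ex_sim_touch]
  by_cases hj : j ∈ s.com
  · have e : { s with com := insert j s.com } = s := by
      rw [Finset.insert_eq_of_mem hj]
    rw [e]
    refine add_le_add_left (ex_mono fun e => ex_mono fun r => ?_) _
    have : (s.img y (e, r)).memo j = some (s.evec e j, s.sval y e r j) := if_pos hj
    rw [this]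
  · have hm : ∀ ω, (s.img y ω).memo j = none := fun ω => if_neg hj
    simp only [hm]
    have hw : Ideal.size { s with com := insert j s.com } = s.size + 1 := by
      simp only [Ideal.size_eq, Finset.card_insert_of_notMem hj]; omega
    -- Row `j` of both completions is split off. The state before the step does not depend on these
    -- rows.
    rw [hw, ex_row j fun e => ex (PMF.uniformOfFintype (Rows pp L J)) fun r =>
      f () (Ideal.img y { s with com := insert j s.com } (e, r))]
    have hr' : ∀ (e : Rows pp L J) (e' : Fin L → Star pp),
        (ex (PMF.uniformOfFintype (Rows pp L J)) fun r =>
        f () (Ideal.img y { s with com := insert j s.com } (Function.update e j e', r))) =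
        (ex (PMF.uniformOfFintype (Rows pp L J)) fun r => ex (PMF.uniformOfFintype
          (Fin L → Star pp)) fun r' => f () ((s.img y (e, r)).setMemo j (e',
            ∑ ℓ, ((r' ℓ).1 : ZMod pp.q) - y.1 * SimState.esum pp L e'))) := by
      intro e e'
      rw [ex_row j]
      simp only [img_insert hj (hsh hj) (hes hj)]
    simp only [hr']
    have step : ∀ e : Rows pp L J,
        (ex (PMF.uniformOfFintype (Rows pp L J)) fun r =>
          ex (PMF.uniformOfFintype (Fin L → Star pp)) fun e' => ex (unifBelow pp.q) fun v =>
            f () ((s.img y (e, r)).setMemo j (e', (v : ZMod pp.q)))) ≤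
        ex (PMF.uniformOfFintype (Fin L → Star pp)) (fun e' =>
          ex (PMF.uniformOfFintype (Rows pp L J)) fun r => ex (PMF.uniformOfFintype
          (Fin L → Star pp)) fun r' => f () ((s.img y (e, r)).setMemo j (e',
            ∑ ℓ, ((r' ℓ).1 : ZMod pp.q) - y.1 * SimState.esum pp L e'))) + eta κ := by
      intro e
      rw [ex_comm, ← ex_const (PMF.uniformOfFintype (Fin L → Star pp)) (eta κ), ← ex_add]
      refine ex_mono fun e' => ?_
      rw [← ex_const (PMF.uniformOfFintype (Rows pp L J)) (eta κ), ← ex_add]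
      exact ex_mono fun r => ex_residue_sum_le (L := L) hκ hL
        (G := fun v => f () ((s.img y (e, r)).setMemo j (e', v))) (fun _ => hf _ _)
        (y.1 * SimState.esum pp L e')
    refine (add_le_add_left (ex_mono step) _).trans ?_
    rw [ex_add, ex_const, add_assoc]
    refine add_le_add_right ?_ _
    rw [add_comm]
    refine (add_le_add_right ?_ _).trans (pot_add_le δ (Nat.lt_succ_self s.size))
    refine le_trans ?_ (hδ.points s.size)
    rw [← mul_assoc]
    refine le_mul_of_one_le_left (by simp) ?_
    exact_mod_cast (by omega : 1 ≤ 2 * (1 + s.size))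

/-! ### Supports of the operations of the ideal game -/

/-- The effect of a hash query with answer `h` on the records. -/
structure PubStep (k : Fin 3) (u : Str) (h : Star pp) (p p' : Pub pp) : Prop where
  here : (p'.T k).lookup u = some h
  other : ∀ k' u', ¬ (k' = k ∧ u' = u) → (p'.T k').lookup u' = (p.T k').lookup u'
  old : ∀ h', (p.T k).lookup u = some h' → h' = h

theorem PubStep.persist {k : Fin 3} {u : Str} {h : Star pp} {p p' : Pub pp}
    (H : PubStep k u h p p') {k' : Fin 3} {u' : Str} {h' : Star pp}
    (hl : (p.T k').lookup u' = some h') : (p'.T k').lookup u' = some h' := by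
  by_cases e : k' = k ∧ u' = u
  · obtain ⟨rfl, rfl⟩ := e
    rw [H.here, H.old h' hl]
  · rw [H.other k' u' e, hl]

theorem pubStep_of_mem {Y : (ZMod pp.p)ˣ} {k : Fin 3} {u : Str} {p : Pub pp} {r : Star pp × Pub pp}
    (hr : r ∈ (pubH pp Y k u p).support) : PubStep k u r.1 p r.2 := by
  unfold pubH at hr
  cases hl : (p.T k).lookup u with
  | some h =>
    rw [hl] at hr
    simp only [PMF.mem_support_pure_iff] at hr
    subst hr
    exact ⟨hl, fun _ _ _ => rfl, fun h' e => by simpa using (hl.symm.trans e).symm⟩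
  | none =>
    rw [hl] at hr
    simp only [PMF.mem_support_bind_iff, PMF.mem_support_pure_iff] at hr
    obtain ⟨h, -, rfl⟩ := hr
    refine ⟨by simp [lookup_add], fun k' u' e => by simp [lookup_add, e], fun h' e => ?_⟩
    exact absurd (hl.symm.trans e) (by simp)

theorem mem_hash {k : Fin 3} {u : Str} {s : Ideal pp L J} {r : ℕ × Ideal pp L J}
    (hr : r ∈ (Ideal.hash pp L J y.1 k u s).support) :
    ∃ h p, PubStep k u h s.pub p ∧ r = (h.1, { s with pub := p }) := by
  simp only [Ideal.hash, PMF.mem_support_bind_iff, PMF.mem_support_pure_iff] at hr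
  obtain ⟨r', hr', rfl⟩ := hr
  exact ⟨r'.1, r'.2, pubStep_of_mem hr', rfl⟩

/-- Record a hash value used in a signature. -/
def Ideal.setEs (s : Ideal pp L J) (j : Fin (J + 1)) (ℓ : Fin L) (h : Star pp) (p : Pub pp) :
    Ideal pp L J :=
  { s with pub := p, es := Function.update s.es j (Function.update (s.es j) ℓ (some h)) }

theorem mem_hashRec {j : Fin (J + 1)} {ℓ : Fin L} {u : Str} {s : Ideal pp L J}
    {r : ℕ × Ideal pp L J} (hr : r ∈ (Ideal.hashRec pp L J y.1 j ℓ u s).support) :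
    ∃ h p, PubStep 2 u h s.pub p ∧ r = (h.1, s.setEs j ℓ h p) := by
  simp only [Ideal.hashRec, PMF.mem_support_bind_iff, PMF.mem_support_pure_iff] at hr
  obtain ⟨r', hr', rfl⟩ := hr
  exact ⟨r'.1, r'.2, pubStep_of_mem hr', rfl⟩

theorem mem_share {j : Fin (J + 1)} {ℓ : Fin L} {s : Ideal pp L J}
    {r : ℕ × Ideal pp L J} (hr : r ∈ (Ideal.share pp L J j ℓ s).support) :
    ∃ h, (∀ h', s.sh j ℓ = some h' → h' = h) ∧ r = (h.1, s.setSh j ℓ h) := by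
  unfold Ideal.share at hr
  cases hsh : s.sh j ℓ with
  | some h =>
    rw [hsh] at hr
    simp only [PMF.mem_support_pure_iff] at hr
    subst hr
    refine ⟨h, fun h' e => (Option.some.inj e).symm, ?_⟩
    unfold Ideal.setSh
    rw [← hsh, Function.update_eq_self, Function.update_eq_self]
  | none =>
    rw [hsh] at hr
    simp only [PMF.mem_support_bind_iff, PMF.mem_support_pure_iff] at hr
    obtain ⟨h, -, rfl⟩ := hr
    exact ⟨h, fun h' e => by simp at e, rfl⟩

theorem mem_signStep {j : Fin (J + 1)} {M : Fin L → Str} {x : ℕ} {acc : ZMod pp.q} {ℓ : Fin L}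
    {s : Ideal pp L J} {r : ZMod pp.q × Ideal pp L J}
    (hr : r ∈ (Ideal.signStep pp L J y.1 j M x acc ℓ s).support) :
    ∃ xl p₁ rl h p₂, PubStep 0 (pp.enc x ++ (ℓ.val + 1).bits) xl s.pub p₁ ∧
      PubStep 2 (M ℓ ++ pp.enc xl.1) h p₁ p₂ ∧
      r = (acc + ((rl.1 : ZMod pp.q) - h.1 * y.1), (s.setSh j ℓ rl).setEs j ℓ h p₂) := by
  unfold Ideal.signStep at hr
  obtain ⟨r₁, h₁, hr⟩ := (mem_support_stateT_bind _ _ _ _).1 hr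
  obtain ⟨r₂, h₂, hr⟩ := (mem_support_stateT_bind _ _ _ _).1 hr
  obtain ⟨r₃, h₃, hr⟩ := (mem_support_stateT_bind _ _ _ _).1 hr
  obtain ⟨xl, p₁, hp₁, rfl⟩ := mem_hash h₁
  obtain ⟨rl, -, rfl⟩ := mem_share h₂
  obtain ⟨h, p₂, hp₂, rfl⟩ := mem_hashRec h₃
  rw [stateT_pure_apply, PMF.mem_support_pure_iff] at hr
  subst hr
  exact ⟨xl, p₁, rl, h, p₂, hp₁, hp₂, by simp [agg]; rfl⟩

/-! ### The records of signatures -/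

/-- The value `e_j^ℓ` has been recorded for the batch `M` and the string `x`. -/
def Cert (s : Ideal pp L J) (j : Fin (J + 1)) (M : Fin L → Str) (x : ℕ) (ℓ : Fin L) : Prop :=
  ∃ xl h : Star pp, (s.pub.T 0).lookup (pp.enc x ++ (ℓ.val + 1).bits) = some xl ∧
    (s.pub.T 2).lookup (M ℓ ++ pp.enc xl.1) = some h ∧ s.es j ℓ = some h

/-- The records of signatures are exactly those with indices in `D`, and belong to the batches and
strings given by `B`. -/
structure CertInv (D : Fin (J + 1) → Finset (Fin L)) (B : Fin (J + 1) → (Fin L → Str) × ℕ)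
    (e : ℕ) (s : Ideal pp L J) : Prop where
  shnone : ∀ j ∉ s.com, ∀ ℓ, s.sh j ℓ = none
  dcom : ∀ j ∉ s.com, D j = ∅
  xnone : ∀ j : Fin (J + 1), e ≤ j → s.xs.lookup j = none
  cert : ∀ j, ∀ ℓ ∈ D j, Cert s j (B j).1 (B j).2 ℓ
  enone : ∀ j, ∀ ℓ ∉ D j, s.es j ℓ = none

theorem CertInv.esnone {D : Fin (J + 1) → Finset (Fin L)} {B : Fin (J + 1) → (Fin L → Str) × ℕ}
    {e : ℕ} {s : Ideal pp L J} (H : CertInv D B e s) {j : Fin (J + 1)} (hj : j ∉ s.com) (ℓ : Fin L) :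
    s.es j ℓ = none := H.enone j ℓ (by simp [H.dcom j hj])

theorem cert_pub {D : Fin (J + 1) → Finset (Fin L)} {B : Fin (J + 1) → (Fin L → Str) × ℕ}
    {e : ℕ} {s : Ideal pp L J} {k : Fin 3} {u : Str} {h : Star pp} {p : Pub pp}
    (H : CertInv D B e s) (hp : PubStep k u h s.pub p) : CertInv D B e { s with pub := p } :=
  ⟨H.shnone, H.dcom, H.xnone, fun j ℓ hℓ => by
    obtain ⟨xl, h, h₁, h₂, h₃⟩ := H.cert j ℓ hℓ
    exact ⟨xl, h, hp.persist h₁, hp.persist h₂, h₃⟩, H.enone⟩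

theorem cert_hash (D : Fin (J + 1) → Finset (Fin L)) (B : Fin (J + 1) → (Fin L → Str) × ℕ)
    (e : ℕ) (k : Fin 3) (u : Str) :
    Preserves (CertInv D B e) (Ideal.hash pp L J y.1 k u) := by
  intro s hs r hr
  obtain ⟨h, p, hp, rfl⟩ := mem_hash hr
  exact cert_pub hs hp

theorem cert_setSh {D : Fin (J + 1) → Finset (Fin L)} {B : Fin (J + 1) → (Fin L → Str) × ℕ}
    {e : ℕ} {s : Ideal pp L J} (H : CertInv D B e s) {j : Fin (J + 1)} (hj : j ∈ s.com)
    (ℓ : Fin L) (h : Star pp) : CertInv D B e (s.setSh j ℓ h) :=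
  ⟨fun j' hj' ℓ' => by
    have : j' ≠ j := fun e => hj' (e ▸ hj)
    simp [Ideal.setSh, this, H.shnone j' hj' ℓ'], H.dcom, H.xnone, H.cert, H.enone⟩

theorem cert_touch {D : Fin (J + 1) → Finset (Fin L)} {B : Fin (J + 1) → (Fin L → Str) × ℕ}
    {e : ℕ} {s : Ideal pp L J} (H : CertInv D B e s) (j : Fin (J + 1)) :
    CertInv D B e { s with com := insert j s.com } :=
  ⟨fun j' hj' => H.shnone j' fun h => hj' (Finset.mem_insert_of_mem h),
    fun j' hj' => H.dcom j' fun h => hj' (Finset.mem_insert_of_mem h), H.xnone, H.cert, H.enone⟩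

theorem cert_comShares (D : Fin (J + 1) → Finset (Fin L)) (B : Fin (J + 1) → (Fin L → Str) × ℕ)
    (e : ℕ) (j : Fin (J + 1)) :
    Preserves (fun s => CertInv D B e s ∧ j ∈ s.com) (Ideal.comShares pp L J j) :=
  Preserves.foldlM _ (fun _ ℓ _ => Preserves.bind (fun s hs r hr => by
    obtain ⟨h, -, rfl⟩ := mem_share hr
    exact ⟨cert_setSh hs.1 hs.2 ℓ h, hs.2⟩) fun _ => Preserves.pure _) _

theorem cert_comId (D : Fin (J + 1) → Finset (Fin L)) (B : Fin (J + 1) → (Fin L → Str) × ℕ)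
    (e : ℕ) (j : Fin (J + 1)) :
    Preserves (CertInv D B e) (Ideal.comId pp L J j) := by
  intro s hs r hr
  unfold Ideal.comId at hr
  obtain ⟨r₁, h₁, hr⟩ := (mem_support_stateT_bind _ _ _ _).1 hr
  obtain ⟨r₂, h₂, hr⟩ := (mem_support_stateT_bind _ _ _ _).1 hr
  rw [stateT_pure_apply, PMF.mem_support_pure_iff] at hr
  subst hr
  simp only [Ideal.touch, PMF.mem_support_pure_iff] at h₁
  subst h₁
  exact (cert_comShares D B e j _ ⟨cert_touch hs j, Finset.mem_insert_self _ _⟩ _ h₂).1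

/-- Earlier certificates survive since the ideal oracles never change a recorded value, and the step
creates precisely the certificate for `ℓ`. -/
theorem cert_signStep {D : Fin (J + 1) → Finset (Fin L)} {B : Fin (J + 1) → (Fin L → Str) × ℕ}
    {e : ℕ} {s : Ideal pp L J} (H : CertInv D B e s) {j : Fin (J + 1)} (hj : j ∈ s.com)
    {acc : ZMod pp.q} {ℓ : Fin L} {r : ZMod pp.q × Ideal pp L J}
    (hr : r ∈ (Ideal.signStep pp L J y.1 j (B j).1 (B j).2 acc ℓ s).support) :
    CertInv (Function.update D j (insert ℓ (D j))) B e r.2 ∧ j ∈ r.2.com := by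
  obtain ⟨xl, p₁, rl, h, p₂, h₁, h₂, rfl⟩ := mem_signStep hr
  have H₁ := cert_setSh (cert_pub (cert_pub H h₁) h₂) hj ℓ rl
  refine ⟨⟨H₁.shnone, fun j' hj' => ?_, H₁.xnone, fun j' ℓ' hℓ' => ?_, fun j' ℓ' hℓ' => ?_⟩, hj⟩
  · have : j' ≠ j := fun e => hj' (e ▸ hj)
    simpa [this] using H₁.dcom j' hj'
  · by_cases e₁ : j' = j ∧ ℓ' = ℓ
    · obtain ⟨rfl, rfl⟩ := e₁
      exact ⟨xl, h, h₂.persist h₁.here, h₂.here, by simp [Ideal.setEs]⟩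
    · have hm : ℓ' ∈ D j' := by
        by_cases e₂ : j' = j
        · subst e₂
          simp only [Function.update_self, Finset.mem_insert] at hℓ'
          exact hℓ'.resolve_left fun e => e₁ ⟨rfl, e⟩
        · simpa [e₂] using hℓ'
      obtain ⟨xl', h', a, b, c⟩ := H₁.cert j' ℓ' hm
      refine ⟨xl', h', a, b, ?_⟩
      refine Eq.trans ?_ c
      by_cases e₂ : j' = j
      · subst e₂
        have : ℓ' ≠ ℓ := fun e => e₁ ⟨rfl, e⟩
        simp [Ideal.setEs, Ideal.setSh, this]
      · simp [Ideal.setEs, Ideal.setSh, e₂]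
  · by_cases e₂ : j' = j
    · subst e₂
      simp only [Function.update_self, Finset.mem_insert, not_or] at hℓ'
      simpa [Ideal.setEs, Ideal.setSh, hℓ'.1] using H.enone j' ℓ' hℓ'.2
    · rw [Function.update_of_ne e₂] at hℓ'
      simpa [Ideal.setEs, Ideal.setSh, e₂] using H.enone j' ℓ' hℓ'

theorem cert_signFold {B : Fin (J + 1) → (Fin L → Str) × ℕ} {e : ℕ} {j : Fin (J + 1)}
    (l : List (Fin L)) : ∀ {D : Fin (J + 1) → Finset (Fin L)} {s : Ideal pp L J},
      CertInv D B e s → j ∈ s.com → ∀ {acc : ZMod pp.q} {r : ZMod pp.q × Ideal pp L J},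
      r ∈ (l.foldlM (Ideal.signStep pp L J y.1 j (B j).1 (B j).2) acc s).support →
      CertInv (Function.update D j (D j ∪ l.toFinset)) B e r.2 := by
  induction l with
  | nil =>
    intro D s H hj acc r hr
    rw [List.foldlM_nil, stateT_pure_apply, PMF.mem_support_pure_iff] at hr
    subst hr
    simpa using H
  | cons ℓ l ih =>
    intro D s H hj acc r hr
    rw [List.foldlM_cons] at hr
    obtain ⟨r₁, h₁, hr⟩ := (mem_support_stateT_bind _ _ _ _).1 hr
    obtain ⟨H₁, hj₁⟩ := cert_signStep H hj h₁
    have := ih H₁ hj₁ hr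
    simpa [Finset.insert_union, Finset.union_insert] using this

end IdealSim

section IdealSim

variable {pp : GroupParams} {L J κ : ℕ} {y : Star pp} {δ : ℕ → ℝ≥0∞}

/-! ### Signatures -/

theorem simAvg_congr {f g : SimState pp L J → ℝ≥0∞} {s : Ideal pp L J}
    (h : ∀ ω, f (s.img y ω) = g (s.img y ω)) : simAvg y f s = simAvg y g s := by
  unfold simAvg
  simp only [h]

theorem simΦ_congr {f g : SimState pp L J → ℝ≥0∞} {s : Ideal pp L J}
    (h : ∀ ω, f (s.img y ω) = g (s.img y ω)) : simΦ y δ f s = simΦ y δ g s := by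
  by_cases hs : Good L s.pub
  · rw [simΦ_good hs, simΦ_good hs, simAvg_congr h]
  · rw [simΦ_bad hs, simΦ_bad hs]

theorem ex_hashRec (j : Fin (J + 1)) (ℓ : Fin L) (u : Str) (s : Ideal pp L J)
    (f : ℕ × Ideal pp L J → ℝ≥0∞) :
    ex (Ideal.hashRec pp L J y.1 j ℓ u s) f = match (s.pub.T 2).lookup u with
      | some h => f (h.1, s.setEs j ℓ h s.pub)
      | none => ex (unif pp) fun h => f (h.1, s.setEs j ℓ h (s.pub.add 2 u h)) := by
  have hc : s.pub.check (pp.α ^ y.1) 2 u = s.pub := check_eq_self (by simp)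
  simp only [Ideal.hashRec, ex_bind, ex_pure, ex_pubH, hc]
  cases (s.pub.T 2).lookup u <;> rfl

/-- Program the value `e_j^ℓ` of a simulated signature at a point of `H_2`. -/
def SimState.prog (g : SimState pp L J) (j : Fin (J + 1)) (ℓ : Fin L) (u : Str) :
    SimState pp L J := { g with pub := g.pub.add 2 u (((g.memo j).getD default).1 ℓ) }

/-- Recording a fresh hash value as `e_j^ℓ` in the ideal game amounts to putting it into the
completion and then programming `H_2` with it. -/
theorem img_setEs {s : Ideal pp L J} {j : Fin (J + 1)} {ℓ : Fin L} (hj : j ∈ s.com)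
    (hes : s.es j ℓ = none) (u : Str) (h : Star pp) (e r : Rows pp L J) :
    (s.setEs j ℓ h (s.pub.add 2 u h)).img y (e, r) =
      (s.img y (Function.update e j (Function.update (e j) ℓ h), r)).prog j ℓ u := by
  have : ∀ j', (s.setEs j ℓ h (s.pub.add 2 u h)).evec e j' =
      s.evec (Function.update e j (Function.update (e j) ℓ h)) j' := by
    intro j'
    funext ℓ'
    unfold Ideal.evec
    by_cases hj : j' = j
    · subst hj
      by_cases hℓ : ℓ' = ℓ
      · subst hℓ; simp [hes, Ideal.setEs]
      · simp [hℓ, Ideal.setEs]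
    · simp [hj, Ideal.setEs]
  unfold SimState.prog Ideal.img Ideal.sval
  simp only [this, if_pos hj]
  simp [Ideal.setEs, Ideal.evec, hes]
  rfl

/-- At an unasked point a value chosen in advance is as good as a fresh one: entry `(j, ℓ)` of the
completion is still uniform, and resampling it is the draw of the ideal game. Only the possible loss
of `Good` costs something. -/
theorem sim_hashRec (hκ : 2 ^ κ ≤ pp.q) (hδ : SimError κ L δ) {j : Fin (J + 1)} {ℓ : Fin L}
    {u : Str} {s : Ideal pp L J} (hj : j ∈ s.com) (hes : s.es j ℓ = none)
    (hu : (s.pub.T 2).lookup u = none) (f : SimState pp L J → ℝ≥0∞) (hf : ∀ g, f g ≤ 1) :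
    simΦ y δ (fun g => f (g.prog j ℓ u)) s ≤
      ex (Ideal.hashRec pp L J y.1 j ℓ u s) fun r => simΦ y δ f r.2 := by
  refine simΦ_le s (fun hs => ?_)
    (pot_le_ex (fun n => (sizeMono_opClosed (y := y) n).hashRec j ℓ u) (fun _ => f) s)
  rw [ex_hashRec, hu]
  simp only
  have e : simAvg y (fun g => f (g.prog j ℓ u)) s =
      ex (unif pp) fun h => simAvg y f (s.setEs j ℓ h (s.pub.add 2 u h)) := by
    unfold simAvg
    rw [ex_comm (unif pp), ex_entry j ℓ]
    refine congrArg _ (funext fun e => congrArg _ (funext fun h => ?_))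
    simp only [img_setEs hj hes]
  rw [e]
  have hw : ∀ h, (s.setEs j ℓ h (s.pub.add 2 u h)).size = s.size + 1 := fun h => by
    have : (s.setEs j ℓ h (s.pub.add 2 u h)).size =
      (s.pub.add 2 u h).size + s.com.card + s.xs.length := rfl
    rw [this, size_add, Ideal.size_eq]; omega
  refine ex_bad_le (fun h => simAvg_le_one hf _)
    (ex_not_good_le_error hκ hδ hs 2 (u := u) (n := s.size) (by rw [Ideal.size_eq]; omega))
    (pot_add_le δ (Nat.lt_succ_self s.size)) (fun h hb => ?_) fun h => ?_
  · have hs' : Good L (s.setEs j ℓ h (s.pub.add 2 u h)).pub := not_not.1 hb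
    rw [simΦ_good hs', hw]
  · refine le_trans ?_ (pot_le_simΦ _ _)
    rw [hw]

theorem ex_sim_signStep (j : Fin (J + 1)) (M : Fin L → Str) (x : ℕ) (ℓ : Fin L)
    (g : SimState pp L J) (f : SimState pp L J → ℝ≥0∞) :
    ex (SimState.signStep pp L J (pp.α ^ y.1) j M x () ℓ g) (fun r => f r.2) =
      ex (SimState.hash pp L J (pp.α ^ y.1) 0 (pp.enc x ++ (ℓ.val + 1).bits) g) fun r =>
        f (r.2.prog j ℓ (M ℓ ++ pp.enc r.1)) := by
  unfold SimState.signStep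
  rw [ex_stateT_bind]
  refine congrArg _ (funext fun r => ?_)
  unfold SimState.program
  rw [ex_pure]
  rfl

/-- A fresh value makes a point of `H_2` known with small probability. -/
theorem ex_known_le (hκ : 2 ^ κ ≤ pp.q) (p : Pub pp) (m : Str) :
    ex (unif pp) (fun h => ind ((p.T 2).lookup (m ++ pp.enc h.1) ≠ none)) ≤ p.size * eta κ := by
  classical
  refine ex_unif_mem_le hκ _ p.dom _ p.card_dom_le
    (fun u => if h : ∃ h : Star pp, u = m ++ pp.enc h.1 then h.choose else default) ?_
  intro h hh
  refine ⟨_, Pub.mem_dom hh, ?_⟩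
  have hex : ∃ h' : Star pp, m ++ pp.enc h.1 = m ++ pp.enc h'.1 := ⟨h, rfl⟩
  rw [dif_pos hex]
  exact Subtype.ext (pp.append_enc_inj (star_lt h) (star_lt _) hex.choose_spec).2.symm

/-- Two accidents are possible when `x_j^ℓ` is drawn: it may collide with an earlier value of `H_0`,
or the point `m^ℓ ‖ x_j^ℓ` may already have a value under `H_2`, which programming would contradict.
Together they account for the factor 2 in `SimError.points`. -/
theorem sim_signStep (hκ : 2 ^ κ ≤ pp.q) (hδ : SimError κ L δ) {j : Fin (J + 1)}
    {M : Fin L → Str} {x : ℕ} {ℓ : Fin L} {s : Ideal pp L J} (acc : ZMod pp.q) (hj : j ∈ s.com)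
    (hes : s.es j ℓ = none) (hu : (s.pub.T 0).lookup (pp.enc x ++ (ℓ.val + 1).bits) = none)
    (f : SimState pp L J → ℝ≥0∞) (hf : ∀ g, f g ≤ 1) :
    simΦ y δ (fun g => ex (SimState.signStep pp L J (pp.α ^ y.1) j M x () ℓ g) fun r => f r.2) s ≤
      ex (Ideal.signStep pp L J y.1 j M x acc ℓ s) fun r => simΦ y δ f r.2 := by
  simp only [ex_sim_signStep]
  refine simΦ_le s (fun hs => ?_)
    (pot_le_ex (fun n => (sizeMono_opClosed (y := y) n).signStep j M x acc ℓ) (fun _ => f) s)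
  unfold Ideal.signStep
  rw [ex_stateT_bind, ex_ideal_hash, hu]
  simp only
  set u := pp.enc x ++ (ℓ.val + 1).bits with hu_def
  set p : Star pp → Pub pp := fun h => (s.pub.check (pp.α ^ y.1) 0 u).add 0 u h with hp
  have e : simAvg y (fun g => ex (SimState.hash pp L J (pp.α ^ y.1) 0 u g) fun r =>
      f (r.2.prog j ℓ (M ℓ ++ pp.enc r.1))) s =
      ex (unif pp) fun h => simAvg y (fun g => f (g.prog j ℓ (M ℓ ++ pp.enc h.1)))
        { s with pub := p h } := by
    unfold simAvg
    rw [ex_comm (unif pp)]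
    refine congrArg _ (funext fun e => ?_)
    rw [ex_comm (unif pp)]
    refine congrArg _ (funext fun r => ?_)
    dsimp only
    rw [ex_sim_hash]
    have : ((s.img y (e, r)).pub.T 0).lookup u = none := hu
    rw [this]
    rfl
  rw [e]
  have hw : ∀ h, Ideal.size { s with pub := p h } = s.size + 1 := fun h => by
    rw [size_pub, size_add, size_check, Ideal.size_eq]; omega
  have hs' : Good L (s.pub.check (pp.α ^ y.1) 0 u) := (good_check _ _ _ _).2 hs
  have hsz : s.pub.size ≤ s.size := by rw [Ideal.size_eq]; omega
  have rest : ∀ (h : Star pp) n, Preserves (fun s : Ideal pp L J => n ≤ s.size) (do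
      let rl ← Ideal.share pp L J j ℓ
      let el ← Ideal.hashRec pp L J y.1 j ℓ (M ℓ ++ pp.enc h.1)
      pure (agg pp [acc, (rl : ZMod pp.q) - (el : ZMod pp.q) * (y.1 : ZMod pp.q)])) := fun h n =>
    ((sizeMono_opClosed (y := y) n).share _ _).bind fun _ => ((sizeMono_opClosed (y := y) n).hashRec _ _ _).bind
      fun _ => Preserves.pure _
  refine ex_bad_le (bad := fun h => ¬ Good L (p h) ∨
    ((p h).T 2).lookup (M ℓ ++ pp.enc h.1) ≠ none) (d := δ s.size)
    (fun h => simAvg_le_one (fun g => hf _) _) ?_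
    (pot_add_le δ (Nat.lt_succ_self s.size)) (fun h hb => ?_) fun h => ?_
  · refine (ex_mono fun h => ind_or_le _ _).trans ?_
    rw [ex_add]
    have h₁ := (ex_not_good_le hκ hs' 0 (u := u)).1 (by decide)
    have h₂ := ex_known_le hκ s.pub (M ℓ)
    have h₃ : ∀ h, ((p h).T 2) = s.pub.T 2 := fun h => by simp [hp, Pub.add]
    simp only [h₃]
    refine (add_le_add h₁ h₂).trans (le_trans ?_ (hδ.points s.size))
    rw [size_check, two_mul]
    gcongr <;> omega
  · push Not at hb
    have hg : Good L (Ideal.pub { s with pub := p h }) := hb.1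
    rw [Nat.succ_eq_add_one, ← hw h, ← simΦ_good (δ := δ) hg, ex_stateT_bind]
    refine (sim_share j ℓ _ _).trans (ex_mono_support fun r hr => ?_)
    obtain ⟨rl, -, rfl⟩ := mem_share hr
    rw [ex_stateT_bind]
    refine (sim_hashRec (s := Ideal.setSh { s with pub := p h } j ℓ rl) hκ hδ hj hes hb.2 f
      hf).trans (ex_mono fun r => ?_)
    rw [ex_stateT_pure]
  · rw [Nat.succ_eq_add_one, ← hw h]
    exact pot_le_ex (rest h) (fun _ => f) { s with pub := p h }

/-- The induction runs over the messages still to be signed, with `acc` equal to the contribution of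
those already treated. When none is left, `acc` has become the component `s` that the simulation
fixed with the commitment, which explains why the left-hand side reads it from `memo`. -/
theorem sim_signFold (hκ : 2 ^ κ ≤ pp.q) (hδ : SimError κ L δ) {j : Fin (J + 1)}
    {M : Fin L → Str} {x : ℕ} (l : List (Fin L)) : ∀ (s : Ideal pp L J) (acc : ZMod pp.q),
      l.Nodup → j ∈ s.com → (∀ ℓ ∈ l, s.es j ℓ = none) →
      (∀ ℓ ∈ l, (s.pub.T 0).lookup (pp.enc x ++ (ℓ.val + 1).bits) = none) →
      (∀ ℓ ∉ l, s.sh j ℓ ≠ none ∧ s.es j ℓ ≠ none) →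
      acc = ∑ ℓ ∈ Finset.univ.filter (· ∉ l), ((((s.sh j ℓ).getD default).1 : ZMod pp.q) -
        ((s.es j ℓ).getD default).1 * y.1) →
      ∀ f : ZMod pp.q → SimState pp L J → ℝ≥0∞, (∀ a g, f a g ≤ 1) →
      simΦ y δ (fun g => ex (l.foldlM (SimState.signStep pp L J (pp.α ^ y.1) j M x) () g) fun r =>
        f ((r.2.memo j).getD default).2 r.2) s ≤
      ex (l.foldlM (Ideal.signStep pp L J y.1 j M x) acc s) fun r => simΦ y δ (f r.1) r.2 := by
  induction l with
  | nil =>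
    intro s acc _ hj _ _ hdone hacc f _
    simp only [List.foldlM_nil, ex_stateT_pure]
    refine (simΦ_congr fun ω => ?_).le
    have : (s.img y ω).memo j = some (s.evec ω.1 j, s.sval y ω.1 ω.2 j) := if_pos hj
    rw [this]
    congr 1
    rw [hacc]
    simp only [Option.getD_some, Ideal.sval, SimState.esum, Ideal.evec, List.not_mem_nil,
      not_false_eq_true, Finset.filter_true, Finset.mul_sum, ← Finset.sum_sub_distrib]
    refine Finset.sum_congr rfl fun ℓ _ => ?_
    obtain ⟨h₁, h₂⟩ := hdone ℓ (by simp)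
    obtain ⟨a, ha⟩ := Option.ne_none_iff_exists'.1 h₁
    obtain ⟨b, hb⟩ := Option.ne_none_iff_exists'.1 h₂
    simp [ha, hb, mul_comm]
  | cons ℓ l ih =>
    intro s acc hl hj htodo hfresh hdone hacc f hf
    obtain ⟨hℓ, hl⟩ := List.nodup_cons.1 hl
    simp only [List.foldlM_cons, ex_stateT_bind]
    refine (sim_signStep hκ hδ acc hj (htodo ℓ List.mem_cons_self)
      (hfresh ℓ List.mem_cons_self) (fun g =>
        ex (l.foldlM (SimState.signStep pp L J (pp.α ^ y.1) j M x) () g) fun r =>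
        f ((r.2.memo j).getD default).2 r.2) fun g => ex_le_of_le fun r => hf _ _).trans
      (ex_mono_support fun r hr => ?_)
    obtain ⟨xl, p₁, rl, h, p₂, h₁, h₂, rfl⟩ := mem_signStep hr
    have hne : ∀ {ℓ'}, ℓ' ∈ l → ℓ' ≠ ℓ := fun h e => hℓ (e ▸ h)
    have sh_ne : ∀ {ℓ'}, ℓ' ≠ ℓ → ((s.setSh j ℓ rl).setEs j ℓ h p₂).sh j ℓ' = s.sh j ℓ' :=
      fun h => by simp [Ideal.setSh, Ideal.setEs, h]
    have es_ne : ∀ {ℓ'}, ℓ' ≠ ℓ → ((s.setSh j ℓ rl).setEs j ℓ h p₂).es j ℓ' = s.es j ℓ' :=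
      fun h => by simp [Ideal.setSh, Ideal.setEs, h]
    have sh_eq : ((s.setSh j ℓ rl).setEs j ℓ h p₂).sh j ℓ = some rl := by
      simp [Ideal.setSh, Ideal.setEs]
    have es_eq : ((s.setSh j ℓ rl).setEs j ℓ h p₂).es j ℓ = some h := by
      simp [Ideal.setEs]
    dsimp only
    refine ih ((s.setSh j ℓ rl).setEs j ℓ h p₂) _ hl hj (fun ℓ' hℓ' => ?_) (fun ℓ' hℓ' => ?_) (fun ℓ' hℓ' => ?_) ?_ f hf
    · rw [es_ne (hne hℓ')]
      exact htodo ℓ' (List.mem_cons_of_mem _ hℓ')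
    · have e₁ : (p₂.T 0).lookup (pp.enc x ++ (ℓ'.val + 1).bits) = none := by
        rw [h₂.other _ _ (by simp), h₁.other _ _ ?_]
        · exact hfresh ℓ' (List.mem_cons_of_mem _ hℓ')
        · rintro ⟨-, e⟩
          have := bits_injective (List.append_cancel_left e)
          exact hne hℓ' (Fin.ext (by omega))
      exact e₁
    · by_cases e : ℓ' = ℓ
      · subst e; rw [sh_eq, es_eq]; simp
      · rw [sh_ne e, es_ne e]
        exact hdone ℓ' (by simp [e, hℓ'])
    · have : Finset.univ.filter (fun ℓ' : Fin L => ℓ' ∉ l) =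
          insert ℓ (Finset.univ.filter fun ℓ' => ℓ' ∉ ℓ :: l) := by
        ext ℓ'
        by_cases e : ℓ' = ℓ
        · subst e; simp [hℓ]
        · simp [e]
      rw [this, Finset.sum_insert (by simp), sh_eq, es_eq, hacc, add_comm]
      congr 1
      refine Finset.sum_congr rfl fun ℓ' hℓ' => ?_
      have e : ℓ' ≠ ℓ := fun e => by simp [e] at hℓ'
      rw [sh_ne e, es_ne e]

theorem ex_getX (j : Fin (J + 1)) (s : Ideal pp L J) (hx : s.xs.lookup j = none)
    (f : ℕ × Ideal pp L J → ℝ≥0∞) :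
    ex (Ideal.getX pp L J j s) f =
      ex (unif pp) fun h => f (h.1, { s with xs := (j, h) :: s.xs }) := by
  unfold Ideal.getX
  rw [hx]
  simp

/-- A fresh string is a prefix of a point with small probability. -/
theorem ex_prefix_le (hκ : 2 ^ κ ≤ pp.q) (p : Pub pp) :
    ex (unif pp) (fun h => ind (∃ u, (p.T 0).lookup (pp.enc h.1 ++ u) ≠ none)) ≤
      p.size * eta κ := by
  classical
  refine ex_unif_mem_le hκ _ ((p.T 0).map Prod.fst).toFinset _
    ((List.toFinset_card_le _).trans (by simpa using length_le_size p 0))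
    (fun v => if h : ∃ h : Star pp, v.take pp.q.size = pp.enc h.1 then h.choose else default) ?_
  rintro h ⟨u, hu⟩
  obtain ⟨z, hz, e⟩ := mem_keys_of_lookup hu
  refine ⟨z.1, List.mem_toFinset.2 (List.mem_map_of_mem hz), ?_⟩
  have ez : z.1.take pp.q.size = pp.enc h.1 := by rw [e]; simp
  have hex : ∃ h' : Star pp, z.1.take pp.q.size = pp.enc h'.1 := ⟨h, ez⟩
  rw [dif_pos hex]
  exact Subtype.ext (pp.enc_inj (star_lt _) (star_lt h) (hex.choose_spec.symm.trans ez))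

/-- The new string `x_j` is with high probability not a prefix of any recorded point of `H_0`. All
points `x_j ‖ ℓ` are then unasked, as `sim_signFold` requires. -/
theorem sim_sign (hκ : 2 ^ κ ≤ pp.q) (hL : 1 ≤ L) (hδ : SimError κ L δ) (j : Fin (J + 1))
    (M : Fin L → Str) (s : Ideal pp L J) (hx : s.xs.lookup j = none)
    (hsh : j ∉ s.com → ∀ ℓ, s.sh j ℓ = none) (hes : ∀ ℓ, s.es j ℓ = none) :
    SimAt y δ s (SimState.sign pp L J (pp.α ^ y.1) j M) (Ideal.sign pp L J y.1 j M) := by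
  intro f hf
  refine simΦ_le s (fun hs => ?_)
    (pot_le_ex (fun n => (sizeMono_opClosed (y := y) n).sign j M) f s)
  unfold Ideal.sign
  rw [ex_stateT_bind, ex_getX j s hx]
  set rest : ℕ → StateT (SimState pp L J) PMF (ZMod pp.q × ℕ) := fun x => do
    SimState.touch pp L J j
    (List.finRange L).foldlM (SimState.signStep pp L J (pp.α ^ y.1) j M x) ()
    let v ← SimState.read pp L J j
    pure (v.2, x) with hrest
  have e : simAvg y (fun g => ex (SimState.sign pp L J (pp.α ^ y.1) j M g) fun r => f r.1 r.2) s =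
      ex (unif pp) fun h => simAvg y (fun g => ex (rest h.1 g) fun r => f r.1 r.2)
        { s with xs := (j, h) :: s.xs } := by
    unfold simAvg
    rw [ex_comm (unif pp)]
    refine congrArg _ (funext fun e => ?_)
    rw [ex_comm (unif pp)]
    refine congrArg _ (funext fun r => ?_)
    unfold SimState.sign
    dsimp only
    rw [ex_stateT_bind, ex_bind]
    simp only [ex_pure]
    rfl
  rw [e]
  have hw : ∀ h, Ideal.size { s with xs := (j, h) :: s.xs } = s.size + 1 := fun h => by
    simp only [Ideal.size_eq, List.length_cons]; omega
  have restMono : ∀ (h : Star pp) n, Preserves (fun s : Ideal pp L J => n ≤ s.size) (do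
      Ideal.touch pp L J j
      let s ← (List.finRange L).foldlM (Ideal.signStep pp L J y.1 j M h.1) 0
      pure (s, h.1)) := fun h n =>
    ((sizeMono_opClosed (y := y) n).touch _).bind fun _ => (Preserves.foldlM _ (fun _ _ _ =>
      (sizeMono_opClosed n).signStep _ _ _ _ _) _).bind fun _ => Preserves.pure _
  refine ex_bad_le (bad := fun h => ∃ u, (s.pub.T 0).lookup (pp.enc h.1 ++ u) ≠ none)
    (d := δ s.size) (fun h => simAvg_le_one (fun g => ex_le_of_le fun r => hf _ _) _) ?_
    (pot_add_le δ (Nat.lt_succ_self s.size)) (fun h hb => ?_) fun h => ?_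
  · refine (ex_prefix_le hκ s.pub).trans (le_trans ?_ (hδ.points s.size))
    refine le_trans ?_ (le_mul_of_one_le_left (by simp) (by norm_num))
    gcongr
    have : s.pub.size ≤ s.size := by rw [Ideal.size_eq]; omega
    omega
  · push Not at hb
    have hg : Good L (Ideal.pub { s with xs := (j, h) :: s.xs }) := hs
    rw [Nat.succ_eq_add_one, ← hw h, ← simΦ_good (δ := δ) hg]
    simp only [hrest, ex_stateT_bind]
    refine (sim_touch hκ hL hδ j { s with xs := (j, h) :: s.xs } hsh (fun _ => hes) (fun _ g =>
      ex (((List.finRange L).foldlM (SimState.signStep pp L J (pp.α ^ y.1) j M h.1) () :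
        StateT (SimState pp L J) PMF Unit) g) fun r =>
        ex (SimState.read pp L J j r.2) fun r => ex ((pure (r.1.2, h.1) :
          StateT (SimState pp L J) PMF (ZMod pp.q × ℕ)) r.2) fun r => f r.1 r.2)
      fun _ _ => ex_le_of_le fun _ => ex_le_of_le fun _ => ex_le_of_le fun _ => hf _ _).trans
      (ex_mono_support fun r hr => ?_)
    simp only [Ideal.touch, PMF.mem_support_pure_iff] at hr
    subst hr
    have := sim_signFold hκ hδ (M := M) (x := h.1) (List.finRange L)
      { s with xs := (j, h) :: s.xs, com := insert j s.com } 0 (y := y) (δ := δ) (j := j)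
      (List.nodup_finRange L) (Finset.mem_insert_self _ _) (fun ℓ _ => hes ℓ)
      (fun ℓ _ => hb _) (fun ℓ hℓ => absurd (List.mem_finRange ℓ) hℓ) (by simp)
      (fun a g => f (a, h.1) g) fun _ _ => hf _ _
    simpa only [SimState.read, ex_pure, ex_stateT_pure] using this
  · rw [Nat.succ_eq_add_one, ← hw h]
    exact pot_le_ex (restMono h) f { s with xs := (j, h) :: s.xs }

end IdealSim

section IdealSim

variable {pp : GroupParams} {L J κ : ℕ} {y : Star pp} {δ : ℕ → ℝ≥0∞}

/-! ### Forgeries -/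

theorem mem_comShares {j : Fin (J + 1)} (l : List (Fin L)) : ∀ (s : Ideal pp L J)
    (acc : ZMod pp.q), ∀ r ∈ ((l.foldlM (fun (acc : ZMod pp.q) ℓ => do
      let rl ← Ideal.share pp L J j ℓ
      pure (acc + (rl : ZMod pp.q))) acc : StateT (Ideal pp L J) PMF (ZMod pp.q)) s).support,
    (∀ ℓ h, s.sh j ℓ = some h → r.2.sh j ℓ = some h) ∧ (∀ ℓ ∈ l, r.2.sh j ℓ ≠ none) ∧
      r.1 = acc + (l.map fun ℓ => (((r.2.sh j ℓ).getD default).1 : ZMod pp.q)).sum := by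
  induction l with
  | nil =>
    intro s acc r hr
    rw [List.foldlM_nil, stateT_pure_apply, PMF.mem_support_pure_iff] at hr
    subst hr
    simp
  | cons ℓ l ih =>
    intro s acc r hr
    rw [List.foldlM_cons] at hr
    obtain ⟨r₁, h₁, hr⟩ := (mem_support_stateT_bind _ _ _ _).1 hr
    obtain ⟨r₂, h₂, h₁⟩ := (mem_support_stateT_bind _ _ _ _).1 h₁
    rw [stateT_pure_apply, PMF.mem_support_pure_iff] at h₁
    subst h₁
    obtain ⟨h, hold, rfl⟩ := mem_share h₂
    obtain ⟨i₁, i₂, i₃⟩ := ih _ _ r hr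
    have hℓ : r.2.sh j ℓ = some h := i₁ ℓ h (by simp [Ideal.setSh])
    refine ⟨fun ℓ' h' e => ?_, fun ℓ' hℓ' => ?_, ?_⟩
    · by_cases e' : ℓ' = ℓ
      · subst e'; rw [hℓ, hold h' e]
      · exact i₁ ℓ' h' (by simpa [Ideal.setSh, e'] using e)
    · rcases List.mem_cons.1 hℓ' with rfl | h'
      · simp [hℓ]
      · exact i₂ ℓ' h'
    · rw [i₃, List.map_cons, List.sum_cons, hℓ]
      simp [add_assoc]

theorem mem_verSum {M : Fin L → Str} {x : ℕ} (l : List (Fin L)) : ∀ (s : Ideal pp L J)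
    (acc : ZMod pp.q), l.Nodup → ∀ r ∈ ((l.foldlM (fun (acc : ZMod pp.q) ℓ => do
      let xl ← Ideal.hash pp L J y.1 0 (pp.enc x ++ (ℓ.val + 1).bits)
      let el ← Ideal.hash pp L J y.1 2 (M ℓ ++ pp.enc xl)
      pure (acc + (el : ZMod pp.q))) acc : StateT (Ideal pp L J) PMF (ZMod pp.q)) s).support,
    ∃ p, ∃ xl el : Fin L → Star pp, r.2 = { s with pub := p } ∧
      (∀ k u h, (s.pub.T k).lookup u = some h → (p.T k).lookup u = some h) ∧
      (∀ ℓ ∈ l, (p.T 0).lookup (pp.enc x ++ (ℓ.val + 1).bits) = some (xl ℓ) ∧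
        (p.T 2).lookup (M ℓ ++ pp.enc (xl ℓ).1) = some (el ℓ)) ∧
      r.1 = acc + (l.map fun ℓ => ((el ℓ).1 : ZMod pp.q)).sum := by
  induction l with
  | nil =>
    intro s acc _ r hr
    rw [List.foldlM_nil, stateT_pure_apply, PMF.mem_support_pure_iff] at hr
    subst hr
    exact ⟨s.pub, default, default, rfl, fun _ _ _ h => h, by simp, by simp⟩
  | cons ℓ l ih =>
    intro s acc hl r hr
    obtain ⟨hℓ, hl⟩ := List.nodup_cons.1 hl
    rw [List.foldlM_cons] at hr
    obtain ⟨r₁, h₁, hr⟩ := (mem_support_stateT_bind _ _ _ _).1 hr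
    obtain ⟨r₂, h₂, h₁⟩ := (mem_support_stateT_bind _ _ _ _).1 h₁
    obtain ⟨r₃, h₃, h₁⟩ := (mem_support_stateT_bind _ _ _ _).1 h₁
    rw [stateT_pure_apply, PMF.mem_support_pure_iff] at h₁
    subst h₁
    obtain ⟨a, p₁, hp₁, rfl⟩ := mem_hash h₂
    obtain ⟨b, p₂, hp₂, rfl⟩ := mem_hash h₃
    obtain ⟨p, xl, el, i₁, i₂, i₃, i₄⟩ := ih _ _ hl r hr
    refine ⟨p, Function.update xl ℓ a, Function.update el ℓ b, i₁,
      fun k u h e => i₂ k u h (hp₂.persist (hp₁.persist e)), fun ℓ' hℓ' => ?_, ?_⟩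
    · by_cases e : ℓ' = ℓ
      · subst e
        simp only [Function.update_self]
        exact ⟨i₂ _ _ _ (hp₂.persist hp₁.here), i₂ _ _ _ hp₂.here⟩
      · simp only [Function.update_of_ne e]
        exact i₃ ℓ' ((List.mem_cons.1 hℓ').resolve_left e)
    · rw [i₄, List.map_cons, List.sum_cons, Function.update_self, add_assoc]
      congr 3
      refine List.map_congr_left fun ℓ' hℓ' => ?_
      rw [Function.update_of_ne (show ℓ' ≠ ℓ from fun e => hℓ (e ▸ hℓ'))]

theorem cast_pow_eq_iff {a : ZMod pp.q} {n : ℕ} : pp.α ^ a.val = pp.α ^ n ↔ a = n := by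
  rw [pp.pow_eq_pow_iff, ZMod.natCast_zmod_val]

/-- A verifying forgery yields the discrete logarithm, unless the sums of the hash values
coincide. -/
theorem extract_eq {r e s e' : ZMod pp.q} {y : ℕ} (h : r = y * e + s) (hne : e ≠ e') :
    (r - y * e' - s) * (e - e') ^ (pp.q - 2) = y := by
  have : Fact pp.q.Prime := ⟨pp.prime_q⟩
  have hd : e - e' ≠ 0 := sub_ne_zero.2 hne
  -- By Fermat's little theorem the power `q - 2` is the inverse. The attacker can compute it by
  -- modular exponentiation.
  have h1 : (e - e') * (e - e') ^ (pp.q - 2) = 1 := by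
    rw [← pow_succ', show pp.q - 2 + 1 = pp.q - 1 from by have := pp.prime_q.two_le; omega]
    exact ZMod.pow_card_sub_one_eq_one hd
  rw [h, show (y * e + s - y * e' - s : ZMod pp.q) = y * (e - e') by ring, mul_assoc, h1, mul_one]

/-- The sum of undetermined values coincides with a given residue with small probability. -/
theorem ex_esum_eq_le (hκ : 2 ^ κ ≤ pp.q) (hL : 1 ≤ L) (c : ZMod pp.q) :
    ex (PMF.uniformOfFintype (Fin L → Star pp)) (fun e => ind (SimState.esum pp L e = c)) ≤
      eta κ := by
  rw [ex_pi_update ⟨0, hL⟩]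
  refine ex_le_of_le fun e => ?_
  refine (ex_unif_mem_le hκ (fun h => SimState.esum pp L (Function.update e ⟨0, hL⟩ h) = c)
    ({()} : Finset Unit) 1 (by simp) (fun _ => if hex : ∃ h : Star pp,
      SimState.esum pp L (Function.update e ⟨0, hL⟩ h) = c then hex.choose else default) ?_).trans
    (by simp)
  intro h hh
  refine ⟨(), by simp, ?_⟩
  have hex : ∃ h : Star pp, SimState.esum pp L (Function.update e ⟨0, hL⟩ h) = c := ⟨h, hh⟩
  rw [dif_pos hex]
  apply star_cast_injective
  -- With the other values fixed, the sum determines the first value, so at most one value is bad.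
  have hsum : ∀ h : Star pp, SimState.esum pp L (Function.update e ⟨0, hL⟩ h) = h.1 +
      ∑ ℓ ∈ Finset.univ.erase (⟨0, hL⟩ : Fin L), ((e ℓ).1 : ZMod pp.q) := by
    intro h
    unfold SimState.esum
    rw [← Finset.add_sum_erase Finset.univ _ (Finset.mem_univ (⟨0, hL⟩ : Fin L)),
      Function.update_self]
    congr 1
    exact Finset.sum_congr rfl fun ℓ hℓ => by simp [Finset.ne_of_mem_erase hℓ]
  have := hex.choose_spec.trans hh.symm
  rw [hsum, hsum] at this
  exact add_right_cancel this

/-- The hash values of a forgery and those of a signature of another batch have different sums. -/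
theorem sums_ne {p : Pub pp} (hp : Good L p) {M M' : Fin L → Str} (hM : M ≠ M') {x x' : ℕ}
    {xl el xl' el' : Fin L → Star pp}
    (h₁ : ∀ ℓ, (p.T 0).lookup (pp.enc x ++ (ℓ.val + 1).bits) = some (xl ℓ))
    (h₂ : ∀ ℓ, (p.T 2).lookup (M ℓ ++ pp.enc (xl ℓ).1) = some (el ℓ))
    (h₁' : ∀ ℓ, (p.T 0).lookup (pp.enc x' ++ (ℓ.val + 1).bits) = some (xl' ℓ))
    (h₂' : ∀ ℓ, (p.T 2).lookup (M' ℓ ++ pp.enc (xl' ℓ).1) = some (el' ℓ)) :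
    ∑ ℓ, ((el ℓ).1 : ZMod pp.q) ≠ ∑ ℓ, ((el' ℓ).1 : ZMod pp.q) := by
  classical
  intro hsum
  have idx : ∀ {a b : ℕ} {ℓ ℓ' : Fin L}, pp.enc a ++ (ℓ.val + 1).bits =
      pp.enc b ++ (ℓ'.val + 1).bits → ℓ = ℓ' := by
    intro a b ℓ ℓ' e
    have := bits_injective (List.append_inj e (by simp [pp.length_enc])).2
    exact Fin.ext (by omega)
  have split : ∀ {u v : Str} {a b : Star pp}, u ++ pp.enc a.1 = v ++ pp.enc b.1 → u = v ∧ a = b :=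
    fun e => by
      obtain ⟨e₁, e₂⟩ := pp.append_enc_inj (star_lt _) (star_lt _) e
      exact ⟨e₁, Subtype.ext e₂⟩
  -- Since `H_0` has no collisions, the suffix `x^ℓ` of a point determines the index `ℓ`. Hence the
  -- points of one batch are distinct and the sum over indices is a sum over a set.
  have inj : ∀ {N : Fin L → Str} {z : ℕ} {zl : Fin L → Star pp},
      (∀ ℓ, (p.T 0).lookup (pp.enc z ++ (ℓ.val + 1).bits) = some (zl ℓ)) →
      Function.Injective fun ℓ => N ℓ ++ pp.enc (zl ℓ).1 := by
    intro N z zl hz ℓ ℓ' e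
    have e' := (split e).2
    exact idx (hp.inj _ _ _ (hz ℓ) (e' ▸ hz ℓ'))
  set A := Finset.univ.image fun ℓ => M ℓ ++ pp.enc (xl ℓ).1 with hA
  set B := Finset.univ.image fun ℓ => M' ℓ ++ pp.enc (xl' ℓ).1 with hB
  have hAB : A = B := by
    refine hp.sums A B ?_ ?_ ?_ ?_ ?_
    · exact Finset.card_image_le.trans (by simp)
    · exact Finset.card_image_le.trans (by simp)
    · intro u hu
      obtain ⟨ℓ, -, rfl⟩ := Finset.mem_image.1 hu
      rw [h₂]; simp
    · intro u hu
      obtain ⟨ℓ, -, rfl⟩ := Finset.mem_image.1 hu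
      rw [h₂']; simp
    · rw [hA, hB, Finset.sum_image ((inj (N := M) h₁).injOn),
        Finset.sum_image ((inj (N := M') h₁').injOn)]
      simpa [Pub.sumVal, h₂, h₂'] using hsum
  -- A point determines its message and, through its suffix, its index. Equal sets of points thus
  -- come from equal batches, even when `x` and `x'` differ.
  refine hM (funext fun ℓ => ?_)
  have : M ℓ ++ pp.enc (xl ℓ).1 ∈ B := hAB ▸ Finset.mem_image_of_mem _ (Finset.mem_univ ℓ)
  obtain ⟨ℓ', -, e⟩ := Finset.mem_image.1 this
  obtain ⟨e₁, e₂⟩ := split e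
  have : ℓ = ℓ' := idx (hp.inj _ _ _ (h₁ ℓ) (e₂ ▸ h₁' ℓ'))
  rw [← e₁, this]

/-- The simulation fails: it has neither met the private key nor computed it. -/
def Fails (pp : GroupParams) (L J : ℕ) (y : Star pp) (b : ZMod pp.q) (g : SimState pp L J) : Prop :=
  ¬ (pp.α ^ b.val = pp.α ^ y.1 ∨ g.pub.flag = true)

/-- All relevant values are determined at this stage. If the verification equation fails or the flag
is raised, the indicator on the right already covers the left. If it holds without the flag, it is
linear over `ZMod q`, and `extract_eq` gives the logarithm unless the sum of the prepared values
equals the sum in the forgery. -/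
theorem sim_final (hκ : 2 ^ κ ≤ pp.q) (hL : 1 ≤ L) {D : Fin (J + 1) → Finset (Fin L)}
    {B : Fin (J + 1) → (Fin L → Str) × ℕ} {n : ℕ} {s : Ideal pp L J} (H : CertInv D B n s)
    {j : Fin (J + 1)} (hj : j ∈ s.com) {M : Fin L → Str} {x : ℕ}
    (hD : D j = ∅ ∨ (D j = Finset.univ ∧ M ≠ (B j).1)) (hsh : ∀ ℓ, s.sh j ℓ ≠ none)
    {xl el : Fin L → Star pp}
    (h₁ : ∀ ℓ, (s.pub.T 0).lookup (pp.enc x ++ (ℓ.val + 1).bits) = some (xl ℓ))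
    (h₂ : ∀ ℓ, (s.pub.T 2).lookup (M ℓ ++ pp.enc (xl ℓ).1) = some (el ℓ)) (sv : ZMod pp.q) :
    simΦ y δ (fun g => ind (Fails pp L J y ((((g.memo j).getD default).2 - sv) *
        (∑ ℓ, ((el ℓ).1 : ZMod pp.q) - SimState.esum pp L ((g.memo j).getD default).1) ^
          (pp.q - 2)) g)) s ≤
      ind (¬ (pp.α ^ (∑ ℓ, (((s.sh j ℓ).getD default).1 : ZMod pp.q)).val =
        (pp.α ^ y.1) ^ (∑ ℓ, ((el ℓ).1 : ZMod pp.q)).val * pp.α ^ sv.val ∨ s.pub.flag = true)) +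
        pot δ s.size + eta κ := by
  refine simΦ_le s (fun hs => ?_) (le_trans le_add_self le_self_add)
  rw [add_assoc, add_comm (pot δ s.size), ← add_assoc]
  refine add_le_add_left ?_ _
  by_cases hfl : s.pub.flag = true
  · refine (ex_le_of_le fun e => ex_le_of_le fun r => ?_).trans zero_le
    exact (ind_false (not_not.2 (Or.inr hfl))).le
  set ev : ZMod pp.q := ∑ ℓ, ((el ℓ).1 : ZMod pp.q) with hev
  set R : ZMod pp.q := ∑ ℓ, (((s.sh j ℓ).getD default).1 : ZMod pp.q) with hR
  by_cases hC : pp.α ^ R.val = (pp.α ^ y.1) ^ ev.val * pp.α ^ sv.val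
  swap
  · rw [ind_true (show ¬ _ from fun h => h.elim hC hfl)]
    exact (simAvg_le_one (fun g => ind_le_one _) _).trans le_self_add
  have hlin : R = y.1 * ev + sv := by
    rw [← pow_mul, ← pow_add, cast_pow_eq_iff] at hC
    rw [hC]
    push_cast
    rw [ZMod.natCast_zmod_val, ZMod.natCast_zmod_val]
  refine le_trans ?_ le_add_self
  have hle : ∀ e r : Rows pp L J, ind (Fails pp L J y
      (((((s.img y (e, r)).memo j).getD default).2 - sv) *
        (ev - SimState.esum pp L (((s.img y (e, r)).memo j).getD default).1) ^ (pp.q - 2))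
          (s.img y (e, r))) ≤ ind (SimState.esum pp L (s.evec e j) = ev) := by
    intro e r
    refine ind_mono fun hf => ?_
    by_contra hne
    refine hf (Or.inl ?_)
    have hm : (s.img y (e, r)).memo j = some (s.evec e j, s.sval y e r j) := if_pos hj
    rw [hm, cast_pow_eq_iff]
    have hsv : s.sval y e r j = R - y.1 * SimState.esum pp L (s.evec e j) := by
      unfold Ideal.sval
      congr 1
      refine Finset.sum_congr rfl fun ℓ _ => ?_
      obtain ⟨a, ha⟩ := Option.ne_none_iff_exists'.1 (hsh ℓ)
      simp [ha]
    simp only [Option.getD_some, hsv]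
    exact extract_eq hlin (Ne.symm hne)
  refine (ex_mono fun e => (ex_le_of_le (hle e)).trans le_rfl).trans ?_
  -- In an unsigned epoch row `j` of the completion is untouched, and its sum hits `ev` with
  -- probability at most `eta κ`. In a signed epoch the values are certified for another batch, and
  -- `sums_ne` excludes the coincidence.
  rcases hD with hD | ⟨hD, hM⟩
  · have : ∀ e : Rows pp L J, s.evec e j = e j := fun e => funext fun ℓ => by
      unfold Ideal.evec
      rw [H.enone j ℓ (by simp [hD])]
      rfl
    simp only [this]
    exact (ex_pi_eval j fun e => ind (SimState.esum pp L e = ev)).le.trans (ex_esum_eq_le hκ hL ev)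
  · refine (ex_le_of_le fun e => ?_).trans zero_le
    rw [ind_false]
    intro he
    have hc : ∀ ℓ, Cert s j (B j).1 (B j).2 ℓ := fun ℓ => H.cert j ℓ (by simp [hD])
    choose xl' el' c₁ c₂ c₃ using hc
    refine sums_ne hs hM h₁ h₂ c₁ c₂ ?_
    rw [← hev, ← he]
    unfold SimState.esum Ideal.evec
    simp [c₃]

end IdealSim

/-! ### Matching the oracle answers and the final outcome of the simulation. -/

section IdealSim

variable {pp : GroupParams} {L J κ : ℕ} {y : Star pp} {δ : ℕ → ℝ≥0∞}

/-- The records belong to the signatures given so far. -/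
def SignInv (s : Ideal pp L J) : Prop :=
  ∃ D B, CertInv D B s.epoch s ∧ ∀ j : Fin (J + 1), D j = ∅ ∨
    ((j : ℕ) < s.epoch ∧ D j = Finset.univ ∧ (B j).1 ∈ s.signed)

theorem SignInv.preserves {α : Type} {op : StateT (Ideal pp L J) PMF α}
    (h₁ : ∀ D B e, Preserves (CertInv D B e) op) (h₂ : ∀ e l, Preserves (Frame e l) op) :
    Preserves SignInv op := by
  rintro s ⟨D, B, H, H'⟩ r hr
  obtain ⟨e₁, e₂⟩ := h₂ s.epoch s.signed s ⟨rfl, rfl⟩ r hr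
  exact ⟨D, B, e₁ ▸ h₁ D B s.epoch s H r hr, by rwa [e₁, e₂]⟩

theorem cert_com' (D : Fin (J + 1) → Finset (Fin L)) (B : Fin (J + 1) → (Fin L → Str) × ℕ)
    (e : ℕ) (keys : Str → Star pp) (id i : Str) (j : Fin (J + 1)) :
    Preserves (CertInv D B e) (Ideal.com' pp L J y.1 keys id i j) := by
  unfold Ideal.com'
  split_ifs
  · exact cert_comId D B e j
  · exact preserves_keyCom (cert_hash D B e) _ _

/-- The current epoch has no records yet, so it may be assigned the new batch and string. The fold
over all indices then makes its set of records complete. -/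
theorem signInv_sign {j : Fin (J + 1)} {M : Fin L → Str} {s : Ideal pp L J} (H : SignInv s)
    (hj : (j : ℕ) = s.epoch) {r : (ZMod pp.q × ℕ) × Ideal pp L J}
    (hr : r ∈ (Ideal.sign pp L J y.1 j M s).support) :
    SignInv { r.2 with epoch := s.epoch + 1, signed := M :: s.signed } := by
  obtain ⟨D, B, H, H'⟩ := H
  unfold Ideal.sign at hr
  obtain ⟨r₁, h₁, hr⟩ := (mem_support_stateT_bind _ _ _ _).1 hr
  obtain ⟨r₂, h₂, hr⟩ := (mem_support_stateT_bind _ _ _ _).1 hr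
  obtain ⟨r₃, h₃, hr⟩ := (mem_support_stateT_bind _ _ _ _).1 hr
  rw [stateT_pure_apply, PMF.mem_support_pure_iff] at hr
  subst hr
  have hx : s.xs.lookup j = none := H.xnone j hj.ge
  unfold Ideal.getX at h₁
  rw [hx] at h₁
  simp only [PMF.mem_support_bind_iff, PMF.mem_support_pure_iff] at h₁
  obtain ⟨x, -, rfl⟩ := h₁
  simp only [Ideal.touch, PMF.mem_support_pure_iff] at h₂
  subst h₂
  have hDj : D j = ∅ := (H' j).resolve_right fun h => by omega
  have H₁ : CertInv D (Function.update B j (M, x.1)) (s.epoch + 1)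
      { s with xs := (j, x) :: s.xs, com := insert j s.com } := by
    refine ⟨fun j' hj' => H.shnone j' fun h => hj' (Finset.mem_insert_of_mem h),
      fun j' hj' => H.dcom j' fun h => hj' (Finset.mem_insert_of_mem h), fun j' hj' => ?_,
      fun j' ℓ hℓ => ?_, H.enone⟩
    · have hne : j' ≠ j := fun e => by rw [e] at hj'; omega
      have : (j' == j) = false := by simpa using hne
      rw [List.lookup_cons, this]
      exact H.xnone j' (by omega)
    · have hne : j' ≠ j := fun e => by rw [e, hDj] at hℓ; simp at hℓ
      rw [Function.update_of_ne hne]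
      exact H.cert j' ℓ hℓ
  have H₂ := cert_signFold (y := y) (j := j) (List.finRange L) H₁ (Finset.mem_insert_self _ _)
    (acc := 0) (r := r₃) (by rw [Function.update_self]; exact h₃)
  refine ⟨_, _, ⟨H₂.shnone, H₂.dcom, H₂.xnone, H₂.cert, H₂.enone⟩, fun j' => ?_⟩
  by_cases e : j' = j
  · subst e
    refine Or.inr ⟨by simp; omega, ?_, by simp⟩
    rw [Function.update_self]
    ext ℓ
    simp
  · simp only [Function.update_of_ne e]
    refine (H' j').imp id fun h => ⟨by omega, h.2.1, List.mem_cons_of_mem _ h.2.2⟩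

theorem simΦ_frame (f : SimState pp L J → ℝ≥0∞) (s : Ideal pp L J) (e : ℕ)
    (l : List (Fin L → Str)) :
    simΦ y δ (fun g => f { g with epoch := e }) s =
      simΦ y δ f { s with epoch := e, signed := l } := by
  by_cases hs : Good L s.pub
  · have hs' : Good L (Ideal.pub { s with epoch := e, signed := l }) := hs
    rw [simΦ_good hs, simΦ_good hs']
    rfl
  · have hs' : ¬ Good L (Ideal.pub { s with epoch := e, signed := l }) := hs
    rw [simΦ_bad hs, simΦ_bad hs']
    rfl

/-- The corresponding simulated state stores `v = ∑ r_j^ℓ - y ∑ e_j^ℓ`, so `Y ^ ∑ e * α ^ v` is the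
honest commitment `α ^ ∑ r`. -/
theorem sim_comId (hκ : 2 ^ κ ≤ pp.q) (hL : 1 ≤ L) (hδ : SimError κ L δ) (j : Fin (J + 1))
    {s : Ideal pp L J} (hs : SignInv s) :
    SimAt y δ s (SimState.comId pp L J (pp.α ^ y.1) j) (Ideal.comId pp L J j) := by
  obtain ⟨D, B, H, -⟩ := hs
  intro f hf
  unfold SimState.comId Ideal.comId
  simp only [ex_stateT_bind]
  refine (sim_touch hκ hL hδ j s (H.shnone j) H.esnone (fun _ g =>
      ex (SimState.read pp L J j g) fun r => ex ((pure ((pp.α ^ y.1) ^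
        (SimState.esum pp L r.1.1).val * pp.α ^ r.1.2.val) :
        StateT (SimState pp L J) PMF (ZMod pp.p)ˣ) r.2) fun r => f r.1 r.2)
      fun _ _ => ex_le_of_le fun _ => ex_le_of_le fun _ => hf _ _).trans
      (ex_mono_support fun r hr => ?_)
  simp only [Ideal.touch, PMF.mem_support_pure_iff] at hr
  subst hr
  refine (sim_comShares j (List.finRange L) 0 _ _).trans (ex_mono_support fun r hr => ?_)
  have hj : j ∈ r.2.com :=
    (cert_comShares D B s.epoch j _ ⟨cert_touch H j, Finset.mem_insert_self _ _⟩ r hr).2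
  obtain ⟨-, hsome, hsum⟩ := mem_comShares _ _ _ r hr
  rw [ex_stateT_pure]
  simp only [SimState.read, ex_pure, ex_stateT_pure]
  refine (simΦ_congr fun ω => ?_).le
  have hm : (r.2.img y ω).memo j = some (r.2.evec ω.1 j, r.2.sval y ω.1 ω.2 j) := if_pos hj
  rw [hm]
  congr 1
  rw [← pow_mul, ← pow_add, ← pp.pow_mod_q, pp.pow_mod_q, pp.pow_eq_pow_iff]
  push_cast
  simp only [ZMod.natCast_zmod_val, Option.getD_some]
  rw [hsum, Ideal.sval, add_sub_cancel, zero_add, ← List.ofFn_eq_map, List.sum_ofFn]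
  refine Finset.sum_congr rfl fun ℓ _ => ?_
  obtain ⟨a, ha⟩ := Option.ne_none_iff_exists'.1 (hsome ℓ (List.mem_finRange ℓ))
  simp [ha]

theorem SimAt.bind_pure {α β : Type} {s : Ideal pp L J} {op₂ : StateT (SimState pp L J) PMF α}
    {op₁ : StateT (Ideal pp L J) PMF α} (hx : SimAt y δ s op₂ op₁) (g : α → β) :
    SimAt y δ s (op₂ >>= fun a => Pure.pure (g a))
      (op₁ >>= fun a => Pure.pure (g a)) :=
  hx.bind fun _ _ => SimAt.pure _ _

theorem sim_com' (hκ : 2 ^ κ ≤ pp.q) (hL : 1 ≤ L) (hδ : SimError κ L δ) (keys : Str → Star pp)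
    (id i : Str) (j : Fin (J + 1)) {s : Ideal pp L J} (hs : SignInv s) :
    SimAt y δ s (SimState.com' pp L J (pp.α ^ y.1) keys id i j)
      (Ideal.com' pp L J y.1 keys id i j) := by
  unfold SimState.com' Ideal.com'
  split_ifs
  · exact sim_comId hκ hL hδ _ hs
  · exact sim_keyCom hκ hδ _ _ s

theorem sim_reply (hκ : 2 ^ κ ≤ pp.q) (hL : 1 ≤ L) (hδ : SimError κ L δ) (ids : List Str)
    (keys : Str → Star pp) (id : Str) (x : Query) (m : Mem) :
    (simHop L J (keys id) δ).Sim (fun _ => ()) SignInv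
      (fun _ => (SimState.oracle pp L J (pp.α ^ (keys id).1) κ ids keys id).reply x m)
      ((Ideal.oracle pp L J κ ids keys id).reply x m) := by
  cases x with
  | hash k d u =>
    refine ⟨?_, fun s hs f hf => ?_⟩
    · exact (SignInv.preserves (fun D B e => cert_hash D B e k (m.reg u))
        fun e l => (frame_opClosed e l).hash _ _).bind fun _ => Preserves.pure _
    · exact SimAt.bind_pure (y := keys id) (sim_hash hκ hδ k (m.reg u) s) (putHash pp m d) (f ())
        fun _ _ => hf _ _ _
  | sign ds dx dj a =>
    refine ⟨fun s hs r hr => ?_, fun s hs f hf => ?_⟩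
    · simp only [Ideal.oracle, Ideal.reply] at hr
      split_ifs at hr with h
      · simp only [PMF.mem_support_bind_iff, PMF.mem_support_pure_iff] at hr
        obtain ⟨r', hr', rfl⟩ := hr
        exact signInv_sign hs rfl hr'
      · rw [PMF.mem_support_pure_iff] at hr
        exact hr ▸ hs
    · simp only [Ideal.oracle, Ideal.reply, SimState.oracle, SimState.reply]
      have he : ∀ ω, (s.img (keys id) ω).epoch = s.epoch := fun _ => rfl
      by_cases h : s.epoch ≤ J
      · obtain ⟨D, B, H, H'⟩ := hs
        -- Complete records exist only for epochs before the counter, so the epoch to be signed has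
        -- none.
        have hD : D ⟨s.epoch, Nat.lt_succ_of_le h⟩ = ∅ :=
          (H' _).resolve_right fun h => lt_irrefl _ h.1
        have := sim_sign (y := keys id) hκ hL hδ ⟨s.epoch, Nat.lt_succ_of_le h⟩ (batch L m a) s
          (H.xnone _ le_rfl) (H.shnone _) (fun ℓ => H.enone _ ℓ (by simp [hD]))
          (fun r g => f () (putSig pp m ds dx dj (some (r.1.val, r.2, s.epoch)))
            { g with epoch := s.epoch + 1 }) fun _ _ => hf _ _ _
        simp only [dif_pos h, ex_bind, ex_pure]
        refine le_trans (le_of_eq ?_) (this.trans (ex_mono fun r => (simΦ_frame _ _ _ _).le))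
        refine simΦ_congr fun ω => ?_
        simp only [he]
        rw [dif_pos h]
        simp only [ex_bind, ex_pure]
      · simp only [dif_neg h, ex_pure]
        refine le_of_eq (simΦ_congr fun ω => ?_)
        simp only [he]
        rw [dif_neg h, ex_pure]
  | com d i j =>
    simp only [Ideal.oracle, Ideal.reply, SimState.oracle, SimState.reply]
    split_ifs with h
    · refine ⟨(SignInv.preserves (fun D B e => cert_com' D B e _ _ _ _)
        fun e l => (frame_opClosed e l).com' _ _ _ _).bind fun _ => Preserves.pure _,
        fun s hs f hf => ?_⟩
      exact SimAt.bind_pure (y := keys id) (sim_com' hκ hL hδ keys id (m.reg i)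
        ⟨(m.reg j).val, Nat.lt_succ_of_le h.2.2⟩ hs) (fun R => putCom pp m d (some R)) (f ()) fun _ _ => hf _ _ _
    · exact Hop.Sim.pure _

theorem flag_sim_hash (k : Fin 3) (u : Str) (Y : (ZMod pp.p)ˣ) :
    Preserves (fun g : SimState pp L J => g.pub.flag = true) (SimState.hash pp L J Y k u) := by
  intro g hg r hr
  simp only [SimState.hash, PMF.mem_support_bind_iff, PMF.mem_support_pure_iff] at hr
  obtain ⟨r', hr', rfl⟩ := hr
  unfold pubH at hr'
  split at hr'
  · rw [PMF.mem_support_pure_iff] at hr'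
    subst hr'
    exact check_flag_mono _ _ _ _ hg
  · simp only [PMF.mem_support_bind_iff, PMF.mem_support_pure_iff] at hr'
    obtain ⟨h, -, rfl⟩ := hr'
    exact check_flag_mono _ _ _ _ hg

theorem memo_sim_hash (k : Fin 3) (u : Str) (Y : (ZMod pp.p)ˣ)
    (v : Fin (J + 1) → Option ((Fin L → Star pp) × ZMod pp.q)) :
    Preserves (fun g : SimState pp L J => g.memo = v) (SimState.hash pp L J Y k u) := by
  intro g hg r hr
  simp only [SimState.hash, PMF.mem_support_bind_iff, PMF.mem_support_pure_iff] at hr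
  obtain ⟨r', hr', rfl⟩ := hr
  exact hg

theorem flag_sim_touch (j : Fin (J + 1)) :
    Preserves (fun g : SimState pp L J => g.pub.flag = true) (SimState.touch pp L J j) := by
  intro g hg r hr
  unfold SimState.touch at hr
  split at hr
  · rw [PMF.mem_support_pure_iff] at hr; exact hr ▸ hg
  · simp only [PMF.mem_support_bind_iff, PMF.mem_support_pure_iff] at hr
    obtain ⟨_, -, _, -, rfl⟩ := hr
    exact hg

theorem flag_sim_finish (m : Mem) (Y : (ZMod pp.p)ˣ) :
    Preserves (fun g : SimState pp L J => g.pub.flag = true) (SimState.finish pp L J Y m) := by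
  intro g hg r hr
  unfold SimState.finish at hr
  split_ifs at hr
  · refine Preserves.bind (flag_sim_touch _) (fun _ => Preserves.bind ?_ fun _ =>
      Preserves.bind (preserves_verSum (fun k u => flag_sim_hash k u Y) _ _) fun _ =>
        Preserves.pure _) g hg r hr
    intro g hg r hr
    simp only [SimState.read, PMF.mem_support_pure_iff] at hr
    exact hr ▸ hg
  · rw [PMF.mem_support_pure_iff] at hr; exact hr ▸ hg

/-- Verification queries do not change `memo`. The prepared signature may therefore be read after
them, which turns the outcome into a function of the final state. -/
theorem ex_extract (j : Fin (J + 1)) (M : Fin L → Str) (sv x : ZMod pp.q) (Y : (ZMod pp.p)ˣ)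
    (g : SimState pp L J) (f : ZMod pp.q → SimState pp L J → ℝ≥0∞) :
    ex (SimState.extract pp L J Y j M sv x g) (fun r => f r.1 r.2) =
      ex (SimState.touch pp L J j g) fun r =>
        ex (verSum pp L (SimState.hash pp L J Y) M x.val r.2) fun r =>
          f ((((r.2.memo j).getD default).2 - sv) *
            (r.1 - SimState.esum pp L ((r.2.memo j).getD default).1) ^ (pp.q - 2)) r.2 := by
  unfold SimState.extract
  simp only [ex_stateT_bind, ex_stateT_pure, SimState.read, ex_pure]
  refine congrArg _ (funext fun r => ex_congr_support fun r' hr' => ?_)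
  have := preserves_verSum (fun k u => memo_sim_hash k u Y r.2.memo) M x.val r.2 rfl r' hr'
  rw [this]

/-- For an admissible forgery the steps of verification are matched one by one until `sim_final`
applies. `SignInv` supplies the alternative needed there, because the forged batch was signed in no
epoch. -/
theorem sim_finish (hκ : 2 ^ κ ≤ pp.q) (hL : 1 ≤ L) (hδ : SimError κ L δ) (m : Mem)
    {s : Ideal pp L J} (hs : SignInv s) :
    simΦ y δ (fun g => ex (SimState.finish pp L J (pp.α ^ y.1) m g) fun r =>
        ind (Fails pp L J y r.1 r.2)) s ≤
      ex (Ideal.finish pp L J y.1 m s) fun r =>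
        ind (¬ (r.1 = true ∨ r.2.pub.flag = true)) + pot δ r.2.size + eta κ := by
  by_cases h : ((m.reg 0).val < pp.q ∧ (m.reg 1).val < pp.q ∧ 1 ≤ (m.reg 2).val ∧
      (m.reg 2).val ≤ J) ∧ batch L m 1 ∉ s.signed
  · unfold Ideal.finish SimState.finish
    simp only [dif_pos h, dif_pos h.1]
    set j : Fin (J + 1) := ⟨(m.reg 2).val, Nat.lt_succ_of_le h.1.2.2.2⟩
    set M := batch L m 1
    set sv : ZMod pp.q := ((m.reg 0).val : ZMod pp.q)
    set x : ZMod pp.q := ((m.reg 1).val : ZMod pp.q)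
    obtain ⟨D, B, H, H'⟩ := hs
    simp only [ex_extract (f := fun a b => ind (Fails pp L J y a b))]
    unfold Ideal.verify Ideal.comId
    simp only [ex_stateT_bind]
    refine (sim_touch hκ hL hδ j s (H.shnone j) H.esnone (fun _ g =>
      ex (verSum pp L (SimState.hash pp L J (pp.α ^ y.1)) M x.val g) fun r =>
        ind (Fails pp L J y ((((r.2.memo j).getD default).2 - sv) *
          (r.1 - SimState.esum pp L ((r.2.memo j).getD default).1) ^ (pp.q - 2)) r.2))
      fun _ _ => ex_le_of_le fun _ => ind_le_one _).trans (ex_mono_support fun r hr => ?_)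
    simp only [Ideal.touch, PMF.mem_support_pure_iff] at hr
    subst hr
    refine (sim_comShares j (List.finRange L) 0 _ _).trans (ex_mono_support fun r hr => ?_)
    obtain ⟨H₁, hj⟩ := cert_comShares D B s.epoch j _
      ⟨cert_touch H j, Finset.mem_insert_self _ _⟩ r hr
    obtain ⟨-, hsome, hsum⟩ := mem_comShares _ _ _ r hr
    rw [ex_stateT_pure]
    refine (sim_verSum hκ hδ M x.val r.2 (fun e g => ind (Fails pp L J y
      ((((g.memo j).getD default).2 - sv) *
          (e - SimState.esum pp L ((g.memo j).getD default).1) ^ (pp.q - 2)) g))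
      fun _ _ => ind_le_one _).trans (ex_mono_support fun r' hr' => ?_)
    have H₂ := preserves_verSum (cert_hash D B s.epoch) M x.val r.2 H₁ r' hr'
    obtain ⟨p, xl, el, e₁, -, e₂, e₃⟩ := mem_verSum _ _ _ (List.nodup_finRange L) r' hr'
    rw [ex_stateT_pure]
    have hsum' : r'.1 = ∑ ℓ, ((el ℓ).1 : ZMod pp.q) := by
      rw [e₃, zero_add, ← List.ofFn_eq_map, List.sum_ofFn]
    have hcom : r.1 = ∑ ℓ, (((r'.2.sh j ℓ).getD default).1 : ZMod pp.q) := by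
      rw [hsum, zero_add, ← List.ofFn_eq_map, List.sum_ofFn, e₁]
    rw [hsum', hcom]
    refine (sim_final hκ hL H₂ (xl := xl) (j := j) (M := M) (x := x.val) (by rw [e₁]; exact hj) ?_ ?_
      (fun ℓ => ?_) (fun ℓ => ?_) sv).trans (le_of_eq ?_)
    · refine (H' j).imp id fun h' => ⟨h'.2.1, fun e => h.2 (e ▸ h'.2.2)⟩
    · rw [e₁]
      exact fun ℓ => hsome ℓ (List.mem_finRange ℓ)
    · rw [e₁]; exact (e₂ ℓ (List.mem_finRange ℓ)).1
    · rw [e₁]; exact (e₂ ℓ (List.mem_finRange ℓ)).2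
    · simp only [decide_eq_true_eq]
  · unfold Ideal.finish
    rw [dif_neg h, ex_pure]
    refine simΦ_le s (fun _ => ?_) (le_trans le_add_self le_self_add)
    refine le_trans (add_le_add_left ?_ _) le_self_add
    refine ex_le_of_le fun e => ex_le_of_le fun r => ?_
    -- The ideal outcome is `false` here, so the right-hand side is at least one unless the flag is
    -- raised. A raised flag stays raised, and then the simulation cannot fail.
    by_cases hfl : s.pub.flag = true
    · refine le_trans (ex_mono_support fun r' hr' => ?_) ((ex_const _ 0).le.trans zero_le)
      have := flag_sim_finish m (pp.α ^ y.1) (s.img y (e, r)) hfl r' hr'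
      exact (ind_false (not_not.2 (Or.inr this))).le
    · rw [ind_true (by simpa using hfl)]
      exact ex_le_of_le fun _ => ind_le_one _

theorem signInv_init : SignInv (Ideal.init pp L J) :=
  ⟨fun _ => ∅, fun _ => (fun _ => [], 0), ⟨fun _ _ _ => rfl, fun _ _ => rfl, fun _ _ => rfl,
    fun _ _ h => by simp at h, fun _ _ _ => rfl⟩, fun _ => Or.inl rfl⟩

theorem img_init (ω : Rows pp L J × Rows pp L J) :
    (Ideal.init pp L J).img y ω = ⟨⟨fun _ => [], false⟩, fun _ => none, 1⟩ := by
  unfold Ideal.img Ideal.init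
  simp

/-- The initial state of the simulation. -/
def SimState.init (pp : GroupParams) (L J : ℕ) : SimState pp L J :=
  ⟨⟨fun _ => [], false⟩, fun _ => none, 1⟩

theorem good_init : Good L (Ideal.init pp L J).pub := by
  refine ⟨fun u u' h hu => ?_, fun A B _ _ hA hB _ => ?_⟩
  · simp [Ideal.init] at hu
  · have : ∀ A : Finset Str, (∀ u ∈ A, ((Ideal.init pp L J).pub.T 2).lookup u ≠ none) → A = ∅ :=
      fun A hA => Finset.eq_empty_of_forall_notMem fun u hu => hA u hu rfl
    rw [this A hA, this B hB]

/-- The failure probability of the simulation is at most the probability that the ideal game ends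
without a forgery and without a query that reveals the private key, up to the error. -/
theorem sim_le_ideal (hκ : 2 ^ κ ≤ pp.q) (hL : 1 ≤ L) (hδ : SimError κ L δ) (ids : List Str)
    (keys : Str → Star pp) (id : Str) (A : Prog Query) (fuel : ℕ) (m : Mem) (t : ℕ) :
    ex (run (SimState.oracle pp L J (pp.α ^ (keys id).1) κ ids keys id) fuel A
        ⟨m, t, SimState.init pp L J⟩) (fun o => o.elim 1 fun c =>
          ex (SimState.finish pp L J (pp.α ^ (keys id).1) c.mem c.orc) fun r =>
            ind (Fails pp L J (keys id) r.1 r.2)) ≤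
    ex (run (Ideal.oracle pp L J κ ids keys id) fuel A ⟨m, t, Ideal.init pp L J⟩) fun o =>
      o.elim ⊤ fun c => ex (Ideal.finish pp L J (keys id).1 c.mem c.orc) fun r =>
        ind (¬ (r.1 = true ∨ r.2.pub.flag = true)) + pot δ r.2.size + eta κ := by
  have key := Hop.run_le (h := simHop L J (keys id) δ) (obs := fun _ => ()) (I := SignInv)
    (O₂ := fun _ => SimState.oracle pp L J (pp.α ^ (keys id).1) κ ids keys id)
    (O₁ := Ideal.oracle pp L J κ ids keys id) (fun _ => rfl)
    (fun x m => sim_reply hκ hL hδ ids keys id x m) fuel A m t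
    (Ideal.init pp L J) signInv_init
    (fun _ c => ex (SimState.finish pp L J (pp.α ^ (keys id).1) c.mem c.orc) fun r =>
      ind (Fails pp L J (keys id) r.1 r.2)) fun _ _ => ex_le_of_le fun _ => ind_le_one _
  refine le_trans ?_ (key.trans (ex_mono_support fun o ho => ?_))
  · refine le_trans ?_ (simΦ_good (y := keys id) (δ := δ) good_init _).ge
    refine le_trans (le_of_eq ?_) le_self_add
    unfold simAvg
    simp only [img_init, ex_const]
    rfl
  · cases o with
    | none => exact le_rfl
    | some c =>
      exact sim_finish hκ hL hδ c.mem
        (run_preserves (fun x m => (sim_reply hκ hL hδ ids keys id x m).1) signInv_init ho)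

end IdealSim

/-! ### Runs with oracles that give well-formed answers -/

section AnyOracle

variable {pp : GroupParams} {L J κ d : ℕ}

/-- An oracle call can turn the memory `m` into `m'`. -/
def Answer (pp : GroupParams) (J : ℕ) (m m' : Mem) : Query → Prop
  | .hash _ d _ => ∃ h : Star pp, m' = putHash pp m d h.1
  | .sign ds dx dj _ => m' = putSig pp m ds dx dj none ∨ ∃ s < pp.q, ∃ x : Star pp, ∃ j ≤ J,
      m' = putSig pp m ds dx dj (some (s, x.1, j))
  | .com d _ _ => m' = putCom pp m d none ∨ ∃ r < pp.q, m' = putCom pp m d (some (pp.α ^ r))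

theorem mem_unifStar (h : Star pp) : h.1 ∈ pp.unifStar.support := by
  exact (PMF.mem_support_uniformOfFinset_iff _ _).2 h.2

theorem mem_unifBelow {n v : ℕ} (h : v < n) : v ∈ (unifBelow n).support := by
  unfold unifBelow
  rw [dif_pos (by omega)]
  exact (PMF.mem_support_uniformOfFinset_iff _ _).2 (Finset.mem_range.2 h)

theorem lt_of_mem_unifBelow {n v : ℕ} (h : v ∈ (unifBelow n).support) : v < n ∨ v = 0 := by
  unfold unifBelow at h
  split_ifs at h
  · exact Or.inl (Finset.mem_range.1 ((PMF.mem_support_uniformOfFinset_iff _ _).1 h))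
  · rw [PMF.mem_support_pure_iff] at h
    exact Or.inr h

theorem any_answer {m m' : Mem} {x : Query} (h : Answer pp J m m' x) (n : ℕ × ℕ) :
    ∃ r ∈ ((anyOracle pp L κ J).reply x m n).support, r.1 = m' := by
  cases x with
  | hash k d u =>
    obtain ⟨h, rfl⟩ := h
    refine ⟨(putHash pp m d h.1, (n.1 + 1, n.2)), ?_, rfl⟩
    simp only [anyOracle, PMF.mem_support_bind_iff, PMF.mem_support_pure_iff]
    exact ⟨h.1, mem_unifStar h, rfl⟩
  | sign ds dx dj a =>
    have key : ∀ s < pp.q, ∀ x : Star pp, ∀ j ≤ J, ∀ ok : Bool,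
        (putSig pp m ds dx dj (if ok then some (s, x.1, j) else none), (n.1, n.2 + 1)) ∈
          ((anyOracle pp L κ J).reply (.sign ds dx dj a) m n).support := by
      intro s hs x j hj ok
      simp only [anyOracle]
      refine (PMF.mem_support_bind_iff _ _ _).2 ⟨s, mem_unifBelow hs, ?_⟩
      refine (PMF.mem_support_bind_iff _ _ _).2 ⟨x.1, mem_unifStar x, ?_⟩
      refine (PMF.mem_support_bind_iff _ _ _).2 ⟨j, mem_unifBelow (by omega), ?_⟩
      refine (PMF.mem_support_bind_iff _ _ _).2 ⟨ok, PMF.mem_support_uniformOfFintype _, ?_⟩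
      exact (PMF.mem_support_pure_iff _ _).2 rfl
    rcases h with rfl | ⟨s, hs, x, j, hj, rfl⟩
    · exact ⟨_, key 0 pp.prime_q.pos default 0 (Nat.zero_le _) false, rfl⟩
    · exact ⟨_, key s hs x j hj true, rfl⟩
  | com d i j =>
    have key : ∀ r < pp.q, ∀ ok : Bool,
        (putCom pp m d (if ok then some (pp.α ^ r) else none), n) ∈
          ((anyOracle pp L κ J).reply (.com d i j) m n).support := by
      intro r hr ok
      simp only [anyOracle]
      refine (PMF.mem_support_bind_iff _ _ _).2 ⟨r, mem_unifBelow hr, ?_⟩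
      refine (PMF.mem_support_bind_iff _ _ _).2 ⟨ok, PMF.mem_support_uniformOfFintype _, ?_⟩
      exact (PMF.mem_support_pure_iff _ _).2 rfl
    rcases h with rfl | ⟨r, hr, rfl⟩
    · exact ⟨_, key 0 pp.prime_q.pos false, rfl⟩
    · exact ⟨_, key r hr true, rfl⟩

/-- All strings in the memory are at most proportional to the time. -/
def LenBound (d : ℕ) (m : Mem) (t : ℕ) : Prop :=
  (∀ i, (m.reg i).length ≤ (d + 1) * t) ∧ ∀ k u, (m.arr k u).length ≤ (d + 1) * t

theorem LenBound.setReg {m : Mem} {t t' : ℕ} (h : LenBound d m t) (ht : t ≤ t') {r : ℕ} {s : Str}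
    (hs : s.length ≤ (d + 1) * t') : LenBound d (m.setReg r s) t' := by
  have ht' : (d + 1) * t ≤ (d + 1) * t' := Nat.mul_le_mul_left _ ht
  refine ⟨fun i => ?_, fun k u => (h.2 k u).trans ht'⟩
  unfold Mem.setReg
  by_cases e : i = r
  · subst e; simpa using hs
  · simpa [e] using (h.1 i).trans ht'

theorem Op.length_le_cost (o : Op) (a b c : Str) : (o.eval a b c).length ≤ o.cost a b c := by
  unfold Op.cost
  refine le_trans ?_ (Nat.le_self_pow ?_ _)
  · omega
  · unfold Op.deg; split <;> simp

/-- Every instruction pays for the string it writes. For `rand` the bound below which the number is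
drawn is paid for, and the number is no longer than that. -/
theorem lenBound_stepClosed (d : ℕ) : StepClosed (LenBound d) := by
  have le_d : ∀ n, n ≤ (d + 1) * n := fun n => Nat.le_mul_of_pos_left n (Nat.succ_pos d)
  constructor
  · intro m t t' h ht
    have ht' : (d + 1) * t ≤ (d + 1) * t' := Nat.mul_le_mul_left _ ht
    exact ⟨fun i => (h.1 i).trans ht', fun k u => (h.2 k u).trans ht'⟩
  · intro m t h o r a b e
    refine h.setReg (Nat.le_add_right _ _) ?_
    exact ((Op.length_le_cost o _ _ _).trans (Nat.le_add_left _ t)).trans (le_d _)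
  · intro m t h r k i
    refine h.setReg (Nat.le_add_right _ _) (le_trans ?_ (le_d _))
    omega
  · intro m t h k i s
    have ht' : (d + 1) * t ≤ (d + 1) * (t + (1 + (m.reg i).length + (m.reg s).length)) :=
      Nat.mul_le_mul_left _ (Nat.le_add_right _ _)
    refine ⟨fun i => (h.1 i).trans ht', fun k' u => ?_⟩
    unfold Mem.setArr
    by_cases e : k' = k
    · subst e
      by_cases e' : u = m.reg i
      · subst e'
        simp only [Function.update_self]
        exact le_trans (by omega) (le_d _)
      · simpa [e'] using (h.2 k' u).trans ht'
    · simpa [e] using (h.2 k' u).trans ht'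
  · intro m t h r n v hv
    refine h.setReg (Nat.le_add_right _ _) (le_trans ?_ (le_d _))
    rw [length_bits]
    have : v.size ≤ (m.reg n).length := by
      rw [Nat.size_le]
      rcases lt_of_mem_unifBelow hv with h | rfl
      · exact h.trans (Str.val_lt _)
      · positivity
    omega

/-- Since `q` divides `p - 1`, the bound on `p` also bounds `q`. The case `κ = 0` is impossible
because then `p < 1`. -/
theorem size_lt_of_level (h : pp.Level d κ) : pp.q.size ≤ d * κ ∧ pp.p.size ≤ d * κ ∧ 1 ≤ κ := by
  have hqp : pp.q ≤ pp.p := by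
    have h1 : pp.q ∣ pp.p - 1 := by
      have := Fact.mk pp.prime_p
      rw [← pp.order_α, ← ZMod.card_units pp.p]
      exact orderOf_dvd_card
    have h2 := pp.prime_p.two_le
    exact (Nat.le_of_dvd (by omega) h1).trans (Nat.sub_le _ _)
  refine ⟨Nat.size_le.2 (hqp.trans_lt h.2), Nat.size_le.2 h.2, ?_⟩
  by_contra hc
  have : κ = 0 := by omega
  have h2 := pp.prime_p.two_le
  have h3 := h.2
  simp [this] at h3
  omega

theorem elt_length_le (g : (ZMod pp.p)ˣ) : (pp.elt g).length ≤ pp.p.size := by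
  have : NeZero pp.p := ⟨pp.prime_p.ne_zero⟩
  unfold GroupParams.elt
  rw [length_bits]
  exact Nat.size_le_size (ZMod.val_lt _).le

/-- Residues, hash values and group elements have at most `d * κ ≤ d * κ ^ 3` bits, and a call is
charged at least `κ ^ 3`. This is the source of the factor `d + 1`. The epoch number in a signature
is covered by the charge for the length of `J`. -/
theorem lenBound_answer (hl : pp.Level d κ) {m m' : Mem} {x : Query} (h : Answer pp J m m' x)
    {t : ℕ} (hm : LenBound d m t) : LenBound d m' (t + queryCost L κ J x m) := by
  obtain ⟨hq, hp, hκ⟩ := size_lt_of_level hl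
  have hκ3 : d * κ ≤ d * κ ^ 3 := Nat.mul_le_mul_left _ (Nat.le_self_pow (by norm_num) _)
  have small : ∀ {n c : ℕ}, n ≤ d * κ → n ≤ (d + 1) * (t + (κ ^ 3 + 1 + c)) := by
    intro n c hn
    calc n ≤ d * κ ^ 3 := hn.trans hκ3
      _ ≤ (d + 1) * (t + (κ ^ 3 + 1 + c)) := Nat.mul_le_mul (by omega) (by omega)
  have hs : ∀ {n : ℕ}, n < pp.q → n.bits.length ≤ d * κ := fun hn => by
    rw [length_bits]
    exact (Nat.size_le_size hn.le).trans hq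
  have he : ∀ g, (pp.elt g).length ≤ d * κ := fun g => (elt_length_le g).trans hp
  cases x with
  | hash k r u =>
    obtain ⟨h, rfl⟩ := h
    exact hm.setReg (Nat.le_add_right _ _) (by rw [pp.length_enc]; exact small hq)
  | sign ds dx dj a =>
    have hc : t ≤ t + queryCost L κ J (.sign ds dx dj a) m := Nat.le_add_right _ _
    have e : queryCost L κ J (.sign ds dx dj a) m =
        κ ^ 3 + 1 + (J.size + ∑ ℓ, (batch L m a ℓ).length) := by
      simp only [queryCost]; omega
    rcases h with rfl | ⟨s, hs', x, j, hj, rfl⟩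
    · exact ((hm.setReg hc (by simp)).setReg le_rfl (by simp)).setReg le_rfl (by simp)
    · refine ((hm.setReg hc ?_).setReg le_rfl ?_).setReg le_rfl ?_
      · rw [e]; exact small (hs hs')
      · rw [e, pp.length_enc]; exact small hq
      · rw [length_bits, e]
        have := Nat.size_le_size hj
        refine le_trans ?_ (Nat.le_mul_of_pos_left _ (Nat.succ_pos d))
        omega
  | com r i j =>
    have hc : t ≤ t + queryCost L κ J (.com r i j) m := Nat.le_add_right _ _
    have e : queryCost L κ J (.com r i j) m =
        κ ^ 3 + 1 + (J.size + (m.reg i).length + (m.reg j).length) := by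
      simp only [queryCost]; omega
    rcases h with rfl | ⟨r', hr', rfl⟩
    · exact hm.setReg hc (by simp)
    · exact hm.setReg hc (by rw [e]; exact small (he _))

theorem lenBound_init (ids : List Str) (id : Str) (Y : (ZMod pp.p)ˣ)
    (pks : List (ZMod pp.p)ˣ) {σ : Type} (s : σ) :
    LenBound d (laInit pp L κ J ids id Y pks s).mem (laInit pp L κ J ids id Y pks s).time := by
  have le_d : ∀ n, n ≤ (d + 1) * n := fun n => Nat.le_mul_of_pos_left n (Nat.succ_pos d)
  unfold laInit initCfg
  refine ⟨fun i => le_trans ?_ (le_d _), fun k u => le_trans ?_ (le_d _)⟩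
  · simp only
    refine le_trans ?_ (Nat.le_add_right _ _)
    generalize [κ.bits, pp.p.bits, pp.q.bits, pp.elt pp.α, J.bits, L.bits, id, pp.elt Y] = l
    by_cases hi : i < l.length
    · rw [List.getD_eq_getElem _ _ hi]
      exact List.single_le_sum (by simp) _ (List.mem_map_of_mem (List.getElem_mem hi))
    · rw [List.getD_eq_default _ _ (by omega)]
      simp
  · simp only
    refine le_trans ?_ (Nat.le_add_left _ _)
    split_ifs
    · generalize ids.zip (pks.map pp.elt) = l
      cases hl : l.lookup u with
      | none => simp
      | some v =>
        simp only [Option.getD_some]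
        refine le_trans (Nat.le_add_left _ u.length) (List.single_le_sum (by simp) _
          (List.mem_map.2 ⟨(u, v), mem_of_lookup hl, rfl⟩))
    · simp

/-- A run of a forger with an oracle that gives well-formed answers. -/
theorem forger_run {σ : Type} {O : Oracle Query σ} {size : σ → ℕ} {b : ℕ} (hl : pp.Level d κ)
    (hcost : O.cost = queryCost L κ J)
    (hans : ∀ x m s, ∀ r ∈ (O.reply x m s).support, Answer pp J m r.1 x)
    (hsize : ∀ x m s, ∀ r ∈ (O.reply x m s).support, size r.2 ≤ size s + b)
    {ids : List Str} {id : Str} {A : Prog Query} {t qs qs' : ℕ}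
    (hA : ForgerTime pp L κ J ids id A t qs qs') (keys : Str → Star pp) (s : σ) (hs : size s = 0) :
    ∀ o ∈ (run O t A (laInit pp L κ J ids id (pp.α ^ (keys id).1)
      (ids.map fun i => pp.α ^ (keys i).1) s)).support,
      ∃ c, o = some c ∧ c.time + A.size ≤ t ∧ LenBound d c.mem c.time ∧
        size c.orc ≤ b * c.time ∧ J.size ≤ c.time := by
  intro o ho
  have hks := hA (ids.map fun i => (keys i).1) (by simp) (fun k hk => by
    obtain ⟨i, -, rfl⟩ := List.mem_map.1 hk
    exact (keys i).2) (keys id).1 (keys id).2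
  rw [List.map_map] at hks
  -- Every well-formed answer is possible for `anyOracle`, so the guarantee given for that oracle
  -- applies to each outcome of the run considered.
  obtain ⟨o', ho', hsame⟩ := run_support_rel (O' := anyOracle pp L κ J) (B := LenBound d)
    (R := fun t s (_ : ℕ × ℕ) => size s ≤ b * t ∧ J.size ≤ t) (lenBound_stepClosed d)
    (fun h ht => ⟨h.1.trans (Nat.mul_le_mul_left _ ht), h.2.trans ht⟩) (by rw [hcost]; rfl)
    (fun x m t s n hB hR r hr => by
      obtain ⟨r', hr', e⟩ := any_answer (L := L) (κ := κ) (hans x m s r hr) n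
      refine ⟨r', hr', e, ?_, ?_, hR.2.trans (Nat.le_add_right _ _)⟩
      · rw [hcost]; exact lenBound_answer hl (hans x m s r hr) hB
      -- A call costs at least one unit of time, so the records grow by at most `b` per unit.
      · refine (hsize x m s r hr).trans ((Nat.add_le_add_right hR.1 b).trans ?_)
        rw [Nat.mul_add]
        refine Nat.add_le_add_left (Nat.le_mul_of_pos_right _ ?_) _
        rw [hcost]
        cases x <;> simp only [queryCost] <;> omega) t A _ _ s (0, 0)
    (lenBound_init (d := d) (L := L) (κ := κ) (J := J) ids id (pp.α ^ (keys id).1)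
      (ids.map fun i => pp.α ^ (keys i).1) s) ⟨by simp [hs], by
      simp [laInit, initCfg, length_bits]; omega⟩ o ho
  obtain ⟨c', rfl, h₁, -, -⟩ := hks o' ho'
  cases o with
  | none => exact hsame.elim
  | some c =>
    obtain ⟨e₁, e₂, e₃, e₄⟩ := hsame
    exact ⟨c, rfl, by rw [← e₂]; exact h₁, e₃, e₄⟩

/-! ### The answers of the games -/

theorem mem_keyCom {σ : Type} {hash : Fin 3 → Str → StateT σ PMF ℕ} {y j : ℕ} {s : σ}
    {r : (ZMod pp.p)ˣ × σ} (hr : r ∈ (keyCom pp L hash y j s).support) :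
    ∃ n < pp.q, r.1 = pp.α ^ n := by
  unfold keyCom at hr
  obtain ⟨r₁, -, hr⟩ := (mem_support_stateT_bind _ _ _ _).1 hr
  obtain ⟨r₂, -, hr⟩ := (mem_support_stateT_bind _ _ _ _).1 hr
  rw [stateT_pure_apply, PMF.mem_support_pure_iff] at hr
  subst hr
  exact ⟨_, ZMod.val_lt _, rfl⟩

theorem ideal_answer {ids : List Str} {keys : Str → Star pp} {id : Str} (x : Query) (m : Mem)
    (s : Ideal pp L J) : ∀ r ∈ ((Ideal.oracle pp L J κ ids keys id).reply x m s).support,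
      Answer pp J m r.1 x := by
  intro r hr
  cases x with
  | hash k d u =>
    obtain ⟨r₁, h₁, hr⟩ := (mem_support_stateT_bind _ _ _ _).1 hr
    rw [stateT_pure_apply, PMF.mem_support_pure_iff] at hr
    obtain ⟨h, p, -, rfl⟩ := mem_hash h₁
    exact ⟨h, by rw [hr]⟩
  | sign ds dx dj a =>
    simp only [Ideal.oracle, Ideal.reply] at hr
    split_ifs at hr with h
    · simp only [PMF.mem_support_bind_iff, PMF.mem_support_pure_iff] at hr
      obtain ⟨r', hr', rfl⟩ := hr
      have : ∃ x : Star pp, r'.1.2 = x.1 := by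
        unfold Ideal.sign at hr'
        obtain ⟨r₁, h₁, hr'⟩ := (mem_support_stateT_bind _ _ _ _).1 hr'
        obtain ⟨r₂, h₂, hr'⟩ := (mem_support_stateT_bind _ _ _ _).1 hr'
        obtain ⟨r₃, h₃, hr'⟩ := (mem_support_stateT_bind _ _ _ _).1 hr'
        rw [stateT_pure_apply, PMF.mem_support_pure_iff] at hr'
        subst hr'
        unfold Ideal.getX at h₁
        split at h₁
        · rw [PMF.mem_support_pure_iff] at h₁
          exact ⟨_, by rw [h₁]⟩
        · simp only [PMF.mem_support_bind_iff, PMF.mem_support_pure_iff] at h₁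
          obtain ⟨x, -, rfl⟩ := h₁
          exact ⟨x, rfl⟩
      obtain ⟨x, hx⟩ := this
      exact Or.inr ⟨_, ZMod.val_lt _, x, s.epoch, h, by rw [← hx]⟩
    · rw [PMF.mem_support_pure_iff] at hr
      exact Or.inl (by rw [hr])
  | com d i j =>
    simp only [Ideal.oracle, Ideal.reply] at hr
    split_ifs at hr with h
    · obtain ⟨r₁, h₁, hr⟩ := (mem_support_stateT_bind _ _ _ _).1 hr
      rw [stateT_pure_apply, PMF.mem_support_pure_iff] at hr
      subst hr
      suffices ∃ n < pp.q, r₁.1 = pp.α ^ n by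
        obtain ⟨n, hn, e⟩ := this
        exact Or.inr ⟨n, hn, by rw [← e]⟩
      unfold Ideal.com' at h₁
      split_ifs at h₁
      · unfold Ideal.comId at h₁
        obtain ⟨r₂, -, h₁⟩ := (mem_support_stateT_bind _ _ _ _).1 h₁
        obtain ⟨r₃, -, h₁⟩ := (mem_support_stateT_bind _ _ _ _).1 h₁
        rw [stateT_pure_apply, PMF.mem_support_pure_iff] at h₁
        subst h₁
        exact ⟨_, ZMod.val_lt _, rfl⟩
      · exact mem_keyCom h₁
    · rw [stateT_pure_apply, PMF.mem_support_pure_iff] at hr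
      exact Or.inl (by rw [hr])

theorem sim_answer {ids : List Str} {keys : Str → Star pp} {id : Str} {y : ℕ} (x : Query) (m : Mem)
    (s : SimState pp L J) :
    ∀ r ∈ ((SimState.oracle pp L J (pp.α ^ y) κ ids keys id).reply x m s).support,
      Answer pp J m r.1 x := by
  intro r hr
  cases x with
  | hash k d u =>
    obtain ⟨r₁, h₁, hr⟩ := (mem_support_stateT_bind _ _ _ _).1 hr
    rw [stateT_pure_apply, PMF.mem_support_pure_iff] at hr
    simp only [SimState.hash, PMF.mem_support_bind_iff, PMF.mem_support_pure_iff] at h₁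
    obtain ⟨r', -, rfl⟩ := h₁
    exact ⟨r'.1, by rw [hr]⟩
  | sign ds dx dj a =>
    simp only [SimState.oracle, SimState.reply] at hr
    split_ifs at hr with h
    · simp only [PMF.mem_support_bind_iff, PMF.mem_support_pure_iff] at hr
      obtain ⟨r', hr', rfl⟩ := hr
      have : ∃ x : Star pp, r'.1.2 = x.1 := by
        unfold SimState.sign at hr'
        obtain ⟨r₁, h₁, hr'⟩ := (mem_support_stateT_bind _ _ _ _).1 hr'
        obtain ⟨r₂, h₂, hr'⟩ := (mem_support_stateT_bind _ _ _ _).1 hr'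
        obtain ⟨r₃, h₃, hr'⟩ := (mem_support_stateT_bind _ _ _ _).1 hr'
        obtain ⟨r₄, h₄, hr'⟩ := (mem_support_stateT_bind _ _ _ _).1 hr'
        rw [stateT_pure_apply, PMF.mem_support_pure_iff] at hr'
        subst hr'
        simp only [PMF.mem_support_bind_iff, PMF.mem_support_pure_iff] at h₁
        obtain ⟨x, -, rfl⟩ := h₁
        exact ⟨x, rfl⟩
      obtain ⟨x, hx⟩ := this
      exact Or.inr ⟨_, ZMod.val_lt _, x, s.epoch, h, by rw [← hx]⟩
    · rw [PMF.mem_support_pure_iff] at hr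
      exact Or.inl (by rw [hr])
  | com d i j =>
    simp only [SimState.oracle, SimState.reply] at hr
    split_ifs at hr with h
    · obtain ⟨r₁, h₁, hr⟩ := (mem_support_stateT_bind _ _ _ _).1 hr
      rw [stateT_pure_apply, PMF.mem_support_pure_iff] at hr
      subst hr
      suffices ∃ n < pp.q, r₁.1 = pp.α ^ n by
        obtain ⟨n, hn, e⟩ := this
        exact Or.inr ⟨n, hn, by rw [← e]⟩
      unfold SimState.com' at h₁
      split_ifs at h₁
      · unfold SimState.comId at h₁
        obtain ⟨r₂, -, h₁⟩ := (mem_support_stateT_bind _ _ _ _).1 h₁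
        obtain ⟨r₃, -, h₁⟩ := (mem_support_stateT_bind _ _ _ _).1 h₁
        rw [stateT_pure_apply, PMF.mem_support_pure_iff] at h₁
        subst h₁
        -- The simulated commitment is a power of `α` with this exponent. The simulation itself does
        -- not know the exponent, as it involves `y`.
        refine ⟨_, Nat.mod_lt (y * (SimState.esum pp L r₃.1.1).val + r₃.1.2.val) pp.prime_q.pos, ?_⟩
        rw [pp.pow_mod_q, pow_add, pow_mul]
      · exact mem_keyCom h₁
    · rw [stateT_pure_apply, PMF.mem_support_pure_iff] at hr
      exact Or.inl (by rw [hr])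

/-! ### The growth of the records of the ideal game -/

theorem PubH_size_le {Y : (ZMod pp.p)ˣ} {k : Fin 3} {u : Str} {p : Pub pp} {r : Star pp × Pub pp}
    (hr : r ∈ (pubH pp Y k u p).support) : r.2.size ≤ p.size + 1 := by
  unfold pubH at hr
  split at hr
  · rw [PMF.mem_support_pure_iff] at hr; simp [hr]
  · simp only [PMF.mem_support_bind_iff, PMF.mem_support_pure_iff] at hr
    obtain ⟨h, -, rfl⟩ := hr
    simp [size_add]

theorem grows_hash (y : ℕ) (k : Fin 3) (u : Str) :
    Grows Ideal.size 1 (Ideal.hash pp L J y k u) := by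
  intro s r hr
  simp only [Ideal.hash, PMF.mem_support_bind_iff, PMF.mem_support_pure_iff] at hr
  obtain ⟨r', hr', rfl⟩ := hr
  have := PubH_size_le hr'
  simp only [Ideal.size_eq]
  omega

theorem grows_hashRec (y : ℕ) (j : Fin (J + 1)) (ℓ : Fin L) (u : Str) :
    Grows Ideal.size 1 (Ideal.hashRec pp L J y j ℓ u) := by
  intro s r hr
  simp only [Ideal.hashRec, PMF.mem_support_bind_iff, PMF.mem_support_pure_iff] at hr
  obtain ⟨r', hr', rfl⟩ := hr
  have := PubH_size_le hr'
  simp only [Ideal.size_eq]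
  omega

theorem grows_touch (j : Fin (J + 1)) : Grows Ideal.size 1 (Ideal.touch pp L J j) := by
  intro s r hr
  simp only [Ideal.touch, PMF.mem_support_pure_iff] at hr
  subst hr
  simp only [Ideal.size_eq]
  have := Finset.card_insert_le j s.com
  omega

theorem grows_share (j : Fin (J + 1)) (ℓ : Fin L) : Grows Ideal.size 0 (Ideal.share pp L J j ℓ) := by
  intro s r hr
  obtain ⟨h, -, rfl⟩ := mem_share hr
  exact le_rfl

theorem grows_getX (j : Fin (J + 1)) : Grows Ideal.size 1 (Ideal.getX pp L J j) := by
  intro s r hr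
  unfold Ideal.getX at hr
  split at hr
  · rw [PMF.mem_support_pure_iff] at hr; subst hr; exact Nat.le_add_right _ _
  · simp only [PMF.mem_support_bind_iff, PMF.mem_support_pure_iff] at hr
    obtain ⟨r', -, rfl⟩ := hr
    simp only [Ideal.size_eq, List.length_cons]; omega

theorem grows_comId (j : Fin (J + 1)) : Grows Ideal.size 1 (Ideal.comId pp L J j) := by
  unfold Ideal.comId
  refine Grows.bind (n := 1) (m := 0) (grows_touch j) (fun _ => ?_) le_rfl
  refine Grows.bind (n := L * 0) (m := 0) ?_ (fun _ => Grows.pure _) (by omega)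
  unfold Ideal.comShares
  rw [show L * 0 = (List.finRange L).length * 0 by simp]
  exact Grows.foldlM _ (fun b ℓ =>
    Grows.bind (n := 0) (m := 0) (grows_share j ℓ) (fun _ => Grows.pure _) le_rfl) 0

theorem grows_keyCom (y y' j : ℕ) :
    Grows Ideal.size (L + 1) (keyCom pp L (Ideal.hash pp L J y) y' j) :=
  Grows.bind (m := L) (grows_hash _ _ _) (fun _ => Grows.bind (n := L) (m := 0)
    (by simpa using Grows.foldlM (List.finRange L) (n := 1) (fun b ℓ =>
      (grows_hash _ _ _).bind fun _ => Grows.pure _) 0) (fun _ => Grows.pure _)) (by omega)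

theorem grows_verSum (y : ℕ) (M : Fin L → Str) (x : ℕ) :
    Grows Ideal.size (L * 2) (verSum pp L (Ideal.hash pp L J y) M x) := by
  simpa [verSum] using Grows.foldlM (List.finRange L) (n := 2) (fun b ℓ =>
      Grows.bind (m := 1) (grows_hash y 0 _) fun _ => (grows_hash y 2 _).bind fun _ => Grows.pure _) 0

theorem grows_sign (y : ℕ) (j : Fin (J + 1)) (M : Fin L → Str) :
    Grows Ideal.size (2 * L + 2) (Ideal.sign pp L J y j M) := by
  unfold Ideal.sign
  refine Grows.bind (n := 1) (m := 2 * L + 1) (grows_getX j) (fun x => ?_) (by omega)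
  refine Grows.bind (n := 1) (m := 2 * L) (grows_touch j) (fun _ => ?_) (by omega)
  refine Grows.bind (n := L * 2) (m := 0) ?_ (fun _ => Grows.pure _) (by omega)
  rw [show L * 2 = (List.finRange L).length * 2 by simp]
  refine Grows.foldlM _ (fun b ℓ => ?_) 0
  refine Grows.bind (n := 1) (m := 1) (grows_hash y 0 _) (fun _ => ?_) (by omega)
  refine Grows.bind (n := 0) (m := 1) (grows_share j ℓ) (fun _ => ?_) (by omega)
  exact Grows.bind (n := 1) (m := 0) (grows_hashRec y j ℓ _) (fun _ => Grows.pure _) (by omega)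

/-- A signature query sets the bound: one string `x_j`, one determined epoch, and two hash points
for each of the `L` messages. -/
theorem ideal_grows {ids : List Str} {keys : Str → Star pp} {id : Str} (x : Query) (m : Mem)
    (s : Ideal pp L J) : ∀ r ∈ ((Ideal.oracle pp L J κ ids keys id).reply x m s).support,
      r.2.size ≤ s.size + (2 * L + 2) := by
  intro r hr
  cases x with
  | hash k d u =>
    have := ((grows_hash (pp := pp) (L := L) (J := J) (keys id).1 k (m.reg u)).bind (N := 1)
      fun h => Grows.pure (putHash pp m d h)) s r hr
    omega
  | sign ds dx dj a =>
    simp only [Ideal.oracle, Ideal.reply] at hr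
    split_ifs at hr with h
    · simp only [PMF.mem_support_bind_iff, PMF.mem_support_pure_iff] at hr
      obtain ⟨r', hr', rfl⟩ := hr
      exact grows_sign _ _ _ s r' hr'
    · rw [PMF.mem_support_pure_iff] at hr
      subst hr; exact Nat.le_add_right _ _
  | com d i j =>
    simp only [Ideal.oracle, Ideal.reply] at hr
    split_ifs at hr with h
    · have := (Grows.bind (size := Ideal.size) (N := L + 1) (n := L + 1) (m := 0) (x := Ideal.com' pp L J (keys id).1
        keys id (m.reg i) ⟨(m.reg j).val, Nat.lt_succ_of_le h.2.2⟩) (by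
        unfold Ideal.com'
        split_ifs
        · intro s r hr
          have := grows_comId _ s r hr
          omega
        · exact grows_keyCom _ _ _) (fun R => Grows.pure (putCom pp m d (some R)))) s r hr
      omega
    · rw [stateT_pure_apply, PMF.mem_support_pure_iff] at hr
      subst hr; exact Nat.le_add_right _ _

theorem grows_finish (y : ℕ) (m : Mem) : Grows Ideal.size (2 * L + 1) (Ideal.finish pp L J y m) := by
  intro s r hr
  unfold Ideal.finish at hr
  split_ifs at hr with h
  · exact Grows.bind (n := 1) (m := L * 2) (grows_comId _) (fun _ => (grows_verSum y _ _).bind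
      fun _ => Grows.pure _) (by omega) s r hr
  · rw [PMF.mem_support_pure_iff] at hr
    subst hr; exact Nat.le_add_right _ _

end AnyOracle
end LAHases

/-! ### Weakest preconditions of loop-free programs -/

/-- The expected value of `f` after a loop-free program, and infinity if a step can cost more than
`U`. -/
def cw (U : ℕ) : Prog Empty → Mem → (Mem → ℝ≥0∞) → ℝ≥0∞
  | .skip, M, f => f M
  | .op o d a b e, M, f =>
    if o.cost (M.reg a) (M.reg b) (M.reg e) ≤ U then
      f (M.setReg d (o.eval (M.reg a) (M.reg b) (M.reg e))) else ⊤
  | .load d k i, M, f =>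
    if 1 + (M.reg i).length + (M.arr k (M.reg i)).length ≤ U then
      f (M.setReg d (M.arr k (M.reg i))) else ⊤
  | .store k i s, M, f =>
    if 1 + (M.reg i).length + (M.reg s).length ≤ U then
      f (M.setArr k (M.reg i) (M.reg s)) else ⊤
  | .rand d n, M, f =>
    if 1 + (M.reg n).length ≤ U then
      ex (unifBelow (M.reg n).val) fun v => f (M.setReg d v.bits) else ⊤
  | .call x, _, _ => x.elim
  | .seq p₁ p₂, M, f => cw U p₁ M fun M' => cw U p₂ M' f
  | .ite r p₁ p₂, M, f =>
    if 1 + (M.reg r).length ≤ U then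
      if (M.reg r).val = 0 then cw U p₂ M f else cw U p₁ M f else ⊤
  | .loop _ _, _, _ => ⊤

/-- The number of instructions. -/
def Prog.steps {Q : Type} : Prog Q → ℕ
  | .seq p₁ p₂ => p₁.steps + p₂.steps
  | .ite _ p₁ p₂ => 1 + p₁.steps + p₂.steps
  | .loop _ p => 1 + p.steps
  | _ => 1

theorem Prog.steps_le_size {Q : Type} (p : Prog Q) : p.steps ≤ p.size := by
  induction p with
  | op o d a b e => cases o <;> simp [Prog.steps, Prog.size]
  | seq p₁ p₂ h₁ h₂ => simp only [Prog.steps, Prog.size]; omega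
  | ite r p₁ p₂ h₁ h₂ => simp only [Prog.steps, Prog.size]; omega
  | loop r p h => simp only [Prog.steps, Prog.size]; omega
  | _ => exact le_rfl

/-- `cw` forgets the clock. That is legitimate because no step costs more than `U` when `cw` is
finite, and the hypothesis on `g` covers all clock readings that can then occur. -/
theorem run_le_cw {U fuel : ℕ} (hU : 1 ≤ U) (p : Prog Empty) :
    ∀ (M : Mem) (τ : ℕ) (g : Cfg Unit → ℝ≥0∞) (f : Mem → ℝ≥0∞),
      (∀ M' τ', τ' ≤ τ + p.steps * U → g ⟨M', τ', ()⟩ ≤ f M') →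
      ex (run noOracle fuel p ⟨M, τ, ()⟩) (fun o => o.elim ⊤ g) ≤ cw U p M f := by
  induction p with
  | skip =>
    intro M τ g f h
    simp only [run, ex_pure, cw]
    exact h _ _ (by simp [Prog.steps]; omega)
  | op o d a b e =>
    intro M τ g f h
    simp only [run, ex_pure, cw]
    split_ifs with hc
    · exact h _ _ (Nat.add_le_add_left (hc.trans (by simp [Prog.steps])) _)
    · exact le_top
  | load d k i =>
    intro M τ g f h
    simp only [run, ex_pure, cw]
    split_ifs with hc
    · exact h _ _ (Nat.add_le_add_left (hc.trans (by simp [Prog.steps])) _)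
    · exact le_top
  | store k i s =>
    intro M τ g f h
    simp only [run, ex_pure, cw]
    split_ifs with hc
    · exact h _ _ (Nat.add_le_add_left (hc.trans (by simp [Prog.steps])) _)
    · exact le_top
  | rand d n =>
    intro M τ g f h
    simp only [run, ex_bind, ex_pure, cw]
    split_ifs with hc
    · exact ex_mono fun v => h _ _ (Nat.add_le_add_left (hc.trans (by simp [Prog.steps])) _)
    · exact le_top
  | call x => exact x.elim
  | seq p₁ p₂ h₁ h₂ =>
    intro M τ g f h
    simp only [run, cw]
    rw [ex_andThen]
    simp only [Option.elim_none]
    refine h₁ M τ _ _ fun M' τ' hτ => h₂ _ _ _ _ fun M'' τ'' hτ' => h _ _ ?_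
    simp only [Prog.steps]
    rw [Nat.add_mul]
    omega
  | ite r p₁ p₂ h₁ h₂ =>
    intro M τ g f h
    simp only [run, cw, Cfg.next]
    by_cases hc : 1 + (M.reg r).length ≤ U
    · rw [if_pos hc]
      split_ifs
      · refine h₂ _ _ _ _ fun M' τ' hτ => h _ _ ?_
        simp only [Prog.steps]
        rw [Nat.add_mul, Nat.add_mul]
        omega
      · refine h₁ _ _ _ _ fun M' τ' hτ => h _ _ ?_
        simp only [Prog.steps]
        rw [Nat.add_mul, Nat.add_mul]
        omega
    · rw [if_neg hc]; exact le_top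
  | loop r p _ =>
    intro M τ g f h
    simp only [cw]; exact le_top

/-- The program implements the random variable `μ`: its results are related by `I`. -/
def Imp {β : Type} (U : ℕ) (p : Prog Empty) (M : Mem) (μ : PMF β) (I : β → Mem → Prop) : Prop :=
  ∀ (f : Mem → ℝ≥0∞) (G : β → ℝ≥0∞), (∀ b M', I b M' → f M' ≤ G b) → cw U p M f ≤ ex μ G

/-- A block of instructions. -/
def block : List (Prog Empty) → Prog Empty
  | [] => .skip
  | p :: l => .seq p (block l)

namespace Imp

variable {β γ : Type} {U : ℕ} {p q : Prog Empty} {l : List (Prog Empty)} {M : Mem} {μ : PMF β}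
  {I : β → Mem → Prop}

theorem of_ex {μ' : PMF β} (h : Imp U p M μ I) (e : ∀ G, ex μ G ≤ ex μ' G) : Imp U p M μ' I :=
  fun f G hf => (h f G hf).trans (e G)

theorem weaken {I' : β → Mem → Prop} (h : Imp U p M μ I) (hI : ∀ b M', I b M' → I' b M') :
    Imp U p M μ I' := fun f G hf => h f G fun b M' hb => hf b M' (hI b M' hb)

theorem bind {ν : β → PMF γ} {I' : γ → Mem → Prop} (h : Imp U p M μ I)
    (hν : ∀ b M', I b M' → Imp U (block l) M' (ν b) I') :
    Imp U (block (p :: l)) M (μ.bind ν) I' := fun f G hf => by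
  rw [ex_bind]
  exact h _ _ fun b M' hb => hν b M' hb f G hf

theorem nil {b : β} (h : I b M) : Imp U (block []) M (PMF.pure b) I := fun f G hf => by
  rw [ex_pure]; exact hf _ _ h

theorem op (o : Op) (d a b e : ℕ) {x y z : Str} (hx : M.reg a = x) (hy : M.reg b = y)
    (hz : M.reg e = z) (hc : o.cost x y z ≤ U)
    (h : Imp U (block l) (M.setReg d (o.eval x y z)) μ I) :
    Imp U (block (.op o d a b e :: l)) M μ I := fun f G hf => by
  subst hx hy hz
  simp only [block, cw]
  rw [if_pos hc]
  exact h f G hf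

theorem load (d k i : ℕ) {x y : Str} (hx : M.reg i = x) (hy : M.arr k x = y)
    (hc : 1 + x.length + y.length ≤ U) (h : Imp U (block l) (M.setReg d y) μ I) :
    Imp U (block (.load d k i :: l)) M μ I := fun f G hf => by
  subst hx hy
  simp only [block, cw]
  rw [if_pos hc]
  exact h f G hf

theorem store (k i s : ℕ) {x y : Str} (hx : M.reg i = x) (hy : M.reg s = y)
    (hc : 1 + x.length + y.length ≤ U) (h : Imp U (block l) (M.setArr k x y) μ I) :
    Imp U (block (.store k i s :: l)) M μ I := fun f G hf => by
  subst hx hy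
  simp only [block, cw]
  rw [if_pos hc]
  exact h f G hf

theorem rand (d n : ℕ) {x : Str} {N : ℕ} {ν : ℕ → PMF β} (hx : M.reg n = x) (hN : x.val = N)
    (hc : 1 + x.length ≤ U) (h : ∀ v ∈ (unifBelow N).support, Imp U (block l) (M.setReg d v.bits) (ν v) I) :
    Imp U (block (.rand d n :: l)) M ((unifBelow N).bind ν) I := fun f G hf => by
  subst hx hN
  simp only [block, cw]
  rw [if_pos hc, ex_bind]
  exact ex_mono_support fun v hv => h v hv f G hf

theorem ite_pos {r : ℕ} {x : Str} (hx : M.reg r = x) (hc : 1 + x.length ≤ U) (hv : x.val ≠ 0)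
    (h : Imp U p M μ I) : Imp U (.ite r p q) M μ I := fun f G hf => by
  subst hx
  simp only [cw]
  rw [if_pos hc, if_neg hv]
  exact h f G hf

theorem ite_neg {r : ℕ} {x : Str} (hx : M.reg r = x) (hc : 1 + x.length ≤ U) (hv : x.val = 0)
    (h : Imp U q M μ I) : Imp U (.ite r p q) M μ I := fun f G hf => by
  subst hx
  simp only [cw]
  rw [if_pos hc, if_pos hv]
  exact h f G hf

theorem skip {b : β} (h : I b M) : Imp U .skip M (PMF.pure b) I := nil h

/-- Run a subprogram that computes no result. -/
theorem then_ {I₁ : Unit → Mem → Prop} (h : Imp U p M (PMF.pure ()) I₁)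
    (hl : ∀ M', I₁ () M' → Imp U (block l) M' μ I) : Imp U (block (p :: l)) M μ I := fun f G hf => by
  have := h (fun M' => cw U (block l) M' f) (fun _ => ex μ G) fun _ M' h' => hl M' h' f G hf
  rwa [ex_pure] at this

theorem bindS {σ : Type} {x : StateT σ PMF β} {k : β → StateT σ PMF γ} {s : σ}
    {I : β × σ → Mem → Prop} {I' : γ × σ → Mem → Prop} (h : Imp U p M (x s) I)
    (hν : ∀ r M', I r M' → Imp U (block l) M' (k r.1 r.2) I') :
    Imp U (block (p :: l)) M ((x >>= k) s) I' := bind h hν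

/-- A sequence of steps with an invariant, which may depend on the remaining steps. -/
theorem fold {α σ : Type} {g : β → α → StateT σ PMF β} {code : α → Prog Empty}
    {I : List α → β × σ → Mem → Prop}
    (step : ∀ l b s a M, I (a :: l) (b, s) M → Imp U (code a) M (g b a s) (I l)) (l : List α) :
    ∀ b s M, I l (b, s) M → Imp U (block (l.map code)) M (l.foldlM g b s) (I []) := by
  induction l with
  | nil => exact fun b s M h => nil h
  | cons a l ih =>
    intro b s M h
    rw [List.foldlM_cons]
    exact bindS (step l b s a M h) fun r M' h' => ih r.1 r.2 M' h'

end Imp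

/-! ### Compilation of programs with oracle calls -/

/-- Replace the oracle calls of a program by code. The registers and the arrays of the program are
moved. -/
def compile {Q : Type} (code : Q → Prog Empty) (r₀ k₀ : ℕ) : Prog Q → Prog Empty
  | .skip => .skip
  | .op o d a b e => .op o (r₀ + d) (r₀ + a) (r₀ + b) (r₀ + e)
  | .load d k i => .load (r₀ + d) (k₀ + k) (r₀ + i)
  | .store k i s => .store (k₀ + k) (r₀ + i) (r₀ + s)
  | .rand d n => .rand (r₀ + d) (r₀ + n)
  | .call x => code x
  | .seq p₁ p₂ => .seq (compile code r₀ k₀ p₁) (compile code r₀ k₀ p₂)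
  | .ite r p₁ p₂ => .ite (r₀ + r) (compile code r₀ k₀ p₁) (compile code r₀ k₀ p₂)
  | .loop r p => .loop (r₀ + r) (compile code r₀ k₀ p)

theorem compile_size {Q : Type} {code : Q → Prog Empty} {r₀ k₀ S : ℕ} (hS : 1 ≤ S)
    (h : ∀ x, (code x).size ≤ S) (p : Prog Q) : (compile code r₀ k₀ p).size ≤ S * p.size := by
  induction p with
  | op o d a b e =>
    simp only [compile]
    cases o <;> simp only [Prog.size, mul_one] <;> first | exact hS | skip
    exact Nat.le_mul_of_pos_left _ hS
  | call x => simpa [compile, Prog.size] using h x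
  | seq p₁ p₂ h₁ h₂ => simp only [compile, Prog.size, Nat.mul_add, mul_one]; omega
  | ite r p₁ p₂ h₁ h₂ => simp only [compile, Prog.size, Nat.mul_add, mul_one]; omega
  | loop r p h => simp only [compile, Prog.size, Nat.mul_add, mul_one]; omega
  | _ => simpa [compile, Prog.size] using hS

/-- A relation between the configurations of a program with oracle calls and the memory of the
compiled program. -/
structure Layout {σ : Type} (r₀ k₀ : ℕ) (R : Mem → σ → Mem → Prop) : Prop where
  reg : ∀ {m s M}, R m s M → ∀ i, M.reg (r₀ + i) = m.reg i
  arr : ∀ {m s M}, R m s M → ∀ k, M.arr (k₀ + k) = m.arr k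
  setReg : ∀ {m s M}, R m s M → ∀ i x, R (m.setReg i x) s (M.setReg (r₀ + i) x)
  setArr : ∀ {m s M}, R m s M → ∀ k u x, R (m.setArr k u x) s (M.setArr (k₀ + k) u x)

/-- Ordinary instructions are only renamed and keep their price. A call becomes at most `S` steps,
each at most `C` times the price of the call, so the clock is stretched by at most `S * C` after the
offset `T₀`. More fuel on the compiled side is harmless, because exhausted fuel on the other side
counts as infinity. -/
theorem run_compile_le {Q σ : Type} {O : Oracle Q σ} {code : Q → Prog Empty} {r₀ k₀ S C T₀ : ℕ}
    {R : Mem → σ → Mem → Prop} (hR : Layout r₀ k₀ R) (hsize : ∀ x, (code x).size ≤ S)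
    (hS : 1 ≤ S) (hC : 1 ≤ C) (hO : ∀ x m, 1 ≤ O.cost x m)
    (hcall : ∀ x m s M, R m s M → Imp (C * O.cost x m) (code x) M (O.reply x m s)
      fun r M' => R r.1 r.2 M') {t t' : ℕ} (ht : t ≤ t') (p : Prog Q) :
    ∀ (m : Mem) (τ : ℕ) (s : σ) (M : Mem) (τ' : ℕ) (gF : Cfg Unit → ℝ≥0∞) (gS : Cfg σ → ℝ≥0∞),
      R m s M → τ' ≤ S * C * τ + T₀ →
      (∀ m τ s M τ', R m s M → τ' ≤ S * C * τ + T₀ → gF ⟨M, τ', ()⟩ ≤ gS ⟨m, τ, s⟩) →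
      ex (run noOracle t' (compile code r₀ k₀ p) ⟨M, τ', ()⟩) (fun o => o.elim ⊤ gF) ≤
        ex (run O t p ⟨m, τ, s⟩) fun o => o.elim ⊤ gS := by
  have time : ∀ {τ τ'} (c : ℕ), τ' ≤ S * C * τ + T₀ → τ' + c ≤ S * C * (τ + c) + T₀ := by
    intro τ τ' c h
    have : c ≤ S * C * c := Nat.le_mul_of_pos_left _ (Nat.mul_pos hS hC)
    rw [Nat.mul_add]
    omega
  induction p with
  | skip =>
    intro m τ s M τ' gF gS h hτ hg
    simp only [compile, run, ex_pure]
    exact hg _ _ _ _ _ h (time _ hτ)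
  | op o d a b e =>
    intro m τ s M τ' gF gS h hτ hg
    simp only [compile, run, ex_pure, hR.reg h]
    exact hg _ _ _ _ _ (hR.setReg h _ _) (time _ hτ)
  | load d k i =>
    intro m τ s M τ' gF gS h hτ hg
    simp only [compile, run, ex_pure, hR.reg h, hR.arr h]
    exact hg _ _ _ _ _ (hR.setReg h _ _) (time _ hτ)
  | store k i u =>
    intro m τ s M τ' gF gS h hτ hg
    simp only [compile, run, ex_pure, hR.reg h]
    exact hg _ _ _ _ _ (hR.setArr h _ _ _) (time _ hτ)
  | rand d n =>
    intro m τ s M τ' gF gS h hτ hg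
    simp only [compile, run, ex_bind, ex_pure, hR.reg h]
    exact ex_mono fun v => hg _ _ _ _ _ (hR.setReg h _ _) (time _ hτ)
  | call x =>
    intro m τ s M τ' gF gS h hτ hg
    simp only [compile, run, ex_bind, ex_pure]
    have hU : 1 ≤ C * O.cost x m := Nat.mul_pos hC (hO x m)
    -- The code forgets its exact running time, so the continuation is estimated by its supremum
    -- over all admissible clock readings.
    refine (run_le_cw hU (code x) M τ' gF (fun M' => ⨆ (τ'') (_ : τ'' ≤ τ' + (code x).steps *
      (C * O.cost x m)), gF ⟨M', τ'', ()⟩) fun M' τ'' hτ' => le_iSup₂_of_le τ'' hτ' le_rfl).trans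
      (hcall x m s M h _ _ fun r M' h' => iSup₂_le fun τ'' hτ' => hg _ _ _ _ _ h' ?_)
    refine hτ'.trans ((Nat.add_le_add hτ (Nat.mul_le_mul_right _ ((code x).steps_le_size.trans (hsize x)))).trans ?_)
    rw [Nat.mul_add, Nat.mul_assoc S C (O.cost x m)]
    omega
  | seq p₁ p₂ h₁ h₂ =>
    intro m τ s M τ' gF gS h hτ hg
    simp only [compile, run]
    rw [ex_andThen, ex_andThen]
    exact h₁ _ _ _ _ _ _ _ h hτ fun _ _ _ _ _ h' hτ' => h₂ _ _ _ _ _ _ _ h' hτ' hg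
  | ite r p₁ p₂ h₁ h₂ =>
    intro m τ s M τ' gF gS h hτ hg
    simp only [compile, run, hR.reg h, Cfg.next]
    split_ifs
    · exact h₂ _ _ _ _ _ _ _ h (time _ hτ) hg
    · exact h₁ _ _ _ _ _ _ _ h (time _ hτ) hg
  | loop r p hp =>
    intro m τ s M τ' gF gS h hτ hg
    simp only [compile, run]
    -- The two loops start with different fuel, so the induction carries two counters of which the
    -- compiled one is at least as large.
    have key : ∀ (n n' : ℕ), n ≤ n' → ∀ m τ s M τ', R m s M → τ' ≤ S * C * τ + T₀ →
        ex (iterate (r₀ + r) (run noOracle t' (compile code r₀ k₀ p)) n' ⟨M, τ', ()⟩)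
          (fun o => o.elim ⊤ gF) ≤
        ex (iterate r (run O t p) n ⟨m, τ, s⟩) fun o => o.elim ⊤ gS := by
      intro n
      induction n with
      | zero =>
        intro n' _ m τ s M τ' _ _
        simp [iterate]
      | succ n ih =>
        intro n' hn m τ s M τ' h hτ
        obtain ⟨n', rfl⟩ : ∃ k, n' = k + 1 := ⟨n' - 1, by omega⟩
        simp only [iterate, hR.reg h, Cfg.next]
        split_ifs
        · simp only [ex_pure]
          exact hg _ _ _ _ _ h (time _ hτ)
        · rw [ex_andThen, ex_andThen]
          exact hp _ _ _ _ _ _ _ h (time _ hτ) fun _ _ _ _ _ h' hτ' =>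
            ih n' (by omega) _ _ _ _ _ h' hτ'
    exact key t t' ht m τ s M τ' h hτ

/-! ### Memory updates and the cost of operations -/

@[simp] theorem Mem.reg_setReg (M : Mem) (d i : ℕ) (s : Str) :
    (M.setReg d s).reg i = if i = d then s else M.reg i := by
  simp [Mem.setReg, Function.update_apply]

@[simp] theorem Mem.arr_setReg (M : Mem) (d : ℕ) (s : Str) : (M.setReg d s).arr = M.arr := rfl

@[simp] theorem Mem.reg_setArr (M : Mem) (k : ℕ) (u s : Str) : (M.setArr k u s).reg = M.reg := rfl

@[simp] theorem Mem.arr_setArr (M : Mem) (k k' : ℕ) (u u' s : Str) :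
    (M.setArr k u s).arr k' u' = if k' = k ∧ u' = u then s else M.arr k' u' := by
  unfold Mem.setArr
  by_cases h : k' = k
  · subst h
    simp [Function.update_apply]
  · simp [h]

@[simp] theorem Mem.setReg_setReg (M : Mem) (d : ℕ) (s s' : Str) :
    (M.setReg d s).setReg d s' = M.setReg d s' := by
  simp [Mem.setReg]

/-- A bound for the cost of the operations on strings of length `n`, and of linear operations on
strings of length `e`. -/
structure Budget (n e U : ℕ) : Prop where
  le : (6 * n + 2) ^ 3 + 4 * e ≤ U

namespace Budget

variable {n e U w : ℕ}

theorem cube (h : Budget n e U) (hw : w ≤ 6 * n + 2) : w ^ 3 ≤ U :=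
  (Nat.pow_le_pow_left hw 3).trans (le_trans (Nat.le_add_right _ _) h.le)

theorem sq (h : Budget n e U) (hw : w ≤ 6 * n + 2) : w ^ 2 ≤ U :=
  (Nat.pow_le_pow_left hw 2).trans ((Nat.pow_le_pow_right (by omega) (by norm_num)).trans
    (h.cube le_rfl))

theorem lin (h : Budget n e U) (hw : w ≤ 6 * n + 2 + 4 * e) : w ≤ U := by
  have h₁ : 6 * n + 2 ≤ (6 * n + 2) ^ 3 := Nat.le_self_pow (by norm_num) _
  have := h.le
  omega

end Budget

theorem Nat.size_add_le (a b : ℕ) : (a + b).size ≤ a.size + b.size + 1 := by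
  rw [Nat.size_le]
  have ha := Nat.lt_size_self a
  have hb := Nat.lt_size_self b
  have h₁ : 2 ^ a.size ≤ 2 ^ (a.size + b.size) := Nat.pow_le_pow_right (by norm_num) (by omega)
  have h₂ : 2 ^ b.size ≤ 2 ^ (a.size + b.size) := Nat.pow_le_pow_right (by norm_num) (by omega)
  rw [pow_succ]
  omega

theorem Nat.size_mul_le (a b : ℕ) : (a * b).size ≤ a.size + b.size := by
  rcases Nat.eq_zero_or_pos b with rfl | hb
  · simp
  · rw [Nat.size_le, pow_add]
    exact Nat.mul_lt_mul_of_lt_of_le (Nat.lt_size_self a) (Nat.lt_size_self b).le (by positivity)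

theorem Str.size_val_le (s : Str) : s.val.size ≤ s.length := Nat.size_le.2 s.val_lt

namespace Imp

variable {β : Type} {U d a b e : ℕ} {l : List (Prog Empty)} {M : Mem} {μ : PMF β}
  {I : β → Mem → Prop} {x y z : Str}

theorem cst (s : Str) (h9 : M.reg 9 = []) (hc : 1 + s.length ≤ U)
    (h : Imp U (block l) (M.setReg d s) μ I) : Imp U (block (.op (.cst s) d 9 9 9 :: l)) M μ I :=
  op _ _ _ _ _ h9 h9 h9 (by simpa [Op.cost, Op.eval, Op.deg] using hc) h

theorem cat (hx : M.reg a = x) (hy : M.reg b = y) (h9 : M.reg 9 = [])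
    (hc : 1 + 2 * x.length + 2 * y.length ≤ U) (h : Imp U (block l) (M.setReg d (x ++ y)) μ I) :
    Imp U (block (.op .cat d a b 9 :: l)) M μ I :=
  op _ _ _ _ _ hx hy h9 (by simp [Op.cost, Op.eval, Op.deg]; omega) h

/-- Copy a register. -/
theorem copy (hx : M.reg a = x) (h9 : M.reg 9 = [])
    (hc : 1 + 2 * x.length ≤ U) (h : Imp U (block l) (M.setReg d x) μ I) :
    Imp U (block (.op .cat d a 9 9 :: l)) M μ I :=
  cat hx h9 h9 (by simpa using hc) (by simpa using h)

theorem take (hx : M.reg a = x) (hy : M.reg b = y) (h9 : M.reg 9 = [])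
    (hc : 1 + 2 * x.length + y.length ≤ U)
    (h : Imp U (block l) (M.setReg d (x.take y.val)) μ I) :
    Imp U (block (.op .take d a b 9 :: l)) M μ I :=
  op _ _ _ _ _ hx hy h9 (by simp [Op.cost, Op.eval, Op.deg]; omega) h

theorem len (hx : M.reg a = x) (h9 : M.reg 9 = []) (hc : 1 + 2 * x.length ≤ U)
    (h : Imp U (block l) (M.setReg d x.length.bits) μ I) :
    Imp U (block (.op .len d a 9 9 :: l)) M μ I :=
  op _ _ _ _ _ hx h9 h9 (by
    have : x.length.size ≤ x.length := Nat.size_le.2 Nat.lt_two_pow_self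
    simp [Op.cost, Op.eval, Op.deg, length_bits]; omega) h

theorem pad (hx : M.reg a = x) (hy : M.reg b = y) (h9 : M.reg 9 = [])
    (hc : 1 + x.length + y.length + y.val ≤ U)
    (h : Imp U (block l) (M.setReg d (fixedBits y.val x.val)) μ I) :
    Imp U (block (.op .pad d a b 9 :: l)) M μ I :=
  op _ _ _ _ _ hx hy h9 (by simp [Op.cost, Op.eval, Op.deg]; omega) h

theorem add (hx : M.reg a = x) (hy : M.reg b = y) (h9 : M.reg 9 = [])
    (hc : 2 + 2 * x.length + 2 * y.length ≤ U)
    (h : Imp U (block l) (M.setReg d (x.val + y.val).bits) μ I) :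
    Imp U (block (.op .add d a b 9 :: l)) M μ I :=
  op _ _ _ _ _ hx hy h9 (by
    have := Nat.size_add_le x.val y.val
    have := x.size_val_le
    have := y.size_val_le
    simp [Op.cost, Op.eval, Op.deg, length_bits]; omega) h

theorem sub (hx : M.reg a = x) (hy : M.reg b = y) (h9 : M.reg 9 = [])
    (hc : 1 + 2 * x.length + y.length ≤ U)
    (h : Imp U (block l) (M.setReg d (x.val - y.val).bits) μ I) :
    Imp U (block (.op .sub d a b 9 :: l)) M μ I :=
  op _ _ _ _ _ hx hy h9 (by
    have := Nat.size_le_size (Nat.sub_le x.val y.val)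
    have := x.size_val_le
    simp [Op.cost, Op.eval, Op.deg, length_bits]; omega) h

theorem mul (hx : M.reg a = x) (hy : M.reg b = y) (h9 : M.reg 9 = [])
    (hc : (1 + 2 * x.length + 2 * y.length) ^ 2 ≤ U)
    (h : Imp U (block l) (M.setReg d (x.val * y.val).bits) μ I) :
    Imp U (block (.op .mul d a b 9 :: l)) M μ I :=
  op _ _ _ _ _ hx hy h9 (by
    have := Nat.size_mul_le x.val y.val
    have := x.size_val_le
    have := y.size_val_le
    refine le_trans (Nat.pow_le_pow_left ?_ 2) hc
    simp [Op.eval, length_bits]; omega) h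

theorem mod (hx : M.reg a = x) (hy : M.reg b = y) (h9 : M.reg 9 = [])
    (hc : (1 + 2 * x.length + y.length) ^ 2 ≤ U)
    (h : Imp U (block l) (M.setReg d (x.val % y.val).bits) μ I) :
    Imp U (block (.op .mod d a b 9 :: l)) M μ I :=
  op _ _ _ _ _ hx hy h9 (by
    have := Nat.size_le_size (Nat.mod_le x.val y.val)
    have := x.size_val_le
    refine le_trans (Nat.pow_le_pow_left ?_ 2) hc
    simp [Op.eval, length_bits]; omega) h

theorem powMod (hx : M.reg a = x) (hy : M.reg b = y) (hz : M.reg e = z) (h0 : 0 < z.val)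
    (hc : (1 + x.length + y.length + 2 * z.length) ^ 3 ≤ U)
    (h : Imp U (block l) (M.setReg d (x.val ^ y.val % z.val).bits) μ I) :
    Imp U (block (.op .powMod d a b e :: l)) M μ I :=
  op _ _ _ _ _ hx hy hz (by
    have := Nat.size_le_size (Nat.mod_lt (x.val ^ y.val) h0).le
    have := z.size_val_le
    refine le_trans (Nat.pow_le_pow_left ?_ 3) hc
    simp [Op.eval, length_bits]; omega) h

theorem eq (hx : M.reg a = x) (hy : M.reg b = y) (h9 : M.reg 9 = [])
    (hc : 2 + x.length + y.length ≤ U)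
    (h : Imp U (block l) (M.setReg d (if x = y then [true] else [])) μ I) :
    Imp U (block (.op .eq d a b 9 :: l)) M μ I :=
  op _ _ _ _ _ hx hy h9 (by simp [Op.cost, Op.eval, Op.deg]; split_ifs <;> simp <;> omega) h

theorem lt (hx : M.reg a = x) (hy : M.reg b = y) (h9 : M.reg 9 = [])
    (hc : 2 + x.length + y.length ≤ U)
    (h : Imp U (block l) (M.setReg d (if x.val < y.val then [true] else [])) μ I) :
    Imp U (block (.op .lt d a b 9 :: l)) M μ I :=
  op _ _ _ _ _ hx hy h9 (by simp [Op.cost, Op.eval, Op.deg]; split_ifs <;> simp <;> omega) h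

theorem single {p : Prog Empty} (h : Imp U p M μ I) : Imp U (block [p]) M μ I := fun f G hf =>
  h f G hf

/-- A conditional on a truth value. -/
theorem ite {p q : Prog Empty} {r : ℕ} {P : Prop} [Decidable P]
    (hr : M.reg r = if P then [true] else []) (hU : 2 ≤ U) (hp : P → Imp U p M μ I)
    (hq : ¬ P → Imp U q M μ I) : Imp U (.ite r p q) M μ I := by
  by_cases h : P
  · rw [if_pos h] at hr
    exact ite_pos hr (by simpa using hU) (by simp [Str.val]) (hp h)
  · rw [if_neg h] at hr
    exact ite_neg hr (by simp; omega) rfl (hq h)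

theorem iter {α : Type} {code : α → Prog Empty} {I : List α → Mem → Prop}
    (step : ∀ l a M, I (a :: l) M → Imp U (code a) M (PMF.pure ()) fun _ => I l) (l : List α) :
    ∀ M, I l M → Imp U (block (l.map code)) M (PMF.pure ()) fun _ => I [] := by
  induction l with
  | nil => exact fun M h => nil h
  | cons a l ih => exact fun M h => then_ (step l a M h) fun M' h' => ih M' h'

end Imp

namespace GroupParams

variable (pp : GroupParams)

theorem elt_injective : Function.Injective pp.elt := fun a b h => by
  have := bits_injective h
  have : NeZero pp.p := ⟨pp.prime_p.ne_zero⟩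
  exact Units.ext (ZMod.val_injective _ ‹_›)

theorem elt_pow (g : (ZMod pp.p)ˣ) (n : ℕ) :
    (Str.val (pp.elt g) ^ n % pp.p).bits = pp.elt (g ^ n) := by
  unfold elt
  have : NeZero pp.p := ⟨pp.prime_p.ne_zero⟩
  rw [Str.val_bits, ← ZMod.val_natCast]
  simp

theorem elt_mul (g h : (ZMod pp.p)ˣ) :
    (Str.val (pp.elt g) * Str.val (pp.elt h) % pp.p).bits = pp.elt (g * h) := by
  unfold elt
  have : NeZero pp.p := ⟨pp.prime_p.ne_zero⟩
  rw [Str.val_bits, Str.val_bits, ← ZMod.val_natCast]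
  simp

end GroupParams

namespace LAHases

/-! ### The memory of the reduction -/

/-- The first array of the memory of the forger. The arrays before it hold the tables of the
random oracles, the keys, the signatures and the values `e_j^ℓ`. -/
def arrBase (L : ℕ) : ℕ := 6 + L

open Classical in
/-- The memory `M` of the reduction represents the memory `m` of the forger and the state of the
simulated oracles. -/
structure Rep {pp : GroupParams} {L J : ℕ} (ids : List Str) (keys : Str → Star pp) (id : Str)
    (Y : (ZMod pp.p)ˣ) (m : Mem) (s : SimState pp L J) (M : Mem) : Prop where
  reg : ∀ i, M.reg (40 + i) = m.reg i
  arr : ∀ k, M.arr (arrBase L + k) = m.arr k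
  regP : M.reg 1 = pp.p.bits
  regQ : M.reg 2 = pp.q.bits
  regα : M.reg 3 = pp.elt pp.α
  regY : M.reg 4 = pp.elt Y
  regLen : M.reg 5 = pp.q.size.bits
  regQ1 : M.reg 6 = (pp.q - 1).bits
  regOne : M.reg 7 = [true]
  regJ : M.reg 8 = J.bits
  regNil : M.reg 9 = []
  regId : M.reg 10 = id
  regEpoch : M.reg 11 = s.epoch.bits
  regFlag : M.reg 12 = if s.pub.flag = true then [true] else []
  cand : s.pub.flag = true → pp.α ^ (M.reg 13).val = Y ∧ (M.reg 13).length ≤ pp.q.size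
  tab : ∀ (k : Fin 3) u, M.arr k u = ((s.pub.T k).lookup u).elim [] fun h => pp.enc h.1
  key : ∀ u, M.arr 3 u = if u = id then [true] else if u ∈ ids then pp.enc (keys u).1 else []
  memo : ∀ (j : Fin (J + 1)) e v, s.memo j = some (e, v) →
    M.arr 4 j.val.bits = v.val.bits ∧ ∀ ℓ : Fin L, M.arr (5 + ℓ) j.val.bits = pp.enc (e ℓ).1
  memo_none : ∀ j : Fin (J + 1), s.memo j = none → M.arr 5 j.val.bits = []
  epoch_le : s.epoch ≤ J + 1

/-- Registers for intermediate results. -/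
def Scratch (d : ℕ) : Prop := d = 0 ∨ 14 ≤ d ∧ d < 40

section Code

variable {pp : GroupParams} {L J : ℕ} {ids : List Str} {keys : Str → Star pp} {id : Str}
  {Y : (ZMod pp.p)ˣ} {m M : Mem} {s : SimState pp L J}

theorem Rep.setReg (h : Rep ids keys id Y m s M) {d : ℕ} (hd : Scratch d) (x : Str) :
    Rep ids keys id Y m s (M.setReg d x) := by
  unfold Scratch at hd
  have ne : ∀ {i}, 1 ≤ i ∧ i < 14 ∨ 40 ≤ i → (M.setReg d x).reg i = M.reg i := by
    intro i hi
    rw [Mem.reg_setReg, if_neg (by omega)]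
  exact ⟨fun i => (ne (by omega)).trans (h.reg i), h.arr, (ne (by omega)).trans h.regP,
    (ne (by omega)).trans h.regQ, (ne (by omega)).trans h.regα, (ne (by omega)).trans h.regY,
    (ne (by omega)).trans h.regLen, (ne (by omega)).trans h.regQ1, (ne (by omega)).trans h.regOne,
    (ne (by omega)).trans h.regJ, (ne (by omega)).trans h.regNil, (ne (by omega)).trans h.regId,
    (ne (by omega)).trans h.regEpoch, (ne (by omega)).trans h.regFlag,
    fun hf => by rw [ne (by omega)]; exact h.cand hf, h.tab, h.key, h.memo, h.memo_none, h.epoch_le⟩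

/-- The moved cells of the forger lie in registers from 40 and arrays from `arrBase L`, apart from
everything else that `Rep` mentions. -/
theorem layout : Layout (σ := SimState pp L J) 40 (arrBase L) (Rep ids keys id Y) := by
  refine ⟨fun h => h.reg, fun h => h.arr, fun {m s M} h i x => ?_, fun {m s M} h k u x => ?_⟩
  · have ne : ∀ {i'}, i' < 40 → (M.setReg (40 + i) x).reg i' = M.reg i' := by
      intro i' hi
      rw [Mem.reg_setReg, if_neg (by omega)]
    refine ⟨fun i' => ?_, h.arr, (ne (by omega)).trans h.regP,
      (ne (by omega)).trans h.regQ, (ne (by omega)).trans h.regα, (ne (by omega)).trans h.regY,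
      (ne (by omega)).trans h.regLen, (ne (by omega)).trans h.regQ1, (ne (by omega)).trans h.regOne,
      (ne (by omega)).trans h.regJ, (ne (by omega)).trans h.regNil, (ne (by omega)).trans h.regId,
      (ne (by omega)).trans h.regEpoch, (ne (by omega)).trans h.regFlag,
      fun hf => by rw [ne (by omega)]; exact h.cand hf, h.tab, h.key, h.memo, h.memo_none,
      h.epoch_le⟩
    simp [h.reg]
  · have ne : ∀ {k'}, k' < arrBase L → (M.setArr (arrBase L + k) u x).arr k' = M.arr k' := by
      intro k' hk
      funext u'
      rw [Mem.arr_setArr, if_neg (by omega)]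
    have hb : 5 ≤ arrBase L := by unfold arrBase; omega
    refine ⟨h.reg, fun k' => ?_, h.regP, h.regQ, h.regα, h.regY, h.regLen, h.regQ1, h.regOne, h.regJ, h.regNil, h.regId, h.regEpoch,
      h.regFlag, h.cand, fun k' u' => by rw [ne (by omega)]; exact h.tab k' u', fun u' => by
      rw [ne (by omega)]; exact h.key u', fun j e v hj => ⟨?_, fun ℓ => ?_⟩, fun j hj => ?_,
      h.epoch_le⟩
    · funext u'
      simp [h.arr]
    · rw [ne (by omega)]; exact (h.memo j e v hj).1
    · rw [ne (by unfold arrBase; omega)]; exact (h.memo j e v hj).2 ℓ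
    · rw [ne (by unfold arrBase; omega)]; exact h.memo_none j hj

end Code

/-! ### Code for sampling and for the random oracles. -/

section Code

variable {pp : GroupParams} {L J : ℕ} {ids : List Str} {keys : Str → Star pp} {id : Str}
  {Y : (ZMod pp.p)ˣ} {m M : Mem} {s : SimState pp L J} {n e U : ℕ}

/-- The parameters have length at most `n`. -/
structure Small (pp : GroupParams) (n : ℕ) : Prop where
  q : pp.q.size + 1 ≤ n
  p : pp.p.size ≤ n

theorem Small.enc (h : Small pp n) (x : ℕ) : (pp.enc x).length + 1 ≤ n := by
  rw [pp.length_enc]; exact h.q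

theorem Small.elt (h : Small pp n) (g : (ZMod pp.p)ˣ) : (pp.elt g).length ≤ n :=
  (elt_length_le g).trans h.p

theorem Small.lt (h : Small pp n) {x : ℕ} (hx : x ≤ pp.q) : x.bits.length + 1 ≤ n := by
  rw [length_bits]
  have := Nat.size_le_size hx
  have := h.q
  omega

theorem Small.pbits (h : Small pp n) : pp.p.bits.length ≤ n := by
  rw [length_bits]; exact h.p

theorem Small.size (h : Small pp n) : pp.q.size.bits.length ≤ n := by
  have := h.q
  have h' : pp.q.size.size ≤ pp.q.size := Nat.size_le.2 Nat.lt_two_pow_self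
  rw [length_bits]
  omega

@[simp] theorem Str.val_true : Str.val [true] = 1 := rfl

/-- Draw an element of `ℤ_q^*`. -/
def sampleStar (r : ℕ) : Prog Empty :=
  block [.rand r 6, .op .add r r 7 9, .op .pad r r 5 9]

theorem ex_unif_eq (G : Star pp → ℝ≥0∞) :
    ex (unif pp) G = ex ((unifBelow (pp.q - 1)).bind fun v =>
      PMF.pure (if h : v + 1 ∈ Finset.Ico 1 pp.q then (⟨v + 1, h⟩ : Star pp) else default)) G := by
  have hq := pp.prime_q.two_le
  rw [ex_bind]
  simp only [ex_pure]
  unfold unif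
  rw [ex_unifBelow (by omega), ex_uniformOfFintype, card_star]
  congr 1
  refine (Finset.sum_bij' (fun v _ => if h : v + 1 ∈ Finset.Ico 1 pp.q then (⟨v + 1, h⟩ : Star pp)
    else default) (fun h _ => h.1 - 1) (fun _ _ => Finset.mem_univ _) ?_ ?_ ?_ ?_).symm
  · intro h _
    have := star_lt h
    have := star_pos h
    exact Finset.mem_range.2 (by omega)
  · intro v hv
    have := Finset.mem_range.1 hv
    rw [dif_pos (Finset.mem_Ico.2 (by omega))]
    simp
  · intro h _
    have := star_pos h
    have := star_lt h
    rw [dif_pos (Finset.mem_Ico.2 (by omega))]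
    exact Subtype.ext (by simp; omega)
  · intro v _; rfl

theorem imp_sampleStar (hn : Small pp n) (hb : Budget n e U) {r : ℕ} (hr : 14 ≤ r)
    (h5 : M.reg 5 = pp.q.size.bits) (h6 : M.reg 6 = (pp.q - 1).bits) (h7 : M.reg 7 = [true])
    (h9 : M.reg 9 = []) :
    Imp U (sampleStar r) M (unif pp) fun h M' => M' = M.setReg r (pp.enc h.1) := by
  have hq := pp.prime_q.two_le
  refine Imp.of_ex (μ := ((unifBelow (pp.q - 1)).bind fun v =>
      PMF.pure (if h : v + 1 ∈ Finset.Ico 1 pp.q then (⟨v + 1, h⟩ : Star pp) else default))) ?_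
    fun G => (ex_unif_eq G).ge
  have l1 := hn.lt (Nat.sub_le pp.q 1)
  have l2 := hn.q
  have l3 := hn.size
  refine Imp.rand r 6 h6 (Str.val_bits _) (hb.lin (by omega)) fun v hv => ?_
  have hv : v < pp.q - 1 := by
    rcases lt_of_mem_unifBelow hv with h | rfl <;> omega
  have l4 := hn.lt (x := v) (by omega)
  have l5 := hn.lt (x := v + 1) (by omega)
  refine Imp.add (x := v.bits) (y := [true]) (by simp) (by simp [h7, show 7 ≠ r by omega])
    (by simp [h9, show 9 ≠ r by omega]) (hb.lin (by simp; omega)) ?_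
  refine Imp.pad (x := (v + 1).bits) (y := pp.q.size.bits) (by simp)
    (by simp [h5, show 5 ≠ r by omega]) (by simp [h9, show 9 ≠ r by omega])
    (hb.lin (by simp; omega)) ?_
  rw [dif_pos (Finset.mem_Ico.2 (by omega))]
  exact Imp.nil (by simp [GroupParams.enc])

/-- Answer a query to `H_k` at the string in register `20`, in register `16`. -/
def hashCode (k : Fin 3) : Prog Empty :=
  block [if k = 2 then .skip else block [.op .take 14 20 5 9, .op .powMod 15 3 14 1,
      .op .eq 15 15 4 9, .ite 15 (block [.op .cat 12 7 9 9, .op .cat 13 14 9 9]) .skip],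
    .load 16 k 20, .ite 16 .skip (block [sampleStar 16, .store k 20 16])]

/-- The registers from `17` on are unchanged. -/
def Keep (M M' : Mem) : Prop := ∀ i, 17 ≤ i → i < 40 → M'.reg i = M.reg i

theorem Rep.setFlag (h : Rep ids keys id Y m s M) {s' : SimState pp L J} {x y : Str}
    (hT : s'.pub.T = s.pub.T) (hm : s'.memo = s.memo) (he : s'.epoch = s.epoch)
    (hx : x = if s'.pub.flag = true then [true] else [])
    (hy : s'.pub.flag = true → pp.α ^ y.val = Y ∧ y.length ≤ pp.q.size) :
    Rep ids keys id Y m s' ((M.setReg 12 x).setReg 13 y) := by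
  constructor
  · intro i
    rw [← h.reg i]
    simp [show 40 + i ≠ 13 by omega, show 40 + i ≠ 12 by omega]
  · exact h.arr
  · simpa using h.regP
  · simpa using h.regQ
  · simpa using h.regα
  · simpa using h.regY
  · simpa using h.regLen
  · simpa using h.regQ1
  · simpa using h.regOne
  · simpa using h.regJ
  · simpa using h.regNil
  · simpa using h.regId
  · simpa [he] using h.regEpoch
  · simpa using hx
  · simpa using hy
  · intro k u; rw [hT]; exact h.tab k u
  · exact h.key
  · intro j e v hj; exact h.memo j e v (hm ▸ hj)
  · intro j hj; exact h.memo_none j (hm ▸ hj)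
  · exact he ▸ h.epoch_le

theorem Rep.state_eq (h : Rep ids keys id Y m s M) {s' : SimState pp L J}
    (hT : s'.pub.T = s.pub.T) (hf : s'.pub.flag = s.pub.flag) (hm : s'.memo = s.memo)
    (he : s'.epoch = s.epoch) : Rep ids keys id Y m s' M :=
  ⟨h.reg, h.arr, h.regP, h.regQ, h.regα, h.regY, h.regLen, h.regQ1, h.regOne, h.regJ, h.regNil,
    h.regId, he ▸ h.regEpoch, hf ▸ h.regFlag, hf ▸ h.cand, hT ▸ h.tab, h.key, hm ▸ h.memo,
    hm ▸ h.memo_none, he ▸ h.epoch_le⟩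

theorem Rep.add (h : Rep ids keys id Y m s M) (k : Fin 3) (u : Str) (v : Star pp) :
    Rep ids keys id Y m { s with pub := s.pub.add k u v } (M.setArr k u (pp.enc v.1)) := by
  have ne : ∀ k', 3 ≤ k' → (M.setArr k u (pp.enc v.1)).arr k' = M.arr k' := by
    intro k' hk
    funext u'
    rw [Mem.arr_setArr, if_neg]
    have := k.2
    omega
  refine ⟨h.reg, fun k' => by rw [ne _ (by unfold arrBase; omega)]; exact h.arr k', h.regP, h.regQ,
    h.regα, h.regY, h.regLen, h.regQ1, h.regOne, h.regJ, h.regNil,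
    h.regId, h.regEpoch, h.regFlag, h.cand, fun k' u' => ?_,
    fun u => by rw [ne _ le_rfl]; exact h.key u, fun j e v hj => ⟨?_, fun ℓ => ?_⟩,
    fun j hj => ?_, h.epoch_le⟩
  · rw [lookup_add, Mem.arr_setArr, h.tab]
    simp only [Fin.val_inj]
    by_cases hc : k' = k ∧ u' = u
    · rw [if_pos hc, if_pos hc]; rfl
    · rw [if_neg hc, if_neg hc]
  · rw [ne _ (by omega)]; exact (h.memo j e v hj).1
  · rw [ne _ (by omega)]; exact (h.memo j e v hj).2 ℓ
  · rw [ne _ (by omega)]; exact h.memo_none j hj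

theorem scratch (d : ℕ) (h : 14 ≤ d ∧ d < 40 := by omega) : Scratch d := Or.inr h

/-- The prefix of the query serves as an exponent. If it gives `Y` it is a solution of the
challenge, and it is kept in register 13 for the end. -/
theorem imp_check (hn : Small pp n) (hb : Budget n e U) (h : Rep ids keys id Y m s M) {u : Str}
    (hu : M.reg 20 = u) (hl : u.length ≤ 2 * n + e) (k : Fin 3) :
    Imp U (if k = 2 then Prog.skip else block [.op .take 14 20 5 9, .op .powMod 15 3 14 1,
      .op .eq 15 15 4 9, .ite 15 (block [.op .cat 12 7 9 9, .op .cat 13 14 9 9]) .skip]) M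
      (PMF.pure ()) fun _ M' =>
        Rep ids keys id Y m { s with pub := s.pub.check Y k u } M' ∧ Keep M M' := by
  have l1 := hn.size
  have l2 := hn.pbits
  have l3 := hn.elt pp.α
  have l4 := hn.elt Y
  have l5 := hn.q
  have hpos := pp.prime_p.pos
  split_ifs with hk
  · exact Imp.skip ⟨h.state_eq (by simp) (by simp [Pub.check, hk]) rfl rfl, fun _ _ _ => rfl⟩
  have hlt : (u.take pp.q.size).length ≤ n := by rw [List.length_take]; omega
  refine Imp.take hu h.regLen h.regNil (hb.lin (by omega)) ?_
  rw [Str.val_bits]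
  have h := h.setReg (scratch 14) (u.take pp.q.size)
  refine Imp.powMod h.regα (Mem.reg_setReg _ 14 14 _) h.regP (by simpa using hpos) (hb.cube ?_) ?_
  · simp only [if_true]; omega
  rw [Str.val_bits, pp.elt_pow]
  simp only [if_true]
  have h := h.setReg (scratch 15) (pp.elt (pp.α ^ Str.val (List.take pp.q.size u)))
  have l6 := hn.elt (pp.α ^ Str.val (List.take pp.q.size u))
  refine Imp.eq (x := pp.elt (pp.α ^ Str.val (List.take pp.q.size u))) (by simp) h.regY h.regNil
    (hb.lin (by omega)) ?_
  classical
  simp only [Mem.setReg_setReg, pp.elt_injective.eq_iff]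
  have hx : ∀ x, Rep ids keys id Y m s
      (((M.setReg 14 (List.take pp.q.size u)).setReg 15 x)) := fun x =>
    (Mem.setReg_setReg _ _ _ _) ▸ h.setReg (scratch 15) x
  refine Imp.single (Imp.ite (P := pp.α ^ Str.val (List.take pp.q.size u) = Y) (by simp)
    (hb.lin (by omega)) (fun hp => ?_) fun hp => ?_)
  · rw [if_pos hp]
    have h := hx [true]
    refine Imp.copy h.regOne h.regNil (hb.lin (by simp; omega)) ?_
    refine Imp.copy (x := List.take pp.q.size u) (by simp)
      (by simpa using h.regNil) (hb.lin (by omega)) ?_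
    refine Imp.nil ⟨h.setFlag (by simp) rfl rfl ?_ fun _ => ⟨hp, List.length_take_le _ _⟩, ?_⟩
    · have : Hit pp Y u := hp
      simp [Pub.check, this, hk]
    · intro i h1 h2
      simp [show i ≠ 12 by omega, show i ≠ 13 by omega, show i ≠ 14 by omega, show i ≠ 15 by omega]
  · rw [if_neg hp]
    refine Imp.skip ⟨(hx []).state_eq (by simp) ?_ rfl rfl, ?_⟩
    · have : ¬ Hit pp Y u := hp
      simp [Pub.check, this]
    · intro i h1 h2
      simp [show i ≠ 14 by omega, show i ≠ 15 by omega]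

theorem imp_hash (hn : Small pp n) (hb : Budget n e U) (h : Rep ids keys id Y m s M) {u : Str}
    (hu : M.reg 20 = u) (hl : u.length ≤ 2 * n + e) (k : Fin 3) :
    Imp U (hashCode k) M (SimState.hash pp L J Y k u s) fun r M' =>
      Rep ids keys id Y m r.2 M' ∧ Keep M M' ∧ M'.reg 16 = pp.enc r.1 ∧ r.1 < pp.q ∧
        r.2.memo = s.memo := by
  refine Imp.then_ (imp_check hn hb h hu hl k) fun M₁ ⟨h₁, k₁⟩ => ?_
  have hu₁ : M₁.reg 20 = u := (k₁ 20 (by omega) (by omega)).trans hu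
  have ht := h₁.tab k u
  simp only [check_T] at ht
  unfold SimState.hash pubH
  have l1 := hn.q
  cases hlu : (s.pub.T k).lookup u with
  | some v =>
    rw [hlu] at ht
    have l2 := hn.enc v.1
    refine Imp.load 16 k 20 hu₁ ht (hb.lin (by simp; omega)) ?_
    simp only [PMF.pure_bind]
    -- Hash values are nonzero while an unused cell is empty and has value zero. Testing the cell
    -- thus tells whether the point has a record.
    refine Imp.single (Imp.ite_pos (x := pp.enc v.1) (by simp) (hb.lin (by omega)) ?_ (Imp.skip ?_))
    · rw [pp.val_enc (star_lt v)]
      have := star_pos v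
      omega
    · refine ⟨h₁.setReg (scratch 16) _, fun i h1 h2 => ?_, by simp, star_lt v, rfl⟩
      rw [Mem.reg_setReg, if_neg (by omega)]
      exact k₁ i h1 h2
  | none =>
    rw [hlu] at ht
    refine Imp.load 16 k 20 hu₁ ht (hb.lin (by simp; omega)) ?_
    simp only [PMF.bind_bind, PMF.pure_bind]
    have h₂ := h₁.setReg (scratch 16) []
    refine Imp.single (Imp.ite_neg (x := []) (by simp) (hb.lin (by simp; omega)) rfl ?_)
    refine Imp.bind (imp_sampleStar hn hb (by omega) h₂.regLen h₂.regQ1 h₂.regOne h₂.regNil)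
      fun v M' hM' => ?_
    subst hM'
    have l2 := hn.enc v.1
    rw [Mem.setReg_setReg]
    refine Imp.store k 20 16 (x := u) (y := pp.enc v.1) (by simp [hu₁]) (by simp)
      (hb.lin (by omega)) (Imp.nil ?_)
    refine ⟨(h₁.setReg (scratch 16) _).add k u v, fun i h1 h2 => ?_, by simp, star_lt v, rfl⟩
    rw [Mem.reg_setArr, Mem.reg_setReg, if_neg (by omega)]
    exact k₁ i h1 h2

end Code

/-! ### Code that prepares the signature of an epoch. -/

section Code

variable {pp : GroupParams} {L J : ℕ} {ids : List Str} {keys : Str → Star pp} {id : Str}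
  {Y : (ZMod pp.p)ˣ} {m M : Mem} {s : SimState pp L J} {n e U : ℕ}

/-- Choose the values `e_j^ℓ` and the signature for the epoch in register `21`. -/
def touchCode (L : ℕ) : Prog Empty :=
  block [.load 22 5 21, .ite 22 .skip (block [
    block ((List.finRange L).map fun ℓ : Fin L => block [sampleStar 22, .store (5 + ℓ.val) 21 22]),
    .rand 22 2, .store 4 21 22])]

/-- Resample one coordinate. -/
def resample (pp : GroupParams) {L : ℕ} (e : Fin L → Star pp) (ℓ : Fin L) :
    StateT Unit PMF (Fin L → Star pp) := fun _ =>
  (unif pp).bind fun h => PMF.pure (Function.update e ℓ h, ())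

/-- Coordinates drawn one after another form a uniform family, which relates the code to the single
draw in `SimState.touch`. -/
theorem ex_resample (l : List (Fin L)) (hl : l.Nodup) (G : (Fin L → Star pp) × Unit → ℝ≥0∞) :
    ∀ e, ex (l.foldlM (resample pp) e ()) G =
      ex (PMF.uniformOfFintype (Fin L → Star pp)) fun ω =>
        G (fun ℓ => if ℓ ∈ l then ω ℓ else e ℓ, ()) := by
  induction l with
  | nil => intro e; simp [ex_stateT_pure]
  | cons a l ih =>
    intro e
    obtain ⟨ha, hl⟩ := List.nodup_cons.1 hl
    rw [List.foldlM_cons, ex_stateT_bind]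
    simp only [resample, ex_bind, ex_pure]
    simp only [ih hl]
    unfold unif
    rw [ex_comm, ex_pi_fresh a (fun ω h => G (fun ℓ => if ℓ ∈ l then ω ℓ else
      Function.update e a h ℓ, ())) ?_]
    · congr 1
      funext ω
      congr 2
      funext ℓ
      by_cases h : ℓ = a
      · subst h; simp [ha]
      · simp [h]
    · intro ω b h
      congr 2
      funext ℓ
      by_cases h : ℓ = a
      · subst h; simp [ha]
      · simp [h]

theorem Rep.touch (h : Rep ids keys id Y m s M) {j : Fin (J + 1)} {f : Fin L → Star pp}
    {v : ZMod pp.q} {M' : Mem} (hr : ∀ i, i ≠ 22 → M'.reg i = M.reg i)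
    (ha : ∀ k u, ¬ (4 ≤ k ∧ k < 5 + L ∧ u = j.val.bits) → M'.arr k u = M.arr k u)
    (h4 : M'.arr 4 j.val.bits = v.val.bits)
    (h5 : ∀ ℓ : Fin L, M'.arr (5 + ℓ) j.val.bits = pp.enc (f ℓ).1) :
    Rep ids keys id Y m { s with memo := Function.update s.memo j (some (f, v)) } M' := by
  have reg : ∀ i, i < 14 ∨ 40 ≤ i → M'.reg i = M.reg i := fun i hi => hr i (by omega)
  refine ⟨fun i => (reg _ (by omega)).trans (h.reg i), fun k => ?_, (reg _ (by omega)).trans h.regP,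
    (reg _ (by omega)).trans h.regQ, (reg _ (by omega)).trans h.regα, (reg _ (by omega)).trans h.regY,
    (reg _ (by omega)).trans h.regLen, (reg _ (by omega)).trans h.regQ1,
    (reg _ (by omega)).trans h.regOne, (reg _ (by omega)).trans h.regJ,
    (reg _ (by omega)).trans h.regNil, (reg _ (by omega)).trans h.regId,
    (reg _ (by omega)).trans h.regEpoch, (reg _ (by omega)).trans h.regFlag, fun hf => ?_,
    fun k u => ?_, fun u => (ha 3 u (by omega)).trans (h.key u), fun j' e' v' hj => ?_, fun j' hj => ?_,
    h.epoch_le⟩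
  · funext u
    rw [ha _ _ (by unfold arrBase; omega)]
    exact congrFun (h.arr k) u
  · rw [reg _ (by omega)]; exact h.cand hf
  · have := k.2
    exact (ha k u (by omega)).trans (h.tab k u)
  · by_cases e : j' = j
    · subst e
      simp only [Function.update_self, Option.some.injEq, Prod.mk.injEq] at hj
      obtain ⟨rfl, rfl⟩ := hj
      exact ⟨h4, h5⟩
    · simp only [Function.update_of_ne e] at hj
      have ne : j'.val.bits ≠ j.val.bits := fun e' => e (Fin.ext (bits_injective e'))
      exact ⟨(ha _ _ fun hc => ne hc.2.2).trans (h.memo j' e' v' hj).1,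
        fun ℓ => (ha _ _ fun hc => ne hc.2.2).trans ((h.memo j' e' v' hj).2 ℓ)⟩
  · by_cases e : j' = j
    · subst e
      simp at hj
    · simp only [Function.update_of_ne e] at hj
      have ne : j'.val.bits ≠ j.val.bits := fun e' => e (Fin.ext (bits_injective e'))
      exact (ha _ _ fun hc => ne hc.2.2).trans (h.memo_none j' hj)

/-- The registers other than `22` are unchanged. -/
def KeepBut (M M' : Mem) : Prop := ∀ i, i ≠ 22 → M'.reg i = M.reg i

theorem imp_touch (hL : 1 ≤ L) (hn : Small pp n) (hb : Budget n e U) (h : Rep ids keys id Y m s M)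
    {j : Fin (J + 1)} (hj : M.reg 21 = j.val.bits) (hl : J.size ≤ e) :
    Imp U (touchCode L) M (SimState.touch pp L J j s) fun r M' =>
      Rep ids keys id Y m r.2 M' ∧ KeepBut M M' ∧ ∃ v, r.2.memo j = some v := by
  have l1 : j.val.bits.length ≤ e := by
    rw [length_bits]
    exact (Nat.size_le_size (Nat.le_of_lt_succ j.2)).trans hl
  have l2 := hn.q
  have l3 := hn.lt (x := pp.q) le_rfl
  unfold SimState.touch
  cases hm : s.memo j with
  | some v =>
    -- The cell of the first value `e_j^1` shows whether the epoch has been prepared, because this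
    -- value is nonzero. It exists since `1 ≤ L`.
    have h5 := (h.memo j v.1 v.2 hm).2 ⟨0, hL⟩
    simp only [Nat.add_zero] at h5
    have l4 := hn.enc (v.1 ⟨0, hL⟩).1
    refine Imp.load 22 5 21 hj h5 (hb.lin (by omega)) ?_
    refine Imp.single (Imp.ite_pos (x := pp.enc (v.1 ⟨0, hL⟩).1) (by simp) (hb.lin (by omega)) ?_
      (Imp.skip ⟨h.setReg (scratch 22) _, fun i hi => ?_, v, hm⟩))
    · rw [pp.val_enc (star_lt _)]
      have := star_pos (v.1 ⟨0, hL⟩)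
      omega
    · simp [hi]
  | none =>
    have h5 := h.memo_none j hm
    refine Imp.load 22 5 21 hj h5 (hb.lin (by simp; omega)) ?_
    refine Imp.single (Imp.ite_neg (x := []) (by simp) (hb.lin (by simp; omega)) rfl ?_)
    -- The code draws the values singly, so the random variable is first rewritten in that form.
    refine Imp.of_ex (μ := (((List.finRange L).foldlM (resample pp) default ()).bind fun r =>
      (unifBelow pp.q).bind fun v => PMF.pure ((), { s with
        memo := Function.update s.memo j (some (r.1, (v : ZMod pp.q))) }))) ?_ fun G => ?_
    · refine Imp.bind (Imp.fold (I := fun (l : List (Fin L)) (r : (Fin L → Star pp) × Unit) M' =>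
        (∀ i, i ≠ 22 → M'.reg i = M.reg i) ∧
        (∀ k u, ¬ (5 ≤ k ∧ k < 5 + L ∧ u = j.val.bits) → M'.arr k u = M.arr k u) ∧
        ∀ ℓ : Fin L, ℓ ∉ l → M'.arr (5 + ℓ) j.val.bits = pp.enc (r.1 ℓ).1) ?_ (List.finRange L)
        default () _ ⟨fun i hi => ?_, fun k u hk => ?_, fun ℓ hℓ => ?_⟩) ?_
      · rintro l f ⟨⟩ a M₁ ⟨hr, ha, hs⟩
        refine Imp.bind (imp_sampleStar hn hb (by omega) ((hr 5 (by omega)).trans h.regLen)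
          ((hr 6 (by omega)).trans h.regQ1) ((hr 7 (by omega)).trans h.regOne)
          ((hr 9 (by omega)).trans h.regNil)) fun v M' hM' => ?_
        subst hM'
        have l4 := hn.enc v.1
        refine Imp.store (5 + a) 21 22 (x := j.val.bits) (y := pp.enc v.1)
          (by simp [hr 21 (by omega), hj]) (by simp) (hb.lin (by omega)) (Imp.nil ⟨fun i hi => ?_,
            fun k u hk => ?_, fun ℓ hℓ => ?_⟩)
        · rw [Mem.reg_setArr, Mem.reg_setReg, if_neg hi]
          exact hr i hi
        · rw [Mem.arr_setArr, if_neg]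
          · exact ha k u hk
          · have := a.2
            rintro ⟨rfl, rfl⟩
            exact hk ⟨by omega, by omega, rfl⟩
        · simp only [Mem.arr_setArr]
          by_cases e : ℓ = a
          · subst e; simp
          · rw [if_neg fun hc => e (Fin.ext (by omega))]
            simp only [Function.update_of_ne e]
            exact hs ℓ (by simp [e, hℓ])
      · simp [hi]
      · rfl
      · exact absurd (List.mem_finRange ℓ) hℓ
      · rintro ⟨f, ⟨⟩⟩ M₁ ⟨hr, ha, hs⟩
        refine Imp.rand 22 2 ((hr 2 (by omega)).trans h.regQ) (Str.val_bits _) (hb.lin (by omega)) fun v hv => ?_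
        have hv : v < pp.q := by
          have := pp.prime_q.pos
          rcases lt_of_mem_unifBelow hv with h | rfl <;> omega
        have l4 := hn.lt hv.le
        refine Imp.store 4 21 22 (x := j.val.bits) (y := v.bits)
          (by simp [hr 21 (by omega), hj]) (by simp) (hb.lin (by omega)) (Imp.nil ⟨?_, ?_, ?_⟩)
        · refine h.touch (fun i hi => ?_) (fun k u hk => ?_) ?_ fun ℓ => ?_
          · simpa [hi] using hr i hi
          · rw [Mem.arr_setArr, if_neg]
            · exact ha k u fun hc => hk ⟨by omega, hc.2⟩
            · rintro ⟨rfl, rfl⟩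
              exact hk ⟨by omega, by omega, rfl⟩
          · simp [ZMod.val_natCast, Nat.mod_eq_of_lt hv]
          · rw [Mem.arr_setArr, if_neg (by omega)]
            exact hs ℓ (by simp)
        · intro i hi
          simpa [hi] using hr i hi
        · exact ⟨(f, v), by simp⟩
    · rw [ex_bind, ex_resample _ (List.nodup_finRange L)]
      simp only [List.mem_finRange, if_true, ex_bind, le_refl]

end Code

/-! ### Code for commitments. -/

section Code

variable {pp : GroupParams} {L J : ℕ} {ids : List Str} {keys : Str → Star pp} {id : Str}
  {Y : (ZMod pp.p)ˣ} {m M : Mem} {s : SimState pp L J} {n e U : ℕ}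

theorem imp_addMod {β : Type} {μ : PMF β} {I : β → Mem → Prop} {l : List (Prog Empty)}
    (hn : Small pp n) (hb : Budget n e U) (h : Rep ids keys id Y m s M) {r a x : ℕ}
    {acc : ZMod pp.q} (hr : M.reg r = acc.val.bits) (ha : M.reg a = pp.enc x) (hx : x < pp.q)
    (hr' : 14 ≤ r) (hi : Imp U (block l) (M.setReg r (acc + x).val.bits) μ I) :
    Imp U (block (.op .add r r a 9 :: .op .mod r r 2 9 :: l)) M μ I := by
  have l1 := hn.lt (ZMod.val_lt acc).le
  have l2 := hn.enc x
  have l3 := hn.q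
  refine Imp.add hr ha h.regNil (hb.lin (by omega)) ?_
  rw [pp.val_enc hx, Str.val_bits]
  have l4 := hn.lt (x := pp.q) le_rfl
  have l5 := hn.lt hx.le
  -- Before reduction the sum is below `2 q` and may need one bit more than `q`. This is why `Small`
  -- asks for `q.size + 1 ≤ n`.
  have l6 : (acc.val + x).bits.length ≤ n := by
    have h1 : (acc.val + x).size ≤ pp.q.size + 1 := by
      have := ZMod.val_lt acc
      have := Nat.lt_size_self pp.q
      rw [Nat.size_le, pow_succ]
      omega
    rw [length_bits]
    omega
  refine Imp.mod (x := (acc.val + x).bits) (y := pp.q.bits) (by simp)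
    (by rw [Mem.reg_setReg, if_neg (by omega)]; exact h.regQ)
    (by rw [Mem.reg_setReg, if_neg (by omega)]; exact h.regNil) (hb.sq (by omega)) ?_
  rw [Mem.setReg_setReg, Str.val_bits, Str.val_bits]
  convert hi using 3
  rw [ZMod.val_add, ZMod.val_natCast, Nat.add_mod_mod]

/-- Add up the values `e_j^ℓ` for the epoch in register `21`, in register `23`. -/
def esumCode (L : ℕ) : Prog Empty :=
  block ((List.finRange L).map fun ℓ : Fin L => block
    [.load 24 (5 + ℓ.val) 21, .op .add 23 23 24 9, .op .mod 23 23 2 9])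

theorem length_epoch_le (j : Fin (J + 1)) (hl : J.size ≤ e) : j.val.bits.length ≤ e := by
  rw [length_bits]
  exact (Nat.size_le_size (Nat.le_of_lt_succ j.2)).trans hl

theorem imp_esum (hn : Small pp n) (hb : Budget n e U) (h : Rep ids keys id Y m s M)
    {j : Fin (J + 1)} {f : Fin L → Star pp} {v : ZMod pp.q} (hm : s.memo j = some (f, v))
    (hj : M.reg 21 = j.val.bits) (hl : J.size ≤ e) (h23 : M.reg 23 = []) :
    Imp U (esumCode L) M (PMF.pure ()) fun _ M' => Rep ids keys id Y m s M' ∧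
      (∀ i, i ≠ 23 → i ≠ 24 → M'.reg i = M.reg i) ∧
        M'.reg 23 = (SimState.esum pp L f).val.bits := by
  have l1 := length_epoch_le j hl
  refine (Imp.iter (I := fun (l : List (Fin L)) M' => Rep ids keys id Y m s M' ∧
    (∀ i, i ≠ 23 → i ≠ 24 → M'.reg i = M.reg i) ∧ ∃ acc : ZMod pp.q, M'.reg 23 = acc.val.bits ∧
      acc + (l.map fun ℓ => ((f ℓ).1 : ZMod pp.q)).sum = SimState.esum pp L f) ?_
      (List.finRange L) M ⟨h, fun _ _ _ => rfl, 0, by simp [h23], ?_⟩).weaken ?_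
  · rintro l ℓ M₁ ⟨h₁, k₁, acc, ha, hs⟩
    have l2 := hn.enc (f ℓ).1
    refine Imp.load 24 (5 + ℓ.val) 21 ((k₁ 21 (by omega) (by omega)).trans hj)
      ((h₁.memo j f v hm).2 ℓ) (hb.lin (by omega)) ?_
    have h₂ := h₁.setReg (scratch 24) (pp.enc (f ℓ).1)
    refine imp_addMod hn hb h₂ (x := (f ℓ).1) (acc := acc) (by simpa using ha) (by simp)
      (star_lt _) (by omega) (Imp.nil ⟨h₂.setReg (scratch 23) _, fun i h1 h2 => ?_, acc + ((f ℓ).1 : ZMod pp.q), by simp, ?_⟩)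
    · simpa [h1, h2] using k₁ i h1 h2
    · rw [← hs, List.map_cons, List.sum_cons, add_assoc]
  · rw [zero_add, SimState.esum, ← List.sum_ofFn, List.ofFn_eq_map]
  · rintro ⟨⟩ M₁ ⟨h₁, k₁, acc, ha, hs⟩
    refine ⟨h₁, k₁, ?_⟩
    rw [ha, ← hs]
    simp

/-- The commitment of the attacked user for the epoch in register `21`, in register `23`. -/
def comIdCode (L : ℕ) : Prog Empty :=
  block [touchCode L, .op .cat 23 9 9 9, esumCode L, .op .powMod 23 4 23 1, .load 24 4 21,
    .op .powMod 24 3 24 1, .op .mul 23 23 24 9, .op .mod 23 23 1 9]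

theorem read_bind {β : Type} (j : Fin (J + 1)) (F : (Fin L → Star pp) × ZMod pp.q →
    StateT (SimState pp L J) PMF β) {v : (Fin L → Star pp) × ZMod pp.q} (hm : s.memo j = some v) :
    (SimState.read pp L J j >>= F) s = F v s := by
  simp [stateT_bind_apply, SimState.read, hm]

theorem imp_comId (hL : 1 ≤ L) (hn : Small pp n) (hb : Budget n e U) (h : Rep ids keys id Y m s M)
    {j : Fin (J + 1)} (hj : M.reg 21 = j.val.bits) (hl : J.size ≤ e) :
    Imp U (comIdCode L) M (SimState.comId pp L J Y j s) fun r M' =>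
      Rep ids keys id Y m r.2 M' ∧ M'.reg 23 = pp.elt r.1 := by
  have l1 := length_epoch_le j hl
  have hpos := pp.prime_p.pos
  have l0 := hn.pbits
  unfold SimState.comId
  refine Imp.bindS (imp_touch hL hn hb h hj hl) ?_
  rintro ⟨⟨⟩, s₁⟩ M₁ ⟨h₁, k₁, ⟨f, v⟩, hv⟩
  dsimp only at h₁ hv ⊢
  rw [read_bind j _ hv]
  refine Imp.copy h₁.regNil h₁.regNil (hb.lin (by simp; omega)) ?_
  refine Imp.then_ (imp_esum hn hb (h₁.setReg (scratch 23) []) hv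
    (by simpa [k₁ 21 (by omega)] using hj) hl (by simp)) fun M₂ ⟨h₂, k₂, hs⟩ => ?_
  have l2 := hn.elt Y
  have l3 := hn.lt (ZMod.val_lt (SimState.esum pp L f)).le
  refine Imp.powMod h₂.regY hs h₂.regP (by simpa using hpos) (hb.cube (by omega)) ?_
  rw [Str.val_bits, Str.val_bits, pp.elt_pow]
  have h₃ := h₂.setReg (scratch 23) (pp.elt (Y ^ (SimState.esum pp L f).val))
  have l4 := hn.lt (ZMod.val_lt v).le
  have l5 := hn.elt (Y ^ (SimState.esum pp L f).val)
  refine Imp.load 24 4 21 (x := j.val.bits) (y := v.val.bits) ?_ (h₃.memo j f v hv).1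
    (hb.lin (by omega)) ?_
  · simpa [k₂ 21 (by omega) (by omega), k₁ 21 (by omega)] using hj
  have h₄ := h₃.setReg (scratch 24) v.val.bits
  have l6 := hn.elt pp.α
  refine Imp.powMod (y := v.val.bits) h₄.regα (by simp) h₄.regP (by simpa using hpos)
    (hb.cube (by omega)) ?_
  rw [Str.val_bits, Str.val_bits, pp.elt_pow, Mem.setReg_setReg]
  have h₅ := h₃.setReg (scratch 24) (pp.elt (pp.α ^ v.val))
  have l7 := hn.elt (pp.α ^ v.val)
  refine Imp.mul (x := pp.elt (Y ^ (SimState.esum pp L f).val)) (y := pp.elt (pp.α ^ v.val))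
    (by simp) (by simp) h₅.regNil (hb.sq (by omega)) ?_
  have l8 : (Str.val (pp.elt (Y ^ (SimState.esum pp L f).val)) *
      Str.val (pp.elt (pp.α ^ v.val))).bits.length ≤ 2 * n := by
    rw [length_bits]
    have := Nat.size_mul_le (Str.val (pp.elt (Y ^ (SimState.esum pp L f).val)))
      (Str.val (pp.elt (pp.α ^ v.val)))
    have := Str.size_val_le (pp.elt (Y ^ (SimState.esum pp L f).val))
    have := Str.size_val_le (pp.elt (pp.α ^ v.val))
    omega
  have h₆ := h₅.setReg (scratch 23) (Str.val (pp.elt (Y ^ (SimState.esum pp L f).val)) *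
      Str.val (pp.elt (pp.α ^ v.val))).bits
  refine Imp.mod (x := (Str.val (pp.elt (Y ^ (SimState.esum pp L f).val)) *
      Str.val (pp.elt (pp.α ^ v.val))).bits) (by simp) h₆.regP h₆.regNil (hb.sq (by omega)) ?_
  rw [Str.val_bits, Str.val_bits, pp.elt_mul]
  exact Imp.nil ⟨h₆.setReg (scratch 23) _, by simp⟩

/-- The commitment in register `23` for the private key in register `23` and the epoch in register
`21`. -/
def keyComCode (L : ℕ) : Prog Empty :=
  block [.op .cat 20 23 21 9, hashCode 1, .op .cat 25 16 9 9, .op .cat 26 9 9 9,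
    block ((List.finRange L).map fun ℓ : Fin L => block [.op (.cst (ℓ.val + 1).bits) 20 9 9 9,
      .op .cat 20 25 20 9, hashCode 1, .op .add 26 26 16 9, .op .mod 26 26 2 9]),
    .op .powMod 23 3 26 1]

theorem length_index_le {L : ℕ} (hL : L.size ≤ n) (ℓ : Fin L) : (ℓ.val + 1).bits.length ≤ n := by
  rw [length_bits]
  exact (Nat.size_le_size ℓ.2).trans hL

theorem imp_keyCom (hLn : L.size ≤ n) (hn : Small pp n) (hb : Budget n e U)
    (h : Rep ids keys id Y m s M) {y j : ℕ} (hy : M.reg 23 = pp.enc y) (hj : M.reg 21 = j.bits)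
    (hl : j.bits.length ≤ e) :
    Imp U (keyComCode L) M (keyCom pp L (SimState.hash pp L J Y) y j s) fun r M' =>
      Rep ids keys id Y m r.2 M' ∧ M'.reg 23 = pp.elt r.1 := by
  have hpos := pp.prime_p.pos
  have l0 := hn.pbits
  have l1 := hn.enc y
  unfold keyCom
  refine Imp.cat hy hj h.regNil (hb.lin (by omega)) ?_
  refine Imp.bindS (imp_hash hn hb (h.setReg (scratch 20) _) (u := pp.enc y ++ j.bits) (by simp)
    (by simp; omega) 1) ?_
  rintro ⟨rj, s₁⟩ M₁ ⟨h₁, -, e₁, -, -⟩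
  have l2 := hn.enc rj
  refine Imp.copy (x := pp.enc rj) e₁ h₁.regNil (hb.lin (by omega)) ?_
  have h₂ := h₁.setReg (scratch 25) (pp.enc rj)
  refine Imp.copy h₂.regNil h₂.regNil (hb.lin (by simp; omega)) ?_
  have h₃ := h₂.setReg (scratch 26) []
  refine Imp.bindS (Imp.fold (I := fun (_ : List (Fin L)) (r : ZMod pp.q × SimState pp L J) M' =>
    Rep ids keys id Y m r.2 M' ∧ M'.reg 25 = pp.enc rj ∧ M'.reg 26 = r.1.val.bits) ?_
    (List.finRange L) 0 s₁ _ ⟨h₃, by simp, by simp⟩) ?_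
  · rintro l acc s₂ ℓ M₂ ⟨h₂, h25, h26⟩
    have l3 := length_index_le hLn ℓ
    refine Imp.cst _ h₂.regNil (hb.lin (by omega)) ?_
    have h₃ := h₂.setReg (scratch 20) (ℓ.val + 1).bits
    refine Imp.cat (x := pp.enc rj) (y := (ℓ.val + 1).bits) (by simpa using h25) (by simp) h₃.regNil
      (hb.lin (by omega)) ?_
    refine Imp.bindS (imp_hash hn hb (h₃.setReg (scratch 20) _)
      (u := pp.enc rj ++ (ℓ.val + 1).bits) (by simp) (by simp; omega) 1) ?_
    rintro ⟨rl, s₄⟩ M₄ ⟨h₄, k₄, e₄, hlt, -⟩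
    refine imp_addMod hn hb h₄ (x := rl) (acc := acc) ?_ e₄ hlt (by omega)
      (Imp.nil ⟨h₄.setReg (scratch 26) _, ?_, by simp⟩)
    · rw [k₄ 26 (by omega) (by omega)]; simpa using h26
    · simpa [k₄ 25 (by omega) (by omega)] using h25
  · rintro ⟨r, s₂⟩ M₂ ⟨h₂, -, h26⟩
    have l3 := hn.elt pp.α
    have l4 := hn.lt (ZMod.val_lt r).le
    refine Imp.powMod (y := r.val.bits) h₂.regα h26 h₂.regP (by simpa using hpos) (hb.cube (by omega)) ?_
    rw [Str.val_bits, Str.val_bits, pp.elt_pow]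
    exact Imp.nil ⟨h₂.setReg (scratch 23) _, by simp⟩

/-- Answer a commitment query. -/
def comCode (L d i j : ℕ) : Prog Empty :=
  block [.load 23 3 (40 + i), .ite 23 (block [.op .add 21 (40 + j) 9 9, .ite 21 (block
      [.op .lt 15 8 21 9, .ite 15 (.op .cat (40 + d) 9 9 9) (block
        [.op .eq 15 (40 + i) 10 9, .ite 15 (comIdCode L) (keyComCode L),
          .op .cat (40 + d) 23 9 9])]) (.op .cat (40 + d) 9 9 9)]) (.op .cat (40 + d) 9 9 9)]

theorem imp_comFail (hb : Budget n e U) (h : Rep ids keys id Y m s M) (d : ℕ) :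
    Imp U (.op .cat (40 + d) 9 9 9) M (PMF.pure (putCom pp m d none, s)) fun r M' =>
      Rep ids keys id Y r.1 r.2 M' := fun f G hf => by
  have := Imp.copy (d := 40 + d) (l := []) h.regNil h.regNil (hb.lin (by simp; omega))
    (Imp.nil (I := fun (r : Mem × SimState pp L J) M' => Rep ids keys id Y r.1 r.2 M')
      (b := (putCom pp m d none, s)) (layout.setReg h d [])) f G hf
  exact this

theorem imp_com' (hL : 1 ≤ L) (hLn : L.size ≤ n) (hn : Small pp n) (hb : Budget n e U)
    (h : Rep ids keys id Y m s M) {i : Str} {j : Fin (J + 1)}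
    (h15 : M.reg 15 = if i = id then [true] else [])
    (h23 : i ≠ id → M.reg 23 = pp.enc (keys i).1) (hj : M.reg 21 = j.val.bits) (hl : J.size ≤ e) :
    Imp U (.ite 15 (comIdCode L) (keyComCode L)) M (SimState.com' pp L J Y keys id i j s)
      fun r M' => Rep ids keys id Y m r.2 M' ∧ M'.reg 23 = pp.elt r.1 := by
  have l1 := hn.q
  unfold SimState.com'
  by_cases c : i = id
  · rw [if_pos c] at h15 ⊢
    exact Imp.ite_pos h15 (hb.lin (by simp; omega)) (by simp) (imp_comId hL hn hb h hj hl)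
  · rw [if_neg c] at h15 ⊢
    exact Imp.ite_neg h15 (hb.lin (by simp; omega)) rfl
      (imp_keyCom hLn hn hb h (h23 c) hj (length_epoch_le j hl))

/-- Membership in the list of users is tested through the key table: its cell is nonzero exactly for
listed identities, with a marker in place of the unknown key of `id`. -/
theorem imp_com (hL : 1 ≤ L) (hLn : L.size ≤ n) (hn : Small pp n) (hid : id ∈ ids)
    (hidn : id.length ≤ n) (d i j : ℕ)
    (hb : Budget n (J.size + (m.reg i).length + (m.reg j).length) U)
    (h : Rep ids keys id Y m s M) :
    Imp U (comCode L d i j) M (SimState.reply pp L J Y ids keys id (.com d i j) m s) fun r M' =>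
      Rep ids keys id Y r.1 r.2 M' := by
  have hi := h.reg i
  have hj := h.reg j
  have hk := h.key (m.reg i)
  simp only [SimState.reply]
  have l1 : (M.arr 3 (m.reg i)).length ≤ n := by
    have l2 := hn.enc (keys (m.reg i)).1
    rw [hk]
    split_ifs
    · simp; omega
    · omega
    · simp
  refine Imp.load 23 3 (40 + i) hi rfl (hb.lin (by omega)) ?_
  have h₁ := h.setReg (scratch 23) (M.arr 3 (m.reg i))
  by_cases c₁ : m.reg i ∈ ids
  swap
  · rw [dif_neg fun hc => c₁ hc.1, stateT_pure_apply]
    have : M.arr 3 (m.reg i) = [] := by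
      rw [hk, if_neg (fun hc : m.reg i = id => c₁ (hc ▸ hid)), if_neg c₁]
    exact Imp.single (Imp.ite_neg (x := []) (by simpa using this) (hb.lin (by simp; omega)) rfl
      (imp_comFail hb h₁ d))
  refine Imp.single (Imp.ite_pos (x := M.arr 3 (m.reg i)) (by simp) (hb.lin (by omega)) ?_ ?_)
  · rw [hk, if_pos c₁]
    have := star_pos (keys (m.reg i))
    split_ifs
    · simp
    · rw [pp.val_enc (star_lt _)]; omega
  -- Adding the empty string, whose value is zero, removes leading zeros from the forger's epoch
  -- number. Array cells and hash inputs use this canonical form.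
  refine Imp.add (x := m.reg j) (y := []) (h₁.reg j) h₁.regNil h₁.regNil
    (hb.lin (by simp; omega)) ?_
  simp only [Str.val_nil, add_zero]
  have h₂ := h₁.setReg (scratch 21) (Str.val (m.reg j)).bits
  have l2 : (Str.val (m.reg j)).bits.length ≤ (m.reg j).length := by
    rw [length_bits]; exact Str.size_val_le _
  by_cases c₂ : Str.val (m.reg j) = 0
  · rw [dif_neg fun hc => by omega, stateT_pure_apply]
    exact Imp.single (Imp.ite_neg (x := (Str.val (m.reg j)).bits) (by simp) (hb.lin (by omega))
      (by simpa using c₂) (imp_comFail hb h₂ d))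
  refine Imp.single (Imp.ite_pos (x := (Str.val (m.reg j)).bits) (by simp) (hb.lin (by omega))
      (by simpa using c₂) ?_)
  have l3 : J.bits.length = J.size := length_bits J
  refine Imp.lt (x := J.bits) (y := (Str.val (m.reg j)).bits) h₂.regJ (by simp) h₂.regNil
    (hb.lin (by omega)) ?_
  simp only [Str.val_bits]
  have h₃ := h₂.setReg (scratch 15) (if J < Str.val (m.reg j) then [true] else [])
  refine Imp.single (Imp.ite (P := J < Str.val (m.reg j)) (by simp) (hb.lin (by omega))
    (fun c₃ => ?_) fun c₃ => ?_)
  · rw [dif_neg fun hc => by omega, stateT_pure_apply]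
    exact imp_comFail hb h₃ d
  rw [dif_pos ⟨c₁, by omega, by omega⟩]
  refine Imp.eq (x := m.reg i) (y := id) (h₃.reg i) h₃.regId h₃.regNil
    (hb.lin (by omega)) ?_
  simp only [Mem.setReg_setReg]
  have h₄ := h₂.setReg (scratch 15) (if m.reg i = id then [true] else [])
  have hJ : Str.val (m.reg j) ≤ J := by omega
  refine Imp.bindS (imp_com' hL hLn hn hb h₄ (i := m.reg i)
    (j := ⟨Str.val (m.reg j), Nat.lt_succ_of_le hJ⟩) (by simp) (fun c₄ => by simp [hk, c₁, c₄])
    (by simp) (by omega)) ?_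
  · rintro ⟨R, s₅⟩ M₅ ⟨h₅, e₅⟩
    have l4 := hn.elt R
    refine Imp.copy (x := pp.elt R) e₅ h₅.regNil (hb.lin (by omega)) ?_
    rw [stateT_pure_apply]
    exact Imp.nil (layout.setReg h₅ d _)

end Code

/-! ### Code for signature and hash queries. -/

section Code

variable {pp : GroupParams} {L J : ℕ} {ids : List Str} {keys : Str → Star pp} {id : Str}
  {Y : (ZMod pp.p)ˣ} {m M : Mem} {s : SimState pp L J} {n e U : ℕ}

theorem Rep.setEpoch (h : Rep ids keys id Y m s M) {E : ℕ} (hE : E ≤ J + 1) :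
    Rep ids keys id Y m { s with epoch := E } (M.setReg 11 E.bits) := by
  have ne : ∀ {i}, i ≠ 11 → (M.setReg 11 E.bits).reg i = M.reg i := by
    intro i hi
    rw [Mem.reg_setReg, if_neg hi]
  exact ⟨fun i => (ne (by omega)).trans (h.reg i), h.arr, (ne (by omega)).trans h.regP,
    (ne (by omega)).trans h.regQ, (ne (by omega)).trans h.regα, (ne (by omega)).trans h.regY,
    (ne (by omega)).trans h.regLen, (ne (by omega)).trans h.regQ1, (ne (by omega)).trans h.regOne,
    (ne (by omega)).trans h.regJ, (ne (by omega)).trans h.regNil, (ne (by omega)).trans h.regId,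
    by simp, (ne (by omega)).trans h.regFlag,
    fun hf => by rw [ne (by omega)]; exact h.cand hf, h.tab, h.key, h.memo, h.memo_none, hE⟩

/-- Store the value `e_j^ℓ` as the hash value of the `ℓ`-th message and the string `x_j^ℓ`, for the
string `x_j` in register `25`. -/
def signStepCode (L a : ℕ) (ℓ : Fin L) : Prog Empty :=
  block [.op (.cst (ℓ.val + 1).bits) 20 9 9 9, .load 26 (arrBase L + a) 20, .op .cat 20 25 20 9,
    hashCode 0, .op .cat 20 26 16 9, .load 24 (5 + ℓ.val) 21, .store 2 20 24]

theorem imp_signStep (hLn : L.size ≤ n) (hn : Small pp n) (hb : Budget n e U)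
    (h : Rep ids keys id Y m s M) {j : Fin (J + 1)} {f : Fin L → Star pp} {v : ZMod pp.q}
    (hm : s.memo j = some (f, v)) (hj : M.reg 21 = j.val.bits) {x : ℕ} (hx : M.reg 25 = pp.enc x)
    (a : ℕ) (ℓ : Fin L) (hl : J.size + (batch L m a ℓ).length ≤ e) :
    Imp U (signStepCode L a ℓ) M (SimState.signStep pp L J Y j (batch L m a) x () ℓ s) fun r M' =>
      Rep ids keys id Y m r.2 M' ∧ r.2.memo j = some (f, v) ∧ M'.reg 21 = j.val.bits ∧
        M'.reg 25 = pp.enc x := by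
  have l1 := length_epoch_le (e := e) j (by omega)
  have l2 := hn.enc x
  have l3 := length_index_le hLn ℓ
  unfold SimState.signStep
  refine Imp.cst _ h.regNil (hb.lin (by omega)) ?_
  have h₁ := h.setReg (scratch 20) (ℓ.val + 1).bits
  refine Imp.load 26 (arrBase L + a) 20 (x := (ℓ.val + 1).bits) (y := batch L m a ℓ) (by simp)
    (congrFun (h₁.arr a) _) (hb.lin (by omega)) ?_
  have h₂ := h₁.setReg (scratch 26) (batch L m a ℓ)
  refine Imp.cat (x := pp.enc x) (y := (ℓ.val + 1).bits) (by simpa using hx) (by simp) h₂.regNil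
    (hb.lin (by omega)) ?_
  refine Imp.bindS (imp_hash hn hb (h₂.setReg (scratch 20) _)
    (u := pp.enc x ++ (ℓ.val + 1).bits) (by simp) (by simp; omega) 0) ?_
  rintro ⟨xl, s₁⟩ M₁ ⟨h₃, k₃, e₃, -, hm₁⟩
  dsimp only at h₃ e₃ hm₁ ⊢
  have l4 := hn.enc xl
  have l5 := hn.enc (f ℓ).1
  refine Imp.cat (x := batch L m a ℓ) (y := pp.enc xl)
    ((k₃ 26 (by omega) (by omega)).trans (by simp)) e₃ h₃.regNil (hb.lin (by omega)) ?_
  have h₄ := h₃.setReg (scratch 20) (batch L m a ℓ ++ pp.enc xl)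
  have h21 : M₁.reg 21 = j.val.bits := by
    rw [k₃ 21 (by omega) (by omega)]; simpa using hj
  rw [← hm₁] at hm
  refine Imp.load 24 (5 + ℓ.val) 21 (x := j.val.bits) (y := pp.enc (f ℓ).1)
    (by simpa using h21) ((h₄.memo j f v hm).2 ℓ) (hb.lin (by omega)) ?_
  have h₅ := h₄.setReg (scratch 24) (pp.enc (f ℓ).1)
  refine Imp.store 2 20 24 (x := batch L m a ℓ ++ pp.enc xl) (y := pp.enc (f ℓ).1) (by simp)
    (by simp) (hb.lin (by simp; omega)) ?_
  -- The hash query has left `memo` unchanged, so the stored value is the one that the simulation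
  -- programs.
  have e : SimState.program pp L J j ℓ (batch L m a ℓ ++ pp.enc xl) s₁ =
      PMF.pure ((), { s₁ with pub := s₁.pub.add 2 (batch L m a ℓ ++ pp.enc xl) (f ℓ) }) := by
    simp [SimState.program, hm]
  rw [e]
  refine Imp.nil ⟨h₅.add 2 _ (f ℓ), hm, by simpa using h21, ?_⟩
  simp [k₃ 25 (by omega) (by omega), hx]

/-- Answer a signature query. -/
def signCode (L ds dx dj a : ℕ) : Prog Empty :=
  block [.op .lt 15 8 11 9, .ite 15 (block [.op .cat (40 + ds) 9 9 9, .op .cat (40 + dx) 9 9 9,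
    .op .cat (40 + dj) 9 9 9]) (block [.op .cat 21 11 9 9, sampleStar 25, touchCode L,
      block ((List.finRange L).map (signStepCode L a)), .load 23 4 21, .op .cat (40 + ds) 23 9 9,
      .op .cat (40 + dx) 25 9 9, .op .cat (40 + dj) 21 9 9, .op .add 11 21 7 9])]

theorem imp_sign (hL : 1 ≤ L) (hLn : L.size ≤ n) (hn : Small pp n) (ds dx dj a : ℕ)
    (hb : Budget n (J.size + ∑ ℓ, (batch L m a ℓ).length) U) (h : Rep ids keys id Y m s M) :
    Imp U (signCode L ds dx dj a) M (SimState.reply pp L J Y ids keys id (.sign ds dx dj a) m s)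
      fun r M' => Rep ids keys id Y r.1 r.2 M' := by
  have l1 := hn.q
  have l2 : s.epoch.bits.length ≤ J.size + 1 := by
    rw [length_bits, Nat.size_le, pow_succ]
    have := h.epoch_le
    have := Nat.lt_size_self J
    omega
  have l3 : J.bits.length = J.size := length_bits J
  simp only [SimState.reply]
  refine Imp.lt h.regJ h.regEpoch h.regNil (hb.lin (by omega)) ?_
  simp only [Str.val_bits]
  have h₁ := h.setReg (scratch 15) (if J < s.epoch then [true] else [])
  refine Imp.single (Imp.ite (P := J < s.epoch) (by simp) (hb.lin (by omega)) (fun hc => ?_)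
    fun hc => ?_)
  · rw [dif_neg (by omega)]
    refine Imp.copy h₁.regNil h₁.regNil (hb.lin (by simp; omega)) ?_
    have h₂ := layout.setReg h₁ ds []
    refine Imp.copy h₂.regNil h₂.regNil (hb.lin (by simp; omega)) ?_
    have h₃ := layout.setReg h₂ dx []
    refine Imp.copy h₃.regNil h₃.regNil (hb.lin (by simp; omega)) ?_
    exact Imp.nil (layout.setReg h₃ dj [])
  · have hE : s.epoch ≤ J := by omega
    rw [dif_pos hE]
    generalize hj : (⟨s.epoch, Nat.lt_succ_of_le hE⟩ : Fin (J + 1)) = j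
    have hjv : j.val = s.epoch := by rw [← hj]
    refine Imp.copy h₁.regEpoch h₁.regNil (hb.lin (by omega)) ?_
    have h₂ := h₁.setReg (scratch 21) s.epoch.bits
    unfold SimState.sign
    simp only [stateT_bind_apply, PMF.bind_bind, PMF.pure_bind]
    refine Imp.bind (imp_sampleStar hn hb (by omega) h₂.regLen h₂.regQ1 h₂.regOne h₂.regNil)
      fun x M₃ hM₃ => ?_
    have h₃ := h₂.setReg (scratch 25) (pp.enc x.1)
    rw [← hM₃] at h₃
    have l4 := hn.enc x.1
    refine Imp.bind (imp_touch hL hn hb h₃ (j := j) (by simp [hM₃, hjv]) (by omega)) ?_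
    rintro ⟨⟨⟩, s₄⟩ M₄ ⟨h₄, k₄, ⟨f, v⟩, hv⟩
    dsimp only at h₄ hv ⊢
    refine Imp.bind (Imp.fold (I := fun (_ : List (Fin L)) (r : Unit × SimState pp L J) M' =>
      Rep ids keys id Y m r.2 M' ∧ r.2.memo j = some (f, v) ∧ M'.reg 21 = j.val.bits ∧
        M'.reg 25 = pp.enc x.1) (fun l b s' ℓ M' hI => imp_signStep hLn hn hb hI.1 hI.2.1 hI.2.2.1
          hI.2.2.2 a ℓ ?_) (List.finRange L) () s₄ M₄ ⟨h₄, hv, ?_, ?_⟩) ?_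
    · have := Finset.single_le_sum (f := fun ℓ => (batch L m a ℓ).length) (fun _ _ => Nat.zero_le _)
        (Finset.mem_univ ℓ)
      omega
    · rw [k₄ 21 (by omega), hM₃]; simp [hjv]
    · rw [k₄ 25 (by omega), hM₃]; simp
    · rintro ⟨⟨⟩, s₅⟩ M₅ ⟨h₅, hm₅, h21, h25⟩
      dsimp only at h₅ hm₅ ⊢
      have l5 := hn.lt (ZMod.val_lt v).le
      have l6 := length_epoch_le (e := J.size) j le_rfl
      refine Imp.load 23 4 21 h21 (h₅.memo j f v hm₅).1 (hb.lin (by omega)) ?_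
      have h₆ := h₅.setReg (scratch 23) v.val.bits
      refine Imp.copy (x := v.val.bits) (by simp) h₆.regNil (hb.lin (by omega)) ?_
      have h₇ := layout.setReg h₆ ds v.val.bits
      refine Imp.copy (x := pp.enc x.1) ?_ h₇.regNil (hb.lin (by omega)) ?_
      · simpa [show 25 ≠ 40 + ds by omega] using h25
      have h₈ := layout.setReg h₇ dx (pp.enc x.1)
      refine Imp.copy (x := j.val.bits) ?_ h₈.regNil (hb.lin (by omega)) ?_
      · simpa [show 21 ≠ 40 + ds by omega, show 21 ≠ 40 + dx by omega] using h21
      have h₉ := layout.setReg h₈ dj j.val.bits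
      refine Imp.add (x := j.val.bits) (y := [true]) ?_ h₉.regOne h₉.regNil
        (hb.lin (by simp; omega)) ?_
      · simpa [show 21 ≠ 40 + ds by omega, show 21 ≠ 40 + dx by omega,
          show 21 ≠ 40 + dj by omega] using h21
      have h₁₀ := h₉.setEpoch (E := s.epoch + 1) (by omega)
      simp only [Str.val_bits, Str.val_true]
      simp only [SimState.read, hm₅, stateT_pure_apply, PMF.pure_bind, Option.getD_some]
      rw [hjv] at h₁₀ ⊢
      exact Imp.nil h₁₀

/-- Answer a hash query. -/
def queryHashCode (k : Fin 3) (d u : ℕ) : Prog Empty :=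
  block [.op .cat 20 (40 + u) 9 9, hashCode k, .op .cat (40 + d) 16 9 9]

theorem imp_queryHash (hn : Small pp n) (k : Fin 3) (d u : ℕ)
    (hb : Budget n (m.reg u).length U) (h : Rep ids keys id Y m s M) :
    Imp U (queryHashCode k d u) M (SimState.reply pp L J Y ids keys id (.hash k d u) m s)
      fun r M' => Rep ids keys id Y r.1 r.2 M' := by
  simp only [SimState.reply]
  refine Imp.copy (h.reg u) h.regNil (hb.lin (by have := hn.q; omega)) ?_
  refine Imp.bindS (imp_hash hn hb (h.setReg (scratch 20) _) (u := m.reg u) (by simp)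
    (by omega) k) ?_
  rintro ⟨x, s₁⟩ M₁ ⟨h₁, -, e₁, -, -⟩
  have l1 := hn.enc x
  refine Imp.copy (x := pp.enc x) e₁ h₁.regNil (hb.lin (by omega)) (Imp.nil ?_)
  exact layout.setReg h₁ d _

/-- The code that replaces an oracle call. -/
def callCode (L : ℕ) : Query → Prog Empty
  | .hash k d u => queryHashCode k d u
  | .sign ds dx dj a => signCode L ds dx dj a
  | .com d i j => comCode L d i j

/-- The constant `C` bounds the cubic cost on strings of parameter length by a multiple of `κ ^ 3 +
1`. The lengths of the forger's own strings enter linearly and are part of the price of the call. -/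
theorem imp_call (hL : 1 ≤ L) (hLn : L.size ≤ n) (hn : Small pp n) (hid : id ∈ ids)
    (hidn : id.length ≤ n) {κ C : ℕ} (hC : (6 * n + 2) ^ 3 ≤ C * (κ ^ 3 + 1)) (hC4 : 4 ≤ C)
    (x : Query) (m : Mem) (s : SimState pp L J) (M : Mem) (h : Rep ids keys id Y m s M) :
    Imp (C * queryCost L κ J x m) (callCode L x) M (SimState.reply pp L J Y ids keys id x m s)
      fun r M' => Rep ids keys id Y r.1 r.2 M' := by
  have key : ∀ e, Budget n e (C * (κ ^ 3 + 1 + e)) := fun e => ⟨by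
    have := Nat.mul_le_mul_right e hC4
    rw [Nat.mul_add]
    omega⟩
  cases x with
  | hash k d u => exact imp_queryHash hn k d u (key _) h
  | sign ds dx dj a =>
    refine imp_sign hL hLn hn ds dx dj a ?_ h
    have := key (J.size + ∑ ℓ, (batch L m a ℓ).length)
    rwa [← Nat.add_assoc] at this
  | com d i j =>
    refine imp_com hL hLn hn hid hidn d i j ?_ h
    have := key (J.size + (m.reg i).length + (m.reg j).length)
    rwa [← Nat.add_assoc, ← Nat.add_assoc] at this

end Code

/-! ### Code for the extraction of the discrete logarithm. -/

section Code

variable {pp : GroupParams} {L J : ℕ} {ids : List Str} {keys : Str → Star pp} {id : Str}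
  {Y : (ZMod pp.p)ˣ} {m M : Mem} {s : SimState pp L J} {n e U : ℕ}

/-- One step of the computation of the verification exponent. -/
def verStepCode (L : ℕ) (ℓ : Fin L) : Prog Empty :=
  block [.op (.cst (ℓ.val + 1).bits) 20 9 9 9, .load 26 (arrBase L + 1) 20, .op .cat 20 25 20 9,
    hashCode 0, .op .cat 20 26 16 9, hashCode 2, .op .add 27 27 16 9, .op .mod 27 27 2 9]

theorem imp_verStep (hLn : L.size ≤ n) (hn : Small pp n) (hb : Budget n e U)
    (h : Rep ids keys id Y m s M) {x : ℕ} (hx : M.reg 25 = pp.enc x) {acc : ZMod pp.q}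
    (ha : M.reg 27 = acc.val.bits) (ℓ : Fin L) (hl : (batch L m 1 ℓ).length ≤ e) :
    Imp U (verStepCode L ℓ) M ((do
      let xl ← SimState.hash pp L J Y 0 (pp.enc x ++ (ℓ.val + 1).bits)
      let el ← SimState.hash pp L J Y 2 (batch L m 1 ℓ ++ pp.enc xl)
      pure (acc + (el : ZMod pp.q)) : StateT (SimState pp L J) PMF (ZMod pp.q)) s) fun r M' =>
      Rep ids keys id Y m r.2 M' ∧ M'.reg 25 = pp.enc x ∧ M'.reg 27 = r.1.val.bits ∧
        M'.reg 23 = M.reg 23 ∧ M'.reg 24 = M.reg 24 := by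
  have l2 := hn.enc x
  have l3 := length_index_le hLn ℓ
  refine Imp.cst _ h.regNil (hb.lin (by omega)) ?_
  have h₁ := h.setReg (scratch 20) (ℓ.val + 1).bits
  refine Imp.load 26 (arrBase L + 1) 20 (x := (ℓ.val + 1).bits) (y := batch L m 1 ℓ) (by simp)
    (congrFun (h₁.arr 1) _) (hb.lin (by omega)) ?_
  have h₂ := h₁.setReg (scratch 26) (batch L m 1 ℓ)
  refine Imp.cat (x := pp.enc x) (y := (ℓ.val + 1).bits) (by simpa using hx) (by simp) h₂.regNil
    (hb.lin (by omega)) ?_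
  refine Imp.bindS (imp_hash hn hb (h₂.setReg (scratch 20) _)
    (u := pp.enc x ++ (ℓ.val + 1).bits) (by simp) (by simp; omega) 0) ?_
  rintro ⟨xl, s₁⟩ M₁ ⟨h₃, k₃, e₃, -, -⟩
  dsimp only at h₃ e₃ ⊢
  have l4 := hn.enc xl
  refine Imp.cat (x := batch L m 1 ℓ) (y := pp.enc xl)
    ((k₃ 26 (by omega) (by omega)).trans (by simp)) e₃ h₃.regNil (hb.lin (by omega)) ?_
  have h₄ := h₃.setReg (scratch 20) (batch L m 1 ℓ ++ pp.enc xl)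
  refine Imp.bindS (imp_hash hn hb h₄
    (u := batch L m 1 ℓ ++ pp.enc xl) (by simp) (by simp; omega) 2) ?_
  rintro ⟨el, s₅⟩ M₅ ⟨h₅, k₅, e₅, lt₅, -⟩
  dsimp only at h₅ e₅ lt₅ ⊢
  have k : ∀ i, 21 ≤ i → i ≠ 26 → i < 40 → M₅.reg i = M.reg i := by
    intro i h₁ h₂ h₃
    rw [k₅ i (by omega) h₃, Mem.reg_setReg, if_neg (by omega), k₃ i (by omega) h₃]
    simp [h₂, show i ≠ 20 by omega]
  refine imp_addMod hn hb h₅ (acc := acc) ((k 27 (by omega) (by omega) (by omega)).trans ha) e₅ lt₅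
    (by omega) ?_
  rw [stateT_pure_apply]
  refine Imp.nil ⟨h₅.setReg (scratch 27) _, ?_, by simp, ?_, ?_⟩
  · simpa [k 25 (by omega) (by omega) (by omega)] using hx
  · simp [k 23 (by omega) (by omega) (by omega)]
  · simp [k 24 (by omega) (by omega) (by omega)]

/-- Extract the discrete logarithm from a forgery for the epoch in register `21`. -/
def extractCode (L : ℕ) : Prog Empty :=
  block [touchCode L, .op .cat 23 9 9 9, esumCode L, .load 24 4 21, .op .pad 25 41 5 9,
    .op .cat 27 9 9 9, block ((List.finRange L).map (verStepCode L)),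
    .op .add 24 24 2 9, .op .sub 24 24 40 9, .op .add 27 27 2 9, .op .sub 27 27 23 9,
    .op .mod 27 27 2 9, .op .sub 28 6 7 9, .op .powMod 27 27 28 2, .op .mul 24 24 27 9,
    .op .mod 0 24 2 9]

/-- The machine's subtraction stops at zero, so `q` is added before subtracting. This does not
change the residue. -/
theorem val_extract {v e f : ZMod pp.q} {a : ℕ} (ha : a < pp.q) :
    (v.val + pp.q - a) * (((e.val + pp.q - f.val) % pp.q) ^ (pp.q - 1 - 1) % pp.q) % pp.q =
      ((v - a) * (e - f) ^ (pp.q - 2)).val := by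
  have hf := ZMod.val_lt f
  rw [← ZMod.val_natCast]
  congr 1
  rw [Nat.cast_mul, ZMod.natCast_mod, Nat.cast_pow, ZMod.natCast_mod, Nat.cast_sub (by omega),
    Nat.cast_sub (by omega), Nat.sub_sub]
  simp

theorem size_add_q_le (hn : Small pp n) {x : ℕ} (hx : x ≤ pp.q + pp.q) : x.bits.length ≤ n := by
  rw [length_bits]
  refine (Nat.size_le.2 ?_).trans hn.q
  have := Nat.lt_size_self pp.q
  rw [pow_succ]
  omega

theorem imp_extract (hL : 1 ≤ L) (hLn : L.size ≤ n) (hn : Small pp n) (hb : Budget n e U)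
    (h : Rep ids keys id Y m s M) {j : Fin (J + 1)} (hj : M.reg 21 = j.val.bits) (hl : J.size ≤ e)
    (hm : ∀ ℓ, (batch L m 1 ℓ).length ≤ e) (h0 : (m.reg 0).length ≤ e) (h1 : (m.reg 1).length ≤ e)
    (hs : (m.reg 0).val < pp.q) (hx : (m.reg 1).val < pp.q) :
    Imp U (extractCode L) M
      (SimState.extract pp L J Y j (batch L m 1) (m.reg 0).val (m.reg 1).val s) fun r M' =>
        Rep ids keys id Y m r.2 M' ∧ M'.reg 0 = r.1.val.bits := by
  have l1 := length_epoch_le j hl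
  have lq := hn.q
  have lb := hn.lt (x := pp.q) le_rfl
  have hq := pp.prime_q.pos
  unfold SimState.extract
  refine Imp.bindS (imp_touch hL hn hb h hj hl) ?_
  rintro ⟨⟨⟩, s₁⟩ M₁ ⟨h₁, k₁, ⟨f, v⟩, hv⟩
  dsimp only at h₁ hv ⊢
  rw [read_bind j _ hv]
  refine Imp.copy h₁.regNil h₁.regNil (hb.lin (by simp; omega)) ?_
  refine Imp.then_ (imp_esum hn hb (h₁.setReg (scratch 23) []) hv
    (by simpa [k₁ 21 (by omega)] using hj) hl (by simp)) fun M₂ ⟨h₂, k₂, hs₂⟩ => ?_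
  have l4 := hn.lt (ZMod.val_lt v).le
  refine Imp.load 24 4 21 (x := j.val.bits) (y := v.val.bits) ?_ (h₂.memo j f v hv).1
    (hb.lin (by omega)) ?_
  · simpa [k₂ 21 (by omega) (by omega), k₁ 21 (by omega)] using hj
  have h₃ := h₂.setReg (scratch 24) v.val.bits
  have l5 := hn.size
  -- The forger may write `x` with any number of digits. Padding produces the fixed-length encoding,
  -- without loss because `x < q`.
  refine Imp.pad (h₃.reg 1) h₃.regLen h₃.regNil (hb.lin (by simp; omega)) ?_
  have e₁ : fixedBits (Str.val pp.q.size.bits) (Str.val (m.reg 1)) =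
      pp.enc ((Str.val (m.reg 1) : ZMod pp.q)).val := by
    rw [Str.val_bits, ZMod.val_natCast, Nat.mod_eq_of_lt hx]
    rfl
  rw [e₁]
  generalize ((Str.val (m.reg 1) : ℕ) : ZMod pp.q) = x
  have h₄ := h₃.setReg (scratch 25) (pp.enc x.val)
  refine Imp.copy h₄.regNil h₄.regNil (hb.lin (by simp; omega)) ?_
  have h₅ := h₄.setReg (scratch 27) []
  unfold verSum
  refine Imp.bindS (Imp.fold (I := fun (_ : List (Fin L)) (r : ZMod pp.q × SimState pp L J) M' =>
    Rep ids keys id Y m r.2 M' ∧ M'.reg 25 = pp.enc x.val ∧ M'.reg 27 = r.1.val.bits ∧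
      M'.reg 23 = (SimState.esum pp L f).val.bits ∧ M'.reg 24 = v.val.bits) ?_
    (List.finRange L) 0 s₁ _ ⟨h₅, by simp, by simp, by simpa using hs₂, by simp⟩) ?_
  · rintro l acc s' ℓ M' ⟨h', h25, h27, h23, h24⟩
    refine (imp_verStep hLn hn hb h' h25 h27 ℓ (hm ℓ)).weaken ?_
    rintro r M'' ⟨c₁, c₂, c₃, c₄, c₅⟩
    exact ⟨c₁, c₂, c₃, c₄.trans h23, c₅.trans h24⟩
  rintro ⟨w, s₆⟩ M₆ ⟨h₆, -, h27, h23, h24⟩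
  dsimp only at h₆ h27 ⊢
  have lv := ZMod.val_lt v
  have lw := ZMod.val_lt w
  have l6 := hn.lt lw.le
  have lf := ZMod.val_lt (SimState.esum pp L f)
  have l7 := hn.lt lf.le
  refine Imp.add h24 h₆.regQ h₆.regNil (hb.lin (by omega)) ?_
  rw [Str.val_bits, Str.val_bits]
  have l8 := size_add_q_le hn (x := v.val + pp.q) (by omega)
  have h₇ := h₆.setReg (scratch 24) (v.val + pp.q).bits
  refine Imp.sub (x := (v.val + pp.q).bits) (by simp) (h₇.reg 0) h₇.regNil (hb.lin (by omega)) ?_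
  rw [Mem.setReg_setReg, Str.val_bits]
  have l9 := size_add_q_le hn (x := v.val + pp.q - Str.val (m.reg 0)) (by omega)
  have h₈ := h₆.setReg (scratch 24) (v.val + pp.q - Str.val (m.reg 0)).bits
  refine Imp.add (x := w.val.bits) (by simpa using h27) h₈.regQ h₈.regNil (hb.lin (by omega)) ?_
  rw [Str.val_bits, Str.val_bits]
  have l10 := size_add_q_le hn (x := w.val + pp.q) (by omega)
  have h₉ := h₈.setReg (scratch 27) (w.val + pp.q).bits
  refine Imp.sub (x := (w.val + pp.q).bits) (y := (SimState.esum pp L f).val.bits) (by simp)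
    (by simpa using h23) h₉.regNil (hb.lin (by omega)) ?_
  rw [Mem.setReg_setReg, Str.val_bits, Str.val_bits]
  have l11 := size_add_q_le hn (x := w.val + pp.q - (SimState.esum pp L f).val) (by omega)
  have h₁₀ := h₈.setReg (scratch 27) (w.val + pp.q - (SimState.esum pp L f).val).bits
  refine Imp.mod (x := (w.val + pp.q - (SimState.esum pp L f).val).bits) (by simp) h₁₀.regQ
    h₁₀.regNil (hb.sq (by omega)) ?_
  rw [Mem.setReg_setReg, Str.val_bits, Str.val_bits]
  have l12 := hn.lt (Nat.mod_lt (w.val + pp.q - (SimState.esum pp L f).val) hq).le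
  have h₁₁ := h₈.setReg (scratch 27) ((w.val + pp.q - (SimState.esum pp L f).val) % pp.q).bits
  have l13 := hn.lt (Nat.sub_le pp.q 1)
  have l14 := hn.lt (x := pp.q - 1 - 1) (by omega)
  refine Imp.sub h₁₁.regQ1 h₁₁.regOne h₁₁.regNil (hb.lin (by simp; omega)) ?_
  rw [Str.val_bits, Str.val_true]
  have h₁₂ := h₁₁.setReg (scratch 28) (pp.q - 1 - 1).bits
  refine Imp.powMod (x := ((w.val + pp.q - (SimState.esum pp L f).val) % pp.q).bits)
    (y := (pp.q - 1 - 1).bits) (by simp) (by simp) h₁₂.regQ (by simpa using hq)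
    (hb.cube (by omega)) ?_
  rw [Str.val_bits, Str.val_bits, Str.val_bits]
  generalize hg : ((w.val + pp.q - (SimState.esum pp L f).val) % pp.q) ^ (pp.q - 1 - 1) % pp.q = g
  have l15 := hn.lt (x := g) (by rw [← hg]; exact (Nat.mod_lt _ hq).le)
  have h₁₃ := h₁₂.setReg (scratch 27) g.bits
  refine Imp.mul (x := (v.val + pp.q - Str.val (m.reg 0)).bits) (y := g.bits) (by simp) (by simp)
    h₁₃.regNil (hb.sq (by omega)) ?_
  rw [Str.val_bits, Str.val_bits]
  have l16 : ((v.val + pp.q - Str.val (m.reg 0)) * g).bits.length ≤ 2 * n := by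
    have := Nat.size_mul_le (v.val + pp.q - Str.val (m.reg 0)) g
    simp only [length_bits] at *
    omega
  have h₁₄ := h₁₃.setReg (scratch 24) ((v.val + pp.q - Str.val (m.reg 0)) * g).bits
  refine Imp.mod (x := ((v.val + pp.q - Str.val (m.reg 0)) * g).bits) (by simp) h₁₄.regQ h₁₄.regNil
    (hb.sq (by omega)) ?_
  rw [Str.val_bits, Str.val_bits, stateT_pure_apply]
  refine Imp.nil ⟨h₁₄.setReg (Or.inl rfl) _, ?_⟩
  rw [Mem.reg_setReg, if_pos rfl, ← hg, val_extract hs]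

/-- Compute the discrete logarithm when the forger has stopped. -/
def finalCode (L : ℕ) : Prog Empty :=
  block [.op .lt 15 40 2 9, .ite 15 (block [.op .lt 15 41 2 9, .ite 15 (block [.op .add 21 42 9 9,
      .ite 21 (block [.op .lt 15 8 21 9, .ite 15 (.op .cat 0 9 9 9) (extractCode L)])
        (.op .cat 0 9 9 9)]) (.op .cat 0 9 9 9)]) (.op .cat 0 9 9 9),
    .ite 12 (.op .cat 0 13 9 9) .skip]

theorem imp_finish_fail (hb : Budget n e U) (h : Rep ids keys id Y m s M) :
    Imp U (.op .cat 0 9 9 9) M (PMF.pure ((0 : ZMod pp.q), s)) fun r M' =>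
      Rep ids keys id Y m r.2 M' ∧ M'.reg 0 = r.1.val.bits := fun f G hf => by
  have := Imp.copy (d := 0) (l := []) h.regNil h.regNil (hb.lin (by simp; omega))
    (Imp.nil (I := fun (r : ZMod pp.q × SimState pp L J) M' => Rep ids keys id Y m r.2 M' ∧
      M'.reg 0 = r.1.val.bits)
      (b := (0, s)) ⟨h.setReg (Or.inl rfl) [], by simp⟩) f G hf
  exact this

/-- A raised flag overrides the result of the extraction with the candidate in register 13, so the
two ways of success in `Fails` are both realized. -/
theorem imp_finish (hL : 1 ≤ L) (hLn : L.size ≤ n) (hn : Small pp n) (hb : Budget n e U)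
    (h : Rep ids keys id Y m s M) (hl : J.size ≤ e)
    (hm : ∀ ℓ, (batch L m 1 ℓ).length ≤ e) (hr : ∀ i, (m.reg i).length ≤ e) :
    Imp U (finalCode L) M (SimState.finish pp L J Y m s) fun r M' =>
      pp.α ^ (M'.reg 0).val = Y ∨ M'.reg 0 = r.1.val.bits ∧ r.2.pub.flag = false := by
  have lq := hn.q
  have lb := hn.lt (x := pp.q) le_rfl
  have r0 := hr 0
  have r1 := hr 1
  have r2 := hr 2
  refine Imp.lt (h.reg 0) h.regQ h.regNil (hb.lin (by omega)) ?_
  rw [← PMF.bind_pure (SimState.finish pp L J Y m s)]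
  have h₁ := h.setReg (scratch 15) (if Str.val (m.reg 0) < Str.val pp.q.bits then [true] else [])
  refine Imp.bind (I := fun r M' => Rep ids keys id Y m r.2 M' ∧ M'.reg 0 = r.1.val.bits) ?_ ?_
  · unfold SimState.finish
    refine Imp.ite (P := Str.val (m.reg 0) < Str.val pp.q.bits) (by simp) (hb.lin (by omega))
      (fun c₁ => ?_) fun c₁ => ?_
    swap
    · rw [Str.val_bits] at c₁
      rw [dif_neg fun hc => c₁ hc.1]
      exact imp_finish_fail hb h₁
    refine Imp.lt (h₁.reg 1) h₁.regQ h₁.regNil (hb.lin (by omega)) ?_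
    rw [Mem.setReg_setReg]
    have h₂ := h.setReg (scratch 15) (if Str.val (m.reg 1) < Str.val pp.q.bits then [true] else [])
    refine Imp.single (Imp.ite (P := Str.val (m.reg 1) < Str.val pp.q.bits) (by simp)
      (hb.lin (by omega)) (fun c₂ => ?_) fun c₂ => ?_)
    swap
    · rw [Str.val_bits] at c₂
      rw [dif_neg fun hc => c₂ hc.2.1]
      exact imp_finish_fail hb h₂
    refine Imp.add (h₂.reg 2) h₂.regNil h₂.regNil (hb.lin (by simp; omega)) ?_
    rw [Str.val_nil, Nat.add_zero]
    have h₃ := h₂.setReg (scratch 21) (Str.val (m.reg 2)).bits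
    have l2 : (Str.val (m.reg 2)).bits.length ≤ (m.reg 2).length := by
      rw [length_bits]; exact Str.size_val_le _
    by_cases c₃ : Str.val (m.reg 2) = 0
    · rw [dif_neg fun hc => by omega]
      exact Imp.single (Imp.ite_neg (x := (Str.val (m.reg 2)).bits) (by simp) (hb.lin (by omega))
        (by simpa using c₃) (imp_finish_fail hb h₃))
    refine Imp.single (Imp.ite_pos (x := (Str.val (m.reg 2)).bits) (by simp) (hb.lin (by omega))
      (by simpa using c₃) ?_)
    have l3 : J.bits.length = J.size := length_bits J
    refine Imp.lt (x := J.bits) (y := (Str.val (m.reg 2)).bits) h₃.regJ (by simp) h₃.regNil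
      (hb.lin (by omega)) ?_
    have h₄ := h₃.setReg (scratch 15)
      (if Str.val J.bits < Str.val (Str.val (m.reg 2)).bits then [true] else [])
    refine Imp.single (Imp.ite (P := Str.val J.bits < Str.val (Str.val (m.reg 2)).bits) (by simp)
      (hb.lin (by omega)) (fun c₄ => ?_) fun c₄ => ?_)
    · rw [Str.val_bits, Str.val_bits] at c₄
      rw [dif_neg fun hc => by omega]
      exact imp_finish_fail hb h₄
    · rw [Str.val_bits] at c₁ c₂
      rw [Str.val_bits, Str.val_bits] at c₄
      rw [dif_pos ⟨c₁, c₂, by omega, by omega⟩]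
      exact imp_extract hL hLn hn hb h₄ (by simp) hl hm r0 r1 c₁ c₂
  · rintro ⟨r, s₁⟩ M₁ ⟨h₅, e₅⟩
    dsimp only at h₅ e₅
    refine Imp.single (Imp.ite h₅.regFlag (hb.lin (by omega)) (fun hf => ?_) fun hf => ?_)
    · obtain ⟨c₁, c₂⟩ := h₅.cand hf
      refine Imp.copy (l := []) rfl h₅.regNil (hb.lin (by omega)) (Imp.nil (Or.inl ?_))
      simpa using c₁
    · exact Imp.skip (Or.inr ⟨e₅, by simpa using hf⟩)

end Code

/-! ### Initialization of the reduction -/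

/-- Choose the private keys of the users in a list, except for those in `S`. -/
def sampleInto {pp : GroupParams} (S : List Str) : List Str → (Str → Star pp) → PMF (Str → Star pp)
  | [], k => PMF.pure k
  | i :: l, k => if i ∈ S then sampleInto S l k else
      (unif pp).bind fun h => sampleInto (i :: S) l (Function.update k i h)

/-- Choose the private keys of the users in a list, except for those in `S`, and store them and the
table of the public keys. -/
def keysCode (L : ℕ) (S : List Str) : List Str → List (Prog Empty)
  | [] => []
  | i :: l => if i ∈ S then keysCode L S l else
      block [sampleStar 16, .op (.cst i) 20 9 9 9, .store 3 20 16, .op .powMod 17 3 16 1,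
        .store (arrBase L) 20 17] :: keysCode L (i :: S) l

/-- Prepare the memory for the forger. -/
def initCode (L : ℕ) (ids : List Str) (J : ℕ) (id : Str) : Prog Empty :=
  block [.op (.cst [true]) 7 9 9 9, .op .len 5 2 9 9, .op .sub 6 2 7 9, .op (.cst J.bits) 8 9 9 9,
    .op (.cst id) 10 9 9 9, .op (.cst [true]) 11 9 9 9, .store 3 10 7, .store (arrBase L) 10 4,
    block (keysCode L [id] ids), .op .cat 40 0 9 9, .op .cat 41 1 9 9, .op .cat 42 2 9 9,
    .op .cat 43 3 9 9, .op .cat 44 8 9 9, .op (.cst L.bits) 45 9 9 9, .op .cat 46 10 9 9,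
    .op .cat 47 4 9 9]

section Init

variable {pp : GroupParams} {L J κ : ℕ} {ids : List Str} {keys : Str → Star pp} {id : Str}
  {Y : (ZMod pp.p)ˣ} {m M : Mem} {s : SimState pp L J} {n e U : ℕ}

open Classical in
/-- The memory during the choice of the keys; the keys of the users with the property `P` have been
chosen. -/
structure KeyRep (L J κ : ℕ) (id : Str) (Y : (ZMod pp.p)ˣ) (P : Str → Prop)
    (keys : Str → Star pp) (M : Mem) : Prop where
  reg0 : M.reg 0 = κ.bits
  regP : M.reg 1 = pp.p.bits
  regQ : M.reg 2 = pp.q.bits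
  regα : M.reg 3 = pp.elt pp.α
  regY : M.reg 4 = pp.elt Y
  regLen : M.reg 5 = pp.q.size.bits
  regQ1 : M.reg 6 = (pp.q - 1).bits
  regOne : M.reg 7 = [true]
  regJ : M.reg 8 = J.bits
  regNil : M.reg 9 = []
  regId : M.reg 10 = id
  regEpoch : M.reg 11 = [true]
  regFlag : M.reg 12 = []
  rest : ∀ i, 40 ≤ i → M.reg i = []
  key : ∀ u, M.arr 3 u = if u = id then [true] else if P u then pp.enc (keys u).1 else []
  tab : ∀ u, M.arr (arrBase L) u = if P u then pp.elt (pp.α ^ (keys u).1) else []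
  arr : ∀ k, k ≠ 3 → k ≠ arrBase L → ∀ u, M.arr k u = []

theorem KeyRep.step {P : Str → Prop} (h : KeyRep L J κ id Y P keys M) {i : Str} (hi : i ≠ id)
    {M' : Mem} (v : Star pp)
    (hr : ∀ r, r ≠ 16 → r ≠ 17 → r ≠ 20 → M'.reg r = M.reg r)
    (ha : ∀ k u, M'.arr k u = if k = arrBase L ∧ u = i then pp.elt (pp.α ^ v.1) else
      if k = 3 ∧ u = i then pp.enc v.1 else M.arr k u) :
    KeyRep L J κ id Y (fun u => u = i ∨ P u) (Function.update keys i v) M' := by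
  have h3 : 3 ≠ arrBase L := by unfold arrBase; omega
  refine ⟨(hr _ (by omega) (by omega) (by omega)).trans h.reg0,
    (hr _ (by omega) (by omega) (by omega)).trans h.regP,
    (hr _ (by omega) (by omega) (by omega)).trans h.regQ,
    (hr _ (by omega) (by omega) (by omega)).trans h.regα,
    (hr _ (by omega) (by omega) (by omega)).trans h.regY,
    (hr _ (by omega) (by omega) (by omega)).trans h.regLen,
    (hr _ (by omega) (by omega) (by omega)).trans h.regQ1,
    (hr _ (by omega) (by omega) (by omega)).trans h.regOne,
    (hr _ (by omega) (by omega) (by omega)).trans h.regJ,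
    (hr _ (by omega) (by omega) (by omega)).trans h.regNil,
    (hr _ (by omega) (by omega) (by omega)).trans h.regId,
    (hr _ (by omega) (by omega) (by omega)).trans h.regEpoch,
    (hr _ (by omega) (by omega) (by omega)).trans h.regFlag,
    fun r h40 => (hr _ (by omega) (by omega) (by omega)).trans (h.rest r h40), fun u => ?_,
    fun u => ?_, fun k hk hk' u => ?_⟩
  · rw [ha, if_neg fun hc => h3 hc.1]
    by_cases hu : u = i
    · subst hu; simp [hi]
    · by_cases hp : P u <;> simp [hu, hp, h.key]
  · rw [ha]
    by_cases hu : u = i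
    · subst hu; simp
    · by_cases hp : P u <;> simp [hu, hp, h.tab]
  · rw [ha, if_neg fun hc => hk' hc.1, if_neg fun hc => hk hc.1]
    exact h.arr k hk hk' u

theorem KeyRep.congr {P P' : Str → Prop} (h : KeyRep L J κ id Y P keys M) (hP : ∀ u, P u ↔ P' u) :
    KeyRep L J κ id Y P' keys M := by
  have : P = P' := funext fun u => propext (hP u)
  rwa [← this]

/-- The list `S` contains the identities already treated, `id` among them. The key of the challenge
is therefore never drawn, and repeated identities receive one key. -/
theorem imp_keys (hn : Small pp n) (hb : Budget n e U) (l : List Str) (hl : ∀ i ∈ l, i.length ≤ n) :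
    ∀ (S : List Str) (keys : Str → Star pp) (M : Mem), id ∈ S →
      KeyRep L J κ id Y (fun u => u ∈ S) keys M →
      Imp U (block (keysCode L S l)) M (sampleInto S l keys) fun k M' =>
        KeyRep L J κ id Y (fun u => u ∈ S ∨ u ∈ l) k M' := by
  have lq := hn.q
  have lp := hn.pbits
  induction l with
  | nil =>
    intro S keys M hS h
    exact Imp.nil (h.congr fun u => by simp)
  | cons i l ih =>
    intro S keys M hS h
    unfold keysCode sampleInto
    split_ifs with hi
    · refine (ih (fun i hi => hl i (List.mem_cons_of_mem _ hi)) S keys M hS h).weaken fun k M' h' =>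
        h'.congr fun u => ?_
      rw [List.mem_cons]
      constructor
      · exact fun hc => hc.imp_right Or.inr
      · rintro (hc | rfl | hc)
        exacts [Or.inl hc, Or.inl hi, Or.inr hc]
    · have li := hl i List.mem_cons_self
      refine Imp.bind (I := fun v M' => KeyRep L J κ id Y (fun u => u ∈ i :: S)
        (Function.update keys i v) M') ?_ fun v M' h' => ?_
      · rw [← PMF.bind_pure (unif pp)]
        refine Imp.bind (imp_sampleStar hn hb (by omega) h.regLen h.regQ1 h.regOne h.regNil)
          fun v M' hM' => ?_
        subst hM'
        have l1 := hn.enc v.1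
        have l2 := hn.elt pp.α
        have l3 := hn.elt (pp.α ^ v.1)
        refine Imp.cst i (by simpa using h.regNil) (hb.lin (by omega)) ?_
        refine Imp.store 3 20 16 (x := i) (y := pp.enc v.1) (by simp) (by simp) (hb.lin (by omega)) ?_
        refine Imp.powMod (x := pp.elt pp.α) (y := pp.enc v.1) (z := pp.p.bits)
          (by simpa using h.regα) (by simp) (by simpa using h.regP) (by simpa using pp.prime_p.pos)
          (hb.cube (by omega)) ?_
        rw [pp.val_enc (star_lt v), Str.val_bits, pp.elt_pow]
        refine Imp.store (arrBase L) 20 17 (x := i) (y := pp.elt (pp.α ^ v.1)) (by simp) (by simp)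
          (hb.lin (by omega)) (Imp.nil ?_)
        refine (h.step (i := i) (fun e => hi (e ▸ hS)) v (fun r h₁ h₂ h₃ => ?_) fun k u => ?_).congr
          fun u => List.mem_cons.symm
        · simp [h₁, h₂, h₃]
        · simp
      · refine (ih (fun i hi => hl i (List.mem_cons_of_mem _ hi)) (i :: S) _ M'
          (List.mem_cons_of_mem _ hS) h').weaken fun k M' h' => h'.congr fun u => ?_
        simp only [List.mem_cons]
        tauto

theorem lookup_zip_map {α : Type} (f : Str → α) (l : List Str) (u : Str) :
    (l.zip (l.map f)).lookup u = if u ∈ l then some (f u) else none := by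
  induction l with
  | nil => simp
  | cons a l ih =>
    rw [List.map_cons, List.zip_cons_cons, List.lookup_cons, ih]
    by_cases h : u = a
    · subst h; simp
    · have : (u == a) = false := by simpa using h
      simp [this, h]

theorem imp_init (hLn : L.size ≤ n) (hn : Small pp n) (hκ : κ.size ≤ n) (hid : id ∈ ids)
    (hidn : ∀ i ∈ ids, i.length ≤ n) (hb : Budget n J.size U) (b : Star pp) :
    Imp U (initCode L ids J id) (dlInit κ pp (pp.α ^ b.1)).mem
      (sampleInto [id] ids (Function.update default id b)) fun keys M' =>
        Rep (J := J) ids keys id (pp.α ^ b.1) (laInit pp L κ J ids id (pp.α ^ b.1)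
          (ids.map fun i => pp.α ^ (keys i).1) (SimState.init pp L J)).mem
          (SimState.init pp L J) M' := by
  have lq := hn.q
  have lb := hn.lt (x := pp.q) le_rfl
  have l1 := hn.lt (Nat.sub_le pp.q 1)
  have l2 : J.bits.length = J.size := length_bits J
  have l3 := hidn id hid
  have l4 := hn.elt (pp.α ^ b.1)
  have lκ : κ.bits.length ≤ n := by rw [length_bits]; exact hκ
  have lL : L.bits.length ≤ n := by rw [length_bits]; exact hLn
  have lp := hn.pbits
  have lα := hn.elt pp.α
  have ls := hn.size
  rw [← PMF.bind_pure (sampleInto [id] ids (Function.update default id b))]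
  refine Imp.cst [true] rfl (hb.lin (by simp; omega)) ?_
  refine Imp.len (x := pp.q.bits) rfl rfl (hb.lin (by omega)) ?_
  refine Imp.sub (x := pp.q.bits) (y := [true]) rfl rfl rfl (hb.lin (by simp; omega)) ?_
  refine Imp.cst J.bits rfl (hb.lin (by omega)) ?_
  refine Imp.cst id rfl (hb.lin (by omega)) ?_
  refine Imp.cst [true] rfl (hb.lin (by simp; omega)) ?_
  -- The attacked key is unknown. A nonzero marker in its cell lets the membership test of
  -- commitment queries succeed.
  refine Imp.store 3 10 7 (x := id) (y := [true]) rfl rfl (hb.lin (by simp; omega)) ?_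
  refine Imp.store (arrBase L) 10 4 (x := id) (y := pp.elt (pp.α ^ b.1)) rfl rfl
    (hb.lin (by omega)) ?_
  rw [Str.val_bits, Str.val_true, length_bits]
  have h3 : 3 ≠ arrBase L := by unfold arrBase; omega
  refine Imp.bind (imp_keys (L := L) (J := J) (κ := κ) (id := id) (Y := pp.α ^ b.1) hn hb ids hidn
    [id] (Function.update default id b) _ List.mem_cons_self ?_) fun keys M h => ?_
  · constructor
    all_goals try rfl
    · intro i hi
      have : ∀ l : List Str, l.length ≤ 5 → l.getD i [] = [] := fun l hl =>
        List.getD_eq_default _ _ (by omega)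
      simp only [Mem.reg_setArr, Mem.reg_setReg]
      iterate 6 rw [if_neg (by omega)]
      exact this _ le_rfl
    · intro u
      rw [Mem.arr_setArr, if_neg fun hc => h3 hc.1, Mem.arr_setArr]
      by_cases hu : u = id
      · simp [hu]
      · simp [hu, dlInit, initCfg]
    · intro u
      rw [Mem.arr_setArr]
      by_cases hu : u = id
      · simp [hu]
      · simp [hu, dlInit, initCfg]
    · intro k h₁ h₂ u
      simp [h₁, h₂, dlInit, initCfg]
  replace h := h.congr (P' := fun u => u ∈ ids) fun u => by
    rw [List.mem_singleton]
    exact ⟨fun hc => hc.elim (fun e => e ▸ hid) fun h => h, Or.inr⟩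
  refine Imp.copy (x := κ.bits) h.reg0 h.regNil (hb.lin (by omega)) ?_
  refine Imp.copy (x := pp.p.bits) (by simpa using h.regP) (by simpa using h.regNil)
    (hb.lin (by omega)) ?_
  refine Imp.copy (x := pp.q.bits) (by simpa using h.regQ) (by simpa using h.regNil)
    (hb.lin (by omega)) ?_
  refine Imp.copy (x := pp.elt pp.α) (by simpa using h.regα) (by simpa using h.regNil)
    (hb.lin (by omega)) ?_
  refine Imp.copy (x := J.bits) (by simpa using h.regJ) (by simpa using h.regNil)
    (hb.lin (by omega)) ?_
  refine Imp.cst L.bits (by simpa using h.regNil) (hb.lin (by omega)) ?_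
  refine Imp.copy (x := id) (by simpa using h.regId) (by simpa using h.regNil)
    (hb.lin (by omega)) ?_
  refine Imp.copy (x := pp.elt (pp.α ^ b.1)) (by simpa using h.regY) (by simpa using h.regNil)
    (hb.lin (by omega)) (Imp.nil ?_)
  constructor
  · intro i
    simp only [Mem.reg_setReg, laInit, initCfg]
    match i with
    | 0 | 1 | 2 | 3 | 4 | 5 | 6 | 7 => simp
    | i + 8 =>
      iterate 8 rw [if_neg (by omega)]
      rw [h.rest _ (by omega)]
      rfl
  · intro k
    funext u
    simp only [Mem.arr_setReg, laInit, initCfg]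
    split_ifs with hk
    · subst hk
      rw [Nat.add_zero, h.tab, List.map_map, lookup_zip_map]
      split_ifs <;> rfl
    · exact h.arr _ (by unfold arrBase; omega) (by omega) u
  · simpa using h.regP
  · simpa using h.regQ
  · simpa using h.regα
  · simpa using h.regY
  · simpa using h.regLen
  · simpa using h.regQ1
  · simpa using h.regOne
  · simpa using h.regJ
  · simpa using h.regNil
  · simpa using h.regId
  · simpa [SimState.init] using h.regEpoch
  · simpa [SimState.init] using h.regFlag
  · simp [SimState.init]
  · intro k u
    have := k.2
    rw [Mem.arr_setReg]
    exact h.arr k (by omega) (by unfold arrBase; omega) u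
  · intro u
    simp only [Mem.arr_setReg]
    convert h.key u
  · simp [SimState.init]
  · intro j _
    exact h.arr 5 (by omega) (by unfold arrBase; omega) _
  · simp [SimState.init]

/-! ### The attacker -/

/-- The attacker against the discrete logarithm problem. -/
def attacker (L : ℕ) (ids : List Str) (J : ℕ) (id : Str) (A : Prog Query) : Prog Empty :=
  .seq (initCode L ids J id) (.seq (compile (callCode L) 40 (arrBase L) A) (finalCode L))

/-- A bound for the length of the code that replaces an oracle call. -/
def callSize (L : ℕ) : ℕ :=
  ∑ k, (queryHashCode k 0 0).size + (signCode L 0 0 0 0).size + (comCode L 0 0 0).size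

theorem size_block_map {α : Type} {f g : α → Prog Empty} (h : ∀ a, (f a).size = (g a).size)
    (l : List α) : (block (l.map f)).size = (block (l.map g)).size := by
  induction l with
  | nil => rfl
  | cons a l ih => simp only [List.map_cons, block, Prog.size, h a, ih]

/-- Register and array numbers do not count towards the length of code, so one representative of
each kind of call gives the bound. -/
theorem callCode_size (L : ℕ) (x : Query) : (callCode L x).size ≤ callSize L := by
  unfold callSize
  cases x with
  | hash k d u =>
    have : (queryHashCode k 0 0).size ≤ ∑ k, (queryHashCode k 0 0).size :=
      Finset.single_le_sum (f := fun k => (queryHashCode k 0 0).size) (fun _ _ => Nat.zero_le _)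
        (Finset.mem_univ k)
    have e : (callCode L (.hash k d u)).size = (queryHashCode k 0 0).size := rfl
    omega
  | sign ds dx dj a =>
    have e : (callCode L (.sign ds dx dj a)).size = (signCode L 0 0 0 0).size := by
      have := size_block_map (f := signStepCode L a) (g := signStepCode L 0) (fun _ => rfl)
        (List.finRange L)
      simp only [callCode, signCode, block, Prog.size, this]
    omega
  | com d i j =>
    have e : (callCode L (.com d i j)).size = (comCode L 0 0 0).size := rfl
    omega

/-- `J` occurs literally in the code. Its length is separated, since it is not bounded by the fixed
data but only by the running time of the forger, which reads `J`. -/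
theorem initCode_size (L : ℕ) (ids : List Str) (J : ℕ) (id : Str) :
    (initCode L ids J id).size = (initCode L ids 0 id).size + J.size := by
  simp only [initCode, block, Prog.size, length_bits]
  simp
  ring

theorem initCode_steps (L : ℕ) (ids : List Str) (J : ℕ) (id : Str) :
    (initCode L ids J id).steps = (initCode L ids 0 id).steps := rfl

end Init

/-! ### Running time and success of the attacker. -/

section Attacker

variable {pp : GroupParams} {L J κ d : ℕ} {ids : List Str} {id : Str}

theorem sampleInto_apply {S l : List Str} {k k' : Str → Star pp} (h : k' ∈ (sampleInto S l k).support)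
    {i : Str} (hi : i ∈ S) : k' i = k i := by
  induction l generalizing S k with
  | nil =>
    rw [sampleInto, PMF.mem_support_pure_iff] at h
    rw [h]
  | cons a l ih =>
    rw [sampleInto] at h
    split_ifs at h with ha
    · exact ih h hi
    · obtain ⟨v, -, h⟩ := (PMF.mem_support_bind_iff _ _ _).1 h
      rw [ih h (List.mem_cons_of_mem _ hi), Function.update_of_ne (fun e : i = a => ha (e ▸ hi))]

/-- The lengths in the reduction are at most this multiple of the security parameter. -/
def lenConst (d L : ℕ) (ids : List Str) : ℕ := d + L + (ids.map List.length).sum + 2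

/-- The price of an operation relative to the price of an oracle call. -/
def opConst (d L : ℕ) (ids : List Str) : ℕ := 512 * lenConst d L ids ^ 3 + 4

/-- A bound for the code of the initialization. -/
def initConst (L : ℕ) (ids : List Str) : ℕ := (ids.map fun i => (initCode L ids 0 i).size).sum

/-- The factor between the time complexities of the forger and the attacker. -/
def timeConst (d L : ℕ) (ids : List Str) : ℕ :=
  callSize L * opConst d L ids + 5 * lenConst d L ids + initConst L ids * (opConst d L ids + 4) +
    (finalCode L).size * (opConst d L ids + 4 * (d + 2)) +
      (3 + initConst L ids + callSize L + (finalCode L).size)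

theorem initCode_size_le (hid : id ∈ ids) : (initCode L ids 0 id).size ≤ initConst L ids :=
  List.single_le_sum (by simp) _ (List.mem_map.2 ⟨id, hid, rfl⟩)

/-- Every contribution is compared with a multiple of `t + y`, where `y` stands for `κ ^ 3`: reading
the input, initialization, the stretched run of the forger, the final computation, and the code. -/
theorem attacker_time {S C D I F T τ τ' A t y j n U₁ U₂ : ℕ} (hτ : τ + A ≤ t) (hj : j ≤ τ)
    (hn : n ≤ D * y) (hU : (6 * n + 2) ^ 3 ≤ C * y) (hy : 1 ≤ y)
    (hU₁ : U₁ = (6 * n + 2) ^ 3 + 4 * j) (hU₂ : U₂ = (6 * n + 2) ^ 3 + 4 * (j + (d + 1) * τ))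
    (hT : T ≤ S * C * τ + (5 * n + I * U₁)) (hτ' : τ' ≤ T + F * U₂) :
    τ' + (3 + I + j + S * A + F) ≤
      (S * C + 5 * D + I * (C + 4) + F * (C + 4 * (d + 2)) + (3 + I + S + F)) * t +
      (S * C + 5 * D + I * (C + 4) + F * (C + 4 * (d + 2)) + (3 + I + S + F)) * y := by
  subst hU₁ hU₂
  have h₁ : S * C * τ ≤ S * C * (t + y) := Nat.mul_le_mul_left _ (by omega)
  have h₂ : 5 * n ≤ 5 * D * (t + y) := by
    rw [Nat.mul_assoc]
    exact Nat.mul_le_mul_left _ (hn.trans (Nat.mul_le_mul_left _ (Nat.le_add_left _ _)))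
  have h₃ : C * y ≤ C * (t + y) := Nat.mul_le_mul_left _ (Nat.le_add_left _ _)
  have h₄ : I * ((6 * n + 2) ^ 3 + 4 * j) ≤ I * (C + 4) * (t + y) := by
    rw [Nat.mul_assoc, Nat.add_mul]
    exact Nat.mul_le_mul_left _ (by omega)
  have h₅ : (d + 1) * τ ≤ (d + 1) * (t + y) := Nat.mul_le_mul_left _ (by omega)
  have h₆ : F * ((6 * n + 2) ^ 3 + 4 * (j + (d + 1) * τ)) ≤
      F * (C + 4 * (d + 2)) * (t + y) := by
    have e : (C + 4 * (d + 2)) * (t + y) = C * (t + y) + 4 * ((t + y) + (d + 1) * (t + y)) := by ring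
    rw [Nat.mul_assoc, e]
    exact Nat.mul_le_mul_left _ (by omega)
  have h₇ : I ≤ I * (t + y) := Nat.le_mul_of_pos_right _ (by omega)
  have h₈ : F ≤ F * (t + y) := Nat.le_mul_of_pos_right _ (by omega)
  have h₉ : S * A ≤ S * (t + y) := Nat.mul_le_mul_left _ (by omega)
  have e : (S * C + 5 * D + I * (C + 4) + F * (C + 4 * (d + 2)) + (3 + I + S + F)) * t +
      (S * C + 5 * D + I * (C + 4) + F * (C + 4 * (d + 2)) + (3 + I + S + F)) * y =
      S * C * (t + y) + 5 * D * (t + y) + I * (C + 4) * (t + y) +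
        F * (C + 4 * (d + 2)) * (t + y) + (3 * (t + y) + I * (t + y) + S * (t + y) +
          F * (t + y)) := by ring
  rw [e]
  omega

open Classical in
/-- The attacker succeeds, up to the error in the simulation, unless the simulation fails, and it
stops in time. -/
theorem attacker_le (hl : pp.Level d κ) (hL : 1 ≤ L) (hid : id ∈ ids) {A : Prog Query}
    {t qs qs' : ℕ} (hA : ForgerTime pp L κ J ids id A t qs qs') (b : Star pp) {T : ℕ}
    (hT : T = timeConst d L ids * t + timeConst d L ids * κ ^ 3) :
    ex (run noOracle T (attacker L ids J id A) (dlInit κ pp (pp.α ^ b.1))) (fun o => o.elim ⊤ fun c =>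
      (if c.time + (attacker L ids J id A).size ≤ T then 0 else ⊤) +
        ind (pp.α ^ (c.mem.reg 0).val ≠ pp.α ^ b.1)) ≤
    ex (sampleInto [id] ids (Function.update default id b)) fun keys =>
      ex (run (SimState.oracle pp L J (pp.α ^ (keys id).1) κ ids keys id) t A
        (laInit pp L κ J ids id (pp.α ^ (keys id).1) (ids.map fun i => pp.α ^ (keys i).1)
          (SimState.init pp L J))) fun o => o.elim 1 fun c =>
            ex (SimState.finish pp L J (pp.α ^ (keys id).1) c.mem c.orc) fun r =>
              ind (Fails pp L J (keys id) r.1 r.2) := by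
  obtain ⟨hq, hp, hκ⟩ := size_lt_of_level hl
  set D := lenConst d L ids with hD
  -- As `κ ≥ 1`, the constant lengths of `L` and of the identities are absorbed by a multiple of
  -- `κ`.
  have hDκ : d * κ + L + (ids.map List.length).sum + 2 * κ ≤ D * κ := by
    rw [hD, lenConst, Nat.add_mul, Nat.add_mul, Nat.add_mul]
    have := Nat.le_mul_of_pos_right L hκ
    have := Nat.le_mul_of_pos_right (ids.map List.length).sum hκ
    omega
  have hn : Small pp (D * κ) := ⟨by omega, by omega⟩
  have hLn : L.size ≤ D * κ := by
    have : L.size ≤ L := Nat.size_le.2 Nat.lt_two_pow_self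
    omega
  have hκn : κ.size ≤ D * κ := by
    have : κ.size ≤ κ := Nat.size_le.2 Nat.lt_two_pow_self
    omega
  have hidn : ∀ i ∈ ids, i.length ≤ D * κ := by
    intro i hi
    have := List.single_le_sum (l := ids.map List.length) (by simp) _ (List.mem_map.2 ⟨i, hi, rfl⟩)
    omega
  have hU : (6 * (D * κ) + 2) ^ 3 ≤ opConst d L ids * κ ^ 3 := by
    have h2 : 2 ≤ D * κ := by omega
    calc (6 * (D * κ) + 2) ^ 3 ≤ (8 * (D * κ)) ^ 3 := Nat.pow_le_pow_left (by omega) 3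
      _ = 512 * D ^ 3 * κ ^ 3 := by ring
      _ ≤ opConst d L ids * κ ^ 3 := Nat.mul_le_mul_right _ (by simp [opConst, hD])
  set C := opConst d L ids with hC
  have hC4 : 4 ≤ C := by rw [hC, opConst]; omega
  set U₁ := (6 * (D * κ) + 2) ^ 3 + 4 * J.size with hU₁
  set S := callSize L with hS
  have hS1 : 1 ≤ S := le_trans (by simp [callCode, queryHashCode, block, Prog.size]; omega)
    (callCode_size L (.hash 0 0 0))
  set I := initConst L ids with hI
  have hsteps : (initCode L ids J id).steps ≤ I := by
    rw [initCode_steps]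
    exact (Prog.steps_le_size _).trans (initCode_size_le hid)
  have hsize : (attacker L ids J id A).size ≤ 3 + I + J.size + S * A.size + (finalCode L).size := by
    have h₁ := initCode_size_le (L := L) hid
    have h₂ := compile_size (r₀ := 40) (k₀ := arrBase L) hS1 (callCode_size L) A
    simp only [attacker, Prog.size, initCode_size L ids J]
    omega
  have hU1 : 1 ≤ U₁ := by
    have : 1 ≤ (6 * (D * κ) + 2) ^ 3 := Nat.one_le_pow _ _ (by omega)
    omega
  -- Exceeding the time bound is penalized by infinity, so a finite upper bound for the expectation
  -- also proves the time bound.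
  set gF : Cfg Unit → ℝ≥0∞ := fun c =>
    (if c.time + (attacker L ids J id A).size ≤ T then 0 else ⊤) +
      ind (pp.α ^ (c.mem.reg 0).val ≠ pp.α ^ b.1) with hgF
  set T₀ := 5 * (D * κ) + I * U₁ with hT₀
  have hinit : (dlInit κ pp (pp.α ^ b.1)).time ≤ 5 * (D * κ) := by
    have := hn.pbits
    have := hn.lt (x := pp.q) le_rfl
    have := hn.elt pp.α
    have := hn.elt (pp.α ^ b.1)
    have : κ.bits.length ≤ D * κ := by rw [length_bits]; exact hκn
    simp only [dlInit, initCfg, List.map_cons, List.map_nil, List.sum_cons, List.sum_nil]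
    omega
  -- The final computation is analysed only under the bounds on time and lengths that `forger_run`
  -- provides. Other configurations have the value infinity and turn out not to occur.
  set gS : Cfg (SimState pp L J) → ℝ≥0∞ := fun c =>
    if c.time + A.size ≤ t ∧ LenBound d c.mem c.time ∧ J.size ≤ c.time then
      ex (SimState.finish pp L J (pp.α ^ b.1) c.mem c.orc) fun r => ind (Fails pp L J b r.1 r.2)
    else ⊤ with hgS
  have hfinal : ∀ (keys : Str → Star pp) m τ s M τ', Rep ids keys id (pp.α ^ b.1) m s M →
      τ' ≤ S * C * τ + T₀ →
      ex (run noOracle T (finalCode L) ⟨M, τ', ()⟩) (fun o => o.elim ⊤ gF) ≤ gS ⟨m, τ, s⟩ := by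
    intro keys m τ s M τ' h hτ'
    rw [hgS]
    dsimp only
    split_ifs with hc
    swap
    · exact le_top
    obtain ⟨c₁, c₂, c₃⟩ := hc
    have hb : Budget (D * κ) (J.size + (d + 1) * τ)
      ((6 * (D * κ) + 2) ^ 3 + 4 * (J.size + (d + 1) * τ)) := ⟨le_rfl⟩
    refine (run_le_cw (hb.lin (by omega)) (finalCode L) M τ' gF
      (fun M' => ind (pp.α ^ (M'.reg 0).val ≠ pp.α ^ b.1)) fun M' τ'' hτ'' => ?_).trans
      (imp_finish hL hLn hn hb h (Nat.le_add_right _ _)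
        (fun ℓ => (c₂.2 _ _).trans (Nat.le_add_left _ _))
        (fun i => (c₂.1 i).trans (Nat.le_add_left _ _)) _ _ fun r M' hM' => ind_mono fun hne => ?_)
    · rw [hgF]
      dsimp only
      rw [if_pos, zero_add]
      have key := attacker_time (S := S) (C := C) (D := D) (I := I) (F := (finalCode L).size)
        (T := S * C * τ + T₀) (τ' := τ'') (n := D * κ) c₁ c₃
        (Nat.mul_le_mul_left D (Nat.le_self_pow (by norm_num : 3 ≠ 0) κ)) hU
        (Nat.one_le_pow 3 κ hκ) hU₁ rfl le_rfl
        (hτ''.trans (Nat.add_le_add hτ' (Nat.mul_le_mul_right _ (Prog.steps_le_size _))))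
      rw [hT]
      exact (Nat.add_le_add_left hsize _).trans key
    · rcases hM' with hM' | ⟨e₁, e₂⟩
      · exact absurd hM' hne
      · rintro (hc | hc)
        · rw [e₁, Str.val_bits] at hne
          exact hne hc
        · rw [e₂] at hc
          exact absurd hc (by simp)
  have hb₁ : Budget (D * κ) J.size U₁ := ⟨le_rfl⟩
  have step₁ : ex (run noOracle T (attacker L ids J id A) (dlInit κ pp (pp.α ^ b.1)))
      (fun o => o.elim ⊤ gF) ≤ ex (sampleInto [id] ids (Function.update default id b)) fun keys =>
        ex (run (SimState.oracle pp L J (pp.α ^ b.1) κ ids keys id) t A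
          (laInit pp L κ J ids id (pp.α ^ b.1) (ids.map fun i => pp.α ^ (keys i).1)
            (SimState.init pp L J))) fun o => o.elim ⊤ gS := by
    unfold attacker
    simp only [run]
    rw [ex_andThen]
    simp only [Option.elim_none]
    refine (run_le_cw hU1 (initCode L ids J id) (dlInit κ pp (pp.α ^ b.1)).mem
      (dlInit κ pp (pp.α ^ b.1)).time _ (fun M' => ⨆ (τ') (_ : τ' ≤ T₀),
        ex (andThen (run noOracle T (compile (callCode L) 40 (arrBase L) A) ⟨M', τ', ()⟩)
          (run noOracle T (finalCode L))) fun o => o.elim ⊤ gF) fun M' τ' hτ' => ?_).trans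
      (imp_init (L := L) (J := J) hLn hn hκn hid hidn hb₁ b _ _ fun keys M' h => ?_)
    · exact le_iSup₂_of_le τ' (hτ'.trans (Nat.add_le_add hinit (Nat.mul_le_mul_right _ hsteps))) le_rfl
    · refine iSup₂_le fun τ' hτ' => ?_
      rw [ex_andThen]
      simp only [Option.elim_none]
      exact run_compile_le (S := S) (C := C) (T₀ := T₀) layout (callCode_size L) hS1 (by omega)
        (fun x m => by
          change 1 ≤ queryCost L κ J x m
          cases x <;> simp only [queryCost] <;> omega)
        (fun x m s M h => imp_call hL hLn hn hid (hidn id hid)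
          (hU.trans (Nat.mul_le_mul_left _ (Nat.le_succ _))) hC4 x m s M h)
        (le_trans (Nat.le_mul_of_pos_left t (by unfold timeConst; omega))
          ((Nat.le_add_right _ _).trans hT.ge)) A _ _ _ _ τ' _ _ h
        (hτ'.trans (Nat.le_add_left _ _)) (hfinal keys)
  refine step₁.trans (ex_mono_support fun keys hk => ?_)
  -- The choice of the remaining keys leaves the entry of `id` alone, which was initialized with the
  -- exponent of the challenge.
  have hkb : keys id = b := by
    rw [sampleInto_apply hk List.mem_cons_self, Function.update_self]
  rw [← hkb] at hgS ⊢
  refine ex_mono_support fun o ho => ?_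
  obtain ⟨c, rfl, c₁, c₂, -, c₃⟩ := forger_run (size := fun _ => 0) (b := 0) hl rfl sim_answer
    (fun _ _ _ _ _ => le_rfl) hA keys (SimState.init pp L J) rfl o ho
  simp only [Option.elim_some]
  rw [hgS]
  dsimp only
  rw [if_pos ⟨c₁, c₂, c₃⟩]

end Attacker

/-! ### Key generation -/

section Keys

variable {pp : GroupParams} {L J κ d : ℕ} {ids : List Str} {id : Str}

theorem sampleInto_congr (l : List Str) : ∀ {S S' : List Str} (k : Str → Star pp),
    (∀ u, u ∈ S ↔ u ∈ S') → sampleInto S l k = sampleInto S' l k := by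
  induction l with
  | nil => intros; rfl
  | cons a l ih =>
    intro S S' k h
    unfold sampleInto
    simp only [h a]
    split_ifs
    · exact ih k h
    · congr 1
      funext v
      exact ih _ fun u => by simp [h u]

/-- The key of one user can be chosen first. -/
theorem ex_sampleInto (l : List Str) : ∀ (S : List Str) (k : Str → Star pp)
    (G : (Str → Star pp) → ℝ≥0∞), id ∈ l → id ∉ S → ex (sampleInto S l k) G =
      ex (unif pp) fun b => ex (sampleInto (id :: S) l (Function.update k id b)) G := by
  induction l with
  | nil => intro S k G h; simp at h
  | cons a l ih =>
    intro S k G hid hS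
    by_cases ha : a ∈ S
    · have e : id ≠ a := fun e => hS (e ▸ ha)
      simp only [sampleInto, if_pos ha, if_pos (List.mem_cons_of_mem id ha)]
      exact ih S k G ((List.mem_cons.1 hid).resolve_left e) hS
    by_cases e : a = id
    · subst e
      simp only [sampleInto, if_neg ha, if_pos List.mem_cons_self, ex_bind]
    · have e' : id ≠ a := fun h => e h.symm
      have ha' : a ∉ id :: S := by simp [e, ha]
      simp only [sampleInto, if_neg ha, if_neg ha', ex_bind]
      have hid' := (List.mem_cons.1 hid).resolve_left e'
      have hS' : id ∉ a :: S := by simp [e', hS]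
      simp only [fun v => ih (a :: S) (Function.update k a v) G hid' hS']
      rw [ex_comm]
      congr 1
      funext b
      congr 1
      funext v
      rw [Function.update_comm e', sampleInto_congr l _ fun u => ?_]
      simp only [List.mem_cons]
      tauto

theorem keyTable_congr {S S' : List Str} (k : Str → Star pp) (msk : Str)
    (h : ∀ u, u ∈ S ↔ u ∈ S') : keyTable S k msk = keyTable S' k msk := by
  unfold keyTable
  simp only [h]

theorem keyTable_self {S : List Str} (k : Str → Star pp) (msk : Str) {i : Str} (hi : i ∈ S) :
    keyTable S k msk 0 (msk ++ i) = some (k i).1 := by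
  unfold keyTable
  rw [if_pos ⟨rfl, i, hi, rfl⟩]
  simp

theorem keyTable_none {S : List Str} (k : Str → Star pp) (msk : Str) {i : Str} (hi : i ∉ S) :
    keyTable S k msk 0 (msk ++ i) = none := by
  unfold keyTable
  rw [if_neg]
  rintro ⟨-, j, hj, e⟩
  exact hi ((List.append_cancel_left e) ▸ hj)

theorem keyTable_cons {S : List Str} (k : Str → Star pp) (msk i : Str) (hi : i ∉ S) (v : Star pp) :
    Function.update (keyTable S k msk) 0 (Function.update (keyTable S k msk 0) (msk ++ i)
      (some v.1)) = keyTable (i :: S) (Function.update k i v) msk := by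
  funext n u
  by_cases hn : n = 0
  · subst hn
    rw [Function.update_self]
    by_cases hu : u = msk ++ i
    · subst hu
      rw [Function.update_self, keyTable_self _ _ List.mem_cons_self, Function.update_self]
    · rw [Function.update_of_ne hu]
      by_cases hc : ∃ j ∈ S, u = msk ++ j
      · obtain ⟨j, hj, rfl⟩ := hc
        rw [keyTable_self _ _ hj, keyTable_self _ _ (List.mem_cons_of_mem _ hj),
          Function.update_of_ne fun e : j = i => hi (e ▸ hj)]
      · unfold keyTable
        rw [if_neg fun h => hc h.2, if_neg]
        rintro ⟨-, j, hj, rfl⟩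
        rcases List.mem_cons.1 hj with rfl | hj
        · exact hu rfl
        · exact hc ⟨j, hj, rfl⟩
  · rw [Function.update_of_ne hn]
    unfold keyTable
    rw [if_neg fun h => hn h.1, if_neg fun h => hn h.1]

/-- An identity that occurs again is answered from the table of the oracle, just as `sampleInto`
skips it. -/
theorem ex_mapM_userKey (msk : Str) (l : List Str) : ∀ (S : List Str) (k : Str → Star pp)
    (G : List ℕ × Table → ℝ≥0∞), ex (l.mapM (userKey pp msk) (keyTable S k msk)) G =
      ex (sampleInto S l k) fun k' => G (l.map fun i => (k' i).1, keyTable (l ++ S) k' msk) := by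
  induction l with
  | nil => intro S k G; simp [sampleInto, ex_stateT_pure]
  | cons a l ih =>
    intro S k G
    rw [List.mapM_cons, ex_stateT_bind, userKey, ex_H]
    by_cases ha : a ∈ S
    · rw [keyTable_self k msk ha]
      simp only [ex_stateT_bind, ex_stateT_pure, sampleInto, if_pos ha]
      rw [ih]
      refine ex_congr_support fun k' hk => ?_
      rw [List.map_cons, sampleInto_apply hk ha, keyTable_congr k' msk fun u => ?_]
      simp only [List.mem_append, List.mem_cons]
      constructor
      · exact fun h => h.imp_left Or.inr
      · rintro ((rfl | h) | h)
        exacts [Or.inr ha, Or.inl h, Or.inr h]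
    · rw [keyTable_none k msk ha]
      simp only [ex_stateT_bind, ex_stateT_pure, sampleInto, if_neg ha, ex_bind]
      refine congrArg _ (funext fun v => ?_)
      rw [keyTable_cons k msk a ha, ih]
      refine ex_congr_support fun k' hk => ?_
      rw [List.map_cons, sampleInto_apply hk List.mem_cons_self, Function.update_self,
        keyTable_congr k' msk fun u => ?_]
      simp only [List.mem_append, List.mem_cons]
      tauto

theorem ex_kg (G : (Str × List ℕ × List (ZMod pp.p)ˣ) × Table → ℝ≥0∞) :
    ex (kg pp κ ids fun _ _ => none) G = ex (PMF.uniformOfFintype (Fin κ → Bool)) fun a =>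
      ex (sampleInto [] ids (default : Str → Star pp)) fun keys => G ((List.ofFn a, ids.map fun i => (keys i).1,
        ids.map fun i => pp.α ^ (keys i).1), keyTable ids keys (List.ofFn a)) := by
  unfold kg
  rw [ex_stateT_bind]
  have e : ∀ (x : PMF Str) (T : Table) (F : Str × Table → ℝ≥0∞),
      ex ((StateT.lift x : ROM Str) T) F = ex x fun a => F (a, T) := by
    intro x T F
    exact (ex_bind _ _ _).trans (congrArg _ (funext fun a => ex_pure _ _))
  rw [e, ex_map]
  refine congrArg _ (funext fun a => ?_)
  rw [ex_stateT_bind]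
  have e₀ : (fun _ _ => none : Table) = keyTable [] (default : Str → Star pp) (List.ofFn a) := by
    funext n u
    unfold keyTable
    rw [if_neg (by simp)]
  dsimp only
  rw [e₀, ex_mapM_userKey]
  refine congrArg _ (funext fun keys => ?_)
  rw [ex_stateT_pure, List.append_nil, List.map_map]
  rfl

theorem expt_le (hid : id ∈ ids) (A : Prog Query) (t : ℕ) :
    advOf pp L κ J ids id A t ≤ ex (sampleInto [] ids (default : Str → Star pp)) fun keys =>
      ex (PMF.uniformOfFintype (Fin κ → Bool)) fun a =>
        ex (run (realOracle pp L κ J ids (List.ofFn a) (keys id).1) t A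
          (laInit pp L κ J ids id (pp.α ^ (keys id).1) (ids.map fun i => pp.α ^ (keys i).1)
            ⟨keyTable ids keys (List.ofFn a), 1, []⟩)) fun o =>
          o.elim 1 (finalProb pp L J id (List.ofFn a) (pp.α ^ (keys id).1)) := by
  rw [advOf, apply_true_eq_ex, ex_comm]
  unfold expt
  refine (ex_bind _ _ _).le.trans ((ex_kg _).le.trans ?_)
  refine ex_mono fun a => ex_mono fun keys => ?_
  dsimp only
  refine (ex_bind _ _ _).le.trans ?_
  rw [userKey, ex_H, keyTable_self keys _ hid]
  dsimp only
  refine (ex_bind _ _ _).le.trans (ex_mono fun o => ?_)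
  cases o with
  | none => exact (ex_pure _ _).le.trans (by simp)
  | some c =>
    dsimp only [Option.elim_some]
    unfold finalProb
    by_cases h : ((c.mem.reg 0).val < pp.q ∧ (c.mem.reg 1).val < pp.q ∧ 1 ≤ (c.mem.reg 2).val ∧
      (c.mem.reg 2).val ≤ J) ∧ batch L c.mem 1 ∉ c.orc.signed
    · rw [if_pos h, if_pos (by tauto)]
      refine (ex_bind _ _ _).le.trans ?_
      rw [ex_stateT_bind]
      refine ex_mono fun r => (ex_bind _ _ _).le.trans (ex_mono fun r' => ?_)
      refine (ex_pure _ _).le.trans ?_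
      by_cases hr : r'.1 = true <;> simp [ind, hr]
    · rw [if_neg h, if_neg (by tauto)]
      exact (ex_pure _ _).le

end Keys


/-! ### The reduction -/

/-- The error per evaluated point of the random oracles. -/
def stepError (κ L n : ℕ) : ℝ≥0∞ := (2 * (n + 1) ^ (2 * L + 1) : ℕ) * eta κ

theorem stepError_mono (κ L : ℕ) : Monotone (stepError κ L) := fun m n h => by
  unfold stepError
  gcongr

theorem realError_stepError (κ L : ℕ) : RealError κ (stepError κ L) := fun n => by
  refine mul_le_mul_left (Nat.cast_le.2 ?_) _
  have := Nat.le_self_pow (n := 2 * L + 1) (by omega) (n + 1)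
  omega

theorem simError_stepError (κ L : ℕ) : SimError κ L (stepError κ L) where
  points n := by
    have e : (2 : ℝ≥0∞) * ((1 + n : ℕ) * eta κ) = (2 * (1 + n) : ℕ) * eta κ := by
      push_cast; ring
    rw [e]
    refine mul_le_mul_left (Nat.cast_le.2 ?_) _
    have := Nat.le_self_pow (n := 2 * L + 1) (by omega) (n + 1)
    omega
  sums n := by
    refine mul_le_mul_left (Nat.cast_le.2 ?_) _
    rw [← pow_add, ← two_mul]
    have := Nat.pow_le_pow_right (n := n + 1) (by omega) (Nat.le_add_right (2 * L) 1)
    omega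

/-- The number of points that an experiment with a forger of running time `t` evaluates. -/
def pointCount (L t : ℕ) : ℕ := (2 * L + 2) * (t + 1)

/-- The security loss. -/
def loss (κ L t : ℕ) : ℝ≥0∞ :=
  2 * eta κ + 2 * (pointCount L t * stepError κ L (pointCount L t))

section Reduction

variable {pp : GroupParams} {L J κ d : ℕ} {ids : List Str} {id : Str}

/-- The bounds refer to complementary events of the same run of the ideal game, whose indicators add
up to one. The errors are evaluated at `pointCount L t`, which bounds the records at the end of
every possible run. -/
theorem real_add_sim_le (hl : pp.Level d κ) (hL : 1 ≤ L) (hid : id ∈ ids) {A : Prog Query}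
    {t qs qs' : ℕ} (hA : ForgerTime pp L κ J ids id A t qs qs') (keys : Str → Star pp) :
    ex (PMF.uniformOfFintype (Fin κ → Bool)) (fun a =>
      ex (run (realOracle pp L κ J ids (List.ofFn a) (keys id).1) t A
        (laInit pp L κ J ids id (pp.α ^ (keys id).1) (ids.map fun i => pp.α ^ (keys i).1)
          ⟨keyTable ids keys (List.ofFn a), 1, []⟩)) fun o =>
        o.elim 1 (finalProb pp L J id (List.ofFn a) (pp.α ^ (keys id).1))) +
    ex (run (SimState.oracle pp L J (pp.α ^ (keys id).1) κ ids keys id) t A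
      (laInit pp L κ J ids id (pp.α ^ (keys id).1) (ids.map fun i => pp.α ^ (keys i).1)
        (SimState.init pp L J))) (fun o => o.elim 1 fun c =>
          ex (SimState.finish pp L J (pp.α ^ (keys id).1) c.mem c.orc) fun r =>
            ind (Fails pp L J (keys id) r.1 r.2)) ≤ 1 + loss κ L t := by
  set δ := stepError κ L
  refine (add_le_add (real_le_ideal hl.1 (realError_stepError κ L) hid A t _ _)
    (sim_le_ideal hl.1 hL (simError_stepError κ L) ids keys id A t _ _)).trans ?_
  rw [add_assoc, ← ex_add]
  have hrun := forger_run (size := Ideal.size) hl rfl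
    (ideal_answer (κ := κ) (ids := ids) (keys := keys) (id := id)) ideal_grows hA keys
    (Ideal.init pp L J) rfl
  have hpot : pot δ (pointCount L t) ≤ pointCount L t * stepError κ L (pointCount L t) :=
    pot_le _ (stepError_mono κ L) _
  refine (add_le_add_right ((ex_mono_support fun o ho => ?_).trans
    (ex_const _ (1 + (2 * pot δ (pointCount L t) + eta κ))).le) _).trans ?_
  · obtain ⟨c, rfl, ht, -, hs, -⟩ := hrun o ho
    dsimp only [Option.elim_some]
    rw [← ex_add]
    refine (ex_mono_support fun r hr => ?_).trans (ex_const _ _).le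
    have hr' := grows_finish _ _ _ _ hr
    have hN : r.2.size ≤ pointCount L t := by
      have : (2 * L + 2) * c.time ≤ (2 * L + 2) * t := Nat.mul_le_mul_left _ (by omega)
      unfold pointCount
      rw [Nat.mul_succ]
      omega
    have hp := pot_mono δ hN
    rw [← ind_add_ind_not (r.1 = true ∨ r.2.pub.flag = true)]
    calc _ = ind (r.1 = true ∨ r.2.pub.flag = true) + ind (¬ (r.1 = true ∨ r.2.pub.flag = true)) +
          (2 * pot δ r.2.size + eta κ) := by ring
      _ ≤ _ := by gcongr
  · calc _ = 1 + (2 * eta κ + 2 * pot δ (pointCount L t)) := by ring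
      _ ≤ _ := by unfold loss; gcongr

/-- The expectation in `attacker_le` is at most one, so no outcome of positive probability can carry
the infinite penalty for a timeout or a late end. -/
theorem dlTime_attacker (hl : pp.Level d κ) (hL : 1 ≤ L) (hid : id ∈ ids) {A : Prog Query}
    {t qs qs' : ℕ} (hA : ForgerTime pp L κ J ids id A t qs qs') :
    DLTime κ pp (attacker L ids J id A) (timeConst d L ids * t + timeConst d L ids * κ ^ 3) := by
  intro b hb o ho
  have h := attacker_le hl hL hid hA ⟨b, hb⟩ rfl
  have h' := h.trans (ex_le_of_le (c := 1) fun keys => ex_le_of_le fun o => by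
    cases o with
    | none => exact le_rfl
    | some c => exact ex_le_of_le fun r => ind_le_one _)
  by_contra hne
  have hle := (ENNReal.le_tsum o).trans h'
  have htop : (o.elim ⊤ fun c =>
      (if c.time + (attacker L ids J id A).size ≤
        timeConst d L ids * t + timeConst d L ids * κ ^ 3 then 0 else ⊤) +
        ind (pp.α ^ (c.mem.reg 0).val ≠ pp.α ^ b) : ℝ≥0∞) = ⊤ := by
    cases o with
    | none => rfl
    | some c =>
      dsimp only [Option.elim_some]
      rw [if_neg fun hc => hne ⟨c, rfl, hc⟩, top_add]
  dsimp only at hle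
  rw [htop, ENNReal.mul_top ((PMF.mem_support_iff _ _).1 ho)] at hle
  simp at hle

/-- Success and failure are complementary. Counting a timeout as an infinite failure keeps the
inequality valid for every program. -/
theorem one_le_dlAdvOf_add (F : Prog Empty) (T : ℕ) :
    1 ≤ dlAdvOf κ pp F T + ex (unif pp) fun b =>
      ex (run noOracle T F (dlInit κ pp (pp.α ^ b.1))) fun o =>
        o.elim ⊤ fun c => ind (pp.α ^ (c.mem.reg 0).val ≠ pp.α ^ b.1) := by
  classical
  have e : dlAdvOf κ pp F T = ex (unif pp) fun b =>
      ex (run noOracle T F (dlInit κ pp (pp.α ^ b.1))) fun o =>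
        o.elim 0 fun c => ind (pp.α ^ (c.mem.reg 0).val = pp.α ^ b.1) := by
    rw [dlAdvOf, apply_true_eq_ex, dlExpt, ex_bind, ex_unifStar]
    refine congrArg _ (funext fun b => ?_)
    rw [ex_bind]
    refine congrArg _ (funext fun o => ?_)
    rw [ex_pure]
    cases o with
    | none => simp
    | some c => simp [ind]
  rw [e, ← ex_add]
  refine (ex_const (unif pp) 1).ge.trans (ex_mono fun b => ?_)
  rw [← ex_add]
  refine (ex_const _ 1).ge.trans (ex_mono fun o => ?_)
  cases o with
  | none => simp
  | some c => exact (ind_add_ind_not _).ge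

/-- With `X` the failure probability of the simulation, the forger's advantage plus `X` is at most
`1 + loss`, and one is at most the attacker's advantage plus `X`. Cancelling `X` gives the
reduction. -/
theorem advOf_le (hl : pp.Level d κ) (hL : 1 ≤ L) (hid : id ∈ ids) {A : Prog Query}
    {t qs qs' : ℕ} (hA : ForgerTime pp L κ J ids id A t qs qs') :
    advOf pp L κ J ids id A t ≤ dlAdvOf κ pp (attacker L ids J id A)
      (timeConst d L ids * t + timeConst d L ids * κ ^ 3) + loss κ L t := by
  set T := timeConst d L ids * t + timeConst d L ids * κ ^ 3 with hT
  set sim : (Str → Star pp) → ℝ≥0∞ := fun keys =>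
    ex (run (SimState.oracle pp L J (pp.α ^ (keys id).1) κ ids keys id) t A
      (laInit pp L κ J ids id (pp.α ^ (keys id).1) (ids.map fun i => pp.α ^ (keys i).1)
        (SimState.init pp L J))) fun o => o.elim 1 fun c =>
          ex (SimState.finish pp L J (pp.α ^ (keys id).1) c.mem c.orc) fun r =>
            ind (Fails pp L J (keys id) r.1 r.2) with hsim
  set X := ex (sampleInto [] ids (default : Str → Star pp)) sim with hX
  have hX1 : X ≤ 1 := ex_le_of_le fun keys => ex_le_of_le fun o => by
    cases o with
    | none => exact le_rfl
    | some c => exact ex_le_of_le fun r => ind_le_one _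
  have hreal : advOf pp L κ J ids id A t + X ≤ 1 + loss κ L t := by
    refine (add_le_add_left (expt_le hid A t) _).trans ?_
    rw [hX, ← ex_add]
    exact ex_le_of_le fun keys => real_add_sim_le hl hL hid hA keys
  have hdl : 1 ≤ dlAdvOf κ pp (attacker L ids J id A) T + X := by
    refine (one_le_dlAdvOf_add _ _).trans (add_le_add_right ?_ _)
    -- The exponent of the challenge takes the place of the key of `id`: among independent keys that
    -- one may be drawn first.
    rw [hX, ex_sampleInto ids [] default sim hid (by simp)]
    refine ex_mono fun b => le_trans (ex_mono fun o => ?_) (attacker_le hl hL hid hA b hT)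
    cases o with
    | none => exact le_rfl
    | some c => exact le_add_self
  -- Cancellation in `ℝ≥0∞` is allowed because `X ≤ 1` is finite.
  refine (ENNReal.add_le_add_iff_right (ne_top_of_le_ne_top ENNReal.one_ne_top hX1)).1
    (hreal.trans ((add_le_add_left hdl _).trans_eq ?_))
  ring

end Reduction

/-! ### Asymptotics -/

theorem negligible_pow_inv (P : Polynomial ℕ) :
    Negligible fun κ => ((P.eval κ : ℕ) : ℝ) * (2⁻¹ : ℝ) ^ κ := by
  have h : Negligible fun κ => (2⁻¹ : ℝ) ^ κ := fun n =>
    tendsto_pow_const_mul_const_pow_of_abs_lt_one n (by rw [abs_of_pos] <;> norm_num)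
  refine (h.polynomial_mul (P.map (Nat.castRingHom ℝ))).congr fun κ => ?_
  rw [Polynomial.eval_natCast_map]
  simp

theorem negligible_mono {f g : ℕ → ℝ} (h : Negligible g) (h₀ : ∀ κ, 0 ≤ f κ)
    (hfg : ∀ᶠ κ in Filter.atTop, f κ ≤ g κ) : Negligible f :=
  Asymptotics.SuperpolynomialDecay.trans_eventually_abs_le h (hfg.mono fun κ hκ => by
    simp only [Function.comp]
    rw [abs_of_nonneg (h₀ κ)]
    exact hκ.trans (le_abs_self _))

theorem loss_eq (κ L t : ℕ) : loss κ L t = ENNReal.ofReal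
    ((4 + 8 * pointCount L t * (pointCount L t + 1) ^ (2 * L + 1) : ℕ) * (2⁻¹ : ℝ) ^ κ) := by
  have e : eta κ = ENNReal.ofReal (2 * (2⁻¹ : ℝ) ^ κ) := by
    rw [ENNReal.ofReal_mul (by norm_num), ENNReal.ofReal_pow (by norm_num),
      ENNReal.ofReal_inv_of_pos (by norm_num), eta, div_eq_mul_inv, ENNReal.inv_pow]
    norm_num
  have h : loss κ L t =
      (2 + 4 * pointCount L t * (pointCount L t + 1) ^ (2 * L + 1) : ℕ) * eta κ := by
    unfold loss stepError
    push_cast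
    ring
  rw [h, e, ← ENNReal.ofReal_natCast, ← ENNReal.ofReal_mul (by positivity)]
  congr 1
  push_cast
  ring

/-- For fixed `L` the loss is a polynomial in the running time multiplied by `2 ^ (-κ)`. -/
theorem loss_negligible (L : ℕ) {t : ℕ → ℕ} (ht : PolyBounded t) :
    ∃ ε : ℕ → ℝ, Negligible ε ∧ (∀ κ, 0 ≤ ε κ) ∧
      ∀ κ, loss κ L (t κ) = ENNReal.ofReal (ε κ) := by
  refine ⟨_, ?_, fun κ => by positivity, fun κ => loss_eq κ L (t κ)⟩
  obtain ⟨P, hP⟩ := ht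
  let N : Polynomial ℕ := Polynomial.C (2 * L + 2) * (P + 1)
  refine negligible_mono (negligible_pow_inv (4 + 8 * N * (N + 1) ^ (2 * L + 1))) (fun κ => by positivity)
    (Filter.Eventually.of_forall fun κ => ?_)
  have hN : pointCount L (t κ) ≤ N.eval κ := by
    simp only [N, pointCount, Polynomial.eval_mul, Polynomial.eval_C, Polynomial.eval_add,
      Polynomial.eval_one]
    gcongr
    exact hP κ
  have e : (4 + 8 * N * (N + 1) ^ (2 * L + 1)).eval κ =
      4 + 8 * N.eval κ * (N.eval κ + 1) ^ (2 * L + 1) := by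
    simp
  rw [e]
  gcongr

theorem polyBounded_reduction {t : ℕ → ℕ} (ht : PolyBounded t) (c : ℕ) :
    PolyBounded fun κ => c * t κ + c * κ ^ 3 := by
  obtain ⟨P, hP⟩ := ht
  refine ⟨Polynomial.C c * P + Polynomial.C c * Polynomial.X ^ 3, fun κ => ?_⟩
  simp only [Polynomial.eval_mul, Polynomial.eval_C, Polynomial.eval_add, Polynomial.eval_pow,
    Polynomial.eval_X]
  gcongr
  exact hP κ

theorem dlAdv_le_one (κ : ℕ) (pp : GroupParams) (t : ℕ) : dlAdv κ pp t ≤ 1 :=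
  iSup₂_le fun _ _ => PMF.coe_le_one _ _

end LAHases

end

theorem theorem5p2 (d L : ℕ) (hL : 1 ≤ L) (ids : List Str) :
    (∃ (c : ℕ) (F : ℕ → Str → Prog LAHases.Query → Prog Empty),
      ∀ t qs qs' : ℕ → ℕ, PolyBounded t →
        ∃ ε : ℕ → ℝ, Negligible ε ∧
          ∀ (κ : ℕ) (pp : GroupParams), pp.Level d κ → ∀ (J : ℕ), ∀ id ∈ ids,
            (∀ A : Prog LAHases.Query,
              LAHases.ForgerTime pp L κ J ids id A (t κ) (qs κ) (qs' κ) →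
                DLTime κ pp (F J id A) (c * t κ + c * κ ^ 3) ∧
                LAHases.advOf pp L κ J ids id A (t κ) ≤
                  dlAdvOf κ pp (F J id A) (c * t κ + c * κ ^ 3) + ENNReal.ofReal (ε κ)) ∧
            LAHases.adv pp L κ J ids id (t κ) (qs κ) (qs' κ) ≤
              dlAdv κ pp (c * t κ + c * κ ^ 3) + ENNReal.ofReal (ε κ)) ∧
    (∀ (pp : ℕ → GroupParams) (J : ℕ → ℕ) (id : ℕ → Str),
      (∀ᶠ κ in Filter.atTop, (pp κ).Level d κ) → (∀ κ, id κ ∈ ids) →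
      (∀ t' : ℕ → ℕ, PolyBounded t' → Negligible fun κ => (dlAdv κ (pp κ) (t' κ)).toReal) →
        ∀ t qs qs' : ℕ → ℕ, PolyBounded t →
          Negligible fun κ =>
            (LAHases.adv (pp κ) L κ (J κ) ids (id κ) (t κ) (qs κ) (qs' κ)).toReal) := by
  have bound : ∀ {t : ℕ → ℕ} (qs qs' : ℕ → ℕ) {ε : ℕ → ℝ},
      (∀ κ, LAHases.loss κ L (t κ) = ENNReal.ofReal (ε κ)) →
      ∀ (κ : ℕ) (pp : GroupParams), pp.Level d κ → ∀ (J : ℕ), ∀ id ∈ ids,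
        LAHases.adv pp L κ J ids id (t κ) (qs κ) (qs' κ) ≤
          dlAdv κ pp (LAHases.timeConst d L ids * t κ + LAHases.timeConst d L ids * κ ^ 3) +
            ENNReal.ofReal (ε κ) := by
    intro t qs qs' ε hε κ pp hl J id hid
    refine iSup₂_le fun A hA => (LAHases.advOf_le hl hL hid hA).trans ?_
    rw [hε κ]
    gcongr
    -- The constructed attacker respects the time bound, so it is among those over which the
    -- advantage against the group is taken.
    exact le_iSup₂ (f := fun F (_ : DLTime κ pp F _) => dlAdvOf κ pp F _) _
      (LAHases.dlTime_attacker hl hL hid hA)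
  constructor
  · refine ⟨LAHases.timeConst d L ids, fun J id A => LAHases.attacker L ids J id A,
      fun t qs qs' ht => ?_⟩
    obtain ⟨ε, hneg, -, hε⟩ := LAHases.loss_negligible L ht
    refine ⟨ε, hneg, fun κ pp hl J id hid => ⟨fun A hA => ⟨LAHases.dlTime_attacker hl hL hid hA, ?_⟩,
      bound qs qs' hε κ pp hl J id hid⟩⟩
    rw [← hε κ]
    exact LAHases.advOf_le hl hL hid hA
  · intro pp J id hl hid hdl t qs qs' ht
    obtain ⟨ε, hneg, hpos, hε⟩ := LAHases.loss_negligible L ht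
    have h := (hdl _ (LAHases.polyBounded_reduction ht (LAHases.timeConst d L ids))).add hneg
    refine LAHases.negligible_mono h (fun κ => ENNReal.toReal_nonneg) (hl.mono fun κ hκ => ?_)
    -- Finiteness is needed to pass from extended nonnegative reals to real numbers, in which
    -- negligibility is expressed.
    have hfin := ne_top_of_le_ne_top ENNReal.one_ne_top (LAHases.dlAdv_le_one κ (pp κ)
      (LAHases.timeConst d L ids * t κ + LAHases.timeConst d L ids * κ ^ 3))
    refine (ENNReal.toReal_mono (ENNReal.add_ne_top.2 ⟨hfin, ENNReal.ofReal_ne_top⟩)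
      (bound qs qs' hε κ (pp κ) hκ (J κ) (id κ) (hid κ))).trans_eq ?_
    rw [ENNReal.toReal_add hfin ENNReal.ofReal_ne_top, ENNReal.toReal_ofReal (hpos κ)]
    rfl
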